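/- Let $\Lambda\subseteq\mathbb{N}^e$ be an affine semigroup with (distinct) minimal generators $\alpha_1,\dots,\alpha_n$, ordered by $\mu\le\nu\iff\nu-\mu\in\Lambda$. Let $k$ be a field, let $I_\Lambda=\ker\bigl(k[z_1,\dots,z_n]\to k[x_1,\dots,x_e],\ z_i\mapsto x^{\alpha_i}\bigr)$, and let $\preceq$ be a monomial term order for which $I_\Lambda$ has a Gröbner basis whose elements have degree at most $2$. Let $J=\mathrm{in}_\preceq(I_\Lambda)$, and fix $0\ne\lambda\in\Lambda$. *Classes.* A saturated chain $0=p_0<p_1<\dots<p_r=\lambda$ has the label sequence $(i_1,\dots,i_r)$ with $p_j-p_{j-1}=\alpha_{i_j}$; its content is the monomial $z_{i_1}\cdots z_{i_r}$. Two label sequences are $J'$-commuting equivalent if one is obtained from the other by repeatedly swapping consecutive labels $a,b$ with $z_az_b\notin J$. A label sequence is $J'$-stuttering if it has consecutive labels $a,a$ with $z_a^2\notin J$, and an equivalence class is $J'$-non-stuttering if none of its members is $J'$-stuttering. *Morse function.* Let $\Delta(0,\lambda)$ be the complex of finite chains of the open interval $(0,\lambda)$, including the empty chain. Order its facets (saturated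 chains) by content with respect to $\preceq$, and those of equal content lexicographically by label sequence, the labels being ordered by $\preceq$ on the variables. The label sequence and content of a face are those of the earliest facet containing it. For a facet $F$, let the $I$-intervals be the sets of ranks of $F$ omitted by the maximal faces of the intersection of $F$ with the union of the earlier facets. The $J$-intervals are obtained from them by repeating: take the interval with least minimum, delete its elements from the other intervals, and keep only those of the truncated intervals that are minimal. Match each face whose earliest facet is $F$ by including or excluding the element of $F$ at the following rank: if the $I$-intervals do not cover all interior ranks of $F$, the lowest uncovered rank; otherwise the lowest rank of the first $J$-interval which the face does not meet exactly in its lowest rank; and if there is no such $J$-interval, the lowest rank not covered by the $J$-intervals. If there is no such rank either, the face is a critical cell. *Cancellation.* The multigraph face poset of critical cells has an edge from $\tau$ to $\sigma$, where $\dim\tau=\dim\sigma+1$, for every gradient path from $\tau$ to $\sigma$. A complete cancellation is an acyclic matching on this multigraph, pairing only critical cells of equal content, such that every critical cell which is not a facet of $\Delta(0,\lambda)$ is matched. The critical cells left unmatched are the surviving critical cells. **Theorem.** A complete cancellation exists. For every complete cancellation and every content $m$ of degree $\lambda$, exactly one member of each $J'$-non-stuttering, $J'$-commuting equivalence class of content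 $m$ is the label sequence of a surviving critical cell. Moreover, sending a surviving critical cell to its label sequence, and a label sequence to its equivalence class, gives bijections between the surviving critical cells of content $m$, their label sequences, and the $J'$-non-stuttering, $J'$-commuting equivalence classes of content $m$. -/

import Mathlib

noncomputable section

namespace MonoidPoset

/-! ### The affine semigroup, its toric ideal and quadratic Gröbner bases -/

/-- The submonoid `Λ` of `ℕ^e` generated by `α₁, …, αₙ`. -/
def semigroup {e n : ℕ} (α : Fin n → (Fin e →₀ ℕ)) : AddSubmonoid (Fin e →₀ ℕ) :=
  AddSubmonoid.closure (Set.range α)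

/-- The `αᵢ` are pairwise distinct, nonzero and indecomposable in `Λ`, i.e. they are the minimal
generators of `Λ`.  This is what makes `μ < μ + αᵢ` a covering relation of `Λ` with label `i`. -/
def IsMinimalGenerating {e n : ℕ} (α : Fin n → (Fin e →₀ ℕ)) : Prop :=
  Function.Injective α ∧
    ∀ i, α i ≠ 0 ∧ ∀ μ ∈ semigroup α, ∀ ν ∈ semigroup α, μ + ν = α i → μ = 0 ∨ ν = 0

/-- `μ < ν` in the poset `Λ`, where `μ ≤ ν` means `ν - μ ∈ Λ`. -/
def SLt {e n : ℕ} (α : Fin n → (Fin e →₀ ℕ)) (μ ν : Fin e →₀ ℕ) : Prop :=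
  μ ≠ ν ∧ ∃ γ ∈ semigroup α, μ + γ = ν

/-- The toric ideal: the kernel of `k[z₁, …, zₙ] → k[x₁, …, x_e]`, `zᵢ ↦ x ^ αᵢ`. -/
def toricIdeal (k : Type*) [Field k] {e n : ℕ} (α : Fin n → (Fin e →₀ ℕ)) :
    Ideal (MvPolynomial (Fin n) k) :=
  RingHom.ker (MvPolynomial.aeval (fun i => MvPolynomial.monomial (α i) (1 : k)) :
    MvPolynomial (Fin n) k →ₐ[k] MvPolynomial (Fin e) k)

/-- The ideal generated by the leading monomials of the nonzero elements of `G`. -/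
def leadingIdeal {k : Type*} [Field k] {n : ℕ} (mo : MonomialOrder (Fin n))
    (G : Set (MvPolynomial (Fin n) k)) : Ideal (MvPolynomial (Fin n) k) :=
  Ideal.span {p | ∃ f ∈ G, f ≠ 0 ∧ p = MvPolynomial.monomial (mo.degree f) (1 : k)}

/-- The ideal `I` has a Gröbner basis with respect to `mo` whose elements have total degree at
most two. -/
def HasQuadraticGroebnerBasis {k : Type*} [Field k] {n : ℕ} (mo : MonomialOrder (Fin n))
    (I : Ideal (MvPolynomial (Fin n) k)) : Prop :=
  ∃ G : Set (MvPolynomial (Fin n) k), G.Finite ∧ Ideal.span G = I ∧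
    leadingIdeal mo G = leadingIdeal mo (I : Set (MvPolynomial (Fin n) k)) ∧
    ∀ g ∈ G, g.totalDegree ≤ 2

/-- `z_a z_b ∈ J`, where `J` is the initial ideal of the toric ideal. -/
def InJ (k : Type*) [Field k] {e n : ℕ} (α : Fin n → (Fin e →₀ ℕ)) (mo : MonomialOrder (Fin n))
    (a b : Fin n) : Prop :=
  (MvPolynomial.X a * MvPolynomial.X b : MvPolynomial (Fin n) k) ∈
    leadingIdeal mo (toricIdeal k α : Set (MvPolynomial (Fin n) k))

/-! ### Label sequences, saturated chains and the content-lex facet order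

A label sequence is a list of generator indices, read from the bottom of the chain upwards. -/

/-- The content of a label sequence, as the exponent vector of the product of its labels. -/
def content {n : ℕ} (w : List (Fin n)) : Fin n →₀ ℕ :=
  (w.map (fun i => Finsupp.single i 1)).sum

/-- The element of `Λ` at rank `r` of the saturated chain from `0` with label sequence `w`. -/
def vertex {e n : ℕ} (α : Fin n → (Fin e →₀ ℕ)) (w : List (Fin n)) (r : ℕ) : Fin e →₀ ℕ :=
  ((w.take r).map α).sum

/-- `w` is the label sequence of a saturated chain of `[0, l]`. -/
def IsLabelSequence {e n : ℕ} (α : Fin n → (Fin e →₀ ℕ)) (l : Fin e →₀ ℕ)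
    (w : List (Fin n)) : Prop :=
  (w.map α).sum = l

/-- The ranks of the interior elements of the saturated chain with label sequence `w`. -/
def ranks {n : ℕ} (w : List (Fin n)) : Finset ℕ := Finset.Ioo 0 w.length

/-- The interior elements of the saturated chain with label sequence `w`, a facet of `Δ(0, l)`. -/
def facet {e n : ℕ} (α : Fin n → (Fin e →₀ ℕ)) (w : List (Fin n)) : Finset (Fin e →₀ ℕ) :=
  (ranks w).image (vertex α w)

/-- The facet order: compare contents by the term order, and label sequences of equal content
lexicographically, the labels being ordered by the term order on the variables. -/
def Earlier {n : ℕ} (mo : MonomialOrder (Fin n)) (w w' : List (Fin n)) : Prop :=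
  mo.toSyn (content w) < mo.toSyn (content w') ∨
    content w = content w' ∧
      List.Lex (fun i j : Fin n =>
        mo.toSyn (Finsupp.single i 1) < mo.toSyn (Finsupp.single j 1)) w w'

/-! ### The order complex `Δ(0, l)` (the empty chain is a face, of dimension `-1`) -/

/-- `s` is a face of `Δ(0, l)`: a finite chain in the open interval `(0, l)` of `Λ`. -/
def IsFace {e n : ℕ} (α : Fin n → (Fin e →₀ ℕ)) (l : Fin e →₀ ℕ)
    (s : Finset (Fin e →₀ ℕ)) : Prop :=
  (∀ μ ∈ s, μ ∈ semigroup α ∧ SLt α 0 μ ∧ SLt α μ l) ∧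
    ∀ μ ∈ s, ∀ ν ∈ s, μ = ν ∨ SLt α μ ν ∨ SLt α ν μ

/-- `w` is the label sequence of the earliest facet containing `s`. -/
def IsEarliest {e n : ℕ} (α : Fin n → (Fin e →₀ ℕ)) (mo : MonomialOrder (Fin n))
    (l : Fin e →₀ ℕ) (s : Finset (Fin e →₀ ℕ)) (w : List (Fin n)) : Prop :=
  IsLabelSequence α l w ∧ s ⊆ facet α w ∧
    ∀ w', IsLabelSequence α l w' → s ⊆ facet α w' → w' = w ∨ Earlier mo w w'

open Classical in
/-- The label sequence of a face: that of the earliest facet containing it. -/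
def labelSeq {e n : ℕ} (α : Fin n → (Fin e →₀ ℕ)) (mo : MonomialOrder (Fin n))
    (l : Fin e →₀ ℕ) (s : Finset (Fin e →₀ ℕ)) : List (Fin n) :=
  if h : ∃ w, IsEarliest α mo l s w then h.choose else []

/-! ### The lex-like discrete Morse function of the facet order -/

/-- `R` is a set of ranks of the facet `w` such that the remaining elements of this facet
lie in an earlier facet. -/
def Skippable {e n : ℕ} (α : Fin n → (Fin e →₀ ℕ)) (mo : MonomialOrder (Fin n))
    (l : Fin e →₀ ℕ) (w : List (Fin n)) (R : Finset ℕ) : Prop :=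
  R ⊆ ranks w ∧ ∃ w', IsLabelSequence α l w' ∧ Earlier mo w' w ∧
    (ranks w \ R).image (vertex α w) ⊆ facet α w'

open Classical in
/-- The interval system (`I`-intervals) of the facet `w`: the rank sets omitted by the maximal
faces of the intersection of the facet with the union of the earlier facets. -/
def iIntervals {e n : ℕ} (α : Fin n → (Fin e →₀ ℕ)) (mo : MonomialOrder (Fin n))
    (l : Fin e →₀ ℕ) (w : List (Fin n)) : Finset (Finset ℕ) :=
  (ranks w).powerset.filter (fun R => Minimal (Skippable α mo l w) R)

open Classical in
/-- The truncation procedure, with a bound on the number of rounds: take the interval with the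
least minimum, remove its elements from the other intervals, keep those of the truncated
intervals that are minimal, and repeat. -/
def truncation : ℕ → Finset (Finset ℕ) → List (Finset ℕ)
  | 0, _ => []
  | t + 1, S =>
    if h : S.Nonempty then
      let K := (S.exists_min_image Finset.min h).choose
      let T := (S.erase K).image (fun R => R \ K)
      K :: truncation t (T.filter (fun R => ∀ R' ∈ T, ¬ R' ⊂ R))
    else []

/-- The `J`-intervals of an interval system, listed with increasing minima. -/
def jIntervals (S : Finset (Finset ℕ)) : List (Finset ℕ) := truncation S.card S

/-- The set consisting of the least element of `K` (empty if `K` is empty). -/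
def lowest (K : Finset ℕ) : Finset ℕ := K.filter (fun r => ∀ t ∈ K, r ≤ t)

/-- The union of a list of sets of ranks. -/
def support (L : List (Finset ℕ)) : Finset ℕ := L.foldr (fun R T => R ∪ T) ∅

/-- The rank at which a face with rank set `S`, lying in a facet with set of ranks `N` and
interval system `A` but in no earlier facet, is matched (as a set with at most one element,
empty if the face is critical).  If the `I`-intervals do not cover `N`, this is the lowest
uncovered rank.  Otherwise it is the lowest element of the first `J`-interval that the face does
not meet exactly in its lowest element; if there is none, the lowest rank not covered by the
`J`-intervals. -/
def pivot (N : Finset ℕ) (A : Finset (Finset ℕ)) (S : Finset ℕ) : Finset ℕ :=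
  if A.biUnion id = N then
    match (jIntervals A).find? (fun K => decide (S ∩ K ≠ lowest K)) with
    | some K => lowest K
    | none => lowest (N \ support (jIntervals A))
  else lowest (N \ A.biUnion id)

/-- The partner of a face: include or exclude the element at the pivot rank. -/
def partner {e n : ℕ} (α : Fin n → (Fin e →₀ ℕ)) (mo : MonomialOrder (Fin n))
    (l : Fin e →₀ ℕ) (s : Finset (Fin e →₀ ℕ)) : Finset (Fin e →₀ ℕ) :=
  let w := labelSeq α mo l s
  symmDiff s ((pivot (ranks w) (iIntervals α mo l w)
    ((ranks w).filter (fun r => vertex α w r ∈ s))).image (vertex α w))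

/-- The face `s` is matched with the larger face `t`. -/
def Matched {e n : ℕ} (α : Fin n → (Fin e →₀ ℕ)) (mo : MonomialOrder (Fin n))
    (l : Fin e →₀ ℕ) (s t : Finset (Fin e →₀ ℕ)) : Prop :=
  IsFace α l s ∧ IsFace α l t ∧ s ⊂ t ∧ partner α mo l s = t

/-- Critical cells: the unmatched faces. -/
def IsCritical {e n : ℕ} (α : Fin n → (Fin e →₀ ℕ)) (mo : MonomialOrder (Fin n))
    (l : Fin e →₀ ℕ) (s : Finset (Fin e →₀ ℕ)) : Prop :=
  IsFace α l s ∧ partner α mo l s = s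

/-! ### Gradient paths and cancellation of critical cells -/

/-- An edge of the face poset, directed upward if it is matched and downward otherwise. -/
def GradientStep {e n : ℕ} (α : Fin n → (Fin e →₀ ℕ)) (mo : MonomialOrder (Fin n))
    (l : Fin e →₀ ℕ) (s t : Finset (Fin e →₀ ℕ)) : Prop :=
  Matched α mo l s t ∨
    (IsFace α l s ∧ IsFace α l t ∧ t ⊆ s ∧ s.card = t.card + 1 ∧ ¬ Matched α mo l t s)

/-- `p` is a gradient path from the critical cell `t` to the critical cell `s` of dimension one
less; these are the edges of the multigraph face poset of critical cells. -/
def IsGradientPath {e n : ℕ} (α : Fin n → (Fin e →₀ ℕ)) (mo : MonomialOrder (Fin n))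
    (l : Fin e →₀ ℕ) (t s : Finset (Fin e →₀ ℕ)) (p : List (Finset (Fin e →₀ ℕ))) : Prop :=
  IsCritical α mo l t ∧ IsCritical α mo l s ∧ t.card = s.card + 1 ∧
    p.head? = some t ∧ p.getLast? = some s ∧ p.IsChain (GradientStep α mo l)

/-- The edges of the multigraph face poset, directed upward if they belong to `M` and downward
otherwise.  Elements of `M` are pairs (larger cell, smaller cell). -/
def CancelStep {e n : ℕ} (α : Fin n → (Fin e →₀ ℕ)) (mo : MonomialOrder (Fin n))
    (l : Fin e →₀ ℕ) (M : Set (Finset (Fin e →₀ ℕ) × Finset (Fin e →₀ ℕ)))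
    (x y : Finset (Fin e →₀ ℕ)) : Prop :=
  (y, x) ∈ M ∨ ((x, y) ∉ M ∧ ∃ p, IsGradientPath α mo l x y p)

/-- `M` is an acyclic matching on the multigraph face poset of critical cells all of whose pairs
consist of cells of equal content.  (A second gradient path joining the cells of a pair of `M`
would be a parallel edge, directed downward, and so create a cycle; hence `∃!`.) -/
structure IsCancellation {e n : ℕ} (α : Fin n → (Fin e →₀ ℕ)) (mo : MonomialOrder (Fin n))
    (l : Fin e →₀ ℕ) (M : Set (Finset (Fin e →₀ ℕ) × Finset (Fin e →₀ ℕ))) : Prop where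
  unique_path : ∀ q ∈ M, ∃! p, IsGradientPath α mo l q.1 q.2 p
  equal_content : ∀ q ∈ M, content (labelSeq α mo l q.1) = content (labelSeq α mo l q.2)
  matching : ∀ q ∈ M, ∀ q' ∈ M, ∀ x, (x = q.1 ∨ x = q.2) → (x = q'.1 ∨ x = q'.2) → q = q'
  acyclic : ∀ x, ¬ Relation.TransGen (CancelStep α mo l M) x x

/-- The surviving critical cells: those not cancelled by `M`. -/
def survivors {e n : ℕ} (α : Fin n → (Fin e →₀ ℕ)) (mo : MonomialOrder (Fin n))
    (l : Fin e →₀ ℕ) (M : Set (Finset (Fin e →₀ ℕ) × Finset (Fin e →₀ ℕ))) :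
    Set (Finset (Fin e →₀ ℕ)) :=
  {s | IsCritical α mo l s ∧ ∀ q ∈ M, s ≠ q.1 ∧ s ≠ q.2}

/-- The cancellation `M` cancels every unsaturated critical cell, i.e. every critical cell that
is not a maximal face of `Δ(0, l)`. -/
def CancelsUnsaturated {e n : ℕ} (α : Fin n → (Fin e →₀ ℕ)) (mo : MonomialOrder (Fin n))
    (l : Fin e →₀ ℕ) (M : Set (Finset (Fin e →₀ ℕ) × Finset (Fin e →₀ ℕ))) : Prop :=
  ∀ s ∈ survivors α mo l M, Maximal (IsFace α l) s

/-! ### Commutation classes of label sequences -/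

/-- Swapping two consecutive labels `a, b` with `z_a z_b ∉ J`. -/
def CommStep (k : Type*) [Field k] {e n : ℕ} (α : Fin n → (Fin e →₀ ℕ))
    (mo : MonomialOrder (Fin n)) (w w' : List (Fin n)) : Prop :=
  ∃ u v a b, ¬ InJ k α mo a b ∧ w = u ++ [a, b] ++ v ∧ w' = u ++ [b, a] ++ v

/-- The `J'`-commuting equivalence class of a label sequence. -/
def commClass (k : Type*) [Field k] {e n : ℕ} (α : Fin n → (Fin e →₀ ℕ))
    (mo : MonomialOrder (Fin n)) (w : List (Fin n)) : Set (List (Fin n)) :=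
  {w' | Relation.EqvGen (CommStep k α mo) w w'}

/-- `w` is `J'`-stuttering: it has consecutive labels `a, a` with `z_a² ∉ J`. -/
def IsStuttering (k : Type*) [Field k] {e n : ℕ} (α : Fin n → (Fin e →₀ ℕ))
    (mo : MonomialOrder (Fin n)) (w : List (Fin n)) : Prop :=
  ∃ u v a, ¬ InJ k α mo a a ∧ w = u ++ [a, a] ++ v

/-- The `J'`-non-stuttering, `J'`-commuting equivalence classes of content `m`. -/
def nonStutteringClasses (k : Type*) [Field k] {e n : ℕ} (α : Fin n → (Fin e →₀ ℕ))
    (mo : MonomialOrder (Fin n)) (m : Fin n →₀ ℕ) : Set (Set (List (Fin n))) :=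
  {C | (∃ w, content w = m ∧ C = commClass k α mo w) ∧ ∀ w ∈ C, ¬ IsStuttering k α mo w}

/-- The label sequences of content `m` of surviving critical cells. -/
def survivingLabelSeqs {e n : ℕ} (α : Fin n → (Fin e →₀ ℕ)) (mo : MonomialOrder (Fin n))
    (l : Fin e →₀ ℕ) (M : Set (Finset (Fin e →₀ ℕ) × Finset (Fin e →₀ ℕ)))
    (m : Fin n →₀ ℕ) : Set (List (Fin n)) :=
  {w | content w = m ∧ ∃ s ∈ survivors α mo l M, labelSeq α mo l s = w}

end MonoidPoset

end

/-! ### Truncation of an interval system into J-intervals. -/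

namespace QuadraticMorse
open Finset MonoidPoset

/-! Everything is translated into words in the labels. Let `N a b` mean that the product of the
variables of `a` and `b` lies in the initial ideal, and let `Rel N a b` mean that `a ≤ b` and not `N
a b`. Since the Gröbner basis is quadratic, a word is the earliest label sequence of its degree
exactly when its letters are pairwise related (`pairwise_not_inJ`, `pos_le_of_pairwise`). Hence a
face is a list of blocks with pairwise related letters, and the I-intervals of a facet are the
minimal clashes of its word (`iIntervals_eq`). A cell is critical exactly when it is a reading: the
first block is a single letter, and each later block ends at the first letter that clashes with the
block before it (`critical_iff`). Reading is deterministic, so a word carries at most one critical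
cell.

A gradient path between critical cells of neighbouring dimensions and equal content alternately
sorts two adjacent blocks into one and splits a block at the pivot. Along it commuting letters are
only ever swapped into increasing order, so the words descend in the order `Dom`. This confines the
path so strongly that in the cases needed it is forced.

For the existence of a complete cancellation, take the least letter of a word that can be moved to
the left past a smaller commuting one, and its last such occurrence (`Tog`). Moving this letter
inside its window produces a fiber of words. The readings in a fiber have the letter in front of
certain tiles, behind them, or before the last one. By `reads_of_two`, and by
`Corridor.existsUnique_same_tail` in the easier cases, a fiber with a reading has exactly two,
joined by exactly one gradient path (`Fiber.exists_pair`). These pairs form the matching. It is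
acyclic because every other path lowers the content or lowers the potential `key`, which is constant
on fibers (`CritPath.key_lt`, `potential_lt`). The unmatched critical cells are the readings of the
words without a movable letter (`Settled`). All their blocks are single letters, so they are facets.
Every commutation class contains exactly one settled word, and that word is a reading exactly when
the class is non-stuttering.

For an arbitrary complete cancellation, a matched pair has equal content and is joined by a path, so
its label sequences lie in one commutation class. The sum of the signs of the critical cells of a
class is therefore not changed by cancelling. The survivors of a class are facets of one and the
same dimension, so their number does not depend on the cancellation (`card_class`), and the
constructed matching shows that it is one or zero. -/

/-- The list of truncated intervals produced from the intervals `(a, c]` with `I a c`, once all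
intervals with `a < m` have been discarded and the ranks up to `b` have been removed. -/
inductive JRun (I : ℕ → ℕ → Prop) : ℕ → ℕ → List (Finset ℕ) → Prop
  | nil {m b : ℕ} : (∀ a c, I a c → a < m) → JRun I m b []
  | cons {m b a c : ℕ} {L : List (Finset ℕ)} : I a c → m ≤ a →
      (∀ a' c', I a' c' → m ≤ a' → a ≤ a') → max a b < c → JRun I (max a b + 1) c L →
      JRun I m b (Ioc (max a b) c :: L)

structure IntervalSystem (I : ℕ → ℕ → Prop) : Prop where
  lt : ∀ {a c}, I a c → a < c
  mono : ∀ {a c a' c'}, I a c → I a' c' → a < a' → c < c'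
  inj : ∀ {a c c'}, I a c → I a c' → c = c'

/-- The invariants are that the members are truncations of remaining intervals, that every remaining
truncation contains a member, and that the members form an antichain. The second is what lets
intervals be dropped as non-minimal without losing the information which one comes next. -/
theorem jrun_truncation {I : ℕ → ℕ → Prop} (hI : IntervalSystem I) :
    ∀ (t : ℕ) (𝓢 : Finset (Finset ℕ)) (m b : ℕ), 𝓢.card ≤ t →
      (∀ Q ∈ 𝓢, ∃ a c, I a c ∧ m ≤ a ∧ b < c ∧ Q = Ioc (max a b) c) →
      (∀ a c, I a c → m ≤ a → ∃ Q ∈ 𝓢, Q ⊆ Ioc (max a b) c) →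
      (∀ Q ∈ 𝓢, ∀ Q' ∈ 𝓢, ¬ Q ⊂ Q') → JRun I m b (truncation t 𝓢) := by
  intro t
  induction t with
  | zero =>
    intro 𝓢 m b hc h1 h2 h3
    have : 𝓢 = ∅ := by simpa using hc
    subst this
    refine JRun.nil fun a c h => ?_
    grind
  | succ t ih =>
    intro 𝓢 m b hc h1 h2 h3
    unfold truncation
    split_ifs with hne
    · have hK := (𝓢.exists_min_image Finset.min hne).choose_spec
      set K := (𝓢.exists_min_image Finset.min hne).choose with hKdef
      obtain ⟨hK𝓢, hKmin⟩ := hK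
      have hex : ∃ a, m ≤ a ∧ ∃ c, I a c := by
        grind
      classical
      obtain ⟨a, ⟨hma, c, hac⟩, hleast⟩ : ∃ a, (m ≤ a ∧ ∃ c, I a c) ∧
          ∀ a', (m ≤ a' ∧ ∃ c, I a' c) → a ≤ a' :=
        ⟨Nat.find hex, Nat.find_spec hex, fun a' h => Nat.find_min' hex h⟩
      have hlea : ∀ a' c', I a' c' → m ≤ a' → a ≤ a' := fun a' c' h h' => hleast a' ⟨h', c', h⟩
      -- In an antichain of intervals the one with the least left end also has the least right end.
      have hcc : ∀ a' c', I a' c' → m ≤ a' → c ≤ c' := by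
        intro a' c' h h'
        rcases (hlea a' c' h h').eq_or_lt with rfl | hlt
        · exact (hI.inj hac h).le
        · exact (hI.mono hac h hlt).le
      -- The truncation of the interval with least left end is itself a member. The chosen `K`
      -- begins no later, so one contains the other and the antichain property makes them equal.
      have hKeq : K = Ioc (max a b) c := by
        obtain ⟨Q, hQ, hQsub⟩ := h2 a c hac hma
        obtain ⟨a2, c2, hI2, hm2, hb2, rfl⟩ := h1 Q hQ
        have hQlt : max a2 b < c2 := by have := hI.lt hI2; omega
        have hc2 : c2 = c := by
          have h := hQsub (mem_Ioc.2 ⟨hQlt, le_refl c2⟩)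
          grind
        subst hc2
        have ha2 : a2 = a := by
          rcases (hlea a2 c2 hI2 hm2).eq_or_lt with h | h
          · exact h.symm
          · exact absurd (hI.mono hac hI2 h) (lt_irrefl _)
        subst ha2
        obtain ⟨a3, c3, hI3, hm3, hb3, hK3⟩ := h1 K hK𝓢
        have hKlt : max a3 b < c3 := by have := hI.lt hI3; omega
        have hle : max a3 b ≤ max a2 b := by
          have hmin := hKmin _ hQ
          have hmem : max a2 b + 1 ∈ Ioc (max a2 b) c2 := mem_Ioc.2 ⟨by omega, by omega⟩
          have h4 := Finset.min_le hmem
          have h5 := hmin.trans h4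
          rw [hK3] at h5
          have hne3 : (Ioc (max a3 b) c3).Nonempty := ⟨c3, mem_Ioc.2 ⟨hKlt, le_refl _⟩⟩
          obtain ⟨k, hk⟩ := Finset.min_of_nonempty hne3
          have hkm := mem_Ioc.1 (Finset.mem_of_min hk)
          rw [hk] at h5
          have : k ≤ max a2 b + 1 := WithTop.coe_le_coe.1 h5
          omega
        grind
      have hKlt : max a b < c := by
        obtain ⟨a3, c3, hI3, hm3, hb3, hK3⟩ := h1 K hK𝓢
        have h3lt : max a3 b < c3 := by have := hI.lt hI3; omega
        have : c3 ∈ Ioc (max a b) c := by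
          rw [← hKeq, hK3]; exact mem_Ioc.2 ⟨h3lt, le_refl _⟩
        have := mem_Ioc.1 this
        omega
      -- the other elements start later
      have hother : ∀ Q ∈ 𝓢, Q ≠ K → ∃ a' c', I a' c' ∧ max a b + 1 ≤ a' ∧ c < c' ∧
          Q = Ioc (max a' b) c' := by
        grind
      have hdiff : ∀ a' c', max a b + 1 ≤ a' →
          Ioc (max a' b) c' \ Ioc (max a b) c = Ioc (max a' c) c' := by
        intro a' c' h
        ext r
        simp only [mem_sdiff, mem_Ioc]
        omega
      -- An interval with left end at most `max a b` other than the chosen one would have a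
      -- truncation containing `K`, so it is no longer present. This explains the new bound `max a b
      -- + 1`.
      have key : JRun I (max a b + 1) c
          (truncation t ((((𝓢.erase K).image (fun R => R \ K))).filter
            (fun R => ∀ R' ∈ ((𝓢.erase K).image (fun R => R \ K)), ¬ R' ⊂ R))) := by
        apply ih
        · grind
        · intro Q hQ
          obtain ⟨Q0, hQ0, rfl⟩ := mem_image.1 (mem_filter.1 hQ).1
          obtain ⟨hne0, hmem0⟩ := mem_erase.1 hQ0
          grind
        · intro a' c' h hle
          obtain ⟨Q0, hQ0, hsub⟩ := h2 a' c' h (by omega)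
          have hne0 : Q0 ≠ K := by
            rintro rfl
            have : max a b + 1 ∈ Ioc (max a' b) c' := hsub (by
              rw [hKeq]; exact mem_Ioc.2 ⟨by omega, by omega⟩)
            have := mem_Ioc.1 this
            omega
          have hmem : Q0 \ K ∈ (𝓢.erase K).image (fun R => R \ K) :=
            mem_image.2 ⟨Q0, mem_erase.2 ⟨hne0, hQ0⟩, rfl⟩
          obtain ⟨Q1, hQ1le, hQ1⟩ := exists_minimal_le_of_wellFoundedLT
            (fun Q => Q ∈ (𝓢.erase K).image (fun R => R \ K)) (Q0 \ K) hmem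
          refine ⟨Q1, mem_filter.2 ⟨hQ1.prop, fun R' hR' hss => hQ1.not_lt hR' hss⟩, ?_⟩
          grind
        · grind
      rw [hKeq] at key ⊢
      exact JRun.cons hac hma hlea hKlt key
    · refine JRun.nil fun a c h => ?_
      grind

theorem jrun_jIntervals {I : ℕ → ℕ → Prop} (hI : IntervalSystem I) (𝓢 : Finset (Finset ℕ))
    (h𝓢 : ∀ Q, Q ∈ 𝓢 ↔ ∃ a c, I a c ∧ Q = Ioc a c) : JRun I 0 0 (jIntervals 𝓢) := by
  refine jrun_truncation hI _ _ _ _ le_rfl ?_ ?_ ?_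
  · intro Q hQ
    obtain ⟨a, c, h, rfl⟩ := (h𝓢 Q).1 hQ
    exact ⟨a, c, h, by omega, by have := hI.lt h; omega, by simp⟩
  · intro a c h _
    exact ⟨Ioc a c, (h𝓢 _).2 ⟨a, c, h, rfl⟩, by simp⟩
  · intro Q hQ Q' hQ' hss
    obtain ⟨a, c, h, rfl⟩ := (h𝓢 Q).1 hQ
    obtain ⟨a', c', h', rfl⟩ := (h𝓢 Q').1 hQ'
    have h1 := hI.lt h
    have h2 := hI.lt h'
    have m1 := mem_Ioc.1 (hss.1 (mem_Ioc.2 ⟨lt_add_one a, h1⟩))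
    have m2 := mem_Ioc.1 (hss.1 (mem_Ioc.2 ⟨h1, le_refl c⟩))
    rcases lt_trichotomy a' a with hlt | rfl | hlt
    · have := hI.mono h' h hlt; omega
    · have := hI.inj h h'; subst this; exact hss.2 (le_refl _)
    · omega

/-! ### The pivot -/

theorem lowest_Ioc {a c : ℕ} (h : a < c) : lowest (Ioc a c) = {a + 1} := by
  ext r
  simp only [lowest, mem_filter, mem_Ioc, mem_singleton]
  grind

theorem lowest_eq_of_least {K : Finset ℕ} {r : ℕ} (hr : r ∈ K) (h : ∀ t ∈ K, r ≤ t) :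
    lowest K = {r} := by
  ext t
  simp only [lowest, mem_filter, mem_singleton]
  grind

theorem lowest_subset (K : Finset ℕ) : lowest K ⊆ K := filter_subset _ _

theorem lowest_nonempty {K : Finset ℕ} (h : K.Nonempty) : (lowest K).Nonempty :=
  ⟨K.min' h, mem_filter.2 ⟨K.min'_mem h, fun _ ht => K.min'_le _ ht⟩⟩

theorem lowest_eq_empty {K : Finset ℕ} : lowest K = ∅ ↔ K = ∅ := by
  constructor
  · intro h
    by_contra hne
    have := lowest_nonempty (nonempty_iff_ne_empty.2 hne)
    rw [h] at this
    simp at this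
  · rintro rfl; rfl

theorem mem_support {L : List (Finset ℕ)} {r : ℕ} : r ∈ support L ↔ ∃ K ∈ L, r ∈ K := by
  induction L with
  | nil => simp [support]
  | cons K L ih =>
    have : support (K :: L) = K ∪ support L := rfl
    rw [this, mem_union, ih]
    simp

theorem pivot_uncovered {N : Finset ℕ} {𝓐 : Finset (Finset ℕ)} {S : Finset ℕ}
    (h : 𝓐.biUnion id ≠ N) : pivot N 𝓐 S = lowest (N \ 𝓐.biUnion id) := by
  simp [pivot, h]

theorem pivot_first_bad {N : Finset ℕ} {𝓐 : Finset (Finset ℕ)} {S : Finset ℕ}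
    (h : 𝓐.biUnion id = N) {L₁ L₂ : List (Finset ℕ)} {K : Finset ℕ}
    (hL : jIntervals 𝓐 = L₁ ++ K :: L₂) (h1 : ∀ K' ∈ L₁, S ∩ K' = lowest K')
    (hK : S ∩ K ≠ lowest K) : pivot N 𝓐 S = lowest K := by
  have : (jIntervals 𝓐).find? (fun K => decide (S ∩ K ≠ lowest K)) = some K := by
    grind
  unfold pivot
  rw [if_pos h, this]

theorem pivot_all_good {N : Finset ℕ} {𝓐 : Finset (Finset ℕ)} {S : Finset ℕ}
    (h : 𝓐.biUnion id = N) (h1 : ∀ K' ∈ jIntervals 𝓐, S ∩ K' = lowest K') :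
    pivot N 𝓐 S = lowest (N \ support (jIntervals 𝓐)) := by
  have : (jIntervals 𝓐).find? (fun K => decide (S ∩ K ≠ lowest K)) = none := by
    rw [List.find?_eq_none]
    intro K' hK'
    simp [h1 K' hK']
  unfold pivot
  rw [if_pos h, this]

theorem exists_first_bad (L : List (Finset ℕ)) (S : Finset ℕ) :
    (∀ K ∈ L, S ∩ K = lowest K) ∨ ∃ L₁ K L₂, L = L₁ ++ K :: L₂ ∧
      (∀ K' ∈ L₁, S ∩ K' = lowest K') ∧ S ∩ K ≠ lowest K := by
  induction L with
  | nil => left; simp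
  | cons K L ih =>
    by_cases hK : S ∩ K = lowest K
    · grind
    · right
      exact ⟨[], K, L, rfl, by simp, hK⟩

/-! ### Properties of truncated intervals. -/

section Runs
variable {I : ℕ → ℕ → Prop}

theorem JRun.lt_of_mem {m b : ℕ} {L : List (Finset ℕ)} (h : JRun I m b L) :
    ∀ K ∈ L, ∀ r ∈ K, b < r := by
  induction h with
  | nil _ => simp
  | @cons m b a c L _ _ _ hlt _ ih =>
    grind

theorem JRun.disjoint {m b : ℕ} {L : List (Finset ℕ)} (h : JRun I m b L) :
    ∀ L₁ K L₂, L = L₁ ++ K :: L₂ → ∀ K' ∈ L₁ ++ L₂, ∀ r ∈ K, r ∉ K' := by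
  induction h with
  | nil _ => intro L₁ K L₂ h; simp at h
  | @cons m b a c L _ _ _ hlt hrun ih =>
    intro L₁ K L₂ h K' hK' r hr hr'
    rcases L₁ with _ | ⟨K₁, L₁⟩
    · simp only [List.nil_append, List.cons.injEq] at h hK'
      obtain ⟨rfl, rfl⟩ := h
      have := hrun.lt_of_mem K' hK' r hr'
      have := mem_Ioc.1 hr
      omega
    · simp only [List.cons_append, List.cons.injEq] at h
      obtain ⟨rfl, rfl⟩ := h
      simp only [List.cons_append, List.mem_cons] at hK'
      rcases hK' with rfl | hK'
      · have := hrun.lt_of_mem K (by simp) r hr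
        have := mem_Ioc.1 hr'
        omega
      · exact ih L₁ K L₂ rfl K' hK' r hr hr'

theorem JRun.nonempty {m b : ℕ} {L : List (Finset ℕ)} (h : JRun I m b L) :
    ∀ K ∈ L, ∃ a c, a < c ∧ K = Ioc a c := by
  induction h with
  | nil _ => simp
  | @cons m b a c L _ _ _ hlt _ ih =>
    grind

/-- If a set of ranks meets the first truncated intervals exactly in their least elements and
misses the next one, it misses one of the original intervals. -/
theorem JRun.exists_missed {m b : ℕ} {L : List (Finset ℕ)} (h : JRun I m b L) {S : Finset ℕ} :
    (∀ r ∈ S, m < r → r ≤ b → False) → ∀ L₁ K L₂, L = L₁ ++ K :: L₂ →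
      (∀ K' ∈ L₁, S ∩ K' = lowest K') → S ∩ K = ∅ → ∃ a c, I a c ∧ ∀ r ∈ S, ¬ (a < r ∧ r ≤ c) := by
  induction h with
  | nil _ => intro _ L₁ K L₂ h; simp at h
  | @cons m b a c L hI hm _ hlt _ ih =>
    intro hS L₁ K L₂ h hgood hK
    rcases L₁ with _ | ⟨K₁, L₁⟩
    · simp only [List.nil_append, List.cons.injEq] at h
      obtain ⟨rfl, rfl⟩ := h
      refine ⟨a, c, hI, fun r hr hac => ?_⟩
      by_cases hb : r ≤ b
      · exact hS r hr (by omega) hb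
      · have : r ∈ S ∩ Ioc (max a b) c := mem_inter.2 ⟨hr, mem_Ioc.2 ⟨by omega, by omega⟩⟩
        rw [hK] at this
        simp at this
    · simp only [List.cons_append, List.cons.injEq] at h
      obtain ⟨rfl, rfl⟩ := h
      refine ih ?_ L₁ K L₂ rfl (fun K' hK' => hgood K' (by simp [hK'])) hK
      -- The interval just passed is met only in its least rank `max a b + 1`, which is the new
      -- lower bound, so no rank of `S` lies strictly between that bound and `c`.
      intro r hr h1 h2
      have h3 := hgood _ (List.mem_cons_self)
      rw [lowest_Ioc hlt] at h3
      have : r ∈ S ∩ Ioc (max a b) c := mem_inter.2 ⟨hr, mem_Ioc.2 ⟨by omega, by omega⟩⟩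
      rw [h3, mem_singleton] at this
      omega

theorem JRun.next (hI : IntervalSystem I) {m b a c : ℕ} {L : List (Finset ℕ)} (h : JRun I m b L)
    (hac : I a c) (hm : m ≤ a) (hl : ∀ a' c', I a' c' → m ≤ a' → a ≤ a') :
    ∃ L', L = Ioc (max a b) c :: L' ∧ max a b < c ∧ JRun I (max a b + 1) c L' := by
  cases h with
  | nil h => exact absurd (h a c hac) (by omega)
  | @cons m b a' c' L hac' hm' hl' hlt hrun =>
    obtain rfl : a = a' := le_antisymm (hl _ _ hac' hm') (hl' _ _ hac hm)
    obtain rfl := hI.inj hac hac'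
    exact ⟨_, rfl, hlt, hrun⟩

end Runs

theorem eq_of_mem_lowest {K : Finset ℕ} {r t : ℕ} (hr : r ∈ lowest K) (ht : t ∈ lowest K) :
    r = t := by
  simp only [lowest, mem_filter] at hr ht
  exact le_antisymm (hr.2 t ht.1) (ht.2 r hr.1)

theorem lowest_eq_singleton {K : Finset ℕ} {r : ℕ} (hr : r ∈ lowest K) : lowest K = {r} := by
  ext t
  rw [mem_singleton]
  exact ⟨fun ht => eq_of_mem_lowest ht hr, fun h => h ▸ hr⟩

/-! ### Clashes of a word, its interval system, and the pivot. -/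

section Words
variable {A : Type*} (R : A → A → Prop)

/-- The letters of `w` at positions `i < j` are not related by `R`. -/
def Clash (w : List A) (i j : ℕ) : Prop :=
  i < j ∧ ∃ a b, w[i]? = some a ∧ w[j]? = some b ∧ ¬ R a b

def MinClash (w : List A) (i j : ℕ) : Prop :=
  Clash R w i j ∧ ∀ i' j', Clash R w i' j' → i ≤ i' → j' ≤ j → i' = i ∧ j' = j

/-- Every clash of `w` is separated by a rank in `S`. -/
def GoodCell (w : List A) (S : Finset ℕ) : Prop :=
  ∀ i j, Clash R w i j → ∃ r ∈ S, i < r ∧ r ≤ j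

open Classical in
noncomputable def clashIntervals (w : List A) : Finset (Finset ℕ) :=
  ((range w.length ×ˢ range w.length).filter (fun p => MinClash R w p.1 p.2)).image
    (fun p => Ioc p.1 p.2)

noncomputable def jList (w : List A) : List (Finset ℕ) := jIntervals (clashIntervals R w)

noncomputable def piv (w : List A) (S : Finset ℕ) : Finset ℕ :=
  pivot (Ioo 0 w.length) (clashIntervals R w) S

def Covered (w : List A) : Prop := (clashIntervals R w).biUnion id = Ioo 0 w.length

/-- The cell is not matched with a smaller one. -/
def Alive (w : List A) (S : Finset ℕ) : Prop := ∀ b ∈ piv R w S, b ∉ S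

variable {R}

theorem Clash.lt_length {w : List A} {i j : ℕ} (h : Clash R w i j) : j < w.length := by
  obtain ⟨_, a, b, _, hb, _⟩ := h
  exact (List.getElem?_eq_some_iff.1 hb).1

theorem mem_clashIntervals {w : List A} {Q : Finset ℕ} :
    Q ∈ clashIntervals R w ↔ ∃ a c, MinClash R w a c ∧ Q = Ioc a c := by
  simp only [clashIntervals, mem_image, mem_filter, mem_product, mem_range, Prod.exists]
  constructor
  · rintro ⟨a, c, ⟨_, h⟩, rfl⟩
    exact ⟨a, c, h, rfl⟩
  · rintro ⟨a, c, h, rfl⟩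
    exact ⟨a, c, ⟨⟨h.1.1.trans h.1.lt_length, h.1.lt_length⟩, h⟩, rfl⟩

theorem intervalSystem_minClash (w : List A) : IntervalSystem (MinClash R w) where
  lt h := h.1.1
  mono := by
    intro a c a' c' h h' hlt
    by_contra hcon
    have := h.2 a' c' h'.1 hlt.le (by omega)
    grind
  inj := by
    intro a c c' h h'
    rcases le_total c c' with hle | hle
    · exact (h'.2 a c h.1 le_rfl hle).2
    · exact (h.2 a c' h'.1 le_rfl hle).2.symm

theorem Clash.exists_min {w : List A} {i j : ℕ} (h : Clash R w i j) :
    ∃ i' j', MinClash R w i' j' ∧ i ≤ i' ∧ j' ≤ j := by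
  induction hd : j - i using Nat.strong_induction_on generalizing i j with
  | _ d ih =>
    by_cases hmin : MinClash R w i j
    · exact ⟨i, j, hmin, le_rfl, le_rfl⟩
    · simp only [MinClash, not_and, not_forall] at hmin
      obtain ⟨i', j', hc, hi, hj, hne⟩ := hmin h
      have := hc.1
      grind

theorem jrun_jList (w : List A) : JRun (MinClash R w) 0 0 (jList R w) :=
  jrun_jIntervals (intervalSystem_minClash w) _ (fun _ => mem_clashIntervals)

theorem covered_iff {w : List A} : Covered R w ↔
    ∀ r, 0 < r → r < w.length → ∃ a c, MinClash R w a c ∧ a < r ∧ r ≤ c := by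
  unfold Covered
  constructor
  · intro h r h1 h2
    have : r ∈ (clashIntervals R w).biUnion id := by rw [h]; exact mem_Ioo.2 ⟨h1, h2⟩
    obtain ⟨Q, hQ, hr⟩ := mem_biUnion.1 this
    obtain ⟨a, c, hm, rfl⟩ := mem_clashIntervals.1 hQ
    exact ⟨a, c, hm, mem_Ioc.1 hr⟩
  · intro h
    ext r
    rw [mem_biUnion, mem_Ioo]
    constructor
    · rintro ⟨Q, hQ, hr⟩
      obtain ⟨a, c, hm, rfl⟩ := mem_clashIntervals.1 hQ
      have := mem_Ioc.1 hr
      have := hm.1.lt_length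
      omega
    · rintro ⟨h1, h2⟩
      obtain ⟨a, c, hm, hr⟩ := h r h1 h2
      exact ⟨_, mem_clashIntervals.2 ⟨a, c, hm, rfl⟩, mem_Ioc.2 hr⟩

/-- A truncated interval that is missed, after all earlier ones were met correctly, comes from an
original interval that is missed, that is, from an unseparated clash. -/
theorem GoodCell.inter_nonempty {w : List A} {S : Finset ℕ} (hS : GoodCell R w S)
    {L₁ L₂ : List (Finset ℕ)} {K : Finset ℕ} (hL : jList R w = L₁ ++ K :: L₂)
    (h1 : ∀ K' ∈ L₁, S ∩ K' = lowest K') : S ∩ K ≠ ∅ := by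
  intro hK
  obtain ⟨a, c, hac, hno⟩ := (jrun_jList w).exists_missed (S := S) (by intros; omega) _ _ _ hL h1 hK
  obtain ⟨r, hr, h⟩ := hS a c hac.1
  exact hno r hr h

theorem piv_of_not_covered {w : List A} (h : ¬ Covered R w) (S S' : Finset ℕ) :
    piv R w S = piv R w S' := by
  unfold piv
  rw [pivot_uncovered h, pivot_uncovered h]

theorem piv_first_bad {w : List A} {S : Finset ℕ} (h : Covered R w) {L₁ L₂ : List (Finset ℕ)}
    {K : Finset ℕ} (hL : jList R w = L₁ ++ K :: L₂) (h1 : ∀ K' ∈ L₁, S ∩ K' = lowest K')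
    (hK : S ∩ K ≠ lowest K) : piv R w S = lowest K := pivot_first_bad h hL h1 hK

theorem piv_all_good {w : List A} {S : Finset ℕ} (h : Covered R w)
    (h1 : ∀ K' ∈ jList R w, S ∩ K' = lowest K') :
    piv R w S = lowest (Ioo 0 w.length \ support (jList R w)) := pivot_all_good h h1

theorem piv_eq_lowest (w : List A) (S : Finset ℕ) : ∃ K, piv R w S = lowest K := by
  by_cases h : Covered R w
  · rcases exists_first_bad (jList R w) S with h1 | ⟨L₁, K, L₂, hL, h1, hK⟩
    · exact ⟨_, piv_all_good h h1⟩
    · exact ⟨_, piv_first_bad h hL h1 hK⟩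
  · exact ⟨_, pivot_uncovered h⟩

theorem eq_of_mem_piv {w : List A} {S : Finset ℕ} {r t : ℕ} (hr : r ∈ piv R w S)
    (ht : t ∈ piv R w S) : r = t := by
  obtain ⟨K, hK⟩ := piv_eq_lowest (R := R) w S
  rw [hK] at hr ht
  exact eq_of_mem_lowest hr ht

theorem piv_eq_singleton {w : List A} {S : Finset ℕ} {r : ℕ} (hr : r ∈ piv R w S) :
    piv R w S = {r} := by
  obtain ⟨K, hK⟩ := piv_eq_lowest (R := R) w S
  rw [hK] at hr ⊢
  exact lowest_eq_singleton hr

theorem jList_subset {w : List A} : ∀ K ∈ jList R w, K ⊆ Ioo 0 w.length := by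
  have key : ∀ m b L, JRun (MinClash R w) m b L → ∀ K ∈ L, K ⊆ Ioo 0 w.length := by
    intro m b L h
    induction h with
    | nil _ => simp
    | @cons m b a c L hac _ _ hlt _ ih =>
      intro K hK
      rcases List.mem_cons.1 hK with rfl | hK
      · intro r hr
        have := mem_Ioc.1 hr
        have := hac.1.lt_length
        exact mem_Ioo.2 ⟨by omega, by omega⟩
      · exact ih K hK
  exact key _ _ _ (jrun_jList w)

theorem piv_subset (w : List A) (S : Finset ℕ) : piv R w S ⊆ Ioo 0 w.length := by
  by_cases h : Covered R w
  · rcases exists_first_bad (jList R w) S with h1 | ⟨L₁, K, L₂, hL, h1, hK⟩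
    · rw [piv_all_good h h1]
      exact (lowest_subset _).trans sdiff_subset
    · rw [piv_first_bad h hL h1 hK]
      exact (lowest_subset _).trans (jList_subset K (by rw [hL]; simp))
  · unfold piv
    rw [pivot_uncovered h]
    exact (lowest_subset _).trans sdiff_subset

/-- The rank `r` is the only rank of `S` in `K`, so deleting it leaves a cell that misses `K`
altogether, while the earlier truncated intervals do not notice the deletion. -/
theorem no_missing_good {w : List A} {S T : Finset ℕ} {r : ℕ}
    (hT : GoodCell R w T) (hTS : ∀ K ∈ jList R w, ∀ t, t ∈ K → t ≠ r → (t ∈ T ↔ t ∈ S))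
    (hrT : r ∉ T) {L₁ L₂ : List (Finset ℕ)} {K : Finset ℕ} (hL : jList R w = L₁ ++ K :: L₂)
    (h1 : ∀ K' ∈ L₁, S ∩ K' = lowest K') (hK : S ∩ K = lowest K) (hrK : r ∈ K) (hrS : r ∈ S) :
    False := by
  have hr1 : ∀ K' ∈ L₁, r ∉ K' := fun K' hK' =>
    (jrun_jList w).disjoint L₁ K L₂ hL K' (by simp [hK']) r hrK
  refine hT.inter_nonempty hL (fun K' hK' => ?_) ?_
  · grind
  · have hlow : lowest K = {r} := lowest_eq_singleton (hK ▸ mem_inter.2 ⟨hrS, hrK⟩)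
    ext t
    simp only [mem_inter, notMem_empty, iff_false, not_and]
    intro ht htK
    by_cases e : t = r
    · exact hrT (e ▸ ht)
    · have : t ∈ S ∩ K := mem_inter.2 ⟨(hTS K (by rw [hL]; simp) t htK e).1 ht, htK⟩
      rw [hK, hlow, mem_singleton] at this
      exact e this

/-- Removing a rank from a critical cell never gives a cell of the same word. -/
theorem not_goodCell_erase_of_critical {w : List A} {S : Finset ℕ} (hpiv : piv R w S = ∅)
    {r : ℕ} (hr : r ∈ S) (hrw : r ∈ Ioo 0 w.length) : ¬ GoodCell R w (S.erase r) := by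
  intro hg
  by_cases h : Covered R w
  · rcases exists_first_bad (jList R w) S with h1 | ⟨L₁, K, L₂, hL, h1, hK⟩
    · rw [piv_all_good h h1, lowest_eq_empty, sdiff_eq_empty_iff_subset] at hpiv
      obtain ⟨K, hK, hrK⟩ := mem_support.1 (hpiv hrw)
      obtain ⟨L₁, L₂, hL⟩ := List.append_of_mem hK
      refine no_missing_good hg (S := S) (r := r) ?_ (by simp) hL (fun K' hK' => h1 K' (by
        rw [hL]; simp [hK'])) (h1 K hK) hrK hr
      intro K _ t _ hne
      simp [hne]
    · rw [piv_first_bad h hL h1 hK, lowest_eq_empty] at hpiv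
      obtain ⟨a, c, hac, hKe⟩ := (jrun_jList w).nonempty K (by rw [hL]; simp)
      simp_all
  · unfold piv at hpiv
    rw [pivot_uncovered h, lowest_eq_empty, sdiff_eq_empty_iff_subset] at hpiv
    apply h
    unfold Covered
    refine subset_antisymm ?_ hpiv
    intro t ht
    obtain ⟨Q, hQ, hr⟩ := mem_biUnion.1 ht
    obtain ⟨a, c, hm, rfl⟩ := mem_clashIntervals.1 hQ
    have := mem_Ioc.1 hr
    have := hm.1.lt_length
    exact mem_Ioo.2 ⟨by omega, by omega⟩

/-- The cells of the same word below an upward match which are not themselves matched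
downward. -/
theorem inword_step {w : List A} {S : Finset ℕ} {b r : ℕ} (hS : GoodCell R w S)
    (hb : b ∈ piv R w S) (hbS : b ∉ S) (hr : r ∈ S)
    (hg : GoodCell R w ((insert b S).erase r)) (hal : Alive R w ((insert b S).erase r)) :
    Covered R w ∧ ∃ L₁ K L₂, jList R w = L₁ ++ K :: L₂ ∧ (∀ K' ∈ L₁, S ∩ K' = lowest K') ∧
      lowest K = {b} ∧ S ∩ K = {r} := by
  have hrb : r ≠ b := fun e => hbS (e ▸ hr)
  have hbS' : b ∈ (insert b S).erase r := by simp [hrb.symm]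
  have hrS' : r ∉ (insert b S).erase r := by simp
  by_cases h : Covered R w
  swap
  -- An uncovered pivot depends on the word only, so the new cell would contain its own pivot `b`.
  · exact absurd hbS' (hal b (piv_of_not_covered h S _ ▸ hb))
  refine ⟨h, ?_⟩
  rcases exists_first_bad (jList R w) S with h1 | ⟨L₁, K, L₂, hL, h1, hK⟩
  · exfalso
    have hb' := hb
    rw [piv_all_good h h1] at hb'
    have hbsup := (mem_sdiff.1 (lowest_subset _ hb')).2
    have hbK : ∀ K ∈ jList R w, b ∉ K := fun K hK hbK => hbsup (mem_support.2 ⟨K, hK, hbK⟩)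
    by_cases hrs : r ∈ support (jList R w)
    · obtain ⟨K, hK, hrK⟩ := mem_support.1 hrs
      obtain ⟨L₁, L₂, hL⟩ := List.append_of_mem hK
      refine no_missing_good hg (S := S) (r := r) ?_ hrS' hL (fun K' hK' => h1 K' (by
        rw [hL]; simp [hK'])) (h1 K hK) hrK hr
      grind
    · refine hal b ?_ hbS'
      rw [piv_all_good h]
      · exact hb'
      · intro K hK
        rw [← h1 K hK]
        ext t
        simp only [mem_inter, mem_erase, mem_insert]
        constructor
        · grind
        · rintro ⟨ht, htK⟩
          exact ⟨⟨fun e => hrs (mem_support.2 ⟨K, hK, e ▸ htK⟩), Or.inr ht⟩, htK⟩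
  · have hpiv := piv_first_bad h hL h1 hK
    have hlow : lowest K = {b} := lowest_eq_singleton (hpiv ▸ hb)
    have hbK : b ∈ K := lowest_subset K (by rw [hlow]; simp)
    have hbL : ∀ K' ∈ L₁, b ∉ K' := fun K' hK' =>
      (jrun_jList w).disjoint L₁ K L₂ hL K' (by simp [hK']) b hbK
    -- An earlier interval is met only in its least rank; deleting that rank would leave a clash
    -- unseparated.
    have hrL : ∀ K' ∈ L₁, r ∉ K' := by
      intro K' hK' hrK'
      obtain ⟨M₁, M₂, hM⟩ := List.append_of_mem hK'
      refine hg.inter_nonempty (L₁ := M₁) (K := K') (L₂ := M₂ ++ K :: L₂) (by rw [hL, hM]; simp)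
        ?_ ?_
      · intro K'' hK''
        rw [← h1 K'' (by rw [hM]; simp [hK''])]
        have hr' : r ∉ K'' := (jrun_jList w).disjoint M₁ K' (M₂ ++ K :: L₂)
          (by rw [hL, hM]; simp) K'' (by simp [hK'']) r hrK'
        grind
      · have hk := h1 K' hK'
        have hlow' : lowest K' = {r} := lowest_eq_singleton (hk ▸ mem_inter.2 ⟨hr, hrK'⟩)
        simp_all
    have hgood : ∀ K' ∈ L₁, (insert b S).erase r ∩ K' = lowest K' := by
      grind
    -- Otherwise `K` would still be the first bad interval, and the new cell would contain its pivot
    -- `b`.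
    have hK' : (insert b S).erase r ∩ K = {b} := by
      by_contra hne
      rw [← hlow] at hne
      refine hal b ?_ hbS'
      rw [piv_first_bad h hL hgood hne, hlow]
      simp
    refine ⟨L₁, K, L₂, hL, h1, hlow, ?_⟩
    have hsub : S ∩ K ⊆ {r} := by
      intro t ht
      obtain ⟨htS, htK⟩ := mem_inter.1 ht
      rw [mem_singleton]
      by_contra hne
      have : t ∈ (insert b S).erase r ∩ K := by simp [hne, htS, htK]
      rw [hK', mem_singleton] at this
      exact hbS (this ▸ htS)
    rcases Finset.subset_singleton_iff.1 hsub with h0 | h0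
    · exact absurd h0 (hS.inter_nonempty hL h1)
    · exact h0

end Words

/-! ### Lists of blocks and their cuts. -/

section Blocks
variable {A : Type*} {R : A → A → Prop}

theorem clash_of_eq {w l₁ l₂ l₃ : List A} {y c : A} (h : w = l₁ ++ y :: (l₂ ++ c :: l₃))
    (hyc : ¬ R y c) : Clash R w l₁.length (l₁.length + 1 + l₂.length) := by
  subst h
  refine ⟨by omega, y, c, by simp, ?_, hyc⟩
  grind

theorem not_clash_of_pairwise {w l₁ G l₂ : List A} (h : w = l₁ ++ G ++ l₂) (hG : G.Pairwise R)
    {i j : ℕ} (hi : l₁.length ≤ i) (hj : j < l₁.length + G.length) : ¬ Clash R w i j := by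
  rintro ⟨hij, a, b, ha, hb, hab⟩
  subst h
  apply hab
  rw [List.append_assoc, List.getElem?_append_right (by omega), List.getElem?_append_left
    (by omega)] at ha hb
  obtain ⟨h1, rfl⟩ := List.getElem?_eq_some_iff.1 ha
  obtain ⟨h2, rfl⟩ := List.getElem?_eq_some_iff.1 hb
  exact List.pairwise_iff_getElem.1 hG _ _ _ _ (by omega)

/-- The minimal clash leaving the block `P = P₁ ++ y :: P₂` of a word. -/
theorem minClash_next {w l₁ P₁ P₂ X rest : List A} {y c : A}
    (h : w = l₁ ++ (P₁ ++ y :: P₂) ++ X ++ c :: rest)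
    (hyc : ¬ R y c) (h1 : (P₁ ++ y :: P₂ ++ X).Pairwise R) (h2 : (P₂ ++ X ++ [c]).Pairwise R) :
    MinClash R w (l₁.length + P₁.length) (l₁.length + (P₁ ++ y :: P₂).length + X.length) ∧
    ∀ a' c', MinClash R w a' c' → l₁.length ≤ a' → l₁.length + P₁.length ≤ a' := by
  have hc0 : Clash R w (l₁.length + P₁.length)
      (l₁.length + (P₁ ++ y :: P₂).length + X.length) := by
    have := clash_of_eq (w := w) (l₁ := l₁ ++ P₁) (l₂ := P₂ ++ X) (l₃ := rest) (by simp [h]) hyc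
    convert this using 1 <;> simp <;> omega
  have hno1 : ∀ i j, l₁.length ≤ i → j < l₁.length + (P₁ ++ y :: P₂).length + X.length →
      ¬ Clash R w i j := fun i j hi hj =>
    not_clash_of_pairwise (l₁ := l₁) (l₂ := c :: rest) (by simp [h]) h1 hi (by
      rw [List.length_append (as := P₁ ++ y :: P₂)]; omega)
  have hno2 : ∀ i j, l₁.length + P₁.length + 1 ≤ i →
      j ≤ l₁.length + (P₁ ++ y :: P₂).length + X.length → ¬ Clash R w i j := fun i j hi hj =>
    not_clash_of_pairwise (l₁ := l₁ ++ P₁ ++ [y]) (l₂ := rest) (by simp [h]) h2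
      (by simp; omega) (by simp at hj ⊢; omega)
  refine ⟨⟨hc0, ?_⟩, ?_⟩
  · grind
  · intro a' c' hm ha'
    by_contra hlt
    -- No two letters before `c` clash from `l₁` onwards. A minimal clash starting before `y` would
    -- thus reach at least to `c` and contain the clash of `y` and `c`.
    have hcc : l₁.length + (P₁ ++ y :: P₂).length + X.length ≤ c' := by
      by_contra hcon
      exact hno1 a' c' ha' (by omega) hm.1
    have := hm.2 _ _ hc0 (by omega) hcc
    omega

/-! ### Lists of blocks -/

def starts : ℕ → List (List A) → Finset ℕ
  | _, [] => ∅
  | o, B :: bs => insert o (starts (o + B.length) bs)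

/-- The ranks between consecutive blocks. -/
def cuts : List (List A) → Finset ℕ
  | [] => ∅
  | B :: bs => starts B.length bs

theorem starts_append (o : ℕ) (bs cs : List (List A)) :
    starts o (bs ++ cs) = starts o bs ∪ starts (o + bs.flatten.length) cs := by
  induction bs generalizing o with
  | nil => simp [starts]
  | cons B bs ih =>
    simp only [List.cons_append, starts, ih, List.flatten_cons, List.length_append,
      Finset.insert_union, add_assoc]

theorem le_of_mem_starts {o r : ℕ} {bs : List (List A)} (h : r ∈ starts o bs) : o ≤ r := by
  induction bs generalizing o with
  | nil => simp [starts] at h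
  | cons B bs ih =>
    rcases mem_insert.1 h with rfl | h
    · exact le_rfl
    · have := ih h; omega

theorem lt_of_mem_starts {o r : ℕ} {bs : List (List A)} (hb : ∀ B ∈ bs, B ≠ [])
    (h : r ∈ starts o bs) : r < o + bs.flatten.length := by
  induction bs generalizing o with
  | nil => simp [starts] at h
  | cons B bs ih =>
    have : 0 < B.length := List.length_pos_of_ne_nil (hb B (by simp))
    rcases mem_insert.1 h with rfl | h
    all_goals grind

theorem mem_starts_self {o : ℕ} {bs : List (List A)} (h : bs ≠ []) : o ∈ starts o bs := by
  cases bs with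
  | nil => exact absurd rfl h
  | cons B bs => exact mem_insert_self _ _

theorem cuts_append {bs cs : List (List A)} (h : bs ≠ []) :
    cuts (bs ++ cs) = cuts bs ∪ starts bs.flatten.length cs := by
  cases bs with
  | nil => exact absurd rfl h
  | cons B bs => simp [cuts, starts_append]

theorem lt_of_mem_cuts {r : ℕ} {bs : List (List A)} (hb : ∀ B ∈ bs, B ≠ [])
    (h : r ∈ cuts bs) : 0 < r ∧ r < bs.flatten.length := by
  cases bs with
  | nil => simp [cuts] at h
  | cons B bs =>
    have h1 : 0 < B.length := List.length_pos_of_ne_nil (hb B (by simp))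
    have := le_of_mem_starts h
    have := lt_of_mem_starts (fun B hB => hb B (by simp [hB])) h
    simp at this ⊢; omega

theorem cuts_subset {bs : List (List A)} (hb : ∀ B ∈ bs, B ≠ []) :
    cuts bs ⊆ Ioo 0 bs.flatten.length := fun _ h => mem_Ioo.2 (lt_of_mem_cuts hb h)

theorem starts_split {o r : ℕ} {bs : List (List A)} (h : r ∈ starts o bs) :
    ∃ b₁ b₂, bs = b₁ ++ b₂ ∧ b₂ ≠ [] ∧ r = o + b₁.flatten.length := by
  induction bs generalizing o with
  | nil => simp [starts] at h
  | cons B bs ih =>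
    rcases mem_insert.1 h with rfl | h
    · exact ⟨[], B :: bs, by simp⟩
    · grind

theorem cuts_split {r : ℕ} {bs : List (List A)} (h : r ∈ cuts bs) :
    ∃ b₁ D D' b₂, bs = b₁ ++ D :: D' :: b₂ ∧ r = b₁.flatten.length + D.length := by
  cases bs with
  | nil => simp [cuts] at h
  | cons B bs =>
    obtain ⟨b₁, b₂, rfl, h1, rfl⟩ := starts_split h
    obtain ⟨D', b₂, rfl⟩ := List.exists_cons_of_ne_nil h1
    rcases List.eq_nil_or_concat (B :: b₁) with h0 | ⟨c, D, hc⟩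
    · simp at h0
    · refine ⟨c, D, D', b₂, ?_, ?_⟩
      · rw [← List.cons_append, hc]; simp
      · have := congrArg (fun l => l.flatten.length) hc
        simp at this ⊢; omega

theorem cuts_merge {b₁ b₂ : List (List A)} {D D' : List A} :
    cuts (b₁ ++ D :: D' :: b₂) =
      insert (b₁.flatten.length + D.length) (cuts (b₁ ++ (D ++ D') :: b₂)) := by
  cases b₁ with
  | nil => simp [cuts, starts]
  | cons B b₁ =>
    simp only [List.cons_append, cuts, starts_append, starts, List.length_append,
      List.flatten_cons]
    ext t
    simp only [mem_union, mem_insert, add_assoc]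
    tauto

theorem not_mem_cuts_merge {b₁ b₂ : List (List A)} {D D' : List A} (hD : D ≠ []) (hD' : D' ≠ [])
    (hb : ∀ B ∈ b₁, B ≠ []) :
    b₁.flatten.length + D.length ∉ cuts (b₁ ++ (D ++ D') :: b₂) := by
  have h1 := List.length_pos_of_ne_nil hD
  have h2 := List.length_pos_of_ne_nil hD'
  cases b₁ with
  | nil =>
    simp only [List.nil_append, cuts]
    intro h
    have := le_of_mem_starts h
    grind
  | cons B b₁ =>
    rw [cuts_append (by simp), mem_union]
    rintro (h | h)
    · have := lt_of_mem_cuts hb h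
      omega
    · rcases mem_insert.1 h with h | h
      · omega
      · have := le_of_mem_starts h
        simp only [List.length_append] at this; omega

theorem eq_of_starts {o : ℕ} {bs bs' : List (List A)} (hb : ∀ B ∈ bs, B ≠ [])
    (hb' : ∀ B ∈ bs', B ≠ []) (hf : bs.flatten = bs'.flatten) (hs : starts o bs = starts o bs') :
    bs = bs' := by
  induction bs generalizing o bs' with
  | nil =>
    cases bs' with
    | nil => rfl
    | cons B bs' => have := hb' B (by simp); simp at hf; exact absurd hf.1 this
  | cons B bs ih =>
    cases bs' with
    | nil => have := hb B (by simp); simp at hf; exact absurd hf.1 this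
    | cons B' bs' =>
      have key : ∀ (B B' : List A) (bs bs' : List (List A)), B ≠ [] → B' ≠ [] →
          (B :: bs).flatten = (B' :: bs').flatten →
          starts o (B :: bs) = starts o (B' :: bs') → ¬ B.length < B'.length := by
        intro B B' bs bs' h h' hf hs hlt
        have h0 := List.length_pos_of_ne_nil h
        have hne : bs ≠ [] := by
          grind
        have hm : o + B.length ∈ starts o (B' :: bs') := by
          rw [← hs]; exact mem_insert_of_mem (mem_starts_self hne)
        rcases mem_insert.1 hm with h | h
        · omega
        · have := le_of_mem_starts h; omega
      have hB0 := hb B (by simp)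
      have hB0' := hb' B' (by simp)
      have hlen : B.length = B'.length := by
        grind
      simp only [List.flatten_cons] at hf
      obtain ⟨rfl, hf'⟩ := List.append_inj hf hlen
      have hpos := List.length_pos_of_ne_nil hB0
      congr 1
      refine ih (o := o + B.length) (fun B hB => hb B (by simp [hB]))
        (fun B hB => hb' B (by simp [hB])) hf' ?_
      have h1 : o ∉ starts (o + B.length) bs := fun h => by have := le_of_mem_starts h; omega
      have h2 : o ∉ starts (o + B.length) bs' := fun h => by have := le_of_mem_starts h; omega
      simp only [starts] at hs
      rw [← erase_insert h1, hs, erase_insert h2]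

/-- Lets block lists of one word be compared through their rank sets, where splitting and merging
are insertion and removal of a rank. -/
theorem eq_of_cuts {bs bs' : List (List A)} (hb : ∀ B ∈ bs, B ≠ [])
    (hb' : ∀ B ∈ bs', B ≠ []) (hf : bs.flatten = bs'.flatten) (hs : cuts bs = cuts bs') :
    bs = bs' := by
  refine eq_of_starts (o := 0) hb hb' hf ?_
  cases bs with
  | nil =>
    cases bs' with
    | nil => rfl
    | cons B bs' => have := hb' B (by simp); simp at hf; exact absurd hf.1 this
  | cons B bs =>
    cases bs' with
    | nil => have := hb B (by simp); simp at hf; exact absurd hf.1 this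
    | cons B' bs' => simpa [cuts, starts] using congrArg (insert 0) hs

/-! ### Cells as lists of blocks -/

variable (R) in
def IsCell (bs : List (List A)) : Prop := ∀ B ∈ bs, B ≠ [] ∧ B.Pairwise R

theorem IsCell.ne_nil {bs : List (List A)} (h : IsCell R bs) : ∀ B ∈ bs, B ≠ [] :=
  fun B hB => (h B hB).1

/-- Letters of one block never clash, so the two letters of a clash lie in different blocks and a
cut separates them. -/
theorem IsCell.goodCell {bs : List (List A)} (h : IsCell R bs) :
    GoodCell R bs.flatten (cuts bs) := by
  have key : ∀ (bs : List (List A)), IsCell R bs → ∀ w l₁ : List A, w = l₁ ++ bs.flatten →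
      ∀ i j, Clash R w i j → l₁.length ≤ i → ∃ r ∈ starts l₁.length bs, i < r ∧ r ≤ j := by
    intro bs
    induction bs with
    | nil =>
      intro _ w l₁ hw i j hc hi
      have h1 := hc.lt_length
      have h2 := hc.1
      grind
    | cons B bs ih =>
      intro hcell w l₁ hw i j hc hi
      have hw' : w = (l₁ ++ B) ++ bs.flatten := by simp [hw]
      by_cases h1 : l₁.length + B.length ≤ i
      · obtain ⟨r, hr, h⟩ := ih (fun B hB => hcell B (by simp [hB])) w (l₁ ++ B) hw' i j hc
          (by simp; omega)
        exact ⟨r, mem_insert_of_mem (by simpa using hr), h⟩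
      · by_cases h2 : j < l₁.length + B.length
        · exact absurd hc (not_clash_of_pairwise hw' (hcell B (by simp)).2 hi h2)
        · refine ⟨l₁.length + B.length, mem_insert_of_mem (mem_starts_self ?_), by omega, by omega⟩
          rintro rfl
          have := hc.lt_length
          simp [hw] at this
          omega
  intro i j hc
  cases bs with
  | nil => have := hc.lt_length; simp at this
  | cons B bs =>
    obtain ⟨r, hr, hir, hrj⟩ := key (B :: bs) h _ [] (by simp) i j hc (by simp)
    refine ⟨r, ?_, hir, hrj⟩
    rcases mem_insert.1 hr with h0 | h0
    · simp at h0; omega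
    · simpa [cuts] using h0

theorem isCell_of_goodCell {bs : List (List A)} (hb : ∀ B ∈ bs, B ≠ [])
    (h : GoodCell R bs.flatten (cuts bs)) : IsCell R bs := by
  intro B hB
  refine ⟨hb B hB, ?_⟩
  obtain ⟨b₁, b₂, rfl⟩ := List.append_of_mem hB
  rw [List.pairwise_iff_getElem]
  intro i j hi hj hij
  by_contra hR
  have hcl : Clash R (b₁ ++ B :: b₂).flatten (b₁.flatten.length + i) (b₁.flatten.length + j) := by
    refine ⟨by omega, B[i], B[j], ?_, ?_, hR⟩
    all_goals grind
  obtain ⟨r, hr, h1, h2⟩ := h _ _ hcl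
  cases b₁ with
  | nil =>
    have := le_of_mem_starts hr
    simp at *; omega
  | cons B' b₁ =>
    rw [cuts_append (by simp), mem_union] at hr
    rcases hr with hr | hr
    · have := lt_of_mem_cuts (fun B hB => hb B (List.mem_append_left _ hB)) hr
      omega
    · rcases mem_insert.1 hr with h | h
      · omega
      · have := le_of_mem_starts h; omega

variable (R) in
def CellAlive (bs : List (List A)) : Prop := Alive R bs.flatten (cuts bs)

variable (R) in
/-- `bs'` is matched with the smaller cell `bs`. -/
def Up (bs bs' : List (List A)) : Prop :=
  ∃ b₁ D D' b₂, bs = b₁ ++ (D ++ D') :: b₂ ∧ bs' = b₁ ++ D :: D' :: b₂ ∧ D ≠ [] ∧ D' ≠ [] ∧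
    b₁.flatten.length + D.length ∈ piv R bs.flatten (cuts bs)

variable (R) in
/-- `bs'` arises from `bs` by sorting two adjacent blocks into one. -/
def Down (bs bs' : List (List A)) : Prop :=
  ∃ b₁ D D' b₂ G, bs = b₁ ++ D :: D' :: b₂ ∧ bs' = b₁ ++ G :: b₂ ∧ G.Perm (D ++ D') ∧
    G.Pairwise R

theorem Up.flatten {bs bs' : List (List A)} (h : Up R bs bs') : bs'.flatten = bs.flatten := by
  obtain ⟨b₁, D, D', b₂, rfl, rfl, _⟩ := h
  simp

theorem Up.isCell {bs bs' : List (List A)} (h : Up R bs bs') (hc : IsCell R bs) :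
    IsCell R bs' := by
  obtain ⟨b₁, D, D', b₂, rfl, rfl, hD, hD', _⟩ := h
  intro B hB
  simp only [List.mem_append, List.mem_cons] at hB
  have hDD := (hc (D ++ D') (by simp)).2
  rw [List.pairwise_append] at hDD
  rcases hB with hB | rfl | rfl | hB
  · exact hc B (by simp [hB])
  · exact ⟨hD, hDD.1⟩
  · exact ⟨hD', hDD.2.1⟩
  · exact hc B (by simp [hB])

theorem Down.isCell {bs bs' : List (List A)} (h : Down R bs bs') (hc : IsCell R bs) :
    IsCell R bs' := by
  obtain ⟨b₁, D, D', b₂, G, rfl, rfl, hG, hG'⟩ := h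
  intro B hB
  simp only [List.mem_append, List.mem_cons] at hB
  rcases hB with hB | rfl | hB
  · exact hc B (by simp [hB])
  · refine ⟨?_, hG'⟩
    rintro rfl
    have := hG.symm.eq_nil
    simp at this
    exact (hc D (by simp)).1 this.1
  · exact hc B (by simp [hB])

theorem Up.cuts_eq {bs bs' : List (List A)} (h : Up R bs bs') (hb : ∀ B ∈ bs, B ≠ []) :
    ∃ b, b ∈ piv R bs.flatten (cuts bs) ∧ b ∉ cuts bs ∧ cuts bs' = insert b (cuts bs) := by
  obtain ⟨b₁, D, D', b₂, rfl, rfl, hD, hD', hp⟩ := h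
  exact ⟨_, hp, not_mem_cuts_merge hD hD' fun B hB => hb B (List.mem_append_left _ hB),
    cuts_merge⟩

/-- The pivot has at most one element, so the cut to be inserted is determined. -/
theorem Up.unique {bs t t' : List (List A)} (hc : IsCell R bs) (h : Up R bs t) (h' : Up R bs t') :
    t = t' := by
  obtain ⟨b, hb, _, hc1⟩ := h.cuts_eq hc.ne_nil
  obtain ⟨b', hb', _, hc1'⟩ := h'.cuts_eq hc.ne_nil
  obtain rfl := eq_of_mem_piv hb hb'
  exact eq_of_cuts (h.isCell hc).ne_nil (h'.isCell hc).ne_nil (by rw [h.flatten, h'.flatten])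
    (by rw [hc1, hc1'])

theorem Up.alive {bs t : List (List A)} (hc : IsCell R bs) (h : Up R bs t) : CellAlive R bs := by
  obtain ⟨b, hb, hn, _⟩ := h.cuts_eq hc.ne_nil
  intro b' hb' hm
  exact hn (eq_of_mem_piv hb' hb ▸ hm)

theorem Down.cuts_eq {bs bs' : List (List A)} (h : Down R bs bs') (hb : ∀ B ∈ bs, B ≠ []) :
    ∃ r ∈ cuts bs, cuts bs' = (cuts bs).erase r := by
  obtain ⟨b₁, D, D', b₂, G, rfl, rfl, hG, -⟩ := h
  have hlen := hG.length_eq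
  refine ⟨b₁.flatten.length + D.length, ?_, ?_⟩
  · rw [cuts_merge]; exact mem_insert_self _ _
  · rw [cuts_merge, erase_insert (not_mem_cuts_merge (hb D (by simp)) (hb D' (by simp))
      fun B hB => hb B (List.mem_append_left _ hB))]
    cases b₁ with
    | nil => simp [cuts, hlen]
    | cons B b₁ => simp [cuts, starts_append, starts, hlen]

end Blocks

theorem exists_last_of_exists {A : Type*} {p : A → Prop} {P : List A} (h : ∃ y ∈ P, p y) :
    ∃ P₁ y P₂, P = P₁ ++ y :: P₂ ∧ p y ∧ ∀ z ∈ P₂, ¬ p z := by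
  induction P using List.reverseRecOn with
  | nil => simp at h
  | append_singleton P a ih =>
    by_cases ha : p a
    · exact ⟨P, a, [], rfl, ha, by simp⟩
    · obtain ⟨y, hy, hpy⟩ := h
      rcases List.mem_append.1 hy with hy | hy
      · obtain ⟨P₁, z, P₂, rfl, hz, h2⟩ := ih ⟨y, hy, hpy⟩
        grind
      · grind

/-! ### Tiles: the blocks read off after a given block. -/

section Tiles
variable {A : Type*} {R : A → A → Prop}

theorem pairwise_of_not_clash {w l₁ G l₂ : List A} (h : w = l₁ ++ G ++ l₂)
    (hno : ∀ i j, l₁.length ≤ i → j < l₁.length + G.length → ¬ Clash R w i j) : G.Pairwise R := by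
  rw [List.pairwise_iff_getElem]
  intro i j hi hj hij
  by_contra hR
  refine hno (l₁.length + i) (l₁.length + j) (by omega) (by omega) ⟨by omega, G[i], G[j], ?_, ?_, hR⟩
  all_goals grind

variable (R) in
/-- `B` is the block following `P` in a critical cell: it ends at the first letter clashing with
`P`, and nowhere before does a clash occur. -/
def Link (P B : List A) : Prop :=
  ∃ X c, B = X ++ [c] ∧ B.Pairwise R ∧ (P ++ X).Pairwise R ∧ ∃ y ∈ P, ¬ R y c

theorem Link.ne_nil {P B : List A} (h : Link R P B) : B ≠ [] := by
  obtain ⟨X, c, rfl, _⟩ := h; simp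

theorem Link.pairwise {P B : List A} (h : Link R P B) : B.Pairwise R := by
  obtain ⟨X, c, _, h, _⟩ := h; exact h

/-- The final letter of `B` clashes with some letter of `P`; the last such letter spans a minimal
clash with it. Clashes starting in `P` or later end there at the earliest. -/
theorem Link.minClash {P B : List A} (h : Link R P B) {w l₁ rest : List A}
    (hw : w = l₁ ++ P ++ B ++ rest) :
    ∃ a, MinClash R w a (l₁.length + P.length + B.length - 1) ∧ l₁.length ≤ a ∧
      a < l₁.length + P.length ∧ ∀ a' c', MinClash R w a' c' → l₁.length ≤ a' → a ≤ a' := by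
  obtain ⟨X, c, rfl, hB, hPX, hy⟩ := h
  obtain ⟨P₁, y, P₂, rfl, hyc, hP₂⟩ := exists_last_of_exists hy
  have h2 : (P₂ ++ X ++ [c]).Pairwise R := by
    grind
  have := minClash_next (w := w) (l₁ := l₁) (P₁ := P₁) (y := y) (P₂ := P₂) (X := X) (c := c)
    (rest := rest) (by simp [hw]) hyc hPX h2
  refine ⟨l₁.length + P₁.length, ?_, by omega, by simp, this.2⟩
  convert this.1 using 1
  simp

variable (R) in
/-- `pre ++ [P]` is an initial part of a critical cell. -/
def CPrefix (pre : List (List A)) (P : List A) : Prop :=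
  List.IsChain (Link R) (pre ++ [P]) ∧ ∃ s, (pre ++ [P]).head? = some [s]

theorem CPrefix.snoc {pre : List (List A)} {P B : List A} (h : CPrefix R pre P)
    (hB : Link R P B) : CPrefix R (pre ++ [P]) B := by
  obtain ⟨h1, s, hs⟩ := h
  refine ⟨?_, s, ?_⟩
  all_goals simp_all

theorem CPrefix.of_snoc {pre : List (List A)} {P B : List A} (h : CPrefix R (pre ++ [P]) B) :
    CPrefix R pre P ∧ Link R P B := by
  obtain ⟨h1, s, hs⟩ := h
  rw [List.isChain_append] at h1
  refine ⟨⟨h1.1, s, ?_⟩, h1.2.2 P (by simp) B (by simp)⟩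
  rw [List.head?_append_of_ne_nil _ (by simp)] at hs
  exact hs

theorem CPrefix.nil {P : List A} (h : CPrefix R [] P) : ∃ s, P = [s] := by
  obtain ⟨_, s, hs⟩ := h
  exact ⟨s, by simpa using hs⟩

theorem CPrefix.isCell {pre : List (List A)} {P : List A} (h : CPrefix R pre P) :
    IsCell R (pre ++ [P]) := by
  induction pre using List.reverseRecOn generalizing P with
  | nil =>
    obtain ⟨s, rfl⟩ := h.nil
    intro B hB
    simp at hB
    simp [hB]
  | append_singleton pre P₀ ih =>
    obtain ⟨h1, h2⟩ := h.of_snoc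
    intro B hB
    rcases List.mem_append.1 hB with hB | hB
    · exact ih h1 B hB
    · rw [List.mem_singleton.1 hB]
      exact ⟨h2.ne_nil, h2.pairwise⟩

/-- The truncated intervals of a word with a given initial part. -/
theorem CPrefix.tiles {pre : List (List A)} {P : List A} (h : CPrefix R pre P) {w rest : List A}
    (hw : w = (pre ++ [P]).flatten ++ rest) :
    ∃ L₁ L₂, jList R w = L₁ ++ L₂ ∧
      JRun (MinClash R w) pre.flatten.length ((pre ++ [P]).flatten.length - 1) L₂ ∧
      ∀ K, K ∈ L₁ ↔ ∃ pre₁ B pre₂, pre ++ [P] = pre₁ ++ B :: pre₂ ∧ pre₁ ≠ [] ∧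
        K = Ico pre₁.flatten.length (pre₁.flatten.length + B.length) := by
  induction pre using List.reverseRecOn generalizing P rest with
  | nil =>
    obtain ⟨s, rfl⟩ := h.nil
    refine ⟨[], jList R w, rfl, jrun_jList w, fun K => ?_⟩
    simp only [List.not_mem_nil, false_iff, not_exists, not_and]
    intro pre₁ B pre₂ he hne
    cases pre₁ with
    | nil => exact absurd rfl hne
    | cons D pre₁ => simp at he
  | append_singleton pre P₀ ih =>
    obtain ⟨h1, h2⟩ := h.of_snoc
    obtain ⟨L₁, L₂, hL, hrun, hmem⟩ := ih h1 (rest := P ++ rest) (by simp [hw])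
    obtain ⟨a, hmin, hle, hlt, hleast⟩ := h2.minClash (w := w) (l₁ := pre.flatten) (rest := rest)
      (by simp [hw])
    obtain ⟨L', rfl, hlt', hrun'⟩ := hrun.next (intervalSystem_minClash w) hmin hle hleast
    have hP0 : 0 < P₀.length := List.length_pos_of_ne_nil (h1.isCell P₀ (by simp)).1
    have hP : 0 < P.length := List.length_pos_of_ne_nil h2.ne_nil
    -- The clash starts inside `P₀`, whose ranks have been used up, so truncation makes the interval
    -- start exactly at the first rank of the next tile.
    have hmax : max a ((pre ++ [P₀]).flatten.length - 1) + 1 = (pre ++ [P₀]).flatten.length := by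
      grind
    refine ⟨L₁ ++ [Ioc (max a ((pre ++ [P₀]).flatten.length - 1))
      (pre.flatten.length + P₀.length + P.length - 1)], L', by simp [hL], ?_, ?_⟩
    · grind
    · intro K
      have hK : Ioc (max a ((pre ++ [P₀]).flatten.length - 1))
          (pre.flatten.length + P₀.length + P.length - 1) =
          Ico (pre ++ [P₀]).flatten.length ((pre ++ [P₀]).flatten.length + P.length) := by
        grind
      rw [List.mem_append, hmem, List.mem_singleton, hK]
      constructor
      · grind
      · rintro ⟨pre₁, B, pre₂, he, hne, rfl⟩
        rcases List.eq_nil_or_concat pre₂ with rfl | ⟨pre₃, C, rfl⟩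
        · right
          obtain ⟨h3, h4⟩ := List.append_inj' he rfl
          simp at h4
          rw [h3, h4]
        · left
          have he' : pre ++ [P₀] ++ [P] = (pre₁ ++ B :: pre₃) ++ [C] := by simpa using he
          obtain ⟨h3, _⟩ := List.append_inj' he' rfl
          exact ⟨pre₁, B, pre₃, h3, hne, rfl⟩

/-- `S` meets the tiles of `bs` exactly in their least elements. -/
def GoodOn (bs : List (List A)) (S : Finset ℕ) : Prop :=
  ∀ pre₁ B pre₂, bs = pre₁ ++ B :: pre₂ → pre₁ ≠ [] →
    S ∩ Ico pre₁.flatten.length (pre₁.flatten.length + B.length) = {pre₁.flatten.length}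

theorem goodOn_cuts {bs cs : List (List A)} (h : ∀ B ∈ bs ++ cs, B ≠ []) :
    GoodOn bs (cuts (bs ++ cs)) := by
  intro pre₁ B pre₂ he hne
  subst he
  have h1 : ∀ B' ∈ pre₁, B' ≠ [] := fun B' hB' => h B' (by simp [hB'])
  have hB : 0 < B.length := List.length_pos_of_ne_nil (h B (by simp))
  have e : pre₁ ++ B :: pre₂ ++ cs = pre₁ ++ (B :: (pre₂ ++ cs)) := by simp
  rw [e, cuts_append hne]
  ext r
  simp only [mem_inter, mem_union, mem_Ico, mem_singleton, starts, mem_insert]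
  constructor
  · rintro ⟨hr | hr | hr, h3, h4⟩
    · have := lt_of_mem_cuts h1 hr; omega
    · exact hr
    · have := le_of_mem_starts hr; omega
  · rintro rfl
    exact ⟨Or.inr (Or.inl rfl), le_rfl, by omega⟩

theorem lowest_Ico {a c : ℕ} (h : a < c) : lowest (Ico a c) = {a} :=
  lowest_eq_of_least (mem_Ico.2 ⟨le_rfl, h⟩) (fun _ ht => (mem_Ico.1 ht).1)

/-- The next truncated interval after an initial part, together with the position of the pivot
if the cell is bad there. -/
theorem CPrefix.next {pre : List (List A)} {P : List A} (h : CPrefix R pre P) {w rest : List A}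
    (hw : w = (pre ++ [P]).flatten ++ rest) {S : Finset ℕ} (hS : GoodOn (pre ++ [P]) S) {a c : ℕ}
    (hac : MinClash R w a c) (ha : pre.flatten.length ≤ a)
    (hl : ∀ a' c', MinClash R w a' c' → pre.flatten.length ≤ a' → a ≤ a') :
    ∃ L₁ L₂, jList R w = L₁ ++ Ioc (max a ((pre ++ [P]).flatten.length - 1)) c :: L₂ ∧
      max a ((pre ++ [P]).flatten.length - 1) < c ∧ (∀ K ∈ L₁, S ∩ K = lowest K) ∧
      (∀ K ∈ L₁, ∀ r ∈ K, r < (pre ++ [P]).flatten.length) ∧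
      JRun (MinClash R w) (max a ((pre ++ [P]).flatten.length - 1) + 1) c L₂ := by
  obtain ⟨L₁, L₂, hL, hrun, hmem⟩ := h.tiles hw
  obtain ⟨L', rfl, hlt, hrun'⟩ := hrun.next (intervalSystem_minClash w) hac ha hl
  refine ⟨L₁, L', hL, hlt, ?_, ?_, hrun'⟩
  · intro K hK
    obtain ⟨pre₁, B, pre₂, he, hne, rfl⟩ := (hmem K).1 hK
    have hB : 0 < B.length := List.length_pos_of_ne_nil (h.isCell B (by rw [he]; simp)).1
    rw [lowest_Ico (by omega)]
    exact hS pre₁ B pre₂ he hne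
  · grind

theorem CPrefix.next_link {pre : List (List A)} {P B : List A} (h : CPrefix R pre P)
    (hB : Link R P B) {w rest : List A}
    (hw : w = (pre ++ [P]).flatten ++ B ++ rest) {S : Finset ℕ} (hS : GoodOn (pre ++ [P]) S) :
    ∃ L₁ L₂, jList R w = L₁ ++ Ico (pre ++ [P]).flatten.length
        ((pre ++ [P]).flatten.length + B.length) :: L₂ ∧
      (∀ K ∈ L₁, S ∩ K = lowest K) := by
  obtain ⟨a, hmin, hle, hlt, hleast⟩ := hB.minClash (w := w) (l₁ := pre.flatten) (rest := rest)
    (by simp [hw])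
  obtain ⟨L₁, L₂, hL, h1, h2, _⟩ := h.next (w := w) (rest := B ++ rest) (by simp [hw]) hS hmin hle
    hleast
  refine ⟨L₁, L₂, ?_, h2⟩
  rw [hL]
  congr 2
  grind

/-- All tiles up to `P` are met correctly and the next truncated interval is the tile `B`, so a
fault there puts the pivot at its beginning. -/
theorem CPrefix.piv_link {pre : List (List A)} {P B : List A} (h : CPrefix R pre P)
    (hB : Link R P B) {w rest : List A} (hcov : Covered R w)
    (hw : w = (pre ++ [P]).flatten ++ B ++ rest) {S : Finset ℕ} (hS : GoodOn (pre ++ [P]) S)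
    (hbad : S ∩ Ico (pre ++ [P]).flatten.length ((pre ++ [P]).flatten.length + B.length) ≠
      {(pre ++ [P]).flatten.length}) :
    piv R w S = {(pre ++ [P]).flatten.length} := by
  obtain ⟨L₁, L₂, hL, h2⟩ := h.next_link hB hw hS
  have hB0 : 0 < B.length := List.length_pos_of_ne_nil hB.ne_nil
  have hlow := lowest_Ico (show (pre ++ [P]).flatten.length <
    (pre ++ [P]).flatten.length + B.length by omega)
  rw [piv_first_bad hcov hL h2 (by rw [hlow]; exact hbad), hlow]

theorem jList_eq_of_mem {w : List A} {K K' : Finset ℕ} (hK : K ∈ jList R w) (hK' : K' ∈ jList R w)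
    {r : ℕ} (hr : r ∈ K) (hr' : r ∈ K') : K = K' := by
  obtain ⟨L₁, L₂, hL⟩ := List.append_of_mem hK
  rw [hL] at hK'
  simp only [List.mem_append, List.mem_cons] at hK'
  by_contra hne
  refine (jrun_jList w).disjoint L₁ K L₂ hL K' ?_ r hr hr'
  grind

/-- This is `inword_step` for block lists. A continuation inside the word trades the only rank of a
truncated interval for the least rank of that interval. -/
theorem inword_cell {s T s' : List (List A)} (hc : IsCell R s) (hup : Up R s T)
    (hd : Down R T s') (hf : s'.flatten = s.flatten) (hne : s' ≠ s) (hal : CellAlive R s') :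
    Covered R s.flatten ∧ ∃ b K r, b ∈ piv R s.flatten (cuts s) ∧ K ∈ jList R s.flatten ∧
      lowest K = {b} ∧ cuts s ∩ K = {r} ∧ r ≠ b ∧ cuts s' = (insert b (cuts s)).erase r := by
  obtain ⟨b, hb, hbS, hcT⟩ := hup.cuts_eq hc.ne_nil
  have hcT' := hup.isCell hc
  have hc' := hd.isCell hcT'
  obtain ⟨r, hr, hcs'⟩ := hd.cuts_eq hcT'.ne_nil
  rw [hcT] at hr hcs'
  have hrb : r ≠ b := by
    rintro rfl
    rw [erase_insert hbS] at hcs'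
    exact hne (eq_of_cuts hc'.ne_nil hc.ne_nil hf hcs')
  have hrS : r ∈ cuts s := (mem_insert.1 hr).resolve_left hrb
  have hg := hc'.goodCell
  unfold CellAlive at hal
  rw [hf, hcs'] at hg hal
  obtain ⟨hcov, L₁, K, L₂, hL, _, hlow, hK⟩ := inword_step hc.goodCell hb hbS hrS hg hal
  grind

/-- A cell whose last block read is too long is still good on the tiles read. -/
theorem goodOn_cuts_append {pre : List (List A)} {P B D : List A} {cs : List (List A)}
    (hne : ∀ C ∈ pre ++ P :: (B ++ D) :: cs, C ≠ []) (hBne : B ≠ []) :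
    GoodOn (pre ++ [P] ++ [B]) (cuts (pre ++ P :: (B ++ D) :: cs)) := by
  have hB0 : 0 < B.length := List.length_pos_of_ne_nil hBne
  intro pre₁ B₁ pre₂ he hpre
  rcases List.eq_nil_or_concat pre₂ with rfl | ⟨pre₃, C, rfl⟩
  · obtain ⟨h3, h4⟩ := List.append_inj' he rfl
    simp at h4
    subst h3 h4
    have := goodOn_cuts (bs := pre ++ [P] ++ [B ++ D]) (cs := cs)
      (by simpa using hne) (pre ++ [P]) (B ++ D) [] (by simp) (by simp)
    grind
  · have he' : pre ++ [P] ++ [B] = (pre₁ ++ B₁ :: pre₃) ++ [C] := by simpa using he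
    obtain ⟨h3, _⟩ := List.append_inj' he' rfl
    refine goodOn_cuts (bs := pre ++ [P]) (cs := (B ++ D) :: cs) (by simpa using hne) pre₁ B₁ pre₃
      h3 hpre |>.symm.trans ?_ |>.symm
    simp

/-- The upward match of a cell whose last block read swallows more than its tile. -/
theorem CPrefix.flow_up {pre : List (List A)} {P B B' D : List A} (h : CPrefix R pre P)
    (hB : Link R P B) (hB' : Link R B B') {cs : List (List A)} {rest : List A}
    (hc : IsCell R (pre ++ P :: (B ++ D) :: cs))
    (hcov : Covered R (pre ++ P :: (B ++ D) :: cs).flatten)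
    (hf : D ++ cs.flatten = B' ++ rest) (hD : D ≠ []) :
    Up R (pre ++ P :: (B ++ D) :: cs) (pre ++ P :: B :: D :: cs) ∧
    Ico (pre ++ [P, B]).flatten.length ((pre ++ [P, B]).flatten.length + B'.length) ∈
      jList R (pre ++ P :: (B ++ D) :: cs).flatten := by
  have hp := h.snoc hB
  have hBne := hB.ne_nil
  have hB0 : 0 < B.length := List.length_pos_of_ne_nil hBne
  have hne := hc.ne_nil
  have e : pre ++ P :: (B ++ D) :: cs = (pre ++ [P]) ++ ((B ++ D) :: cs) := by simp
  have hnot : (pre ++ [P]).flatten.length + B.length ∉ cuts (pre ++ P :: (B ++ D) :: cs) := by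
    rw [e]
    exact not_mem_cuts_merge hBne hD fun B' hB' => hne B' (by rw [e]; exact List.mem_append_left _ hB')
  have hgood := goodOn_cuts_append hne hBne
  have hwf : (pre ++ P :: (B ++ D) :: cs).flatten = (pre ++ [P] ++ [B]).flatten ++ B' ++ rest := by
    simp [← hf]
  have hle : (pre ++ [P] ++ [B]).flatten.length = (pre ++ [P]).flatten.length + B.length := by simp; omega
  constructor
  · refine ⟨pre ++ [P], B, D, cs, by simp, by simp, hBne, hD, ?_⟩
    rw [hp.piv_link hB' hcov hwf hgood, hle]
    · simp
    · rw [hle]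
      intro heq
      clear hc hcov hf hwf
      have : (pre ++ [P]).flatten.length + B.length ∈ cuts (pre ++ P :: (B ++ D) :: cs) ∩ _ :=
        heq ▸ mem_singleton_self _
      exact hnot (mem_inter.1 this).1
  · obtain ⟨L₁, L₂, hL, _⟩ := hp.next_link hB' hwf hgood
    rw [show pre ++ [P, B] = pre ++ [P] ++ [B] by simp, hL]
    simp

/-- The only cell of the same word which can follow is the one swallowing the next block. -/
theorem CPrefix.flow_inword {pre : List (List A)} {P B B' D : List A} (h : CPrefix R pre P)
    (hB : Link R P B) (hB' : Link R B B') {cs : List (List A)} {rest : List A}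
    (hc : IsCell R (pre ++ P :: (B ++ D) :: cs))
    (hcov : Covered R (pre ++ P :: (B ++ D) :: cs).flatten)
    (hf : D ++ cs.flatten = B' ++ rest) (hD : D ≠ []) {s' : List (List A)}
    (hd : Down R (pre ++ P :: B :: D :: cs) s')
    (hfl : s'.flatten = (pre ++ P :: (B ++ D) :: cs).flatten)
    (hne : s' ≠ pre ++ P :: (B ++ D) :: cs) (hal : CellAlive R s') :
    ∃ D₂ cs', cs = D₂ :: cs' ∧ s' = pre ++ P :: B :: (D ++ D₂) :: cs' := by
  obtain ⟨hup, hK⟩ := h.flow_up hB hB' hc hcov hf hD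
  have hcT := hup.isCell hc
  have hc' := hd.isCell hcT
  obtain ⟨_, b, K, r, hb, hKm, hlow, hKr, hrb, hcs'⟩ := inword_cell hc hup hd hfl hne hal
  have hB'0 : 0 < B'.length := List.length_pos_of_ne_nil hB'.ne_nil
  have hD0 : 0 < D.length := List.length_pos_of_ne_nil hD
  obtain ⟨b₂, hb₂, hb₂S, hcT₂⟩ := hup.cuts_eq hc.ne_nil
  obtain rfl := eq_of_mem_piv hb hb₂
  -- All of `D` is compatible with `B`, whereas the tile `B'` contains a letter clashing with `B`.
  have hDB : D.length < B'.length := by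
    by_contra hcon
    obtain ⟨X, c, rfl, _, _, y, hy, hyc⟩ := hB'
    have hpre : X ++ [c] <+: D := by
      rw [List.prefix_append_right_inj [] |>.symm]
      exact List.prefix_of_prefix_length_le (l₃ := D ++ cs.flatten) (by rw [hf]; simp)
        (by simp) (by simpa using hcon)
    have := (hc (B ++ D) (by simp)).2
    exact hyc ((List.pairwise_append.1 this).2.2 y hy c (hpre.subset (by simp)))
  have hbe : b = (pre ++ [P, B]).flatten.length := by
    have h1 : cuts (pre ++ P :: B :: D :: cs) = insert (pre ++ [P, B]).flatten.length
        (cuts (pre ++ P :: (B ++ D) :: cs)) := by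
      have := cuts_merge (b₁ := pre ++ [P]) (b₂ := cs) (D := B) (D' := D)
      simpa [add_assoc] using this
    have h2 : b ∈ insert (pre ++ [P, B]).flatten.length
        (cuts (pre ++ P :: (B ++ D) :: cs)) := by rw [← h1, hcT₂]; exact mem_insert_self _ _
    exact (mem_insert.1 h2).resolve_right hb₂S
  have hKe := jList_eq_of_mem hKm hK (r := b) (lowest_subset K (by rw [hlow]; simp))
    (by rw [hbe]; exact mem_Ico.2 ⟨le_rfl, by omega⟩)
  -- Since `D` is shorter than `B'`, a block must follow it, and the end of `D` is a rank of the
  -- cell inside the tile of `B'`. It is the only one, hence the one removed, which merges `D` with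
  -- the next block.
  cases cs with
  | nil =>
    grind
  | cons D₂ cs =>
    refine ⟨D₂, cs, rfl, ?_⟩
    have hre : (pre ++ [P, B]).flatten.length + D.length = r := by
      have hm : (pre ++ [P, B]).flatten.length + D.length ∈
          cuts (pre ++ P :: (B ++ D) :: D₂ :: cs) ∩ K := by
        refine mem_inter.2 ⟨?_, ?_⟩
        · have e : pre ++ P :: (B ++ D) :: D₂ :: cs = (pre ++ [P, B ++ D]) ++ (D₂ :: cs) := by simp
          rw [e, cuts_append (by simp)]
          refine mem_union_right _ ?_
          have : (pre ++ [P, B]).flatten.length + D.length = (pre ++ [P, B ++ D]).flatten.length := by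
            simp; omega
          rw [this]
          exact mem_insert_self _ _
        · rw [hKe]; exact mem_Ico.2 ⟨by omega, by omega⟩
      rw [hKr, mem_singleton] at hm
      exact hm
    have hne' : ∀ B₁ ∈ pre ++ P :: B :: (D ++ D₂) :: cs, B₁ ≠ [] := by
      have := hcT.ne_nil
      grind
    refine eq_of_cuts hc'.ne_nil hne' (by rw [hfl]; simp) ?_
    rw [hcs', ← hcT₂, ← hre]
    have h1 := cuts_merge (b₁ := pre ++ [P, B]) (b₂ := cs) (D := D) (D' := D₂)
    have h2 := not_mem_cuts_merge (b₁ := pre ++ [P, B]) (b₂ := cs) hD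
      (hc.ne_nil D₂ (by simp)) (fun B₁ hB₁ => by
        rcases List.mem_append.1 hB₁ with h | h
        · exact hc.ne_nil B₁ (List.mem_append_left _ h)
        · rcases List.mem_cons.1 h with rfl | h
          · exact hc.ne_nil B₁ (by simp)
          · rw [List.mem_singleton.1 h]; exact hB.ne_nil)
    grind

end Tiles

/-! ### Critical cells are the readings. -/

section Critical
variable {A : Type*} {R : A → A → Prop}

theorem CPrefix.exists_cover {pre : List (List A)} {P : List A} (h : CPrefix R pre P)
    {w rest : List A} (hw : w = (pre ++ [P]).flatten ++ rest) {r : ℕ} (hr0 : 0 < r)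
    (hr : r < (pre ++ [P]).flatten.length) : ∃ a c, MinClash R w a c ∧ a < r ∧ r ≤ c := by
  induction pre using List.reverseRecOn generalizing P rest with
  | nil => obtain ⟨s, rfl⟩ := h.nil; simp at hr; omega
  | append_singleton pre P₀ ih =>
    obtain ⟨h1, h2⟩ := h.of_snoc
    by_cases hlt : r < (pre ++ [P₀]).flatten.length
    · exact ih h1 (rest := P ++ rest) (by simp [hw]) hlt
    · obtain ⟨a, hmin, hle, hlt', _⟩ := h2.minClash (w := w) (l₁ := pre.flatten) (rest := rest)
        (by simp [hw])
      grind

variable (R) in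
def CellCritical (bs : List (List A)) : Prop := piv R bs.flatten (cuts bs) = ∅

variable (R) in
/-- The block lists of critical cells. -/
def IsReading (bs : List (List A)) : Prop := bs.IsChain (Link R) ∧ ∃ s, bs.head? = some [s]

theorem isReading_snoc {pre : List (List A)} {P : List A} :
    IsReading R (pre ++ [P]) ↔ CPrefix R pre P := Iff.rfl

theorem IsReading.cPrefix {pre post : List (List A)} {P : List A}
    (h : IsReading R (pre ++ P :: post)) : CPrefix R pre P := by
  obtain ⟨h1, s, hs⟩ := h
  have e : pre ++ P :: post = (pre ++ [P]) ++ post := by simp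
  rw [e] at h1 hs
  refine ⟨(List.isChain_append.1 h1).1, s, ?_⟩
  rw [List.head?_append_of_ne_nil _ (by simp)] at hs
  exact hs

theorem IsReading.ne_nil {bs : List (List A)} (h : IsReading R bs) : bs ≠ [] := by
  rintro rfl; obtain ⟨_, s, hs⟩ := h; simp at hs

theorem IsReading.isCell {bs : List (List A)} (h : IsReading R bs) : IsCell R bs := by
  rcases List.eq_nil_or_concat bs with rfl | ⟨pre, P, rfl⟩
  · exact absurd rfl h.ne_nil
  · rw [List.concat_eq_append] at h ⊢
    exact CPrefix.isCell h

theorem IsReading.covered {bs : List (List A)} (h : IsReading R bs) : Covered R bs.flatten := by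
  rcases List.eq_nil_or_concat bs with rfl | ⟨pre, P, rfl⟩
  · exact absurd rfl h.ne_nil
  · rw [List.concat_eq_append] at h ⊢
    rw [covered_iff]
    intro r h0 hr
    exact CPrefix.exists_cover h (rest := []) (by simp) h0 hr

theorem exists_tile {bs : List (List A)} (hs : ∃ s, bs.head? = some [s]) {r : ℕ} (h0 : 0 < r)
    (hr : r < bs.flatten.length) : ∃ pre₁ B pre₂, bs = pre₁ ++ B :: pre₂ ∧ pre₁ ≠ [] ∧
      r ∈ Ico pre₁.flatten.length (pre₁.flatten.length + B.length) := by
  induction bs using List.reverseRecOn with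
  | nil => simp at hr
  | append_singleton bs P ih =>
    obtain ⟨s, hs⟩ := hs
    by_cases hlt : r < bs.flatten.length
    · have hne : bs ≠ [] := by rintro rfl; simp at hlt
      rw [List.head?_append_of_ne_nil _ hne] at hs
      obtain ⟨p1, B, p2, rfl, hp, hm⟩ := ih ⟨s, hs⟩ hlt
      exact ⟨p1, B, p2 ++ [P], by simp, hp, hm⟩
    · grind

/-- The truncated intervals are exactly the blocks after the first one. The cell meets each in its
least rank, and together they exhaust the interior ranks, so no pivot is left. -/
theorem IsReading.critical {bs : List (List A)} (h : IsReading R bs) : CellCritical R bs := by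
  have hcov := h.covered
  have hc := h.isCell
  rcases List.eq_nil_or_concat bs with rfl | ⟨pre, P, rfl⟩
  · exact absurd rfl h.ne_nil
  · rw [List.concat_eq_append] at *
    have h' : CPrefix R pre P := h
    obtain ⟨L₁, L₂, hL, hrun, hmem⟩ := h'.tiles (w := (pre ++ [P]).flatten) (rest := []) (by simp)
    have hgood := goodOn_cuts (bs := pre ++ [P]) (cs := []) (by simpa using hc.ne_nil)
    rw [List.append_nil] at hgood
    have hP0 := List.length_pos_of_ne_nil (hc P (by simp)).1
    have hno : ∀ a c, MinClash R (pre ++ [P]).flatten a c → a < pre.flatten.length := by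
      intro a c hm
      by_contra hcon
      refine not_clash_of_pairwise (w := (pre ++ [P]).flatten) (l₁ := pre.flatten) (G := P)
        (l₂ := []) (by simp) (hc P (by simp)).2 (not_lt.1 hcon) (j := c) ?_ hm.1
      have := hm.1.lt_length
      grind
    -- A further truncated interval would need a clash inside the last block.
    have hL2 : L₂ = [] := by
      cases hrun with
      | nil _ => rfl
      | cons hac hm _ _ _ => exact absurd (hno _ _ hac) (by omega)
    subst hL2
    rw [List.append_nil] at hL
    have hgoodL : ∀ K ∈ jList R (pre ++ [P]).flatten, cuts (pre ++ [P]) ∩ K = lowest K := by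
      rw [hL]
      intro K hK
      obtain ⟨pre₁, B, pre₂, he, hne, rfl⟩ := (hmem K).1 hK
      have hB := List.length_pos_of_ne_nil (hc B (by rw [he]; simp)).1
      rw [hgood pre₁ B pre₂ he hne, lowest_Ico (by omega)]
    unfold CellCritical
    rw [piv_all_good hcov hgoodL, lowest_eq_empty, sdiff_eq_empty_iff_subset]
    intro r hr
    obtain ⟨h0, hlt⟩ := mem_Ioo.1 hr
    obtain ⟨p1, B, p2, he, hp, hm⟩ := exists_tile h.2 h0 hlt
    rw [mem_support, hL]
    exact ⟨_, (hmem _).2 ⟨p1, B, p2, he, hp, rfl⟩, hm⟩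

theorem covered_of_critical {w : List A} {S : Finset ℕ} (hpiv : piv R w S = ∅) :
    Covered R w ∧ (∀ K ∈ jList R w, S ∩ K = lowest K) ∧ Ioo 0 w.length ⊆ support (jList R w) := by
  have h : Covered R w := by
    by_contra h
    unfold piv at hpiv
    rw [pivot_uncovered h, lowest_eq_empty, sdiff_eq_empty_iff_subset] at hpiv
    apply h
    unfold Covered
    refine subset_antisymm ?_ hpiv
    intro t ht
    obtain ⟨Q, hQ, hr⟩ := mem_biUnion.1 ht
    obtain ⟨a, c, hm, rfl⟩ := mem_clashIntervals.1 hQ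
    have := mem_Ioc.1 hr
    have := hm.1.lt_length
    exact mem_Ioo.2 ⟨by omega, by omega⟩
  refine ⟨h, ?_⟩
  rcases exists_first_bad (jList R w) S with h1 | ⟨L₁, K, L₂, hL, h1, hK⟩
  · rw [piv_all_good h h1, lowest_eq_empty, sdiff_eq_empty_iff_subset] at hpiv
    exact ⟨h1, hpiv⟩
  · rw [piv_first_bad h hL h1 hK, lowest_eq_empty] at hpiv
    obtain ⟨a, c, hac, hKe⟩ := (jrun_jList w).nonempty K (by rw [hL]; simp)
    simp_all

/-- In a critical cell the truncated intervals cover the interior ranks and are each met in their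
least rank only. They therefore follow one another without gaps, and the cuts are their beginnings,
so the blocks can be recovered one by one. -/
theorem isReading_of_critical {bs : List (List A)} (hc : IsCell R bs) (hne : bs ≠ [])
    (hcrit : CellCritical R bs) : IsReading R bs := by
  obtain ⟨hcov, hgood, hsup⟩ := covered_of_critical hcrit
  -- the next truncated interval begins at the end of the part read so far
  have next : ∀ (m e : ℕ) (L₁ L₂ : List (Finset ℕ)), 0 < e → e < bs.flatten.length →
      jList R bs.flatten = L₁ ++ L₂ → (∀ K ∈ L₁, ∀ r ∈ K, r < e) →
      JRun (MinClash R bs.flatten) m (e - 1) L₂ → m < e →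
      ∃ a c, MinClash R bs.flatten a c ∧ m ≤ a ∧ a < e ∧ e ≤ c ∧
        (∀ a' c', MinClash R bs.flatten a' c' → m ≤ a' → a ≤ a') ∧
        cuts bs ∩ Ioc (e - 1) c = {e} ∧
        (c + 1 < bs.flatten.length → c + 1 ∈ cuts bs) := by
    intro m e L₁ L₂ he0 hlt hL hL₁ hrun hme
    have hes : e ∈ support (jList R bs.flatten) := hsup (mem_Ioo.2 ⟨he0, hlt⟩)
    obtain ⟨K, hK, heK⟩ := mem_support.1 hes
    rw [hL] at hK
    have hK2 : K ∈ L₂ := (List.mem_append.1 hK).resolve_left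
      fun h => absurd (hL₁ K h e heK) (lt_irrefl _)
    cases hrun with
    | nil h => simp at hK2
    | @cons _ _ a c L' hac hma hleast hltc hrun' =>
      have heK' : K = Ioc (max a (e - 1)) c := by
        rcases List.mem_cons.1 hK2 with h | h
        · exact h
        · have := hrun'.lt_of_mem K h e heK; omega
      rw [heK'] at heK
      have hae := mem_Ioc.1 heK
      have hmax : max a (e - 1) = e - 1 := by omega
      rw [hmax] at hL hltc hrun'
      refine ⟨a, c, hac, hma, by omega, by omega, hleast, ?_, ?_⟩
      · rw [hgood _ (by rw [hL]; simp), lowest_Ioc (by omega)]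
        congr 1; omega
      · intro hlt2
        have hs2 : c + 1 ∈ support (jList R bs.flatten) := hsup (mem_Ioo.2 ⟨by omega, hlt2⟩)
        obtain ⟨K', hK', hcK'⟩ := mem_support.1 hs2
        have hK'' := hK'
        rw [hL] at hK'
        rcases List.mem_append.1 hK' with h | h
        · have := hL₁ K' h _ hcK'; omega
        · rcases List.mem_cons.1 h with rfl | h
          · have := mem_Ioc.1 hcK'; omega
          · have hlow : c + 1 ∈ lowest K' := mem_filter.2 ⟨hcK', fun t ht => by
              have := hrun'.lt_of_mem K' h t ht; omega⟩
            grind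
  have key : ∀ (cs pre : List (List A)) (P : List A), bs = pre ++ P :: cs → CPrefix R pre P →
      IsReading R bs := by
    intro cs
    induction cs with
    | nil => intro pre P he h; rw [he]; exact h
    | cons D cs ih =>
      intro pre P he h
      refine ih (pre ++ [P]) D (by rw [he]; simp) (h.snoc ?_)
      obtain ⟨L₁, L₂, hL, hrun, hmem⟩ := h.tiles (w := bs.flatten) (rest := D ++ cs.flatten)
        (by rw [he]; simp)
      have hP0 := List.length_pos_of_ne_nil (hc P (by rw [he]; simp)).1
      have hD0 := List.length_pos_of_ne_nil (hc D (by rw [he]; simp)).1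
      have hlen : bs.flatten.length = pre.flatten.length + P.length + D.length +
          cs.flatten.length := by rw [he]; simp; omega
      have hPe : (pre ++ [P]).flatten.length = pre.flatten.length + P.length := by
        grind
      obtain ⟨a, c, hac, hma, hae, hec, hleast, hcut, hcut2⟩ := next pre.flatten.length
        (pre ++ [P]).flatten.length L₁ L₂ (by omega) (by omega) hL (by
          intro K hK r hr
          obtain ⟨p1, B, p2, he2, _, rfl⟩ := (hmem K).1 hK
          have := mem_Ico.1 hr
          rw [he2]
          simp only [List.flatten_append, List.flatten_cons, List.length_append]; omega)
        hrun (by omega)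
      have hcuts : cuts bs = cuts (pre ++ [P]) ∪ starts (pre ++ [P]).flatten.length (D :: cs) := by
        rw [← cuts_append (by simp), he]; simp
      rw [hPe] at hae hec hcut hcuts
      -- A block longer than the interval would have the least rank `c + 1` of the next interval in
      -- its interior, where there is no cut. A shorter one would put a second cut into the
      -- interval.
      have hcD : c + 1 = pre.flatten.length + P.length + D.length := by
        have hclt := hac.1.lt_length
        by_contra hne'
        rcases lt_or_gt_of_ne hne' with hlt | hgt
        · have h1 := hcut2 (by omega)
          rw [hcuts, mem_union] at h1
          rcases h1 with h1 | h1
          · have := lt_of_mem_cuts h.isCell.ne_nil h1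
            omega
          · rcases mem_insert.1 h1 with h1 | h1
            · omega
            · have := le_of_mem_starts h1; omega
        · have hcs : cs ≠ [] := by rintro rfl; simp only [List.flatten_nil, List.length_nil] at hlen; omega
          have h1 : pre.flatten.length + P.length + D.length ∈ cuts bs ∩
              Ioc (pre.flatten.length + P.length - 1) c := by
            refine mem_inter.2 ⟨?_, mem_Ioc.2 ⟨by omega, by omega⟩⟩
            rw [hcuts]
            exact mem_union_right _ (mem_insert_of_mem (mem_starts_self hcs))
          rw [hcut, mem_singleton] at h1
          omega
      rcases List.eq_nil_or_concat D with rfl | ⟨X, y, rfl⟩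
      · simp at hD0
      rw [List.concat_eq_append] at *
      have hXlen : (X ++ [y]).length = X.length + 1 := by simp
      obtain ⟨-, y', z, hy', hz, hR⟩ := hac.1
      have hbf : bs.flatten = pre.flatten ++ P ++ X ++ y :: cs.flatten := by rw [he]; simp
      have hzy : z = y := by
        grind
      subst hzy
      refine ⟨X, z, rfl, (hc _ (by rw [he]; simp)).2, ?_, y', ?_, hR⟩
      -- Any clash here contains a minimal one starting at `a` or later, which ends at `c` or later,
      -- hence not before the last letter of the block.
      · refine pairwise_of_not_clash (w := bs.flatten) (l₁ := pre.flatten) (l₂ := z :: cs.flatten)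
          (by rw [hbf]; simp) ?_
        intro i j hi hj hij
        obtain ⟨i', j', hm', hi', hj'⟩ := hij.exists_min
        have h1 := hleast i' j' hm' (by omega)
        have h2 : c ≤ j' := by
          rcases h1.eq_or_lt with rfl | h1
          · exact ((intervalSystem_minClash bs.flatten).inj hac hm').le
          · exact ((intervalSystem_minClash bs.flatten).mono hac hm' h1).le
        simp only [List.length_append] at hj
        omega
      · grind
  obtain ⟨B, cs, rfl⟩ := List.exists_cons_of_ne_nil hne
  have hB := (hc B (by simp)).1
  refine key cs [] B (by simp) ⟨List.isChain_singleton _, ?_⟩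
  obtain ⟨s, B', rfl⟩ := List.exists_cons_of_ne_nil hB
  rcases B' with _ | ⟨t, B'⟩
  · exact ⟨s, by simp⟩
  -- The first truncated interval begins at rank one, which has to be a cut; a longer first block
  -- would have it in its interior.
  · exfalso
    obtain ⟨a, c, hac, hma, hae, hec, hleast, hcut, _⟩ := next 0 1 [] _ (by omega) (by simp) rfl
      (by simp) (jrun_jList _) (by omega)
    have : 1 ∈ cuts ((s :: t :: B') :: cs) := by
      have h1 : 1 ∈ cuts ((s :: t :: B') :: cs) ∩ Ioc (1 - 1) c := by rw [hcut]; simp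
      exact (mem_inter.1 h1).1
    have := le_of_mem_starts this
    simp at this

theorem critical_iff {bs : List (List A)} (hne : bs ≠ []) :
    IsCell R bs ∧ CellCritical R bs ↔ IsReading R bs :=
  ⟨fun h => isReading_of_critical h.1 hne h.2, fun h => ⟨h.isCell, h.critical⟩⟩

/-! ### Readings are determined by their words -/

/-- If `B'` went on after the letter `c`, then `c` would belong to the part of `B'` compatible with
`P'`. In particular a larger memory stops no later. -/
theorem Link.length_le {P P' B B' r r' : List A} (h : Link R P B) (h' : Link R P' B')
    (hf : B ++ r = B' ++ r') {X c} (hX : B = X ++ [c]) {y : A} (hy : y ∈ P') (hyc : ¬ R y c) :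
    B'.length ≤ B.length := by
  by_contra hcon
  obtain ⟨X', c', rfl, _, hgood, _⟩ := h'
  have : B <+: X' := by
    refine List.prefix_of_prefix_length_le (l₃ := X' ++ ([c'] ++ r')) ?_ (by simp) ?_
    all_goals grind
  exact hyc ((List.pairwise_append.1 hgood).2.2 y hy c (this.subset (by rw [hX]; simp)))

theorem Link.length_le_of_subset {P P' B B' r r' : List A} (h : Link R P B) (h' : Link R P' B')
    (hf : B ++ r = B' ++ r') (hP : P ⊆ P') : B'.length ≤ B.length := by
  obtain ⟨X, c, hX, _, _, y, hy, hyc⟩ := id h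
  exact h.length_le h' hf hX (hP hy) hyc

/-- Both tiles stop at the first letter clashing with `P`, so reading is deterministic. -/
theorem Link.unique {P B B' r r' : List A} (h : Link R P B) (h' : Link R P B')
    (hf : B ++ r = B' ++ r') : B = B' ∧ r = r' :=
  List.append_inj hf (le_antisymm (h'.length_le_of_subset h hf.symm (fun _ h => h))
    (h.length_le_of_subset h' hf (fun _ h => h)))

theorem chain_unique {P : List A} {m m' : List (List A)} (h : (P :: m).IsChain (Link R))
    (h' : (P :: m').IsChain (Link R)) (hf : m.flatten = m'.flatten) : m = m' := by
  induction m generalizing P m' with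
  | nil =>
    cases m' with
    | nil => rfl
    | cons B m' =>
      have := (List.isChain_cons_cons.1 h').1.ne_nil
      simp at hf
      exact absurd hf.1 this
  | cons B m ih =>
    cases m' with
    | nil =>
      have := (List.isChain_cons_cons.1 h).1.ne_nil
      simp at hf
      exact absurd hf.1 this
    | cons B' m' =>
      rw [List.isChain_cons_cons] at h h'
      simp only [List.flatten_cons] at hf
      obtain ⟨rfl, hf'⟩ := h.1.unique h'.1 hf
      rw [ih h.2 h'.2 hf']

theorem IsReading.unique {bs bs' : List (List A)} (h : IsReading R bs) (h' : IsReading R bs')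
    (hf : bs.flatten = bs'.flatten) : bs = bs' := by
  obtain ⟨h1, s, hs⟩ := h
  obtain ⟨h1', s', hs'⟩ := h'
  cases bs with
  | nil => simp at hs
  | cons B bs =>
    cases bs' with
    | nil => simp at hs'
    | cons B' bs' =>
      simp at hs hs'
      subst hs hs'
      simp at hf
      obtain ⟨rfl, hf⟩ := hf
      rw [chain_unique h1 h1' (by simpa using hf)]

end Critical

/-! ### Sorting commuting letters: the dominance order on words. -/

section Dominance
variable {A : Type*} [LinearOrder A] (N : A → A → Prop)

/-- The letters `a ≤ b` commute. -/
def Rel (a b : A) : Prop := a ≤ b ∧ ¬ N a b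

/-- Swapping two adjacent commuting letters into increasing order. -/
def SwapStep (w w' : List A) : Prop :=
  ∃ u v a b, a < b ∧ ¬ N a b ∧ w = u ++ b :: a :: v ∧ w' = u ++ a :: b :: v

def Dom : List A → List A → Prop := Relation.ReflTransGen (SwapStep N)

/-- The number of inversions of a word. -/
def inversions : List A → ℕ
  | [] => 0
  | a :: l => l.countP (· < a) + inversions l

variable {N}

theorem Dom.append {w w' : List A} (h : Dom N w w') (u v : List A) :
    Dom N (u ++ w ++ v) (u ++ w' ++ v) := by
  induction h with
  | refl => exact Relation.ReflTransGen.refl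
  | tail _ h ih =>
    obtain ⟨p, q, a, b, hab, hN, rfl, rfl⟩ := h
    exact ih.tail ⟨u ++ p, q ++ v, a, b, hab, hN, by simp, by simp⟩

theorem Dom.cons {w w' : List A} (h : Dom N w w') (a : A) : Dom N (a :: w) (a :: w') := by
  simpa using h.append [a] []

theorem SwapStep.perm {w w' : List A} (h : SwapStep N w w') : w.Perm w' := by
  obtain ⟨p, q, a, b, -, -, rfl, rfl⟩ := h
  exact List.Perm.append_left _ (List.Perm.swap _ _ _)

theorem Dom.perm {w w' : List A} (h : Dom N w w') : w.Perm w' := by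
  induction h with
  | refl => exact List.Perm.refl _
  | tail _ h ih => exact ih.trans h.perm

theorem inversions_lt_of_swapStep {w w' : List A} (h : SwapStep N w w') :
    inversions w' < inversions w := by
  obtain ⟨u, v, a, b, hab, -, rfl, rfl⟩ := h
  induction u with
  | nil =>
    have : ¬ b < a := not_lt.2 hab.le
    simp [inversions, hab, this]
    omega
  | cons c u ih =>
    have : (u ++ a :: b :: v).countP (· < c) = (u ++ b :: a :: v).countP (· < c) :=
      (List.Perm.append_left _ (List.Perm.swap _ _ _)).countP_eq _
    simp only [List.cons_append, inversions, this]
    omega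

theorem Dom.inversions_le {w w' : List A} (h : Dom N w w') :
    inversions w' ≤ inversions w := by
  induction h with
  | refl => exact le_rfl
  | tail _ h ih => exact (inversions_lt_of_swapStep h).le.trans ih

/-- Every swap into increasing order lowers the number of inversions. -/
theorem Dom.antisymm {w w' : List A} (h : Dom N w w') (h' : Dom N w' w) : w = w' := by
  rcases Relation.ReflTransGen.cases_head h with h0 | ⟨v, hv, h1⟩
  · exact h0
  · have := inversions_lt_of_swapStep hv
    have : inversions w' ≤ inversions v := Dom.inversions_le h1
    have := h'.inversions_le
    omega

theorem dom_orderedInsert {a : A} {L : List A} (h : ∀ z ∈ L, ¬ N z a) :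
    Dom N (a :: L) (L.orderedInsert (· ≤ ·) a) := by
  induction L with
  | nil => exact Relation.ReflTransGen.refl
  | cons z L ih =>
    by_cases haz : a ≤ z
    · rw [List.orderedInsert_cons_of_le _ _ haz]
      exact Relation.ReflTransGen.refl
    · rw [List.orderedInsert_of_not_le _ _ haz]
      exact Relation.ReflTransGen.head ⟨[], L, z, a, not_le.1 haz, h z (by simp), rfl, rfl⟩
        ((ih fun y hy => h y (by simp [hy])).cons z)

theorem dom_insertionSort {l : List A} (h : l.Pairwise (fun a b => ¬ N b a)) :
    Dom N l (l.insertionSort (· ≤ ·)) := by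
  induction l with
  | nil => exact Relation.ReflTransGen.refl
  | cons a l ih =>
    rw [List.pairwise_cons] at h
    refine Relation.ReflTransGen.trans ((ih h.2).cons a) (dom_orderedInsert fun z hz => h.1 z ?_)
    exact (List.perm_insertionSort _ l).mem_iff.1 hz

theorem eq_of_perm_of_pairwise {G G' : List A} (h : G.Perm G') (hG : G.Pairwise (Rel N))
    (hG' : G'.Pairwise (Rel N)) : G = G' :=
  List.Perm.eq_of_pairwise (le := fun a b => a ≤ b) (fun _ _ _ _ h h' => le_antisymm h h')
    (hG.imp fun h => h.1) (hG'.imp fun h => h.1) h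

/-- The letters of `l` commute pairwise because those of `G` do, and `G` is the insertion sort of
`l`. -/
theorem dom_of_perm (hN : Symmetric N) {l G : List A} (h : G.Perm l) (hG : G.Pairwise (Rel N)) :
    Dom N l G := by
  have h1 : l.Pairwise (fun a b => ¬ N b a) :=
    (List.Perm.pairwise_iff (R := fun a b => ¬ N b a) (fun h h' => h (hN h')) h).1
      (hG.imp fun h h' => h.2 (hN h'))
  have h2 := dom_insertionSort h1
  have : G = l.insertionSort (· ≤ ·) := by
    refine List.Perm.eq_of_pairwise (le := fun a b => a ≤ b)
      (fun _ _ _ _ h h' => le_antisymm h h') (hG.imp fun h => h.1)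
      (List.pairwise_insertionSort _ _) (h.trans (List.perm_insertionSort _ _).symm)
  rw [this]; exact h2

/-- Together with antisymmetry this confines all alternating paths: they cannot return to a word
once left, and they never leave the word of their target. -/
theorem Down.dom (hN : Symmetric N) {s s' : List (List A)} (h : Down (Rel N) s s') :
    Dom N s.flatten s'.flatten := by
  obtain ⟨b₁, D, D', b₂, G, rfl, rfl, hG, hG'⟩ := h
  have := (dom_of_perm hN hG hG').append b₁.flatten b₂.flatten
  simpa using this

end Dominance

/-! ### Alternating paths and their uniqueness. -/

section Paths
variable {A : Type*} {R : A → A → Prop}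

variable (R) in
/-- The alternating paths to `σ`, beginning with an upward match. -/
inductive AltPath (σ : List (List A)) : List (List A) → List (List (List A)) → Prop
  | nil : AltPath σ σ [σ]
  | cons {s T s' p} : Up R s T → Down R T s' → s' ≠ s → AltPath σ s' p → AltPath σ s (s :: T :: p)

variable (R) in
def HasPath (σ s : List (List A)) : Prop := ∃ p, AltPath R σ s p

variable (R) in
def UniquePath (σ s : List (List A)) : Prop := ∃! p, AltPath R σ s p

theorem CellCritical.not_up {s T : List (List A)} (h : CellCritical R s) : ¬ Up R s T := by
  rintro ⟨b₁, D, D', b₂, rfl, rfl, _, _, hp⟩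
  unfold CellCritical at h
  rw [h] at hp
  simp at hp

theorem CellCritical.alive {s : List (List A)} (h : CellCritical R s) : CellAlive R s := by
  intro b hb
  unfold CellCritical at h
  rw [h] at hb
  simp at hb

/-- A path leaves its first cell by an upward match unless it is already at the target. Cells
matched with smaller ones can thus be discarded as continuations. -/
theorem HasPath.alive {σ s : List (List A)} (hσ : CellCritical R σ) (hc : IsCell R s)
    (h : HasPath R σ s) : CellAlive R s := by
  obtain ⟨p, h⟩ := h
  cases h with
  | nil => exact hσ.alive
  | cons hup _ _ _ => exact hup.alive hc

theorem uniquePath_self {σ : List (List A)} (hσ : CellCritical R σ) : UniquePath R σ σ := by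
  refine ⟨[σ], AltPath.nil, ?_⟩
  intro p hp
  cases hp with
  | nil => rfl
  | cons hup _ _ _ => exact absurd hup hσ.not_up

theorem HasPath.of_up {σ s T : List (List A)} (hσ : CellCritical R σ) (hc : IsCell R s)
    (hup : Up R s T) (h : HasPath R σ s) : ∃ s', Down R T s' ∧ s' ≠ s ∧ HasPath R σ s' := by
  obtain ⟨p, h⟩ := h
  cases h with
  | nil => exact absurd hup hσ.not_up
  | cons hup' hd hne hp =>
    rw [Up.unique hc hup hup']
    exact ⟨_, hd, hne, _, hp⟩

/-- The upward match is forced, so uniqueness is inherited from the only lower neighbour from which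
the target can be reached. -/
theorem UniquePath.step {σ s T s₁ : List (List A)} (hσ : CellCritical R σ) (hc : IsCell R s)
    (hup : Up R s T) (hd : Down R T s₁) (hne : s₁ ≠ s) (h₁ : UniquePath R σ s₁)
    (ho : ∀ s', Down R T s' → s' ≠ s → HasPath R σ s' → s' = s₁) : UniquePath R σ s := by
  obtain ⟨p, hp, hu⟩ := h₁
  refine ⟨s :: T :: p, AltPath.cons hup hd hne hp, ?_⟩
  intro q hq
  cases hq with
  | nil => exact absurd hup hσ.not_up
  | cons hup' hd' hne' hp' =>
    obtain rfl := Up.unique hc hup hup'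
    obtain rfl := ho _ hd' hne' ⟨_, hp'⟩
    rw [hu _ hp']

end Paths

/-! ### Paths inside the word of the target. -/

section SameWord
variable {A : Type*} [LinearOrder A] {N : A → A → Prop}

theorem HasPath.dom (hN : Symmetric N) {σ s : List (List A)} (h : HasPath (Rel N) σ s) :
    Dom N s.flatten σ.flatten := by
  obtain ⟨p, h⟩ := h
  induction h with
  | nil => exact Relation.ReflTransGen.refl
  | cons hup hd _ _ ih =>
    have := hd.dom hN
    rw [hup.flatten] at this
    exact this.trans ih

/-- A step inside the word of the target. -/
theorem UniquePath.step_same_word (hN : Symmetric N) {σ s T s₁ : List (List A)}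
    (hσ : IsReading (Rel N) σ) (hc : IsCell (Rel N) s) (hw : s.flatten = σ.flatten)
    (hup : Up (Rel N) s T) (hd : Down (Rel N) T s₁) (hne : s₁ ≠ s) (h₁ : UniquePath (Rel N) σ s₁)
    (ho : ∀ s', Down (Rel N) T s' → s'.flatten = s.flatten → s' ≠ s → CellAlive (Rel N) s' →
      s' = s₁) : UniquePath (Rel N) σ s := by
  refine UniquePath.step hσ.critical hc hup hd hne h₁ ?_
  intro s' hd' hne' hp
  -- Both cells have the word of the target: the word of `s'` lies between two equal words in the
  -- dominance order.
  have h1 := hp.dom hN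
  have h2 := hd'.dom hN
  rw [hup.flatten, hw] at h2
  refine ho s' hd' ?_ hne' (hp.alive hσ.critical (hd'.isCell (hup.isCell hc)))
  rw [hw]
  exact h1.antisymm h2

/-- The surplus `D` beyond the tile `B` flows to the right: the pivot splits it off, and
`CPrefix.flow_inword` forces it to be merged with the next block. -/
theorem UniquePath.flow (hN : Symmetric N) {σ : List (List A)} (hσ : IsReading (Rel N) σ)
    {pre : List (List A)} {P B B' D D₂ : List A} (h : CPrefix (Rel N) pre P)
    (hB : Link (Rel N) P B) (hB' : Link (Rel N) B B') {cs : List (List A)} {rest : List A}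
    (hc : IsCell (Rel N) (pre ++ P :: (B ++ D) :: D₂ :: cs))
    (hw : (pre ++ P :: (B ++ D) :: D₂ :: cs).flatten = σ.flatten)
    (hf : D ++ D₂ ++ cs.flatten = B' ++ rest) (hD : D ≠ []) (hDD : (D ++ D₂).Pairwise (Rel N))
    (h₁ : UniquePath (Rel N) σ (pre ++ P :: B :: (D ++ D₂) :: cs)) :
    UniquePath (Rel N) σ (pre ++ P :: (B ++ D) :: D₂ :: cs) := by
  have hcov : Covered (Rel N) (pre ++ P :: (B ++ D) :: D₂ :: cs).flatten := by
    rw [hw]; exact hσ.covered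
  have hf' : D ++ (D₂ :: cs).flatten = B' ++ rest := by simpa using hf
  obtain ⟨hup, -⟩ := h.flow_up hB hB' hc hcov hf' hD
  refine UniquePath.step_same_word hN hσ hc hw hup
    ⟨pre ++ [P, B], D, D₂, cs, D ++ D₂, by simp, by simp, List.Perm.refl _, hDD⟩ ?_ h₁ ?_
  · simp_all
  · intro s' hd' hfl hne hal
    obtain ⟨D₃, cs', he, rfl⟩ := h.flow_inword hB hB' hc hcov hf' hD hd' hfl hne hal
    simp only [List.cons.injEq] at he
    rw [he.1, he.2]

/-- The cell reading its last tiles with the memory of `Z` only flows to the one reading them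
with the memory of `Y ++ Z`. -/
theorem uniquePath_merge (hN : Symmetric N) {σ : List (List A)} (hσ : IsReading (Rel N) σ) :
    ∀ (m₂ m₁ pre : List (List A)) (Y Z : List A), σ = pre ++ (Y ++ Z) :: m₂ →
      (Z :: m₁).IsChain (Link (Rel N)) → m₁.flatten = m₂.flatten →
      UniquePath (Rel N) σ (pre ++ (Y ++ Z) :: m₁) := by
  intro m₂
  induction hn : m₂.length using Nat.strong_induction_on generalizing m₂ with
  | _ n ih =>
  intro m₁ pre Y Z hσe hm₁ hf
  have hm₂ : ((Y ++ Z) :: m₂).IsChain (Link (Rel N)) := by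
    have := hσ.1; rw [hσe, List.isChain_append] at this; exact this.2.1
  cases m₁ with
  | nil =>
    cases m₂ with
    | nil => rw [← hσe]; exact uniquePath_self hσ.critical
    | cons B₂ m₂ =>
      have := (List.isChain_cons_cons.1 hm₂).1.ne_nil
      simp at hf
      exact absurd hf.1 this
  | cons B₁ m₁ =>
    rw [List.isChain_cons_cons] at hm₁
    cases m₂ with
    | nil => simp at hf; exact absurd hf.1 hm₁.1.ne_nil
    | cons B₂ m₂ =>
      rw [List.isChain_cons_cons] at hm₂
      simp only [List.flatten_cons] at hf
      -- A larger memory stops earlier, so the tile read with memory `Z` extends the one read with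
      -- memory `Y ++ Z`; `D` is the surplus.
      have hle := hm₁.1.length_le_of_subset hm₂.1 hf (by simp)
      obtain ⟨D, hD⟩ : B₂ <+: B₁ :=
        List.prefix_of_prefix_length_le (l₃ := B₁ ++ m₁.flatten) (by rw [hf]; simp) (by simp) hle
      subst hD
      rw [List.append_assoc] at hf
      have hf1 := List.append_cancel_left hf
      by_cases hD0 : D = []
      · subst hD0
        simp only [List.append_nil, List.nil_append] at *
        rw [chain_unique hm₁.2 hm₂.2 hf1, ← hσe]
        exact uniquePath_self hσ.critical
      cases m₂ with
      | nil => simp at hf1; exact absurd hf1.1 hD0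
      | cons B₃ m₂ =>
        rw [List.isChain_cons_cons] at hm₂
        simp only [List.flatten_cons] at hf1
        have hB1p := hm₁.1.pairwise
        -- `B₃` swallows `D` properly
        have hlt : D.length < B₃.length := by
          by_contra hcon
          obtain ⟨X, c, rfl, _, _, y, hy, hyc⟩ := hm₂.2.1
          have : X ++ [c] <+: D := List.prefix_of_prefix_length_le (l₃ := D ++ m₁.flatten)
            (by rw [hf1]; simp) (by simp) (not_lt.1 hcon)
          exact hyc ((List.pairwise_append.1 hB1p).2.2 y hy c (this.subset (by simp)))
        obtain ⟨E, rfl⟩ : D <+: B₃ := List.prefix_of_prefix_length_le (l₃ := D ++ m₁.flatten)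
          (by simp) (by rw [hf1]; simp) hlt.le
        have hE0 : E ≠ [] := by rintro rfl; simp at hlt
        rw [List.append_assoc] at hf1
        have hf2 := List.append_cancel_left hf1
        cases m₁ with
        | nil => simp at hf2; exact absurd hf2.1 hE0
        | cons B₄ m₁ =>
          have hm₁' := hm₁.2
          rw [List.isChain_cons_cons] at hm₁'
          simp only [List.flatten_cons] at hf2
          have hDE := hm₂.2.1.pairwise
          -- The tile `D ++ E` after `B₂` and the tile `B₄` after `B₂ ++ D` stop at the same letter:
          -- the letter stopping the former clashes with `B₂`, and before it everything is
          -- compatible with both `B₂` and `D`.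
          have hlen : B₄.length = E.length := by
            obtain ⟨X, c, hX, _, hgood, y, hy, hyc⟩ := id hm₂.2.1
            rcases List.eq_nil_or_concat E with rfl | ⟨E', c', rfl⟩
            · exact absurd rfl hE0
            rw [List.concat_eq_append] at *
            rw [← List.append_assoc] at hX
            obtain ⟨rfl, h2⟩ := List.append_inj' hX rfl
            simp only [List.cons.injEq, and_true] at h2
            subst h2
            refine le_antisymm ?_ ?_
            · by_contra hcon
              obtain ⟨X', d, rfl, _, hg, _⟩ := hm₁'.1
              have : E' ++ [c'] <+: X' := List.prefix_of_prefix_length_le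
                (l₃ := X' ++ ([d] ++ m₁.flatten)) (by rw [← List.append_assoc, hf2]; simp)
                (by simp) (by simp only [List.length_append, List.length_cons, List.length_nil]
                                at hcon ⊢; omega)
              exact hyc ((List.pairwise_append.1 hg).2.2 y (by simp [hy]) c'
                (this.subset (by simp)))
            · by_contra hcon
              obtain ⟨X', d, rfl, _, hg, z, hz, hzd⟩ := hm₁'.1
              have hpre : X' ++ [d] <+: E' := List.prefix_of_prefix_length_le
                (l₃ := E' ++ ([c'] ++ m₂.flatten)) (by rw [← List.append_assoc, ← hf2]; simp)
                (by simp) (by simp only [List.length_append, List.length_cons, List.length_nil]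
                                at hcon ⊢; omega)
              have hd : d ∈ E' := hpre.subset (by simp)
              grind
          obtain ⟨rfl, hf3⟩ := List.append_inj hf2 hlen
          have hpre : CPrefix (Rel N) pre (Y ++ Z) := by
            rw [hσe] at hσ; exact hσ.cPrefix
          have hσc := hσ.isCell
          refine UniquePath.flow hN hσ hpre hm₂.1 hm₂.2.1 (rest := m₂.flatten) ?_ ?_ ?_ hD0 hDE ?_
          · have h4 : IsCell (Rel N) (B₄ :: m₁) := fun B hB => by
              have : ∀ (P : List A) (m : List (List A)), (P :: m).IsChain (Link (Rel N)) →
                  ∀ B ∈ m, B ≠ [] ∧ B.Pairwise (Rel N) := by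
                intro P m
                induction m generalizing P with
                | nil => simp
                | cons C m ih =>
                  intro h B hB
                  rw [List.isChain_cons_cons] at h
                  rcases List.mem_cons.1 hB with rfl | hB
                  · exact ⟨h.1.ne_nil, h.1.pairwise⟩
                  · exact ih C h.2 B hB
              exact this _ _ (List.isChain_cons_cons.2 hm₁') B hB
            intro B hB
            simp only [List.mem_append, List.mem_cons] at hB
            rcases hB with hB | rfl | rfl | hB
            · exact hσc B (by rw [hσe]; simp [hB])
            · exact hσc _ (by rw [hσe]; simp)
            · exact ⟨hm₁.1.ne_nil, hB1p⟩
            · exact h4 B (List.mem_cons.2 hB)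
          · rw [hσe]; simp [hf3]
          · simp [hf3]
          -- After one flow step the situation recurs two blocks further on, with `D` and `B₄` as
          -- the new `Y` and `Z`.
          · have := ih m₂.length (by simp at hn; omega) m₂ rfl m₁ (pre ++ [Y ++ Z, B₂]) D B₄
              (by rw [hσe]; simp) hm₁'.2 hf3
            simpa using this

end SameWord

/-! ### Counting letters before an occurrence, and words with one moved letter. -/

section Prefixes
variable {A : Type*} [LinearOrder A] {N : A → A → Prop}

/-- The part of a word before the occurrence of `a` with exactly `c` further `a`s to its right. -/
def prefixBefore (a : A) (c : ℕ) : List A → List A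
  | [] => []
  | h :: t => if h = a ∧ t.count a = c then [] else h :: prefixBefore a c t

theorem prefixBefore_self (a : A) (u v : List A) :
    prefixBefore a (v.count a) (u ++ a :: v) = u := by
  induction u with
  | nil => simp [prefixBefore]
  | cons h u ih =>
    have : ¬ (h = a ∧ (u ++ a :: v).count a = v.count a) := by
      rintro ⟨-, h⟩
      simp at h
      omega
    simp only [List.cons_append, prefixBefore, this, if_false, ih]

theorem count_prefixBefore_append_le {a b : A} {c : ℕ} {q q' : List A} (hq : q.Perm q')
    (h : (prefixBefore a c q').count b ≤ (prefixBefore a c q).count b) (p : List A) :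
    (prefixBefore a c (p ++ q')).count b ≤ (prefixBefore a c (p ++ q)).count b := by
  induction p with
  | nil => exact h
  | cons y p ih =>
    have : (p ++ q').count a = (p ++ q).count a :=
      (List.Perm.append_left p hq.symm).count_eq a
    simp only [List.cons_append, prefixBefore, this]
    grind

/-- Only the prefix of the swapped `x` loses a letter, namely `y`. The prefix of `y` gains `x`,
which is too small to be the counted letter `b > a`. -/
theorem count_prefixBefore_swap {x y a b : A} (hxy : x < y) (hab : a < b) (c : ℕ) (p r : List A) :
    (prefixBefore a c (p ++ x :: y :: r)).count b ≤
      (prefixBefore a c (p ++ y :: x :: r)).count b ∧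
    (¬ (a = x ∧ c = r.count x) → (prefixBefore a c (p ++ x :: y :: r)).count b =
      (prefixBefore a c (p ++ y :: x :: r)).count b) := by
  have hne : x ≠ y := hxy.ne
  have h1 : (prefixBefore a c (x :: y :: r)).count b ≤ (prefixBefore a c (y :: x :: r)).count b ∧
      (¬ (a = x ∧ c = r.count x) → (prefixBefore a c (y :: x :: r)).count b ≤
        (prefixBefore a c (x :: y :: r)).count b) := by
    simp only [prefixBefore]
    grind
  have hp : (y :: x :: r).Perm (x :: y :: r) := List.Perm.swap _ _ _
  exact ⟨count_prefixBefore_append_le hp h1.1 p, fun h =>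
    le_antisymm (count_prefixBefore_append_le hp h1.1 p)
      (count_prefixBefore_append_le hp.symm (h1.2 h) p)⟩

theorem Dom.count_prefixBefore_le {w w' : List A} (h : Dom N w w') {a b : A} (hab : a < b) (c : ℕ) :
    (prefixBefore a c w').count b ≤ (prefixBefore a c w).count b := by
  induction h with
  | refl => exact le_rfl
  | tail _ h ih =>
    obtain ⟨p, q, a', b', hab', -, rfl, rfl⟩ := h
    exact ((count_prefixBefore_swap hab' hab c p q).1).trans ih

/-- Counts in the word where `x` has been moved to the left over larger letters. -/
theorem count_prefixBefore_move {x a b : A} (hab : a < b) {c : ℕ} (α β : List A) {m : List A}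
    (hm : ∀ y ∈ m, x < y) (h : ¬ (a = x ∧ c = β.count x)) :
    (prefixBefore a c (α ++ x :: (m ++ β))).count b =
      (prefixBefore a c (α ++ m ++ x :: β)).count b := by
  induction m generalizing α with
  | nil => simp
  | cons y m ih =>
    have hy := hm y (by simp)
    have hcount : (m ++ β).count x = β.count x := by
      rw [List.count_append, List.count_eq_zero.2, zero_add]
      exact fun hx => lt_irrefl _ (hm x (by simp [hx]))
    have h1 := (count_prefixBefore_swap hy hab c α (m ++ β)).2 (by rw [hcount]; exact h)
    have h2 := ih (α ++ [y]) fun z hz => hm z (by simp [hz])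
    grind

/-- Words between two words which differ only in the position of one letter are of the same kind. -/
theorem Dom.confined {α m β w : List A} {x : A} (hm : ∀ y ∈ m, x < y)
    (h : Dom N (α ++ m ++ x :: β) w) (h' : Dom N w (α ++ x :: (m ++ β))) :
    ∃ m₁ m₂, m = m₁ ++ m₂ ∧ w = α ++ m₁ ++ x :: (m₂ ++ β) := by
  induction h with
  | refl => exact ⟨m, [], by simp, by simp⟩
  | @tail v w _ hstep ih =>
    obtain ⟨m₁, m₂, rfl, rfl⟩ := ih (Relation.ReflTransGen.head hstep h')
    obtain ⟨u, q, a, b, hab, hN, he, rfl⟩ := hstep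
    have hm₁ : ∀ y ∈ m₁, x < y := fun y hy => hm y (by simp [hy])
    have h1 : (prefixBefore a (q.count a) (α ++ x :: (m₁ ++ m₂ ++ β))).count b ≤ u.count b := by
      have := h'.count_prefixBefore_le hab (q.count a)
      have hq : (b :: q).count a = q.count a := List.count_cons_of_ne hab.ne'
      rwa [← hq, prefixBefore_self, hq] at this
    have h2 : prefixBefore a (q.count a) (α ++ m₁ ++ x :: (m₂ ++ β)) = u ++ [b] := by
      rw [he]
      have := prefixBefore_self a (u ++ [b]) q
      simpa using this
    -- If the swap moves another occurrence than the distinguished `x`, the number of letters `b`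
    -- before that occurrence drops. Moving `x` does not affect this number, so it would already be
    -- too small for the final word.
    by_cases hcase : a = x ∧ q.count a = (m₂ ++ β).count x
    · obtain ⟨rfl, hc⟩ := hcase
      rw [hc, prefixBefore_self] at h2
      rcases List.eq_nil_or_concat m₁ with rfl | ⟨m₃, y, rfl⟩
      · exfalso
        rw [List.nil_append, hc, prefixBefore_self] at h1
        grind
      · rw [List.concat_eq_append] at *
        rw [← List.append_assoc] at h2
        obtain ⟨h3, h4⟩ := List.append_inj' h2 rfl
        simp only [List.cons.injEq, and_true] at h4
        subst h4
        refine ⟨m₃, y :: m₂, by simp, ?_⟩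
        have he' : u ++ y :: a :: q = u ++ y :: a :: (m₂ ++ β) := by
          rw [← he, ← h3]; simp
        simp_all
    · exfalso
      have h3 := count_prefixBefore_move hab (c := q.count a) α (m₂ ++ β) hm₁ hcase
      grind

end Prefixes

/-! ### Downward steps that move one letter to the left. -/

section Hops
variable {A : Type*} [LinearOrder A] {N : A → A → Prop}

omit [LinearOrder A] in
theorem eq_of_flatten_length_eq {b b' c c' : List (List A)} (hb : ∀ B ∈ b ++ c, B ≠ [])
    (h : b ++ c = b' ++ c') (hl : b.flatten.length = b'.flatten.length) : b = b' ∧ c = c' := by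
  induction b generalizing b' with
  | nil =>
    cases b' with
    | nil => exact ⟨rfl, h⟩
    | cons B b' =>
      have : B ≠ [] := hb B (by rw [h]; simp)
      have := List.length_pos_of_ne_nil this
      grind
  | cons B b ih =>
    cases b' with
    | nil =>
      have := List.length_pos_of_ne_nil (hb B (by simp))
      grind
    | cons B' b' =>
      grind

/-- A downward step which moves the letter `x` to the left. -/
theorem Down.form {T s' : List (List A)} (hd : Down (Rel N) T s') (hc : IsCell (Rel N) T)
    {α m β : List A} {x : A} (hm : ∀ y ∈ m, x < y) (hm0 : m ≠ [])
    (hT : T.flatten = α ++ m ++ x :: β) (hs : s'.flatten = α ++ x :: (m ++ β)) :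
    ∃ b₁ D₀ V b₂, T = b₁ ++ (D₀ ++ m) :: (x :: V) :: b₂ ∧
      s' = b₁ ++ (D₀ ++ x :: (m ++ V)) :: b₂ ∧ b₁.flatten ++ D₀ = α := by
  obtain ⟨b₁, D, D', b₂, G, rfl, rfl, hG, hGp⟩ := hd
  have hlen := hG.length_eq
  -- A letter of `m` is larger than `x`, so a sorted block cannot contain it in front of `x`; some
  -- cut lies between `m` and `x`.
  have hlast : ∀ (l l' : List A), l ≠ [] → ∀ l₀, m = l₀ ++ l → ¬ (l ++ x :: l').Pairwise (Rel N) := by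
    intro l l' hl l₀ he hp
    obtain ⟨z, l, rfl⟩ := List.exists_cons_of_ne_nil hl
    have h1 := ((List.pairwise_append.1 hp).2.2 z (by simp) x (by simp)).1
    exact absurd (hm z (by rw [he]; simp)) (not_lt.2 h1)
  simp only [List.flatten_append, List.flatten_cons] at hT hs
  rw [List.append_assoc, List.append_eq_append_iff] at hT
  obtain ⟨D₀, rfl, hT₂⟩ : ∃ D₀, α = b₁.flatten ++ D₀ ∧ D ++ (D' ++ b₂.flatten) = D₀ ++ (m ++ x :: β) := by
    rcases hT with ⟨a', h1, h2⟩ | ⟨c', h1, h2⟩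
    · exact ⟨a', h1, h2⟩
    · cases c' with
      | nil => exact ⟨[], by simpa using h1.symm, by simpa using h2.symm⟩
      | cons z c' =>
        exfalso
        obtain ⟨y, m', rfl⟩ := List.exists_cons_of_ne_nil hm0
        simp_all
  rw [List.append_assoc] at hs
  replace hs := List.append_cancel_left hs
  have hT' : (D ++ D') ++ b₂.flatten = (D₀ ++ m ++ [x]) ++ β := by simpa using hT₂
  have hs' : G ++ b₂.flatten = (D₀ ++ x :: m) ++ β := by simpa using hs
  -- If the merged blocks ended before `x`, comparing the two words would make the last letter of
  -- `m` equal to `x`.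
  obtain ⟨V, hV, hβ⟩ : ∃ V, D ++ D' = D₀ ++ m ++ [x] ++ V ∧ β = V ++ b₂.flatten := by
    rcases List.append_eq_append_iff.1 hT' with ⟨a', h1, h2⟩ | ⟨c', h1, h2⟩
    · rcases List.eq_nil_or_concat a' with rfl | ⟨a', z, rfl⟩
      · grind
      · exfalso
        rw [List.concat_eq_append] at *
        rw [← List.append_assoc] at h1
        obtain ⟨h3, h4⟩ := List.append_inj' h1 rfl
        simp only [List.cons.injEq, and_true] at h4
        subst h4
        rw [h2, ← List.append_assoc] at hs'
        have h5 := List.append_cancel_right hs'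
        obtain ⟨m', t, rfl⟩ : ∃ m' t, m = m' ++ [t] := by
          rcases List.eq_nil_or_concat m with h | ⟨m', t, h⟩
          all_goals grind
        rw [← List.append_assoc, ← List.cons_append, ← List.append_assoc] at h5
        obtain ⟨-, h6⟩ := List.append_inj' h5 rfl
        simp only [List.cons.injEq, and_true] at h6
        have := hm t (by simp)
        rw [h6] at this
        exact lt_irrefl _ this
    · exact ⟨c', h1, h2⟩
  have hGe : G = D₀ ++ x :: (m ++ V) := by
    rw [hβ, ← List.append_assoc] at hs'
    have := List.append_cancel_right hs'
    simpa using this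
  have hV' : D ++ D' = (D₀ ++ m) ++ (x :: V) := by simpa using hV
  have hD := (hc D (by simp)).2
  have hD' := (hc D' (by simp)).2
  rcases List.append_eq_append_iff.1 hV' with ⟨a', h1, h2⟩ | ⟨c', h1, h2⟩
  · by_cases ha : a' = []
    · grind
    · exfalso
      rw [h2] at hD'
      rcases List.append_eq_append_iff.1 h1 with ⟨e, h3, h4⟩ | ⟨e, h3, h4⟩
      · exact hlast a' V ha e h4 hD'
      · obtain ⟨y, m', rfl⟩ := List.exists_cons_of_ne_nil hm0
        rw [h4] at hD'
        refine hlast (y :: m') V (by simp) [] rfl (List.Pairwise.sublist ?_ hD')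
        simp
  · cases c' with
    | nil =>
      grind
    | cons z c' =>
      exfalso
      simp only [List.cons_append, List.cons.injEq] at h2
      rw [h1, ← h2.1] at hD
      refine hlast m c' hm0 [] rfl (List.Pairwise.sublist ?_ hD)
      simp

end Hops

/-! ### Uncovered ranks. -/

section Uncovered
variable {A : Type*} {R : A → A → Prop}

variable (R) in
/-- Before the first letter of `l` clashing with `x` there is a clash inside `l`. -/
def Blocked (x : A) (l : List A) : Prop :=
  ∀ l₁ z l₂, l = l₁ ++ z :: l₂ → ¬ R x z → ¬ (l₁ ++ [z]).Pairwise R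

theorem Blocked.append {x : A} {l D : List A} (h : Blocked R x l) (hD : ∀ d ∈ D, R x d) :
    Blocked R x (D ++ l) := by
  intro l₁ z l₂ he hz hp
  rcases List.append_eq_append_iff.1 he with ⟨a', h1, h2⟩ | ⟨c', h1, h2⟩
  · refine h a' z l₂ h2 hz (List.Pairwise.sublist ?_ hp)
    grind
  · cases c' with
    | nil =>
      exact h [] z l₂ (by simpa using h2.symm) hz (List.pairwise_singleton _ _)
    | cons y c' =>
      grind

/-- A minimal clash across the rank behind `x` cannot start at or before `y`, since it would contain
the clash of `y` and `x`. It cannot start at `x` either, since a clash comes before the first letter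
clashing with `x`. -/
theorem not_minClash_of_blocked {w l₁ l₂ : List A} {x y : A} (hw : w = l₁ ++ y :: x :: l₂)
    (hyx : ¬ R y x) (h : Blocked R x l₂) {a c : ℕ} (hac : MinClash R w a c)
    (ha : a < l₁.length + 2) (hc : l₁.length + 2 ≤ c) : False := by
  have h1 : Clash R w l₁.length (l₁.length + 1) := by
    have := clash_of_eq (w := w) (l₁ := l₁) (l₂ := []) (l₃ := l₂) (by simp [hw]) hyx
    simpa using this
  by_cases ha' : a ≤ l₁.length
  · have := hac.2 _ _ h1 ha' (by omega)
    omega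
  · obtain rfl : a = l₁.length + 1 := by omega
    obtain ⟨-, x', z, hx, hz, hxz⟩ := hac.1
    have hw' : w = (l₁ ++ [y, x]) ++ l₂ := by simp [hw]
    have hx' : x' = x := by
      grind
    subst hx'
    rw [hw', List.getElem?_append_right (by simp; omega)] at hz
    obtain ⟨hlt, hz⟩ := List.getElem?_eq_some_iff.1 hz
    have hsplit : l₂ = l₂.take (c - (l₁ ++ [y, x']).length) ++ z ::
        l₂.drop (c - (l₁ ++ [y, x']).length + 1) := by
      rw [← hz]; simp
    have hlen : (l₂.take (c - (l₁ ++ [y, x']).length)).length = c - (l₁.length + 2) := by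
      simp at hlt ⊢; omega
    refine h _ z _ hsplit hxz (pairwise_of_not_clash (w := w) (l₁ := l₁ ++ [y, x'])
      (l₂ := l₂.drop (c - (l₁ ++ [y, x']).length + 1)) ?_ ?_)
    · conv_lhs => rw [hw', hsplit]
      simp
    · intro i j hi hj hij
      simp at hi hj hlen
      have := hac.2 i j hij (by omega) (by omega)
      omega

theorem piv_le_of_uncovered {w : List A} {r : ℕ} (hr0 : 0 < r) (hr : r < w.length)
    (h : ∀ a c, MinClash R w a c → a < r → r ≤ c → False) :
    ¬ Covered R w ∧ ∀ S, ∀ b ∈ piv R w S, b ≤ r := by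
  have hun : r ∉ (clashIntervals R w).biUnion id := by
    rw [mem_biUnion]
    rintro ⟨Q, hQ, hrQ⟩
    obtain ⟨a, c, hm, rfl⟩ := mem_clashIntervals.1 hQ
    have := mem_Ioc.1 hrQ
    exact h a c hm this.1 this.2
  have hnc : ¬ Covered R w := by
    intro hc
    rw [covered_iff] at hc
    grind
  refine ⟨hnc, fun S b hb => ?_⟩
  unfold piv at hb
  rw [pivot_uncovered hnc] at hb
  exact (mem_filter.1 hb).2 r (mem_sdiff.2 ⟨mem_Ioo.2 ⟨hr0, hr⟩, hun⟩)

/-- All interior ranks of an initial part are covered by `CPrefix.exists_cover`, so its end is the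
lowest uncovered rank, whatever the cell. -/
theorem CPrefix.piv_uncovered {pre : List (List A)} {P : List A} (hpre : CPrefix R pre P)
    {w rest : List A} (hw : w = (pre ++ [P]).flatten ++ rest) (hrest : rest ≠ [])
    (h : ∀ a c, MinClash R w a c → a < (pre ++ [P]).flatten.length →
      (pre ++ [P]).flatten.length ≤ c → False) (S : Finset ℕ) :
    piv R w S = {(pre ++ [P]).flatten.length} := by
  have hP : 0 < P.length := List.length_pos_of_ne_nil (hpre.isCell P (by simp)).1
  have hlen : w.length = (pre ++ [P]).flatten.length + rest.length := by
    rw [hw, List.length_append]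
  have hrest' := List.length_pos_of_ne_nil hrest
  have hpos : 0 < (pre ++ [P]).flatten.length := by
    grind
  obtain ⟨hnc, -⟩ := piv_le_of_uncovered (R := R) (w := w) hpos (by omega) h
  unfold piv
  rw [pivot_uncovered hnc]
  refine lowest_eq_of_least ?_ ?_
  · refine mem_sdiff.2 ⟨mem_Ioo.2 ⟨hpos, by omega⟩, ?_⟩
    rw [mem_biUnion]
    rintro ⟨Q, hQ, hrQ⟩
    obtain ⟨a, c, hm, rfl⟩ := mem_clashIntervals.1 hQ
    have := mem_Ioc.1 hrQ
    exact h a c hm this.1 this.2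
  · intro t ht
    obtain ⟨ht1, ht2⟩ := mem_sdiff.1 ht
    by_contra hcon
    obtain ⟨a, c, hm, h1, h2⟩ := hpre.exists_cover hw (mem_Ioo.1 ht1).1 (not_le.1 hcon)
    exact ht2 (mem_biUnion.2 ⟨_, mem_clashIntervals.2 ⟨a, c, hm, rfl⟩, mem_Ioc.2 ⟨h1, h2⟩⟩)

end Uncovered

/-! ### A letter hopping to the left through a corridor of blocks. -/

section Hopping
variable {A : Type*} [LinearOrder A] {N : A → A → Prop}

/-- The word of `s'` lies in the dominance order between two words differing only in the position of
`x`. By `Dom.confined` only `x` has moved, and `Down.form` then locates the two merged blocks. -/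
theorem HasPath.hop_form (hN : Symmetric N) {σ T s' : List (List A)} (hd : Down (Rel N) T s')
    (hc : IsCell (Rel N) T) {α m β : List A} {x : A} (hm : ∀ y ∈ m, x < y)
    (hT : T.flatten = α ++ m ++ x :: β) (hσ : σ.flatten = α ++ x :: (m ++ β))
    (hp : HasPath (Rel N) σ s') (hne : s'.flatten ≠ T.flatten) :
    ∃ m₁ m₂ b₁ D₀ V b₂, m = m₁ ++ m₂ ∧ m₂ ≠ [] ∧ T = b₁ ++ (D₀ ++ m₂) :: (x :: V) :: b₂ ∧
      s' = b₁ ++ (D₀ ++ x :: (m₂ ++ V)) :: b₂ ∧ b₁.flatten ++ D₀ = α ++ m₁ := by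
  have h1 := hp.dom hN
  have h2 := hd.dom hN
  rw [hσ] at h1
  rw [hT] at h2 hne
  obtain ⟨m₁, m₂, rfl, hs⟩ := h2.confined hm h1
  have hm₂ : m₂ ≠ [] := by
    rintro rfl
    apply hne
    rw [hs]; simp
  obtain ⟨b₁, D₀, V, b₂, h3, h4, h5⟩ := hd.form hc (fun y hy => hm y (by simp [hy])) hm₂
    (α := α ++ m₁) (β := β) (by rw [hT]; simp) (by rw [hs])
  grind

/-- The cut before `x` determines which blocks are merged, and a multiset of letters has only one
arrangement as a block. -/
theorem HasPath.hop_eq (hN : Symmetric N) {σ s' c₁ c₂ : List (List A)} {E₀ M : List A} {x : A}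
    (hd : Down (Rel N) (c₁ ++ (E₀ ++ M) :: [x] :: c₂) s')
    (hc : IsCell (Rel N) (c₁ ++ (E₀ ++ M) :: [x] :: c₂)) {α m : List A} (hm : ∀ y ∈ m, x < y)
    (hT : (c₁ ++ [E₀ ++ M]).flatten = α ++ m) (hσ : σ.flatten = α ++ x :: (m ++ c₂.flatten))
    (hG : (E₀ ++ x :: M).Pairwise (Rel N))
    (hp : HasPath (Rel N) σ s') (hne : s'.flatten ≠ (c₁ ++ (E₀ ++ M) :: [x] :: c₂).flatten) :
    s' = c₁ ++ (E₀ ++ x :: M) :: c₂ := by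
  have hTf : (c₁ ++ (E₀ ++ M) :: [x] :: c₂).flatten = α ++ m ++ x :: c₂.flatten := by
    rw [← hT]; simp
  have hc' := hd.isCell hc
  obtain ⟨m₁, m₂, b₁, D₀, V, b₂, rfl, hm₂, h1, rfl, h3⟩ := HasPath.hop_form hN hd hc hm hTf hσ hp hne
  have h4 : (c₁ ++ [E₀ ++ M]) ++ ([x] :: c₂) = (b₁ ++ [D₀ ++ m₂]) ++ ((x :: V) :: b₂) := by
    simpa using h1
  obtain ⟨h5, h6⟩ := eq_of_flatten_length_eq (by
      intro B hB; exact hc.ne_nil B (by simpa using hB)) h4 (by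
    rw [hT]
    have := congrArg List.length h3
    simp only [List.flatten_append, List.flatten_cons, List.flatten_nil, List.length_append,
      List.append_nil] at this ⊢
    omega)
  obtain ⟨rfl, h7⟩ := List.append_inj' h5 rfl
  simp only [List.cons.injEq, and_true] at h6 h7
  obtain ⟨⟨-, rfl⟩, rfl⟩ := h6
  have hp2 := (hc' (D₀ ++ x :: (m₂ ++ [])) (by simp)).2
  rw [List.append_nil] at hp2 ⊢
  have : D₀ ++ x :: m₂ = E₀ ++ x :: M := by
    refine eq_of_perm_of_pairwise ?_ hp2 hG
    have e1 := (List.perm_middle (a := x) (l₁ := D₀) (l₂ := m₂))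
    grind
  rw [this]

/-- One step of the forced path which moves the letter `x` to the front. -/
theorem hop_step (hN : Symmetric N) {σ c₁ G : List (List A)} {E₀ M D : List A} {x : A}
    (hσ : IsReading (Rel N) σ) (hpre : CPrefix (Rel N) c₁ (E₀ ++ M))
    (hc : IsCell (Rel N) (c₁ ++ (E₀ ++ M) :: (x :: D) :: G)) (hD : D ≠ []) (hM0 : M ≠ [])
    (hM : ∀ y ∈ M, x < y) {α m : List A} (hm : ∀ y ∈ m, x < y)
    (hT : (c₁ ++ [E₀ ++ M]).flatten = α ++ m)
    (hσf : σ.flatten = α ++ x :: (m ++ D ++ G.flatten)) (hG : (E₀ ++ x :: M).Pairwise (Rel N))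
    (hbl : Blocked (Rel N) x (D ++ G.flatten)) :
    Up (Rel N) (c₁ ++ (E₀ ++ M) :: (x :: D) :: G) (c₁ ++ (E₀ ++ M) :: [x] :: D :: G) ∧
    Down (Rel N) (c₁ ++ (E₀ ++ M) :: [x] :: D :: G) (c₁ ++ (E₀ ++ x :: M) :: D :: G) ∧
    c₁ ++ (E₀ ++ x :: M) :: D :: G ≠ c₁ ++ (E₀ ++ M) :: (x :: D) :: G ∧
    ∀ s', Down (Rel N) (c₁ ++ (E₀ ++ M) :: [x] :: D :: G) s' →
      s' ≠ c₁ ++ (E₀ ++ M) :: (x :: D) :: G → HasPath (Rel N) σ s' →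
      s' = c₁ ++ (E₀ ++ x :: M) :: D :: G := by
  obtain ⟨M', y, rfl⟩ : ∃ M' y, M = M' ++ [y] := by
    rcases List.eq_nil_or_concat M with h | ⟨M', t, h⟩
    · exact absurd h hM0
    · exact ⟨M', t, by simpa using h⟩
  have hxy : x < y := hM y (by simp)
  have hyx : ¬ Rel N y x := fun h => absurd h.1 (not_le.2 hxy)
  have hlink : Link (Rel N) (E₀ ++ (M' ++ [y])) [x] :=
    ⟨[], x, rfl, List.pairwise_singleton _ _, by simpa using (hc (E₀ ++ (M' ++ [y])) (by simp)).2,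
      y, by simp, hyx⟩
  have hpre' := hpre.snoc hlink
  have hwf : (c₁ ++ (E₀ ++ (M' ++ [y])) :: (x :: D) :: G).flatten =
      (c₁ ++ [E₀ ++ (M' ++ [y])] ++ [[x]]).flatten ++ (D ++ G.flatten) := by simp
  have hlen : (c₁ ++ [E₀ ++ (M' ++ [y])] ++ [[x]]).flatten.length =
      (c₁.flatten ++ E₀ ++ M').length + 2 := by
    grind
  -- The rank behind `x` is the first uncovered one, so the pivot splits `x` off its block.
  have hunc : ∀ a c, MinClash (Rel N) (c₁ ++ (E₀ ++ (M' ++ [y])) :: (x :: D) :: G).flatten a c →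
      a < (c₁ ++ [E₀ ++ (M' ++ [y])] ++ [[x]]).flatten.length →
      (c₁ ++ [E₀ ++ (M' ++ [y])] ++ [[x]]).flatten.length ≤ c → False := by
    intro a c hac h1 h2
    rw [hlen] at h1 h2
    exact not_minClash_of_blocked (l₁ := c₁.flatten ++ E₀ ++ M') (y := y) (x := x)
      (l₂ := D ++ G.flatten) (by simp) hyx hbl hac h1 h2
  have hpiv := hpre'.piv_uncovered hwf (by simp [hD]) hunc
  have hnc : ¬ Covered (Rel N) (c₁ ++ (E₀ ++ (M' ++ [y])) :: (x :: D) :: G).flatten := by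
    refine (piv_le_of_uncovered (r := (c₁ ++ [E₀ ++ (M' ++ [y])] ++ [[x]]).flatten.length)
      (by rw [hlen]; omega) ?_ hunc).1
    rw [hwf, List.length_append]
    have := List.length_pos_of_ne_nil hD
    rw [List.length_append]; omega
  have hup : Up (Rel N) (c₁ ++ (E₀ ++ (M' ++ [y])) :: (x :: D) :: G)
      (c₁ ++ (E₀ ++ (M' ++ [y])) :: [x] :: D :: G) := by
    refine ⟨c₁ ++ [E₀ ++ (M' ++ [y])], [x], D, G, by simp, by simp, by simp, hD, ?_⟩
    rw [hpiv]
    simp; omega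
  refine ⟨hup, ⟨c₁, _, _, _, _, rfl, rfl, ?_, hG⟩, ?_, ?_⟩
  · grind
  · simp_all
  · intro s' hd hne hp
    -- An alive continuation in the same word exists only if all ranks are covered; so the word
    -- changes, and the hop is determined.
    by_cases hfl : s'.flatten = (c₁ ++ (E₀ ++ (M' ++ [y])) :: (x :: D) :: G).flatten
    · exact absurd (inword_cell hc hup hd hfl hne
        (hp.alive hσ.critical (hd.isCell (hup.isCell hc)))).1 hnc
    · exact HasPath.hop_eq hN hd (hup.isCell hc) hm hT (by rw [hσf]; simp) hG hp
        (by rw [hup.flatten]; exact hfl)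

/-- The hypotheses under which the letter `x` moves through the blocks `Ds` to the block
`E₀ ++ M`. -/
structure Corridor (N : A → A → Prop) (Q : List (List A)) (E₀ M : List A) (Ds : List (List A))
    (x : A) : Prop where
  reading : IsReading (Rel N) (Q ++ (E₀ ++ M) :: Ds)
  gt_first : ∀ y ∈ M, x < y
  gt : ∀ B ∈ Ds, ∀ y ∈ B, x < y ∧ ¬ N x y
  first_ne : M ≠ []
  pairwise : (E₀ ++ x :: M).Pairwise (Rel N)

theorem Corridor.dropLast {Q : List (List A)} {E₀ M : List A} {Ds : List (List A)} {B : List A}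
    {x : A} (h : Corridor N Q E₀ M (Ds ++ [B]) x) : Corridor N Q E₀ M Ds x := by
  refine ⟨?_, h.gt_first, fun C hC => h.gt C (by simp [hC]), h.first_ne, h.pairwise⟩
  have h1 := h.reading
  rcases List.eq_nil_or_concat Ds with rfl | ⟨Ds', C, rfl⟩
  · exact IsReading.cPrefix (post := [B]) (by simpa using h1)
  · have : IsReading (Rel N) ((Q ++ (E₀ ++ M) :: Ds') ++ C :: [B]) := by simpa using h1
    have := this.cPrefix
    simpa using isReading_snoc.2 this

/-- The pivot releases `x` from the head of its block, the next downward step sorts it into the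
preceding block, and it becomes the head there. Repeating this is forced until `x` stands in the
first block of the corridor. -/
theorem Corridor.step (hN : Symmetric N) {σ Q : List (List A)} {E₀ M : List A} {Ds : List (List A)}
    {x : A} (hσ : IsReading (Rel N) σ) :
    ∀ (D : List A) (G : List (List A)), Corridor N Q E₀ M Ds x → D ≠ [] →
      (∀ y ∈ D, Rel N x y) → IsCell (Rel N) (Q ++ (E₀ ++ M) :: (Ds ++ (x :: D) :: G)) →
      Blocked (Rel N) x (D ++ G.flatten) →
      σ.flatten = Q.flatten ++ E₀ ++ x :: (M ++ Ds.flatten ++ D ++ G.flatten) →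
      (UniquePath (Rel N) σ (Q ++ (E₀ ++ x :: M) :: (Ds ++ D :: G)) →
        UniquePath (Rel N) σ (Q ++ (E₀ ++ M) :: (Ds ++ (x :: D) :: G))) ∧
      (HasPath (Rel N) σ (Q ++ (E₀ ++ M) :: (Ds ++ (x :: D) :: G)) →
        HasPath (Rel N) σ (Q ++ (E₀ ++ x :: M) :: (Ds ++ D :: G))) := by
  induction Ds using List.reverseRecOn with
  | nil =>
    intro D G h hD hDx hc hbl hσf
    obtain ⟨hup, hd, hne, hu⟩ := hop_step hN hσ (isReading_snoc.1 h.reading) hc hD h.first_ne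
      h.gt_first (α := Q.flatten ++ E₀) (m := M) h.gt_first (by simp) (by rw [hσf]; simp)
      h.pairwise hbl
    refine ⟨fun h1 => UniquePath.step hσ.critical hc hup hd hne h1 hu, fun hp => ?_⟩
    obtain ⟨s', hd', hne', hp'⟩ := hp.of_up hσ.critical hc hup
    rw [hu s' hd' hne' hp'] at hp'
    exact hp'
  | append_singleton Ds B ih =>
    intro D G h hD hDx hc hbl hσf
    have hBgt := h.gt B (by simp)
    have hBc := hc B (by simp)
    have hpre : CPrefix (Rel N) (Q ++ (E₀ ++ M) :: Ds) ([] ++ B) := by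
      have := h.reading
      rw [← List.cons_append, ← List.append_assoc] at this
      exact this
    have hgt : ∀ y ∈ M ++ (Ds ++ [B]).flatten, x < y := by
      intro y hy
      rcases List.mem_append.1 hy with hy | hy
      · exact h.gt_first y hy
      · obtain ⟨C, hC, hy⟩ := List.mem_flatten.1 hy
        exact (h.gt C hC y hy).1
    have hxB : (x :: B).Pairwise (Rel N) :=
      List.pairwise_cons.2 ⟨fun y hy => ⟨(hBgt y hy).1.le, (hBgt y hy).2⟩, hBc.2⟩
    have e : Q ++ (E₀ ++ M) :: (Ds ++ [B] ++ (x :: D) :: G) =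
        (Q ++ (E₀ ++ M) :: Ds) ++ ([] ++ B) :: (x :: D) :: G := by simp
    rw [e] at hc ⊢
    obtain ⟨hup, hd, hne, hu⟩ := hop_step hN hσ hpre hc hD hBc.1 (fun y hy => (hBgt y hy).1)
      (α := Q.flatten ++ E₀) (m := M ++ (Ds ++ [B]).flatten) hgt (by simp) (by simp [hσf])
      hxB hbl
    have hc1 := hd.isCell (hup.isCell hc)
    have e1 : (Q ++ (E₀ ++ M) :: Ds) ++ ([] ++ x :: B) :: D :: G =
      Q ++ (E₀ ++ M) :: (Ds ++ (x :: B) :: (D :: G)) := by simp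
    have e2 : Q ++ (E₀ ++ x :: M) :: (Ds ++ [B] ++ D :: G) =
      Q ++ (E₀ ++ x :: M) :: (Ds ++ B :: (D :: G)) := by simp
    obtain ⟨i1, i2⟩ := ih B (D :: G) h.dropLast hBc.1
      (fun y hy => ⟨(hBgt y hy).1.le, (hBgt y hy).2⟩) (by rw [← e1]; exact hc1)
      (Blocked.append (by simpa using hbl) fun y hy => ⟨(hBgt y hy).1.le, (hBgt y hy).2⟩)
      (by rw [hσf]; simp)
    rw [e2]
    refine ⟨fun h1 => UniquePath.step hσ.critical hc hup hd hne (by rw [e1]; exact i1 h1) hu,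
      fun hp => i2 ?_⟩
    obtain ⟨s', hd', hne', hp'⟩ := hp.of_up hσ.critical hc hup
    rw [hu s' hd' hne' hp', e1] at hp'
    exact hp'

end Hopping

/-! ### Cells from which the target cannot be reached. -/

section Dead
variable {A : Type*} [LinearOrder A] {N : A → A → Prop}

omit [LinearOrder A] in
theorem IsReading.tile_mem {R : A → A → Prop} {σ pre₁ pre₂ : List (List A)} {B : List A}
    (hσ : IsReading R σ)
    (he : σ = pre₁ ++ B :: pre₂) (hne : pre₁ ≠ []) :
    Ico pre₁.flatten.length (pre₁.flatten.length + B.length) ∈ jList R σ.flatten := by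
  rcases List.eq_nil_or_concat pre₁ with rfl | ⟨pre, P, rfl⟩
  · exact absurd rfl hne
  · rw [List.concat_eq_append] at *
    have h1 : CPrefix R (pre ++ [P]) B := by rw [he] at hσ; exact hσ.cPrefix
    obtain ⟨h2, h3⟩ := h1.of_snoc
    obtain ⟨L₁, L₂, hL, -⟩ := h2.next_link h3 (w := σ.flatten) (rest := pre₂.flatten)
      (by rw [he]; simp) (S := cuts (pre ++ [P]))
      (by simpa using goodOn_cuts (bs := pre ++ [P]) (cs := []) (by simpa using h2.isCell.ne_nil))
    rw [hL]; simp

/-- A step inside the word removes a rank only from a truncated interval that the cell meets once. A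
tile met twice therefore keeps both ranks for ever, whereas the target has a single rank in it. -/
theorem not_hasPath_of_two (hN : Symmetric N) {σ pre₁ pre₂ : List (List A)} {B : List A}
    (hσ : IsReading (Rel N) σ) (he : σ = pre₁ ++ B :: pre₂) (hne : pre₁ ≠ []) {r : ℕ}
    (hr : pre₁.flatten.length < r) (hr' : r < pre₁.flatten.length + B.length)
    {s : List (List A)} (hc : IsCell (Rel N) s) (hs : s.flatten = σ.flatten)
    (h1 : pre₁.flatten.length ∈ cuts s) (h2 : r ∈ cuts s) : ¬ HasPath (Rel N) σ s := by
  rintro ⟨p, hp⟩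
  have hF := hσ.tile_mem he hne
  induction hp with
  | nil =>
    have := goodOn_cuts (bs := σ) (cs := []) (by simpa using hσ.isCell.ne_nil) pre₁ B pre₂ he hne
    rw [List.append_nil] at this
    have h3 : r ∈ cuts σ ∩ Ico pre₁.flatten.length (pre₁.flatten.length + B.length) :=
      mem_inter.2 ⟨h2, mem_Ico.2 ⟨hr.le, hr'⟩⟩
    rw [this, mem_singleton] at h3
    omega
  | @cons s T s' p hup hd hne' hp ih =>
    have hc' := hd.isCell (hup.isCell hc)
    have hpath : HasPath (Rel N) σ s' := ⟨p, hp⟩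
    have hfl : s'.flatten = s.flatten := by
      rw [hs]
      refine Dom.antisymm (hpath.dom hN) ?_
      rw [← hs, ← hup.flatten]
      exact hd.dom hN
    obtain ⟨-, b, K, r', hb, hK, hlow, hKr, hrb, hcs⟩ := inword_cell hc hup hd hfl hne'
      (hpath.alive hσ.critical hc')
    have hKF : r' ∉ Ico pre₁.flatten.length (pre₁.flatten.length + B.length) := by
      intro hm
      have hr'K : r' ∈ K := by
        have : r' ∈ cuts s ∩ K := by rw [hKr]; simp
        exact (mem_inter.1 this).2
      obtain rfl := jList_eq_of_mem hK (by rw [hs]; exact hF) hr'K hm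
      have e1 : pre₁.flatten.length ∈ cuts s ∩
        Ico pre₁.flatten.length (pre₁.flatten.length + B.length) :=
        mem_inter.2 ⟨h1, mem_Ico.2 ⟨le_rfl, by omega⟩⟩
      have e2 : r ∈ cuts s ∩ Ico pre₁.flatten.length (pre₁.flatten.length + B.length) :=
        mem_inter.2 ⟨h2, mem_Ico.2 ⟨hr.le, hr'⟩⟩
      rw [hKr, mem_singleton] at e1 e2
      omega
    grind

/-- A step inside the word inserts a rank only into a truncated interval that the cell already
meets. An empty tile therefore stays empty, whereas the target has a rank in it. -/
theorem not_hasPath_of_empty (hN : Symmetric N) {σ pre₁ pre₂ : List (List A)} {B : List A}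
    (hσ : IsReading (Rel N) σ) (he : σ = pre₁ ++ B :: pre₂) (hne : pre₁ ≠ [])
    {s : List (List A)} (hc : IsCell (Rel N) s) (hs : s.flatten = σ.flatten)
    (h1 : cuts s ∩ Ico pre₁.flatten.length (pre₁.flatten.length + B.length) = ∅) :
    ¬ HasPath (Rel N) σ s := by
  rintro ⟨p, hp⟩
  have hF := hσ.tile_mem he hne
  have hB := List.length_pos_of_ne_nil (hσ.isCell B (by rw [he]; simp)).1
  induction hp with
  | nil =>
    have := goodOn_cuts (bs := σ) (cs := []) (by simpa using hσ.isCell.ne_nil) pre₁ B pre₂ he hne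
    rw [List.append_nil, h1] at this
    simp at this
  | @cons s T s' p hup hd hne' hp ih =>
    have hc' := hd.isCell (hup.isCell hc)
    have hpath : HasPath (Rel N) σ s' := ⟨p, hp⟩
    have hfl : s'.flatten = s.flatten := by
      rw [hs]
      refine Dom.antisymm (hpath.dom hN) ?_
      rw [← hs, ← hup.flatten]
      exact hd.dom hN
    obtain ⟨hcov, b, K, r', hb, hK, hlow, hKr, hrb, hcs⟩ := inword_cell hc hup hd hfl hne'
      (hpath.alive hσ.critical hc')
    refine ih hc' (hfl.trans hs) ?_
    rw [eq_empty_iff_forall_notMem]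
    intro t ht
    obtain ⟨ht1, ht2⟩ := mem_inter.1 ht
    rw [hcs, mem_erase, mem_insert] at ht1
    rcases ht1.2 with rfl | ht3
    · have htK : t ∈ K := lowest_subset K (by rw [hlow]; simp)
      obtain rfl := jList_eq_of_mem hK (by rw [hs]; exact hF) htK ht2
      simp_all
    · have : t ∈ cuts s ∩ Ico pre₁.flatten.length (pre₁.flatten.length + B.length) :=
        mem_inter.2 ⟨ht3, ht2⟩
      rw [h1] at this
      simp at this

end Dead

/-! ### Splitting tiles. -/

section Links
variable {A : Type*} {R : A → A → Prop}

theorem isCell_of_chain {P : List A} {m : List (List A)} (h : (P :: m).IsChain (Link R)) :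
    IsCell R m := by
  induction m generalizing P with
  | nil => intro B hB; simp at hB
  | cons C m ih =>
    rw [List.isChain_cons_cons] at h
    intro B hB
    rcases List.mem_cons.1 hB with rfl | hB
    · exact ⟨h.1.ne_nil, h.1.pairwise⟩
    · exact ih h.2 B hB

/-- Adding to the memory a part already read and compatible with `V` does not change where the tile
stops. -/
theorem Link.of_append {P U V : List A} (h : Link R P (U ++ V)) (hV : V ≠ []) :
    Link R (P ++ U) V := by
  obtain ⟨X, c, hX, hp, hg, y, hy, hyc⟩ := h
  rcases List.eq_nil_or_concat V with rfl | ⟨V', c', rfl⟩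
  · exact absurd rfl hV
  rw [List.concat_eq_append] at *
  rw [← List.append_assoc] at hX
  obtain ⟨rfl, h2⟩ := List.append_inj' hX rfl
  simp only [List.cons.injEq, and_true] at h2
  subst h2
  exact ⟨V', c', rfl, (List.pairwise_append.1 hp).2.1, by rwa [List.append_assoc], y, by simp [hy],
    hyc⟩

/-- The tile contains a letter clashing with `P`, so it cannot end within `D`. -/
theorem Link.exists_append {P D B r r' : List A} (h : Link R P B) (hp : (P ++ D).Pairwise R)
    (hf : D ++ r = B ++ r') : ∃ E, E ≠ [] ∧ B = D ++ E ∧ r = E ++ r' := by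
  have hlt : D.length < B.length := by
    by_contra hcon
    obtain ⟨X, c, rfl, _, _, y, hy, hyc⟩ := h
    have : X ++ [c] <+: D := List.prefix_of_prefix_length_le (l₃ := D ++ r)
      (by rw [hf]; simp) (by simp) (not_lt.1 hcon)
    exact hyc ((List.pairwise_append.1 hp).2.2 y hy c (this.subset (by simp)))
  obtain ⟨E, rfl⟩ : D <+: B := List.prefix_of_prefix_length_le (l₃ := D ++ r)
    (by simp) (by rw [hf]; simp) hlt.le
  rw [List.append_assoc] at hf
  refine ⟨E, ?_, rfl, List.append_cancel_left hf⟩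
  rintro rfl
  simp at hlt

theorem IsReading.chain {pre m : List (List A)} {P : List A} (h : IsReading R (pre ++ P :: m)) :
    (P :: m).IsChain (Link R) := (List.isChain_append.1 h.1).2.1

theorem IsReading.link {pre m : List (List A)} {P B : List A}
    (h : IsReading R (pre ++ P :: B :: m)) : Link R P B :=
  (List.isChain_cons_cons.1 h.chain).1

end Links

/-! ### Unique paths between critical cells whose words differ by one moved letter. -/

section Critical
variable {A : Type*} [LinearOrder A] {N : A → A → Prop}

/-- Alternating paths from the critical cell `τ` down to `σ`. -/
def CritPath (R : A → A → Prop) (τ σ : List (List A)) (q : List (List (List A))) : Prop :=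
  ∃ s p, q = τ :: p ∧ Down R τ s ∧ AltPath R σ s p

omit [LinearOrder A] in
theorem existsUnique_critPath {R : A → A → Prop} {τ σ s₁ : List (List A)} (hd : Down R τ s₁)
    (h₁ : UniquePath R σ s₁) (hu : ∀ s', Down R τ s' → HasPath R σ s' → s' = s₁) :
    ∃! q, CritPath R τ σ q := by
  obtain ⟨p, hp, hpu⟩ := h₁
  refine ⟨τ :: p, ⟨s₁, p, rfl, hd, hp⟩, ?_⟩
  rintro q ⟨s, p', rfl, hd', hp'⟩
  obtain rfl := hu s hd' ⟨_, hp'⟩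
  rw [hpu _ hp']

-- A critical cell loses the cell property when a rank is dropped inside its word
-- (`not_goodCell_erase_of_critical`), so every first step changes the word.
omit [LinearOrder A] in
theorem flatten_ne_of_critical {R : A → A → Prop} {τ s : List (List A)} (hτ : IsReading R τ)
    (hd : Down R τ s) : s.flatten ≠ τ.flatten := by
  intro hf
  obtain ⟨r, hr, hcs⟩ := hd.cuts_eq hτ.isCell.ne_nil
  have := (hd.isCell hτ.isCell).goodCell
  rw [hcs, hf] at this
  exact not_goodCell_erase_of_critical hτ.critical hr (cuts_subset hτ.isCell.ne_nil hr) this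

/-- Moving the letter `x` from a block of its own to the front of the corridor. -/
theorem Corridor.hop (hN : Symmetric N) {σ Q : List (List A)} {E₀ M : List A} {Ds : List (List A)}
    {x : A} (hσ : IsReading (Rel N) σ) (h : Corridor N Q E₀ M Ds x) {G : List (List A)}
    (hc : IsCell (Rel N) (Q ++ (E₀ ++ M) :: (Ds ++ [x] :: G)))
    (hbl : ∀ Ds' D, Ds = Ds' ++ [D] → Blocked (Rel N) x (D ++ G.flatten))
    (hσf : σ.flatten = Q.flatten ++ E₀ ++ x :: (M ++ Ds.flatten ++ G.flatten)) :
    ∃ s₁, Down (Rel N) (Q ++ (E₀ ++ M) :: (Ds ++ [x] :: G)) s₁ ∧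
      s₁.flatten ≠ (Q ++ (E₀ ++ M) :: (Ds ++ [x] :: G)).flatten ∧
      (UniquePath (Rel N) σ (Q ++ (E₀ ++ x :: M) :: (Ds ++ G)) → UniquePath (Rel N) σ s₁) ∧
      (HasPath (Rel N) σ s₁ → HasPath (Rel N) σ (Q ++ (E₀ ++ x :: M) :: (Ds ++ G))) ∧
      ∀ s', Down (Rel N) (Q ++ (E₀ ++ M) :: (Ds ++ [x] :: G)) s' →
        s'.flatten ≠ (Q ++ (E₀ ++ M) :: (Ds ++ [x] :: G)).flatten → HasPath (Rel N) σ s' →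
        s' = s₁ := by
  have hperm : ∀ E M : List A, (E ++ x :: M).Perm (E ++ M ++ [x]) := fun E M =>
    (List.perm_middle (a := x) (l₁ := E) (l₂ := M)).trans
      (List.perm_append_singleton x (E ++ M)).symm
  rcases List.eq_nil_or_concat Ds with rfl | ⟨Ds, D, rfl⟩
  · refine ⟨Q ++ (E₀ ++ x :: M) :: G, ⟨Q, E₀ ++ M, [x], G, _, by simp, rfl, hperm _ _, h.pairwise⟩,
      ?_, by simp, by simp, ?_⟩
    · intro heq
      simp only [List.flatten_append, List.flatten_cons, List.nil_append, List.append_assoc] at heq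
      have := List.append_cancel_left (List.append_cancel_left heq)
      obtain ⟨y, M', rfl⟩ := List.exists_cons_of_ne_nil h.first_ne
      simp only [List.cons_append, List.cons.injEq] at this
      exact (h.gt_first y (by simp)).ne this.1
    · intro s' hd hne hp
      exact HasPath.hop_eq hN hd hc (α := Q.flatten ++ E₀) (m := M) h.gt_first (by simp)
        (by rw [hσf]; simp) h.pairwise hp hne
  · rw [List.concat_eq_append] at *
    have hDgt := h.gt D (by simp)
    have e : Q ++ (E₀ ++ M) :: (Ds ++ [D] ++ [x] :: G) =
        (Q ++ (E₀ ++ M) :: Ds) ++ ([] ++ D) :: [x] :: G := by simp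
    have hDc := hc D (by simp)
    have hxD : ([] ++ x :: D).Pairwise (Rel N) :=
      List.pairwise_cons.2 ⟨fun y hy => ⟨(hDgt y hy).1.le, (hDgt y hy).2⟩, hDc.2⟩
    have hgt : ∀ y ∈ M ++ (Ds ++ [D]).flatten, x < y := by
      intro y hy
      rcases List.mem_append.1 hy with hy | hy
      · exact h.gt_first y hy
      · obtain ⟨C, hC, hy⟩ := List.mem_flatten.1 hy
        exact (h.gt C hC y hy).1
    -- The first hop makes `x` the head of the last corridor block; from there `Corridor.step` takes
    -- over.
    have hd1 : Down (Rel N) (Q ++ (E₀ ++ M) :: (Ds ++ [D] ++ [x] :: G))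
        (Q ++ (E₀ ++ M) :: (Ds ++ (x :: D) :: G)) :=
      ⟨Q ++ (E₀ ++ M) :: Ds, D, [x], G, x :: D, by simp, by simp, hperm [] D, hxD⟩
    have hc1 := hd1.isCell hc
    obtain ⟨i1, i2⟩ := Corridor.step hN hσ D G h.dropLast hDc.1
      (fun y hy => ⟨(hDgt y hy).1.le, (hDgt y hy).2⟩) hc1 (hbl Ds D rfl) (by rw [hσf]; simp)
    refine ⟨Q ++ (E₀ ++ M) :: (Ds ++ (x :: D) :: G), hd1, ?_, by simpa using i1, by simpa using i2, ?_⟩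
    · intro heq
      simp only [List.flatten_append, List.flatten_cons, List.flatten_nil, List.append_nil,
        List.append_assoc] at heq
      have := List.append_cancel_left (List.append_cancel_left (List.append_cancel_left
        (List.append_cancel_left heq)))
      obtain ⟨y, D', rfl⟩ := List.exists_cons_of_ne_nil hDc.1
      simp only [List.cons_append, List.cons.injEq] at this
      exact (hDgt y (by simp)).1.ne this.1
    · intro s' hd hne hp
      rw [e] at hd hc hne
      have := HasPath.hop_eq hN hd hc (α := Q.flatten ++ E₀) (m := M ++ (Ds ++ [D]).flatten) hgt
        (by simp) (by simp [hσf]) hxD hp hne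
      rw [this]; simp

theorem Corridor.existsUnique (hN : Symmetric N) {σ Q : List (List A)} {E₀ M : List A}
    {Ds : List (List A)} {x : A} (hσ : IsReading (Rel N) σ) (h : Corridor N Q E₀ M Ds x)
    {G : List (List A)} (hτ : IsReading (Rel N) (Q ++ (E₀ ++ M) :: (Ds ++ [x] :: G)))
    (hbl : ∀ Ds' D, Ds = Ds' ++ [D] → Blocked (Rel N) x (D ++ G.flatten))
    (hσf : σ.flatten = Q.flatten ++ E₀ ++ x :: (M ++ Ds.flatten ++ G.flatten))
    (h₁ : UniquePath (Rel N) σ (Q ++ (E₀ ++ x :: M) :: (Ds ++ G))) :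
    ∃! q, CritPath (Rel N) (Q ++ (E₀ ++ M) :: (Ds ++ [x] :: G)) σ q := by
  obtain ⟨s₁, hd, -, hu, -, ho⟩ := h.hop hN hσ hτ.isCell hbl hσf
  exact existsUnique_critPath hd (hu h₁) fun s' hd' hp =>
    ho s' hd' (flatten_ne_of_critical hτ hd') hp

/-- The two readings have the same tail. -/
theorem Corridor.existsUnique_same_tail (hN : Symmetric N) {Q : List (List A)} {E₀ M : List A}
    {Ds : List (List A)} {x : A} (h : Corridor N Q E₀ M Ds x) {G : List (List A)}
    (hτ : IsReading (Rel N) (Q ++ (E₀ ++ M) :: (Ds ++ [x] :: G)))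
    (hσ : IsReading (Rel N) (Q ++ (E₀ ++ x :: M) :: (Ds ++ G)))
    (hbl : ∀ Ds' D, Ds = Ds' ++ [D] → Blocked (Rel N) x (D ++ G.flatten)) :
    ∃! q, CritPath (Rel N) (Q ++ (E₀ ++ M) :: (Ds ++ [x] :: G))
      (Q ++ (E₀ ++ x :: M) :: (Ds ++ G)) q :=
  h.existsUnique hN hσ hτ hbl (by simp) (uniquePath_self hσ.critical)

/-- The letter hops over `Y`. Now the word is that of the target: `Y` is split off from `x` and
flows into `Z`, and `uniquePath_merge` handles the remaining tiles. -/
theorem existsUnique_last_to_middle (hN : Symmetric N) {pre mA mB : List (List A)} {P Y Z : List A}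
    {x : A} (hτ : IsReading (Rel N) (pre ++ P :: Y :: [x] :: Z :: mA))
    (hσ : IsReading (Rel N) (pre ++ P :: [x] :: (Y ++ Z) :: mB))
    (hY : ∀ y ∈ Y, x < y ∧ ¬ N x y) (hf : mA.flatten = mB.flatten) :
    ∃! q, CritPath (Rel N) (pre ++ P :: Y :: [x] :: Z :: mA)
      (pre ++ P :: [x] :: (Y ++ Z) :: mB) q := by
  have hYc := hτ.isCell Y (by simp)
  have hZc := hτ.isCell Z (by simp)
  have hxY : ([] ++ x :: Y).Pairwise (Rel N) :=
      List.pairwise_cons.2 ⟨fun y hy => ⟨(hY y hy).1.le, (hY y hy).2⟩, hYc.2⟩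
  have e : pre ++ P :: Y :: [x] :: Z :: mA = (pre ++ [P]) ++ ([] ++ Y) :: [x] :: Z :: mA := by simp
  have hd : Down (Rel N) (pre ++ P :: Y :: [x] :: Z :: mA) (pre ++ P :: ([x] ++ Y) :: Z :: mA) :=
    ⟨pre ++ [P], Y, [x], Z :: mA, [x] ++ Y, by simp, by simp,
      (List.perm_append_singleton x Y).symm, hxY⟩
  have hsf : (pre ++ P :: ([x] ++ Y) :: Z :: mA).flatten =
      (pre ++ P :: [x] :: (Y ++ Z) :: mB).flatten := by simp [hf]
  refine existsUnique_critPath (s₁ := pre ++ P :: ([x] ++ Y) :: Z :: mA) hd ?_ ?_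
  · have hP1 : IsReading (Rel N) (pre ++ P :: ([x] :: (Y ++ Z) :: mB)) := hσ
    have hP2 : IsReading (Rel N) ((pre ++ [P]) ++ [x] :: (Y ++ Z) :: mB) := by simpa using hσ
    refine UniquePath.flow hN hσ hP1.cPrefix hP1.link hP2.link (rest := mB.flatten)
      (hd.isCell hτ.isCell) hsf (by simp [hf]) hYc.1 (hσ.isCell (Y ++ Z) (by simp)).2 ?_
    have := uniquePath_merge hN hσ mB mA (pre ++ [P, [x]]) Y Z (by simp) ?_ hf
    · simpa using this
    · have h3 : IsReading (Rel N) ((pre ++ [P, Y, [x]]) ++ Z :: mA) := by simpa using hτ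
      exact h3.chain
  · intro s' hd' hp
    have hne := flatten_ne_of_critical hτ hd'
    rw [e] at hd' hne
    have hc := hτ.isCell
    rw [e] at hc
    have := HasPath.hop_eq hN hd' hc (α := (pre ++ [P]).flatten) (m := Y) (fun y hy => (hY y hy).1)
      (by simp) (by simp [hf]) hxY hp hne
    rw [this]; simp

/-- The letter hops through the whole corridor, which brings the path into the word of the target.
There the surplus `Z` of the block `Y ++ Z` flows into the next block, and `uniquePath_merge`
finishes. -/
theorem Corridor.existsUnique_middle_to_front (hN : Symmetric N) {Q : List (List A)} {E₀ M : List A}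
    {Ds : List (List A)} {x : A} (h : Corridor N Q E₀ M Ds x) {Y Z : List A}
    {m₂ m₃ : List (List A)}
    (hτ : IsReading (Rel N) (Q ++ (E₀ ++ M) :: (Ds ++ [x] :: (Y ++ Z) :: m₂)))
    (hσ : IsReading (Rel N) (Q ++ (E₀ ++ x :: M) :: (Ds ++ Y :: m₃))) (hZ : Z ≠ [])
    (hf : m₃.flatten = Z ++ m₂.flatten)
    (hbl : ∀ Ds' D, Ds = Ds' ++ [D] → Blocked (Rel N) x (D ++ Y ++ Z ++ m₂.flatten)) :
    ∃! q, CritPath (Rel N) (Q ++ (E₀ ++ M) :: (Ds ++ [x] :: (Y ++ Z) :: m₂))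
      (Q ++ (E₀ ++ x :: M) :: (Ds ++ Y :: m₃)) q := by
  refine h.existsUnique hN hσ hτ (by simpa using hbl) (by simp [hf]) ?_
  obtain ⟨pre, P, hpP⟩ : ∃ pre P, Q ++ (E₀ ++ x :: M) :: Ds = pre ++ [P] := by
    rcases List.eq_nil_or_concat (Q ++ (E₀ ++ x :: M) :: Ds) with h | ⟨pre, P, h⟩
    · simp at h
    · exact ⟨pre, P, by simpa using h⟩
  have e : ∀ G, Q ++ (E₀ ++ x :: M) :: (Ds ++ G) = pre ++ P :: G := by
    grind
  rw [e] at hσ ⊢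
  have hYZ := hτ.isCell (Y ++ Z) (by simp)
  cases m₃ with
  | nil => simp at hf; exact absurd hf.1 hZ
  | cons B m₃ =>
    have hσ2 : IsReading (Rel N) ((pre ++ [P]) ++ Y :: B :: m₃) := by simpa using hσ
    have hτ2 : IsReading (Rel N) ((Q ++ (E₀ ++ M) :: (Ds ++ [[x]])) ++ (Y ++ Z) :: m₂) := by
      simpa using hτ
    obtain ⟨E, hE, rfl, hf2⟩ := hσ2.link.exists_append hYZ.2 (r := m₂.flatten) (r' := m₃.flatten)
      (by rw [← hf]; simp)
    have hl := hσ2.link.of_append hE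
    cases m₂ with
    | nil => simp at hf2; exact absurd hf2.1 hE
    | cons U m₂ =>
      obtain ⟨rfl, hf3⟩ := hτ2.link.unique hl (by simpa using hf2)
      rw [e]
      refine UniquePath.flow hN hσ hσ.cPrefix hσ.link hσ2.link (rest := m₃.flatten) ?_ ?_
        (by simp [hf3]) hZ (hσ.isCell (Z ++ U) (by simp)).2 ?_
      · have h1 := hσ.isCell
        have h2 := hτ2.isCell
        intro B hB
        simp only [List.mem_append, List.mem_cons] at hB
        rcases hB with hB | rfl | rfl | rfl | hB
        · exact h1 B (by simp [hB])
        · exact h1 B (by simp)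
        · exact hYZ
        · exact h2 B (by simp)
        · exact h2 B (by simp [hB])
      · simp [hf3]
      · have := uniquePath_merge hN hσ m₃ m₂ (pre ++ [P, Y]) Z U (by simp)
          (List.isChain_cons_cons.1 hτ2.chain).2 hf3
        simpa using this

end Critical

/-! ### Initial parts that a path preserves. -/

section RunTiles
variable {A : Type*} {R : A → A → Prop}

theorem JRun.eq_nil_of_pairwise {w l₁ P : List A} {b : ℕ} {L : List (Finset ℕ)} (hP : P.Pairwise R)
    (hw : w = l₁ ++ P) (h : JRun (MinClash R w) l₁.length b L) : L = [] := by
  cases h with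
  | nil _ => rfl
  | cons hac hm _ _ _ =>
    refine absurd hac.1 (not_clash_of_pairwise (l₂ := []) (by simpa using hw) hP hm ?_)
    have := hac.1.lt_length
    rw [hw, List.length_append] at this
    exact this

/-- The truncated intervals from a block onwards, if the rest of the word is read off from it. -/
theorem JRun.tiles {bs : List (List A)} : ∀ {P l₁ w : List A} {L : List (Finset ℕ)},
    (P :: bs).IsChain (Link R) → P.Pairwise R → P ≠ [] → w = l₁ ++ P ++ bs.flatten →
    JRun (MinClash R w) l₁.length (l₁.length + P.length - 1) L →
    ∀ K ∈ L, ∃ b₁ B b₂, bs = b₁ ++ B :: b₂ ∧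
      K = Ico (l₁.length + P.length + b₁.flatten.length)
        (l₁.length + P.length + b₁.flatten.length + B.length) := by
  induction bs with
  | nil =>
    intro P l₁ w L _ hP _ hw h K hK
    rw [h.eq_nil_of_pairwise hP (by simpa using hw)] at hK
    simp at hK
  | cons B bs ih =>
    intro P l₁ w L hch hP hP0 hw h K hK
    rw [List.isChain_cons_cons] at hch
    obtain ⟨a, hmin, hle, hlt, hleast⟩ := hch.1.minClash (w := w) (l₁ := l₁) (rest := bs.flatten)
      (by simp [hw])
    obtain ⟨L', rfl, hlt', hrun'⟩ := h.next (intervalSystem_minClash w) hmin hle hleast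
    have hP0' := List.length_pos_of_ne_nil hP0
    have hB0' := List.length_pos_of_ne_nil hch.1.ne_nil
    rcases List.mem_cons.1 hK with rfl | hK
    · refine ⟨[], B, bs, rfl, ?_⟩
      ext r
      simp only [mem_Ioc, mem_Ico, List.flatten_nil, List.length_nil]
      omega
    · have hmax : max a (l₁.length + P.length - 1) + 1 = (l₁ ++ P).length := by
        rw [List.length_append]; omega
      rw [hmax] at hrun'
      obtain ⟨b₁, C, b₂, rfl, rfl⟩ := ih (l₁ := l₁ ++ P) (w := w) (L := L') hch.2 hch.1.pairwise hch.1.ne_nil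
        (by simp [hw]) (by rw [List.length_append]; rwa [List.length_append] at hrun') K hK
      refine ⟨B :: b₁, C, b₂, rfl, ?_⟩
      simp only [List.length_append, List.flatten_cons]
      congr 1 <;> omega

theorem mem_cuts_append_self {pre cs : List (List A)} (hpre : pre ≠ []) (hcs : cs ≠ []) :
    pre.flatten.length ∈ cuts (pre ++ cs) := by
  rw [cuts_append hpre]
  exact mem_union_right _ (mem_starts_self hcs)

/-- Equality of cuts up to the end of `base` forces the same blocks there; it is how steps further
to the right are seen to leave `base` alone. -/
theorem eq_append_of_cuts {base G T : List (List A)} (hb : ∀ B ∈ base ++ G, B ≠ [])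
    (hbase : base ≠ []) (hG : G ≠ []) (hT : ∀ B ∈ T, B ≠ [])
    (hf : T.flatten = (base ++ G).flatten)
    (hc : ∀ r ≤ base.flatten.length, r ∈ cuts T ↔ r ∈ cuts (base ++ G)) :
    ∃ G', G' ≠ [] ∧ T = base ++ G' := by
  have he : base.flatten.length ∈ cuts T := (hc _ le_rfl).2 (mem_cuts_append_self hbase hG)
  obtain ⟨b₁, D, D', b₂, rfl, hr⟩ := cuts_split he
  refine ⟨D' :: b₂, by simp, ?_⟩
  have e : b₁ ++ D :: D' :: b₂ = (b₁ ++ [D]) ++ (D' :: b₂) := by simp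
  rw [e] at hf hc hT ⊢
  have hl : (b₁ ++ [D]).flatten.length = base.flatten.length := by
    rw [hr]; simp
  have hfl : (b₁ ++ [D]).flatten = base.flatten := by
    rw [List.flatten_append (L₁ := b₁ ++ [D]), List.flatten_append (L₁ := base)] at hf
    exact (List.append_inj hf hl).1
  suffices h : b₁ ++ [D] = base by rw [h]
  refine eq_of_cuts (fun B hB => hT B (List.mem_append_left _ hB))
    (fun B hB => hb B (List.mem_append_left _ hB)) hfl ?_
  have h1 : ∀ B ∈ b₁ ++ [D], B ≠ [] := fun B hB => hT B (List.mem_append_left _ hB)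
  have h2 : ∀ B ∈ base, B ≠ [] := fun B hB => hb B (List.mem_append_left _ hB)
  ext t
  rw [cuts_append (by simp), cuts_append hbase, hl] at hc
  constructor
  · intro ht
    have hlt := (lt_of_mem_cuts h1 ht).2
    have := (hc t (by omega)).1 (mem_union_left _ ht)
    refine (mem_union.1 this).resolve_right fun h => ?_
    have := le_of_mem_starts h
    omega
  · intro ht
    have hlt := (lt_of_mem_cuts h2 ht).2
    have := (hc t (by omega)).2 (mem_union_left _ ht)
    refine (mem_union.1 this).resolve_right fun h => ?_
    have := le_of_mem_starts h
    omega

/-- A new rank is added behind the part on which the cell is good. -/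
theorem CPrefix.le_of_mem_piv {pre G : List (List A)} {P : List A} (h : CPrefix R pre P)
    (hc : IsCell R (pre ++ P :: G)) (hcov : Covered R (pre ++ P :: G).flatten) {b : ℕ}
    (hb : b ∈ piv R (pre ++ P :: G).flatten (cuts (pre ++ P :: G))) :
    (pre ++ [P]).flatten.length ≤ b := by
  by_contra hlt
  have hb0 := (mem_Ioo.1 (piv_subset _ _ hb)).1
  have e : pre ++ P :: G = (pre ++ [P]) ++ G := by simp
  obtain ⟨L₁, L₂, hL, -, hmem⟩ := h.tiles (w := (pre ++ P :: G).flatten) (rest := G.flatten)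
    (by rw [e]; simp)
  obtain ⟨pre₁, B, pre₂, he, hne, hbB⟩ := exists_tile h.2 hb0 (not_le.1 hlt)
  have hK0 : Ico pre₁.flatten.length (pre₁.flatten.length + B.length) ∈
      jList R (pre ++ P :: G).flatten := by
    grind
  have hgood := goodOn_cuts (bs := pre ++ [P]) (cs := G) (by rw [← e]; exact hc.ne_nil) pre₁ B pre₂
    he hne
  rw [← e] at hgood
  rcases exists_first_bad (jList R (pre ++ P :: G).flatten) (cuts (pre ++ P :: G)) with
    h1 | ⟨M₁, K, M₂, hM, h1, hK⟩
  · rw [piv_all_good hcov h1] at hb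
    exact (mem_sdiff.1 (lowest_subset _ hb)).2 (mem_support.2 ⟨_, hK0, hbB⟩)
  · rw [piv_first_bad hcov hM h1 hK] at hb
    obtain rfl := jList_eq_of_mem (K := K) (by rw [hM]; simp) hK0 (lowest_subset _ hb) hbB
    apply hK
    have := mem_Ico.1 hbB
    rw [hgood, lowest_Ico (by omega)]

/-- With everything covered, the pivot is either the least rank of a truncated interval or outside
all of them, and these intervals are disjoint. -/
theorem mem_lowest_of_mem_piv {w : List A} {S K : Finset ℕ} {b : ℕ} (hcov : Covered R w)
    (hK : K ∈ jList R w) (hbK : b ∈ K) (hb : b ∈ piv R w S) : b ∈ lowest K := by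
  rcases exists_first_bad (jList R w) S with h1 | ⟨M₁, K', M₂, hM, h1, hK'⟩
  · rw [piv_all_good hcov h1] at hb
    exact absurd (mem_support.2 ⟨_, hK, hbK⟩) (mem_sdiff.1 (lowest_subset _ hb)).2
  · rw [piv_first_bad hcov hM h1 hK'] at hb
    rwa [jList_eq_of_mem hK (K' := K') (by rw [hM]; simp) hbK (lowest_subset _ hb)]

end RunTiles

/-! ### Dead cells before the letter has hopped. -/

section DeadCorridor
variable {A : Type*} [LinearOrder A] {N : A → A → Prop}

/-- A cell without ranks in a given tile of the target, lying in a word where no rank of this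
tile is ever added. -/
theorem Corridor.not_hasPath (hN : Symmetric N) {σ Q : List (List A)} {E₀ M : List A}
    {Ds : List (List A)} {x : A} (hσ : IsReading (Rel N) σ) (h : Corridor N Q E₀ M Ds x)
    {tl : List A}
    (hbl : ∀ Ds' D, Ds = Ds' ++ [D] → Blocked (Rel N) x (D ++ tl))
    (hσf : σ.flatten = Q.flatten ++ E₀ ++ x :: (M ++ Ds.flatten ++ tl))
    (hpre : CPrefix (Rel N) (Q ++ (E₀ ++ M) :: Ds) [x]) {w : List A}
    (hw : w = (Q ++ (E₀ ++ M) :: Ds).flatten ++ x :: tl) (hcov : Covered (Rel N) w)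
    {pre₁ pre₂ : List (List A)} {E : List A} (he : σ = pre₁ ++ E :: pre₂) (hne : pre₁ ≠ [])
    {K : Finset ℕ} (hK : K ∈ jList (Rel N) w)
    (hKE : Ico pre₁.flatten.length (pre₁.flatten.length + E.length) ⊆ K) {k : ℕ}
    (hlow : lowest K = {k}) (hk : k < pre₁.flatten.length)
    (hlen : (Q ++ (E₀ ++ M) :: Ds).flatten.length < pre₁.flatten.length)
    {s G : List (List A)} (hc : IsCell (Rel N) s) (hs : s = Q ++ (E₀ ++ M) :: (Ds ++ [x] :: G))
    (hsw : s.flatten = w)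
    (h1 : cuts s ∩ Ico pre₁.flatten.length (pre₁.flatten.length + E.length) = ∅) :
    ¬ HasPath (Rel N) σ s := by
  have hwσ : σ.flatten ≠ w := by
    intro heq
    rw [hσf, hw] at heq
    simp only [List.flatten_append, List.flatten_cons, List.append_assoc] at heq
    have := List.append_cancel_left (List.append_cancel_left heq)
    obtain ⟨y, M', rfl⟩ := List.exists_cons_of_ne_nil h.first_ne
    simp only [List.cons_append, List.cons.injEq] at this
    exact (h.gt_first y (by simp)).ne this.1
  have hpl : (Q ++ (E₀ ++ M) :: Ds ++ [[x]]).flatten.length =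
      (Q ++ (E₀ ++ M) :: Ds).flatten.length + 1 := by
    rw [List.flatten_append, List.length_append]; simp
  rintro ⟨p, hp⟩
  induction hp generalizing G with
  | nil => exact hwσ hsw
  | @cons s T s' p hup hd hne' hp ih =>
    have hcT := hup.isCell hc
    have hc' := hd.isCell hcT
    have hpath : HasPath (Rel N) σ s' := ⟨p, hp⟩
    obtain ⟨b, hb, hbs, hcutT⟩ := hup.cuts_eq hc.ne_nil
    have hG0 : G ≠ [] := by
      rintro rfl
      have h2 : tl = [] := by
        rw [hs, hw] at hsw
        simpa using hsw
      have h3 := congrArg List.length hσf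
      rw [he, h2] at h3
      simp only [List.flatten_append, List.flatten_cons, List.length_append, List.length_cons,
        List.length_nil] at h3 hlen
      have := List.length_pos_of_ne_nil (hσ.isCell E (by rw [he]; simp)).1
      omega
    have e : s = (Q ++ (E₀ ++ M) :: Ds ++ [[x]]) ++ G := by rw [hs]; simp
    have e' : s = (Q ++ (E₀ ++ M) :: Ds) ++ [x] :: G := by rw [hs]; simp
    have hbge : (Q ++ (E₀ ++ M) :: Ds ++ [[x]]).flatten.length < b := by
      have h2 : (Q ++ (E₀ ++ M) :: Ds ++ [[x]]).flatten.length ≤ b := by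
        refine hpre.le_of_mem_piv (G := G) (by rw [← e']; exact hc) ?_ (by rw [← e']; exact hb)
        rw [← e', hsw]; exact hcov
      refine lt_of_le_of_ne h2 ?_
      rintro rfl
      apply hbs
      rw [e]
      exact mem_cuts_append_self (by simp) hG0
    -- The tile lies in `K`, and a pivot in `K` is its least rank `k`, which comes before the tile.
    have hbR : b ∉ Ico pre₁.flatten.length (pre₁.flatten.length + E.length) := by
      intro hm
      have := mem_lowest_of_mem_piv hcov hK (hKE hm) (hsw ▸ hb)
      grind
    have hTR : cuts T ∩ Ico pre₁.flatten.length (pre₁.flatten.length + E.length) = ∅ := by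
      rw [hcutT, insert_inter_of_notMem hbR, h1]
    obtain ⟨GT, hGT, hTe⟩ := eq_append_of_cuts (base := Q ++ (E₀ ++ M) :: Ds ++ [[x]]) (G := G)
      (T := T) (by rw [← e]; exact hc.ne_nil) (by simp) hG0 hcT.ne_nil (by rw [hup.flatten, e])
      (by
        intro r hr
        rw [hcutT, mem_insert, ← e]
        constructor
        · rintro (rfl | h2)
          · omega
          · exact h2
        · exact Or.inr)
    -- Inside the word the step removes a rank not before `b`, hence behind the base, so the base
    -- survives and the tile stays empty. Leaving the word means hopping to the front, where the
    -- empty tile is dead by `not_hasPath_of_empty`.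
    by_cases hfl : s'.flatten = s.flatten
    · obtain ⟨-, b', K', r, hb', hK', hlow', hKr, hrb, hcs'⟩ := inword_cell hc hup hd hfl hne'
        (hpath.alive hσ.critical hc')
      obtain rfl := eq_of_mem_piv hb hb'
      have hrK : r ∈ K' := by
        have : r ∈ cuts s ∩ K' := by rw [hKr]; simp
        exact (mem_inter.1 this).2
      have hbr : b ≤ r := by
        have : b ∈ lowest K' := by rw [hlow']; simp
        exact (mem_filter.1 this).2 r hrK
      obtain ⟨G', hG', hse⟩ := eq_append_of_cuts (base := Q ++ (E₀ ++ M) :: Ds ++ [[x]]) (G := G)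
        (T := s') (by rw [← e]; exact hc.ne_nil) (by simp) hG0 hc'.ne_nil (by rw [hfl, e])
        (by
          intro t ht
          rw [hcs', mem_erase, mem_insert, ← e]
          constructor
          · rintro ⟨-, rfl | h2⟩
            · omega
            · exact h2
          · exact fun h2 => ⟨by omega, Or.inr h2⟩)
      grind
    · have hTe' : T = Q ++ (E₀ ++ M) :: (Ds ++ [x] :: GT) := by rw [hTe]; simp
      have hGTf : GT.flatten = tl := by
        have h2 : T.flatten = w := by rw [hup.flatten, hsw]
        rw [hTe', hw] at h2
        simpa using h2
      rw [hTe'] at hd hcT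
      obtain ⟨s₁, -, -, -, hp₁, hu⟩ := h.hop hN hσ hcT (by rw [hGTf]; exact hbl)
        (by rw [hGTf]; exact hσf)
      have hfl' : s'.flatten ≠ (Q ++ (E₀ ++ M) :: (Ds ++ [x] :: GT)).flatten := by
        rw [← hTe', hup.flatten]; exact hfl
      have hp2 := hp₁ (hu s' hd hfl' hpath ▸ hpath)
      have efr : Q ++ (E₀ ++ x :: M) :: (Ds ++ GT) = (Q ++ (E₀ ++ x :: M) :: Ds) ++ GT := by simp
      have hlf : (Q ++ (E₀ ++ x :: M) :: Ds).flatten.length =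
          (Q ++ (E₀ ++ M) :: Ds ++ [[x]]).flatten.length := by
        grind
      have hcf : IsCell (Rel N) (Q ++ (E₀ ++ x :: M) :: (Ds ++ GT)) := by
        intro B hB
        simp only [List.mem_append, List.mem_cons] at hB
        rcases hB with hB | rfl | hB | hB
        · exact hcT B (by simp [hB])
        · exact ⟨by simp, h.pairwise⟩
        · exact hcT B (by simp [hB])
        · exact hcT B (by simp [hB])
      refine not_hasPath_of_empty hN hσ he hne hcf (by rw [hσf, ← hGTf]; simp) ?_ hp2
      rw [eq_empty_iff_forall_notMem]
      intro t ht
      obtain ⟨ht1, ht2⟩ := mem_inter.1 ht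
      rw [efr, cuts_append (by simp), mem_union, hlf] at ht1
      have ht3 := (mem_Ico.1 ht2).1
      rcases ht1 with ht1 | ht1
      · have := (lt_of_mem_cuts (fun B hB => hcf.ne_nil B (by rw [efr]; exact List.mem_append_left _ hB))
          ht1).2
        omega
      · have : t ∈ cuts T ∩ Ico pre₁.flatten.length (pre₁.flatten.length + E.length) := by
          refine mem_inter.2 ⟨?_, ht2⟩
          rw [hTe, cuts_append (by simp)]
          exact mem_union_right _ ht1
        rw [hTR] at this
        simp at this

end DeadCorridor

/-! ### Choosing between staying in a word and hopping to the word of the target. -/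

section Hopping
variable {A : Type*} {R : A → A → Prop}

/-- The cells `base ++ G` of one word and the cells `front ++ G` of the word of `σ`, where the
paths to `σ` pass from the former to the latter. -/
structure Hopping (R : A → A → Prop) (σ base front : List (List A)) (tl : List A) : Prop where
  base_ne : base ≠ []
  front_cell : IsCell R front
  length_eq : front.flatten.length = base.flatten.length
  flatten_eq : σ.flatten = front.flatten ++ tl
  covered : Covered R (base.flatten ++ tl)
  hop : ∀ G, IsCell R G → G.flatten = tl → ∃ s₁, Down R (base ++ G) s₁ ∧
    s₁.flatten ≠ (base ++ G).flatten ∧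
    (UniquePath R σ (front ++ G) → UniquePath R σ s₁) ∧
    (HasPath R σ s₁ → HasPath R σ (front ++ G)) ∧
    ∀ s', Down R (base ++ G) s' → s'.flatten ≠ (base ++ G).flatten → HasPath R σ s' → s' = s₁
  dead : ∀ pre₁ E pre₂ K k G, σ = pre₁ ++ E :: pre₂ → pre₁ ≠ [] →
    K ∈ jList R (base.flatten ++ tl) →
    Ico pre₁.flatten.length (pre₁.flatten.length + E.length) ⊆ K → lowest K = {k} →
    k < pre₁.flatten.length → base.flatten.length ≤ pre₁.flatten.length →
    IsCell R G → G.flatten = tl →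
    cuts (base ++ G) ∩ Ico pre₁.flatten.length (pre₁.flatten.length + E.length) = ∅ →
    ¬ HasPath R σ (base ++ G)

variable {σ base front : List (List A)} {tl : List A}

theorem IsCell.append {b c : List (List A)} (hb : IsCell R b) (hc : IsCell R c) :
    IsCell R (b ++ c) := by
  intro B hB
  rcases List.mem_append.1 hB with h | h
  · exact hb B h
  · exact hc B h

theorem IsCell.right {b c : List (List A)} (h : IsCell R (b ++ c)) : IsCell R c :=
  fun B hB => h B (List.mem_append_right _ hB)

/-- Any continuation that changes the word has to be the hop, and the hop is excluded because the
front cell it leads to is dead. -/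
theorem Hopping.step_inword (hσ : IsReading R σ) (h : Hopping R σ base front tl)
    {s G : List (List A)} {s₁ : List (List A)} (hc : IsCell R s) (hG : IsCell R G)
    (hGf : G.flatten = tl)
    (hup : Up R s (base ++ G)) (hd : Down R (base ++ G) s₁) (hne : s₁ ≠ s)
    (h₁ : UniquePath R σ s₁)
    (ho : ∀ s', Down R (base ++ G) s' → s'.flatten = s.flatten → s' ≠ s → CellAlive R s' → s' = s₁)
    (hdead : ¬ HasPath R σ (front ++ G)) : UniquePath R σ s := by
  refine UniquePath.step hσ.critical hc hup hd hne h₁ fun s' hd' hne' hp => ?_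
  by_cases hf : s'.flatten = s.flatten
  · exact ho s' hd' hf hne' (hp.alive hσ.critical (hd'.isCell (hup.isCell hc)))
  · obtain ⟨s₂, -, -, -, hp₂, hu⟩ := h.hop G hG hGf
    rw [← hup.flatten] at hf
    obtain rfl := hu s' hd' hf hp
    exact absurd (hp₂ hp) hdead

/-- All continuations inside the word are dead, and outside it the hop is the only one. -/
theorem Hopping.step_hop (hσ : IsReading R σ) (h : Hopping R σ base front tl)
    {s G : List (List A)} (hc : IsCell R s) (hG : IsCell R G) (hGf : G.flatten = tl)
    (hup : Up R s (base ++ G)) (h₁ : UniquePath R σ (front ++ G))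
    (ho : ∀ s', Down R (base ++ G) s' → s'.flatten = s.flatten → s' ≠ s → ¬ HasPath R σ s') :
    UniquePath R σ s := by
  obtain ⟨s₂, hd, hne, hu₂, -, hu⟩ := h.hop G hG hGf
  refine UniquePath.step hσ.critical hc hup hd ?_ (hu₂ h₁) fun s' hd' hne' hp => ?_
  · rintro rfl
    exact hne hup.flatten.symm
  · by_cases hf : s'.flatten = s.flatten
    · exact absurd hp (ho s' hd' hf hne')
    · rw [← hup.flatten] at hf
      exact hu s' hd' hf hp

end Hopping

/-! ### Rotation of memories, and the split preceding a hop. -/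

section Rotate
variable {A : Type*} {R : A → A → Prop}

/-- The tile after `Y` swallows `Z` and continues to `E`, since `Y ++ Z` is compatible. For the same
reason the tile after `Z` swallows `E` and continues to `D`, and `D` is what is read after `Z ++ E`.
Behind these the memories `D` and `E ++ D` read the same word, which is what an induction needs. -/
theorem Link.exists_rotation {Y Z : List A} {m mA : List (List A)} (hY : (Y :: m).IsChain (Link R))
    (hZ : (Z :: mA).IsChain (Link R)) (hYZ : (Y ++ Z).Pairwise R) (hZ0 : Z ≠ [])
    (hf : m.flatten = Z ++ mA.flatten) :
    ∃ E D m' mA', E ≠ [] ∧ D ≠ [] ∧ m = (Z ++ E) :: D :: m' ∧ mA = (E ++ D) :: mA' ∧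
      m'.flatten = mA'.flatten ∧ Link R (Y ++ Z) E := by
  cases m with
  | nil => simp at hf; exact absurd hf.1 hZ0
  | cons B m =>
    rw [List.isChain_cons_cons] at hY
    obtain ⟨E, hE, rfl, hf2⟩ := hY.1.exists_append hYZ (r := mA.flatten) (r' := m.flatten)
      (by rw [← hf]; simp)
    cases mA with
    | nil => simp at hf2; exact absurd hf2.1 hE
    | cons U mA =>
      rw [List.isChain_cons_cons] at hZ
      obtain ⟨D, hD, rfl, hf3⟩ := hZ.1.exists_append hY.1.pairwise (r := m.flatten)
        (r' := mA.flatten) (by rw [← hf2]; simp)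
      cases m with
      | nil => simp at hf3; exact absurd hf3.1 hD
      | cons V m =>
        obtain ⟨rfl, hf4⟩ := (List.isChain_cons_cons.1 hY.2).1.unique (hZ.1.of_append hD)
          (r := m.flatten) (r' := mA.flatten) (by simpa using hf3)
        exact ⟨E, V, m, mA, hE, hD, rfl, rfl, hf4, hY.1.of_append hE⟩

/-- A block swallowing the next tile. -/
theorem Link.of_lt {E₀ D E F r r' : List A} (h : Link R (E₀ ++ D) E) (h' : Link R D F)
    (hf : E ++ r = F ++ r') (hlt : E.length < F.length) : Link R E₀ (D ++ E) := by
  obtain ⟨X, c, rfl, hXc, hX, y, hy, hyc⟩ := h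
  obtain ⟨X', c', rfl, hXc', hX', -⟩ := h'
  have hpre : X ++ [c] <+: X' := List.prefix_of_prefix_length_le (l₃ := X' ++ ([c'] ++ r'))
    (by rw [← List.append_assoc, ← hf]; simp) (by simp)
    (by simp only [List.length_append, List.length_cons, List.length_nil] at hlt ⊢; omega)
  obtain ⟨t, rfl⟩ := hpre
  rw [← List.append_assoc] at hX'
  refine ⟨D ++ X, c, by simp, (List.pairwise_append.1 hX').1, by simpa using hX, y, ?_, hyc⟩
  grind

/-- Splitting the block `E ++ D` whose first part is a tile, the later tiles being blocks.  If no
path continues in the same word, the added rank either is not covered by the truncated intervals,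
or it lies inside `D`, and the first rank of the next block would have to be removed. -/
theorem CPrefix.exists_split {pre : List (List A)} {P E D : List A} {m : List (List A)}
    (h : CPrefix R pre P) (hE : Link R P E) (hD : D ≠ [])
    (hm : (D :: m).IsChain (Link R)) (hm' : ((E ++ D) :: m).IsChain (Link R))
    (hED : (E ++ D).Pairwise R)
    (hcov : Covered R (pre ++ P :: (E ++ D) :: m).flatten) :
    ∃ D₁ D₂, D = D₁ ++ D₂ ∧ D₂ ≠ [] ∧
      Up R (pre ++ P :: (E ++ D) :: m) (pre ++ P :: (E ++ D₁) :: D₂ :: m) ∧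
      ∀ s', Down R (pre ++ P :: (E ++ D₁) :: D₂ :: m) s' →
        s'.flatten = (pre ++ P :: (E ++ D) :: m).flatten →
        s' ≠ pre ++ P :: (E ++ D) :: m → CellAlive R s' →
        ∃ B m' K k, m = B :: m' ∧ K ∈ jList R (pre ++ P :: (E ++ D) :: m).flatten ∧
          Ico (pre ++ [P, E, D]).flatten.length ((pre ++ [P, E, D]).flatten.length + B.length) ⊆ K ∧
          lowest K = {k} ∧ k < (pre ++ [P, E, D]).flatten.length ∧
          (pre ++ [P, E]).flatten.length < k ∧
          cuts s' = (insert k (cuts (pre ++ P :: (E ++ D) :: m))).erase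
            (pre ++ [P, E, D]).flatten.length := by
  have hE0 := hE.ne_nil
  have hE0' := List.length_pos_of_ne_nil hE0
  have hD0' := List.length_pos_of_ne_nil hD
  have hc : IsCell R (pre ++ P :: (E ++ D) :: m) := by
    have h1 := h.isCell
    have h2 := isCell_of_chain hm
    intro B hB
    simp only [List.mem_append, List.mem_cons] at hB
    rcases hB with hB | rfl | rfl | hB
    · exact h1 B (by simp [hB])
    · exact h1 B (by simp)
    · exact ⟨by simp [hE0], hED⟩
    · exact h2 B hB
  set s := pre ++ P :: (E ++ D) :: m with hs
  set w := s.flatten with hw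
  have hsn := h.snoc hE
  have hgood : GoodOn (pre ++ [P] ++ [E]) (cuts s) := goodOn_cuts_append hc.ne_nil hE0
  have hwe : w = (pre ++ [P] ++ [E]).flatten ++ (D ++ m.flatten) := by
    rw [hw, hs]; simp
  have hlen : (pre ++ [P] ++ [E]).flatten.length = (pre ++ [P]).flatten.length + E.length := by
    rw [List.flatten_append, List.length_append]; simp
  have hlenD : (pre ++ [P, E, D]).flatten.length =
      (pre ++ [P]).flatten.length + E.length + D.length := by
    grind
  have hlenE : (pre ++ [P, E]).flatten.length = (pre ++ [P]).flatten.length + E.length := by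
    grind
  -- the uncovered case
  have key : (∀ K ∈ jList R w, (cuts s ∩ K = lowest K ∧
        ((pre ++ [P] ++ [E]).flatten.length ∉ K))) →
      piv R w (cuts s) = {(pre ++ [P] ++ [E]).flatten.length} := by
    intro hall
    rw [piv_all_good hcov fun K hK => (hall K hK).1]
    refine lowest_eq_of_least ?_ ?_
    · rw [mem_sdiff, mem_Ioo, mem_support]
      grind
    · intro t ht
      rw [mem_sdiff, mem_Ioo, mem_support] at ht
      by_contra hlt
      apply ht.2
      obtain ⟨pre₁, B, pre₂, he, hne, htB⟩ := exists_tile hsn.2 ht.1.1 (not_le.1 hlt)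
      obtain ⟨L₁, L₂, hL, -, hmem⟩ := hsn.tiles hwe
      grind
  -- If all truncated intervals are met correctly and none contains the end of `E`, the pivot is
  -- that end. No truncated interval contains it, so no alive cell of the same word follows.
  have main : (∀ K ∈ jList R w, (cuts s ∩ K = lowest K ∧
        ((pre ++ [P] ++ [E]).flatten.length ∉ K))) → ∃ D₁ D₂, D = D₁ ++ D₂ ∧ D₂ ≠ [] ∧
      Up R s (pre ++ P :: (E ++ D₁) :: D₂ :: m) ∧
      ∀ s', Down R (pre ++ P :: (E ++ D₁) :: D₂ :: m) s' → s'.flatten = w → s' ≠ s →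
        CellAlive R s' → ∃ B m' K k, m = B :: m' ∧ K ∈ jList R w ∧
          Ico (pre ++ [P, E, D]).flatten.length ((pre ++ [P, E, D]).flatten.length + B.length) ⊆ K ∧
          lowest K = {k} ∧ k < (pre ++ [P, E, D]).flatten.length ∧
          (pre ++ [P, E]).flatten.length < k ∧
          cuts s' = (insert k (cuts s)).erase (pre ++ [P, E, D]).flatten.length := by
    intro hall
    have hpiv := key hall
    have hup : Up R s (pre ++ P :: (E ++ []) :: D :: m) :=
      ⟨pre ++ [P], E, D, m, by simp [hs], by simp, hE0, hD,
        by rw [← hw, hpiv, hlen]; exact mem_singleton_self _⟩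
    refine ⟨[], D, rfl, hD, hup, fun s' hd hf hne hal => ?_⟩
    obtain ⟨-, b, K, r, hb, hK, hlow, -⟩ := inword_cell hc hup hd hf hne hal
    grind
  obtain ⟨L₁, L₂, hL, hrun, hmem⟩ := hsn.tiles hwe
  have hgoodL₁ : ∀ K ∈ L₁, cuts s ∩ K = lowest K ∧ (pre ++ [P] ++ [E]).flatten.length ∉ K := by
    intro K hK
    obtain ⟨pre₁, B, pre₂, he, hne, rfl⟩ := (hmem K).1 hK
    have hle : pre₁.flatten.length + B.length ≤ (pre ++ [P] ++ [E]).flatten.length := by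
      grind
    have hB := hsn.isCell B (by rw [he]; simp)
    refine ⟨?_, fun hr => by have := (mem_Ico.1 hr).2; omega⟩
    rw [hgood pre₁ B pre₂ he hne, lowest_Ico (by have := List.length_pos_of_ne_nil hB.1; omega)]
  cases m with
  | nil =>
    have : L₂ = [] := hrun.eq_nil_of_pairwise (P := E ++ D) hED (by rw [hwe]; simp)
    refine main fun K hK => hgoodL₁ K ?_
    rw [hL, this] at hK
    simpa using hK
  | cons B m =>
    rw [List.isChain_cons_cons] at hm hm'
    have hB0' := List.length_pos_of_ne_nil hm.1.ne_nil
    obtain ⟨X, c, hBX, hXc, hDX, hy⟩ := id hm.1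
    obtain ⟨X', c', hBX', -, hEDX, -⟩ := id hm'.1
    obtain ⟨rfl, h2⟩ := List.append_inj' (hBX.symm.trans hBX') rfl
    -- The next minimal clash is spanned by `c` and the last letter `y` of `D` clashing with it; the
    -- truncated interval starts at the rank directly behind `y`.
    obtain ⟨D₁, y, D₂, rfl, hyc, hlast⟩ := exists_last_of_exists hy
    have hmin := minClash_next (R := R) (w := w) (l₁ := (pre ++ [P]).flatten) (P₁ := E ++ D₁)
      (y := y) (P₂ := D₂) (X := X) (c := c) (rest := m.flatten) (by rw [hwe, hBX]; simp) hyc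
      (by simpa using hEDX) (by
        rw [List.append_assoc] at hDX
        have h3 := (List.pairwise_append.1 hDX).2.1
        rw [List.cons_append, List.pairwise_cons] at h3
        refine List.pairwise_append.2 ⟨h3.2, List.pairwise_singleton _ _, ?_⟩
        intro a ha b hb
        rw [List.mem_singleton] at hb
        subst hb
        rcases List.mem_append.1 ha with ha | ha
        · exact not_not.1 (hlast a ha)
        · exact (List.pairwise_append.1 (hBX ▸ hXc)).2.2 a ha b (by simp))
    obtain ⟨L', rfl, hlt, hrun'⟩ := hrun.next (intervalSystem_minClash w) hmin.1 (by omega) hmin.2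
    have hBl : B.length = X.length + 1 := by rw [hBX]; simp
    simp only [List.length_append, List.length_cons] at hlenD hD0'
    have hlenEL : (pre ++ [P] ++ [E]).flatten.length = (pre ++ [P]).flatten.length + E.length := hlen
    obtain ⟨a, ha⟩ : ∃ a, a = (pre ++ [P]).flatten.length + (E ++ D₁).length := ⟨_, rfl⟩
    obtain ⟨q, hq⟩ : ∃ q, q = (pre ++ [P, E, D₁ ++ y :: D₂]).flatten.length := ⟨_, rfl⟩
    obtain ⟨c₁, hc₁⟩ : ∃ c₁, c₁ = (pre ++ [P]).flatten.length + (E ++ D₁ ++ y :: D₂).length +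
      X.length := ⟨_, rfl⟩
    have hmax : max ((pre ++ [P]).flatten.length + (E ++ D₁).length)
        ((pre ++ [P] ++ [E]).flatten.length - 1) = a := by
      grind
    rw [hmax, ← hc₁] at hlt hrun' hL
    have hqa : q = a + 1 + D₂.length := by
      rw [hq, hlenD, ha, List.length_append]; omega
    have hcq : c₁ + 1 = q + B.length := by
      grind
    have hgs : GoodOn s (cuts s) := by
      have := goodOn_cuts (bs := s) (cs := []) (by simpa using hc.ne_nil)
      simpa using this
    have hqs : (pre ++ [P, E ++ (D₁ ++ y :: D₂)]).flatten.length = q := by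
      grind
    have hgB : cuts s ∩ Ico q (q + B.length) = {q} := by
      have := hgs (pre ++ [P, E ++ (D₁ ++ y :: D₂)]) B m (by simp [hs]) (by simp)
      rwa [hqs] at this
    rcases eq_or_ne D₂ [] with rfl | hD₂
    · refine main fun K hK => ?_
      rw [hL] at hK
      simp only [List.mem_append, List.mem_cons] at hK
      rw [hlen]
      have hqa' : q = a + 1 := by simpa using hqa
      have hqE : q = (pre ++ [P]).flatten.length + E.length + (D₁.length + 1) := by
        rw [hq, hlenD]; simp
      rcases hK with hK | rfl | hK
      · rw [← hlen]; exact hgoodL₁ K hK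
      · have hKe : Ioc a c₁ = Ico q (q + B.length) := by
          ext t; simp only [mem_Ioc, mem_Ico]; omega
        rw [hKe, hgB, lowest_Ico (by omega), mem_Ico]
        exact ⟨rfl, by omega⟩
      · have hwq : w = (pre ++ [P, E, D₁ ++ [y]]).flatten ++ B ++ m.flatten := by
          rw [hw, hs]; simp
        rw [← hqa', show c₁ = q + B.length - 1 by omega, hq] at hrun'
        obtain ⟨b₁, C, b₂, rfl, rfl⟩ := JRun.tiles hm.2 hm.1.pairwise hm.1.ne_nil hwq hrun' K hK
        have hC : C ≠ [] := hc.ne_nil C (by simp [hs])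
        have h5 := hgs (pre ++ P :: (E ++ (D₁ ++ [y])) :: B :: b₁) C b₂ (by simp [hs]) (by simp)
        have h6 : (pre ++ P :: (E ++ (D₁ ++ [y])) :: B :: b₁).flatten.length =
            (pre ++ [P, E, D₁ ++ [y]]).flatten.length + B.length + b₁.flatten.length := by
          grind
        rw [h6] at h5
        rw [h5, lowest_Ico (by have := List.length_pos_of_ne_nil hC; omega), mem_Ico, ← hq]
        exact ⟨rfl, by omega⟩
    -- The interval contains ranks inside `D`, but the cell meets it only from `q` on, where `B`
    -- begins. So it is bad, and the pivot is its least rank `a + 1`.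
    · have hD₂' := List.length_pos_of_ne_nil hD₂
      have hKlow : lowest (Ioc a c₁) = {a + 1} := lowest_Ioc hlt
      have hpiv : piv R w (cuts s) = {a + 1} := by
        rw [piv_first_bad hcov hL (fun K hK => (hgoodL₁ K hK).1) ?_, hKlow]
        intro heq
        have h7 : q ∈ cuts s ∩ Ioc a c₁ := by
          refine mem_inter.2 ⟨?_, mem_Ioc.2 ⟨by omega, by omega⟩⟩
          have : q ∈ cuts s ∩ Ico q (q + B.length) := by rw [hgB]; simp
          exact (mem_inter.1 this).1
        rw [heq, hKlow, mem_singleton] at h7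
        omega
      have hup : Up R s (pre ++ P :: (E ++ (D₁ ++ [y])) :: D₂ :: B :: m) :=
        ⟨pre ++ [P], E ++ (D₁ ++ [y]), D₂, B :: m, by simp [hs], by simp, by simp, hD₂, by
          rw [← hw, hpiv, mem_singleton, ha]; simp only [List.length_append, List.length_cons,
            List.length_nil]; omega⟩
      refine ⟨D₁ ++ [y], D₂, by simp, hD₂, hup, fun s' hd hf hne hal => ?_⟩
      obtain ⟨-, b, K, r, hb, hK, hlow, hKr, -, hcs⟩ := inword_cell hc hup hd hf hne hal
      rw [← hw, hpiv, mem_singleton] at hb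
      subst hb
      have hK0 : Ioc a c₁ ∈ jList R w := by rw [hL]; simp
      obtain rfl : Ioc a c₁ = K := jList_eq_of_mem hK0 hK (r := a + 1) (mem_Ioc.2 ⟨by omega, by omega⟩)
        (lowest_subset _ (by rw [hlow]; simp))
      have hrq : q = r := by
        have h7 : q ∈ cuts s ∩ Ioc a c₁ := by
          refine mem_inter.2 ⟨?_, mem_Ioc.2 ⟨by omega, by omega⟩⟩
          have : q ∈ cuts s ∩ Ico q (q + B.length) := by rw [hgB]; simp
          exact (mem_inter.1 this).1
        rw [hKr] at h7
        exact mem_singleton.1 h7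
      rw [← hq]
      refine ⟨B, m, Ioc a c₁, a + 1, rfl, hK0, ?_, hKlow, by omega, ?_, by rw [hcs, hrq]⟩
      all_goals grind

end Rotate

/-! ### The path that delays the hop until the tails agree. -/

section Rotation
variable {A : Type*} [LinearOrder A] {N : A → A → Prop}

omit [LinearOrder A] in
theorem IsCell.cons {R : A → A → Prop} {B : List A} {bs : List (List A)} (hB : B ≠ [])
    (hp : B.Pairwise R) (h : IsCell R bs) : IsCell R (B :: bs) := by
  intro C hC
  rcases List.mem_cons.1 hC with rfl | hC
  · exact ⟨hB, hp⟩
  · exact h C hC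

/-- Hopping is possible at any time, but too early a hop leaves two ranks in one tile of the target
and too late a hop leaves a tile empty. Hence there is only one right moment. The induction follows
the tails: as long as the tails read in the two words differ, the path stays in the word and the
memories rotate; as soon as they agree, the path must hop. The last hypothesis carries along the
flow steps still to be made in the word of the target. -/
theorem Hopping.rotate (hN : Symmetric N) {σ base front : List (List A)} {tl : List A}
    (hσ : IsReading (Rel N) σ) (h : Hopping (Rel N) σ base front tl) :
    ∀ (n : ℕ) (mA c₂ preC m₃ : List (List A)) (P Y Z : List A), mA.length ≤ n →
      σ = preC ++ P :: Y :: m₃ → (Z :: mA).IsChain (Link (Rel N)) →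
      CPrefix (Rel N) (base ++ c₂) (Y ++ Z) → m₃.flatten = Z ++ mA.flatten → Z ≠ [] →
      (c₂ ++ (Y ++ Z) :: mA).flatten = tl →
      (∀ G, IsCell (Rel N) (c₂ ++ G) → (c₂ ++ G).flatten = tl →
        UniquePath (Rel N) σ (preC ++ P :: G) → UniquePath (Rel N) σ (front ++ (c₂ ++ G))) →
      UniquePath (Rel N) σ (base ++ c₂ ++ (Y ++ Z) :: mA) := by
  intro n
  induction n with
  | zero =>
    intro mA c₂ preC m₃ P Y Z hn hσe hmA hpre hf hZ htl htr
    obtain ⟨E, D, m', mA', -, -, -, rfl, -⟩ := Link.exists_rotation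
      (IsReading.chain (pre := preC ++ [P]) (P := Y) (m := m₃) (by rw [hσe] at hσ; simpa using hσ))
      hmA (hpre.isCell _ (by simp)).2 hZ hf
    simp at hn
  | succ n ih =>
  intro mA c₂ preC m₃ P Y Z hn hσe hmA hpre hf hZ htl htr
  have hYZ := hpre.isCell (Y ++ Z) (by simp)
  obtain ⟨E₀, D, m', mA', hE₀, hD, rfl, rfl, hf', hl⟩ := Link.exists_rotation
    (IsReading.chain (pre := preC ++ [P]) (P := Y) (m := m₃) (by rw [hσe] at hσ; simpa using hσ))
    hmA hYZ.2 hZ hf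
  have hσ1 : IsReading (Rel N) (preC ++ P :: Y :: (Z ++ E₀) :: D :: m') := hσe ▸ hσ
  have hσ2 : IsReading (Rel N) ((preC ++ [P]) ++ Y :: (Z ++ E₀) :: D :: m') := by simpa using hσ1
  have hσ3 : IsReading (Rel N) ((preC ++ [P, Y]) ++ (Z ++ E₀) :: D :: m') := by simpa using hσ1
  have hσ4 : IsReading (Rel N) ((preC ++ [P, Y, Z ++ E₀]) ++ D :: m') := by simpa using hσ1
  have hσc := hσ1.isCell
  rw [List.isChain_cons_cons] at hmA
  have hED := hmA.1.pairwise
  have hccell : IsCell (Rel N) (c₂ ++ [Y ++ Z]) := by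
    refine IsCell.right (b := base) ?_
    rw [← List.append_assoc]; exact hpre.isCell
  have hcmA' : IsCell (Rel N) mA' := isCell_of_chain hmA.2
  have hE₀c : E₀ ≠ [] ∧ E₀.Pairwise (Rel N) := ⟨hE₀, (List.pairwise_append.1 hED).1⟩
  have hDc : D ≠ [] ∧ D.Pairwise (Rel N) := ⟨hD, (List.pairwise_append.1 hED).2.1⟩
  have hσf : (preC ++ [P]).flatten = (front ++ c₂).flatten := by
    have h1 := h.flatten_eq
    rw [← htl, hσe] at h1
    have h2 : (preC ++ [P]).flatten ++ (Y ++ Z ++ E₀ ++ D ++ m'.flatten) =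
        (front ++ c₂).flatten ++ (Y ++ Z ++ E₀ ++ D ++ m'.flatten) := by
      simpa [hf'] using h1
    exact List.append_cancel_right h2
  have hlfb : (front ++ c₂).flatten.length = (base ++ c₂).flatten.length := by
    rw [List.flatten_append, List.flatten_append, List.length_append, List.length_append,
      h.length_eq]
  have hcov : Covered (Rel N) (base ++ c₂ ++ (Y ++ Z) :: (E₀ ++ D) :: mA').flatten := by
    have := h.covered
    rw [← htl] at this
    simpa using this
  have hwe : (base ++ c₂ ++ (Y ++ Z) :: (E₀ ++ D) :: mA').flatten = base.flatten ++ tl := by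
    rw [← htl]; simp
  have hbc : IsCell (Rel N) (base ++ c₂ ++ [Y ++ Z]) := hpre.isCell
  have hcs : IsCell (Rel N) (base ++ c₂ ++ (Y ++ Z) :: (E₀ ++ D) :: mA') := by
    have e : base ++ c₂ ++ (Y ++ Z) :: (E₀ ++ D) :: mA' =
      (base ++ c₂ ++ [Y ++ Z]) ++ (E₀ ++ D) :: mA' := by simp
    rw [e]
    exact hbc.append (hcmA'.cons (by simp [hE₀]) hED)
  -- With equal tails the block `E₀ ++ D` is split by `CPrefix.exists_split` and the hop follows. In
  -- the word of the target at most two flow steps then complete this part of the path.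
  have fin : m' = mA' → UniquePath (Rel N) σ (base ++ c₂ ++ (Y ++ Z) :: (E₀ ++ D) :: mA') := by
    rintro rfl
    obtain ⟨D₁, D₂, rfl, hD₂, hup, hin⟩ := hpre.exists_split hl hD hσ4.chain hmA.2 hED hcov
    have hE₁ : (E₀ ++ D₁).Pairwise (Rel N) := by
      rw [← List.append_assoc] at hED; exact (List.pairwise_append.1 hED).1
    have hD₂p : D₂.Pairwise (Rel N) := (List.pairwise_append.1 hDc.2).2.1
    have e : ∀ G, base ++ c₂ ++ G = base ++ (c₂ ++ G) := fun G => by simp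
    have e2 : c₂ ++ (Y ++ Z) :: (E₀ ++ D₁) :: D₂ :: m' =
        (c₂ ++ [Y ++ Z]) ++ (E₀ ++ D₁) :: D₂ :: m' := by simp
    have hGc : IsCell (Rel N) (c₂ ++ (Y ++ Z) :: (E₀ ++ D₁) :: D₂ :: m') := by
      rw [e2]
      exact hccell.append ((hcmA'.cons hD₂ hD₂p).cons (by simp [hE₀]) hE₁)
    have hGf : (c₂ ++ (Y ++ Z) :: (E₀ ++ D₁) :: D₂ :: m').flatten = tl := by rw [← htl]; simp
    refine h.step_hop hσ hcs hGc hGf (by rw [← e]; exact hup) ?_ ?_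
    · refine htr _ hGc hGf ?_
      obtain ⟨X, c, hX, -, hZX, -⟩ := id hmA.1
      have hZE : (Z ++ (E₀ ++ D₁)).Pairwise (Rel N) := by
        refine hZX.sublist (List.Sublist.append_left ?_ Z)
        rcases List.eq_nil_or_concat D₂ with rfl | ⟨D₃, d, rfl⟩
        · exact absurd rfl hD₂
        · rw [List.concat_eq_append, ← List.append_assoc, ← List.append_assoc] at hX
          rw [← (List.append_inj' hX rfl).1]
          simp
      have hcell : ∀ B, B ≠ [] → B.Pairwise (Rel N) → ∀ G, IsCell (Rel N) G →
          IsCell (Rel N) (preC ++ P :: B :: G) := by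
        intro B hB hBp G hG C hC
        simp only [List.mem_append, List.mem_cons] at hC
        rcases hC with hC | rfl | rfl | hC
        · exact hσc C (by simp [hC])
        · exact hσc C (by simp)
        · exact ⟨hB, hBp⟩
        · exact hG C hC
      have hYc := hσc Y (by simp)
      refine UniquePath.flow hN hσ hσ1.cPrefix hσ1.link hσ2.link (rest := D₁ ++ D₂ ++ m'.flatten)
        (hcell _ hYZ.1 hYZ.2 _ ((hcmA'.cons hD₂ hD₂p).cons (by simp [hE₀]) hE₁)) (by rw [hσe]; simp)
        (by simp) hZ hZE ?_
      rcases eq_or_ne D₁ [] with rfl | hD₁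
      · rw [hσe]
        simpa using uniquePath_self hσ1.critical
      · have := UniquePath.flow hN hσ (pre := preC ++ [P]) (P := Y) (B := Z ++ E₀) (D := D₁)
          (D₂ := D₂) (cs := m') (rest := m'.flatten) hσ2.cPrefix hσ2.link hσ3.link
          (by
            have := hcell Y hYc.1 hYc.2 (((Z ++ E₀) ++ D₁) :: D₂ :: m')
              ((hcmA'.cons hD₂ hD₂p).cons (by simp [hE₀]) (by simpa using hZE))
            simpa using this)
          (by rw [hσe]; simp) (by simp) hD₁ hDc.2
          (by rw [hσe]; simpa using uniquePath_self hσ1.critical)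
        simpa using this
    · intro s' hd hfl hne hp
      rw [← e] at hd
      have hcT := hup.isCell hcs
      have hal := hp.alive hσ.critical (hd.isCell hcT)
      obtain ⟨B, m'', K, k, rfl, hK, hKB, hlow, hk, hkE, hcuts⟩ := hin s' hd hfl hne hal
      have hlσ : (preC ++ [P, Y, Z ++ E₀, D₁ ++ D₂]).flatten.length =
          (base ++ c₂ ++ [Y ++ Z, E₀, D₁ ++ D₂]).flatten.length := by
        have h1 := congrArg List.length hσf
        rw [hlfb] at h1
        simp only [List.flatten_append, List.flatten_cons, List.flatten_nil, List.length_append,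
          List.length_nil] at h1 ⊢
        omega
      have hs' := hd.isCell hcT
      obtain ⟨G, -, rfl⟩ := eq_append_of_cuts (base := base)
        (G := c₂ ++ (Y ++ Z) :: (E₀ ++ (D₁ ++ D₂)) :: B :: m'') (T := s')
        (by rw [← e]; exact hcs.ne_nil) h.base_ne (by simp) hs'.ne_nil (by rw [hfl, e])
        (by
          intro r hr
          rw [hcuts, mem_erase, mem_insert, ← e]
          have h8 : base.flatten.length ≤ (base ++ c₂ ++ [Y ++ Z, E₀]).flatten.length := by
            simp only [List.flatten_append, List.length_append]; omega
          constructor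
          · rintro ⟨-, rfl | h2⟩
            · omega
            · exact h2
          · exact fun h2 => ⟨by omega, Or.inr h2⟩)
      -- Staying in the word takes the only rank out of the tile `B` of the target; as the interval
      -- `K` starts before this tile, the tile is never refilled.
      refine h.dead (preC ++ [P, Y, Z ++ E₀, D₁ ++ D₂]) B m'' K k G (by rw [hσe]; simp) (by simp)
        (hwe ▸ hK) (by rw [hlσ]; exact hKB) hlow (by rw [hlσ]; exact hk) ?_ hs'.right ?_ ?_ hp
      · rw [hlσ]; simp only [List.flatten_append, List.length_append]; omega
      · have : (base ++ G).flatten = base.flatten ++ tl := by rw [hfl, hwe]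
        rw [List.flatten_append] at this
        exact List.append_cancel_left this
      · rw [eq_empty_iff_forall_notMem]
        intro t ht
        obtain ⟨ht1, ht2⟩ := mem_inter.1 ht
        rw [hlσ] at ht2
        rw [hcuts, mem_erase, mem_insert] at ht1
        rw [mem_Ico] at ht2
        rcases ht1.2 with rfl | ht3
        · omega
        · have h9 := goodOn_cuts (bs := base ++ c₂ ++ (Y ++ Z) :: (E₀ ++ (D₁ ++ D₂)) :: B :: m'')
            (cs := []) (by simpa using hcs.ne_nil) (base ++ c₂ ++ [Y ++ Z, E₀ ++ (D₁ ++ D₂)]) B m''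
            (by simp) (by simp)
          rw [List.append_nil] at h9
          have h10 : (base ++ c₂ ++ [Y ++ Z, E₀ ++ (D₁ ++ D₂)]).flatten.length =
              (base ++ c₂ ++ [Y ++ Z, E₀, D₁ ++ D₂]).flatten.length := by
            simp only [List.flatten_append, List.flatten_cons, List.flatten_nil,
              List.length_append, List.length_nil]; omega
          rw [h10] at h9
          have h11 := mem_inter.2 ⟨ht3, mem_Ico.2 ht2⟩
          rw [h9, mem_singleton] at h11
          exact ht1.1 h11
  cases mA' with
  | nil =>
    cases m' with
    | nil => exact fin rfl
    | cons F m' =>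
      have := (hσc F (by simp)).1
      simp at hf'
      exact absurd hf'.1 this
  | cons E mA' =>
    have hlE := (List.isChain_cons_cons.1 hmA.2).1
    cases m' with
    | nil =>
      simp at hf'
      exact absurd hf'.1 hlE.ne_nil
    | cons F m' =>
      have hlF := hσ4.link
      simp only [List.flatten_cons] at hf'
      have hle := hlF.length_le_of_subset hlE hf' (by simp)
      rcases hle.lt_or_eq with hlt | heq
      -- The tails differ in their first tiles `E` and `F`. Then `D ++ E` is the tile after `E₀`, so
      -- the surplus `D` flows into `E` and the induction continues with `D` and `E` as new `Y` and
      -- `Z`.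
      · have hDE := Link.of_lt hlE hlF hf'.symm hlt
        have hcm := (hcmA' : IsCell (Rel N) (E :: mA'))
        obtain ⟨hup, -⟩ := hpre.flow_up (cs := E :: mA') (rest := mA'.flatten) hl hDE hcs hcov
          (by simp) hD
        have e : ∀ G, base ++ c₂ ++ G = base ++ (c₂ ++ G) := fun G => by simp
        have hEc := hcm E (by simp)
        have hDEp := hDE.pairwise
        have hGc : IsCell (Rel N) (c₂ ++ (Y ++ Z) :: E₀ :: D :: E :: mA') := by
          have e2 : c₂ ++ (Y ++ Z) :: E₀ :: D :: E :: mA' =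
            (c₂ ++ [Y ++ Z]) ++ E₀ :: D :: E :: mA' := by simp
          rw [e2]
          exact hccell.append ((hcm.cons hDc.1 hDc.2).cons hE₀ hE₀c.2)
        have hGf : (c₂ ++ (Y ++ Z) :: E₀ :: D :: E :: mA').flatten = tl := by rw [← htl]; simp
        have hdm : Down (Rel N) (base ++ (c₂ ++ (Y ++ Z) :: E₀ :: D :: E :: mA'))
            (base ++ (c₂ ++ (Y ++ Z) :: E₀ :: (D ++ E) :: mA')) :=
          ⟨base ++ c₂ ++ [Y ++ Z, E₀], D, E, mA', D ++ E, by simp, by simp, List.Perm.refl _, hDEp⟩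
        have hmA'0 : mA' ≠ [] := by
          rintro rfl
          have := congrArg List.length hf'
          grind
        refine h.step_inword hσ hcs hGc hGf (by rw [← e]; exact hup) hdm ?_ ?_ ?_ ?_
        · intro heq
          rw [← e] at heq
          have h2 := List.append_cancel_left heq
          simp only [List.cons.injEq, true_and] at h2
          exact hD (List.self_eq_append_right.1 h2.1)
        · have := ih mA' (c₂ ++ [Y ++ Z, E₀]) (preC ++ [P, Y]) (F :: m') (Z ++ E₀) D E
            (by simp at hn; omega) (by rw [hσe]; simp) (List.isChain_cons_cons.1 hmA.2).2
            (by
              have := (hpre.snoc hl).snoc hDE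
              simpa using this)
            (by simp [hf']) hlE.ne_nil (by rw [← htl]; simp) ?_
          · simpa using this
          · intro G hG hGf' hu
            have hG' : IsCell (Rel N) (c₂ ++ (Y ++ Z) :: E₀ :: G) := by simpa using hG
            have := htr ((Y ++ Z) :: E₀ :: G) hG' (by simpa using hGf')
            rw [show c₂ ++ [Y ++ Z, E₀] ++ G = c₂ ++ (Y ++ Z) :: E₀ :: G by simp]
            refine this ?_
            refine UniquePath.flow hN hσ hσ1.cPrefix hσ1.link hσ2.link (rest := G.flatten)
              ?_ ?_ (by simp) hZ (hσc (Z ++ E₀) (by simp)).2 (by simpa using hu)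
            · have h12 := hG'.right
              intro B hB
              simp only [List.mem_append, List.mem_cons] at hB
              rcases hB with hB | rfl | hB
              · exact hσc B (by simp [hB])
              · exact hσc B (by simp)
              · exact h12 B (by simpa using hB)
            · rw [h.flatten_eq, ← hGf']
              have : (preC ++ [P]).flatten ++ ((Y ++ Z) :: E₀ :: G).flatten =
                  (front ++ c₂).flatten ++ ((Y ++ Z) :: E₀ :: G).flatten := by rw [hσf]
              simpa using this
        · intro s' hd hfl hne hal
          rw [← e] at hd
          obtain ⟨D₂, cs', he, rfl⟩ := hpre.flow_inword hl hDE hcs hcov (rest := mA'.flatten)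
            (by simp) hD hd hfl hne hal
          grind
        · have hlσ : (preC ++ [P, Y, Z ++ E₀, D]).flatten.length =
              (front ++ (c₂ ++ [Y ++ Z, E₀, D])).flatten.length := by
            have h1 := congrArg List.length hσf
            simp only [List.flatten_append, List.flatten_cons, List.flatten_nil, List.length_append,
              List.length_nil] at h1 ⊢
            omega
          have hE0' := List.length_pos_of_ne_nil hEc.1
          -- A hop at this moment would keep both ends of `E` as ranks, and both lie in the longer
          -- tile `F` of the target.
          refine not_hasPath_of_two hN hσ (pre₁ := preC ++ [P, Y, Z ++ E₀, D]) (B := F) (pre₂ := m')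
            (by rw [hσe]; simp) (by simp) (r := (preC ++ [P, Y, Z ++ E₀, D]).flatten.length + E.length)
            (by omega) (by omega) (h.front_cell.append hGc)
            (by rw [List.flatten_append, hGf, h.flatten_eq]) ?_ ?_
          · rw [hlσ]
            have := mem_cuts_append_self (pre := front ++ (c₂ ++ [Y ++ Z, E₀, D])) (cs := E :: mA')
              (by simp) (by simp)
            simpa only [List.append_assoc, List.cons_append, List.nil_append] using this
          · have := mem_cuts_append_self (pre := front ++ (c₂ ++ [Y ++ Z, E₀, D, E])) (cs := mA')
              (by simp) hmA'0
            have hl2 : (preC ++ [P, Y, Z ++ E₀, D]).flatten.length + E.length =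
                (front ++ (c₂ ++ [Y ++ Z, E₀, D, E])).flatten.length := by
              rw [hlσ]
              simp only [List.flatten_append, List.flatten_cons, List.flatten_nil,
                List.length_append, List.length_nil]; omega
            rw [hl2]
            simpa only [List.append_assoc, List.cons_append, List.nil_append] using this
      · obtain ⟨rfl, hf2⟩ := List.append_inj hf' heq.symm
        have h1 := (List.isChain_cons_cons.1 hσ4.chain).2
        have h2 := (List.isChain_cons_cons.1 hmA.2).2
        exact fin (by rw [chain_unique h1 h2 hf2])

end Rotation

/-! ### The path that moves the letter from behind the last tile to the front. -/

section LastToFront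
variable {A : Type*}

theorem exists_cover_of_chain {R : A → A → Prop} : ∀ (m : List (List A)) (P l₁ w : List A) (r : ℕ),
    (P :: m).IsChain (Link R) → w = l₁ ++ P ++ m.flatten → l₁.length + P.length ≤ r →
    r < w.length → ∃ a c, MinClash R w a c ∧ a < r ∧ r ≤ c := by
  intro m
  induction m with
  | nil =>
    grind
  | cons B m ih =>
    intro P l₁ w r hch hw h1 h2
    rw [List.isChain_cons_cons] at hch
    obtain ⟨a, hmin, -, hlt, -⟩ := hch.1.minClash (w := w) (l₁ := l₁) (rest := m.flatten)
      (by simp [hw])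
    grind

theorem CPrefix.covered_of_chain {R : A → A → Prop} {pre mA : List (List A)} {Y Z : List A}
    (h : CPrefix R pre (Y ++ Z)) (hm : (Z :: mA).IsChain (Link R)) :
    Covered R (pre ++ (Y ++ Z) :: mA).flatten := by
  rw [covered_iff]
  intro r h0 hr
  by_cases hlt : r < (pre ++ [Y ++ Z]).flatten.length
  · exact h.exists_cover (rest := mA.flatten) (by simp) h0 hlt
  · refine exists_cover_of_chain mA Z (pre.flatten ++ Y) _ r hm (by simp) ?_ hr
    grind

variable [LinearOrder A] {N : A → A → Prop}

/-- The hops come from `Corridor.hop` and the dead cells from `Corridor.not_hasPath`. -/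
theorem Corridor.hopping (hN : Symmetric N) {σ Q : List (List A)} {E₀ M : List A}
    {Ds : List (List A)} {x : A} (hσ : IsReading (Rel N) σ) (h : Corridor N Q E₀ M Ds x)
    {tl : List A} (hbl : ∀ Ds' D, Ds = Ds' ++ [D] → Blocked (Rel N) x (D ++ tl))
    (hσf : σ.flatten = Q.flatten ++ E₀ ++ x :: (M ++ Ds.flatten ++ tl))
    (hpre : CPrefix (Rel N) (Q ++ (E₀ ++ M) :: Ds) [x])
    (hcov : Covered (Rel N) ((Q ++ (E₀ ++ M) :: Ds ++ [[x]]).flatten ++ tl)) :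
    Hopping (Rel N) σ (Q ++ (E₀ ++ M) :: Ds ++ [[x]]) (Q ++ (E₀ ++ x :: M) :: Ds) tl where
  base_ne := by simp
  front_cell := by
    have := hpre.isCell
    intro B hB
    simp only [List.mem_append, List.mem_cons] at hB
    rcases hB with hB | rfl | hB
    · exact this B (by simp [hB])
    · exact ⟨by simp, h.pairwise⟩
    · exact this B (by simp [hB])
  length_eq := by
    simp only [List.flatten_append, List.flatten_cons, List.flatten_nil, List.length_append,
      List.length_cons, List.length_nil]; omega
  flatten_eq := by rw [hσf]; simp
  covered := hcov
  hop G hG hGf := by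
    subst hGf
    have hc := hpre.isCell.append hG
    have e : Q ++ (E₀ ++ M) :: Ds ++ [[x]] ++ G = Q ++ (E₀ ++ M) :: (Ds ++ [x] :: G) := by simp
    have e' : Q ++ (E₀ ++ x :: M) :: Ds ++ G = Q ++ (E₀ ++ x :: M) :: (Ds ++ G) := by simp
    rw [e] at hc ⊢
    rw [e']
    exact h.hop hN hσ hc hbl hσf
  dead pre₁ E pre₂ K k G he hne hK hKE hlow hk hlen hG hGf h1 := by
    refine h.not_hasPath hN hσ hbl hσf hpre (w := (Q ++ (E₀ ++ M) :: Ds ++ [[x]]).flatten ++ tl)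
      (by simp) hcov he hne hK hKE hlow hk ?_ (G := G) (hpre.isCell.append hG) (by simp)
      (by rw [List.flatten_append, hGf]) h1
    refine lt_of_lt_of_le ?_ hlen
    rw [List.flatten_append (L₁ := Q ++ (E₀ ++ M) :: Ds), List.length_append]
    simp

/-- The letter first hops over `Y` only and pauses there. In this intermediate word `Y` is merged
with `Z`, and `Hopping.rotate` finds the one moment at which the letter moves on to the front. -/
theorem Corridor.existsUnique_last_to_front (hN : Symmetric N) {Q : List (List A)} {E₀ M : List A}
    {Ds : List (List A)} {x : A} (h : Corridor N Q E₀ M Ds x) {Y Z : List A}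
    {mA m₃ : List (List A)}
    (hτ : IsReading (Rel N) (Q ++ (E₀ ++ M) :: (Ds ++ Y :: [x] :: Z :: mA)))
    (hσ : IsReading (Rel N) (Q ++ (E₀ ++ x :: M) :: (Ds ++ Y :: m₃)))
    (hpre : CPrefix (Rel N) (Q ++ (E₀ ++ M) :: Ds ++ [[x]]) (Y ++ Z))
    (hY : ∀ y ∈ Y, x < y ∧ ¬ N x y)
    (hf : m₃.flatten = Z ++ mA.flatten)
    (hbl : ∀ Ds' D, Ds = Ds' ++ [D] → Blocked (Rel N) x (D ++ Y ++ Z ++ mA.flatten)) :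
    ∃! q, CritPath (Rel N) (Q ++ (E₀ ++ M) :: (Ds ++ Y :: [x] :: Z :: mA))
      (Q ++ (E₀ ++ x :: M) :: (Ds ++ Y :: m₃)) q := by
  have hτ' : IsReading (Rel N) ((Q ++ (E₀ ++ M) :: Ds ++ [Y, [x]]) ++ Z :: mA) := by simpa using hτ
  have hmA : (Z :: mA).IsChain (Link (Rel N)) := hτ'.chain
  have hZ := hτ.isCell Z (by simp)
  have hYc := hτ.isCell Y (by simp)
  have hYZ := hpre.isCell (Y ++ Z) (by simp)
  have hmAc := isCell_of_chain hmA
  have hxY : ([] ++ x :: Y).Pairwise (Rel N) :=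
    List.pairwise_cons.2 ⟨fun y hy => ⟨(hY y hy).1.le, (hY y hy).2⟩, hYc.2⟩
  obtain ⟨pre, P, hpP⟩ : ∃ pre P, Q ++ (E₀ ++ M) :: Ds = pre ++ [P] := by
    rcases List.eq_nil_or_concat (Q ++ (E₀ ++ M) :: Ds) with h | ⟨pre, P, h⟩
    · simp at h
    · exact ⟨pre, P, by simpa using h⟩
  obtain ⟨preC, PC, hpC⟩ : ∃ pre P, Q ++ (E₀ ++ x :: M) :: Ds = pre ++ [P] := by
    rcases List.eq_nil_or_concat (Q ++ (E₀ ++ x :: M) :: Ds) with h | ⟨pre, P, h⟩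
    · simp at h
    · exact ⟨pre, P, by simpa using h⟩
  have eB : ∀ G, Q ++ (E₀ ++ M) :: (Ds ++ G) = (Q ++ (E₀ ++ M) :: Ds) ++ G := fun G => by simp
  have eF : ∀ G, Q ++ (E₀ ++ x :: M) :: (Ds ++ G) = (Q ++ (E₀ ++ x :: M) :: Ds) ++ G :=
    fun G => by simp
  obtain ⟨hpx, hlx⟩ := hpre.of_snoc
  have hcov := hpre.covered_of_chain hmA
  have hH := h.hopping hN hσ (tl := Y ++ Z ++ mA.flatten) (by simpa using hbl)
    (by simp [hf]) hpx (by simpa using hcov)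
  have hsd : Down (Rel N) (Q ++ (E₀ ++ M) :: (Ds ++ Y :: [x] :: Z :: mA))
      (Q ++ (E₀ ++ M) :: (Ds ++ ([x] ++ Y) :: Z :: mA)) :=
    ⟨Q ++ (E₀ ++ M) :: Ds, Y, [x], Z :: mA, [x] ++ Y, by simp, by simp,
      (List.perm_append_singleton x Y).symm, hxY⟩
  refine existsUnique_critPath hsd ?_ ?_
  · have hc := hsd.isCell hτ.isCell
    rw [eB, hpP, List.append_assoc, List.singleton_append] at hc ⊢
    have hpx' := hpx
    rw [hpP] at hpx'
    have hw : (pre ++ P :: ([x] ++ Y) :: Z :: mA).flatten =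
        (Q ++ (E₀ ++ M) :: Ds ++ [[x]] ++ (Y ++ Z) :: mA).flatten := by
      rw [hpP]; simp
    have hcov' : Covered (Rel N) (pre ++ P :: ([x] ++ Y) :: Z :: mA).flatten := by
      rw [hw]; exact hcov
    obtain ⟨hup, -⟩ := hpx'.of_snoc.1.flow_up hpx'.of_snoc.2 hlx hc hcov' (rest := mA.flatten)
      (by simp) hYc.1
    have eT : pre ++ P :: [x] :: Y :: Z :: mA = Q ++ (E₀ ++ M) :: Ds ++ [[x]] ++ Y :: Z :: mA := by
      rw [hpP]; simp
    have hcG : IsCell (Rel N) (Y :: Z :: mA) := (hmAc.cons hZ.1 hZ.2).cons hYc.1 hYc.2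
    refine hH.step_inword hσ hc (G := Y :: Z :: mA)
      (s₁ := Q ++ (E₀ ++ M) :: Ds ++ [[x]] ++ (Y ++ Z) :: mA) hcG (by simp)
      (by rw [← eT]; exact hup) ⟨Q ++ (E₀ ++ M) :: Ds ++ [[x]], Y, Z, mA, Y ++ Z, by simp, by simp,
        List.Perm.refl _, hYZ.2⟩ ?_ ?_ ?_ ?_
    · intro heq
      rw [hpP] at heq
      have h2 : pre ++ P :: [x] :: (Y ++ Z) :: mA = pre ++ P :: ([x] ++ Y) :: Z :: mA := by
        simpa using heq
      have h3 := List.append_cancel_left h2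
      grind
    · have := hH.rotate hN hσ mA.length mA [] preC m₃ PC Y Z le_rfl (by rw [eF, hpC]; simp) hmA
        (by simpa using hpre) hf hZ.1 (by simp) ?_
      all_goals grind
    · intro s' hd hfl hne hal
      rw [← eT] at hd
      obtain ⟨D₂, cs', he, rfl⟩ := hpx'.of_snoc.1.flow_inword hpx'.of_snoc.2 hlx hc hcov'
        (rest := mA.flatten) (by simp) hYc.1 hd hfl hne hal
      grind
    -- Hopping before `Y` and `Z` are merged leaves both ends of `Z` as ranks in the tile `Z ++ E`
    -- of the target.
    · have hσ2 : IsReading (Rel N) ((Q ++ (E₀ ++ x :: M) :: Ds) ++ Y :: m₃) := by simpa using hσ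
      obtain ⟨E, D, m', mA', hE, hD, rfl, rfl, -, -⟩ := Link.exists_rotation hσ2.chain hmA hYZ.2 hZ.1 hf
      have hE' := List.length_pos_of_ne_nil hE
      have hZ' := List.length_pos_of_ne_nil hZ.1
      refine not_hasPath_of_two hN hσ (pre₁ := Q ++ (E₀ ++ x :: M) :: Ds ++ [Y]) (B := Z ++ E)
        (pre₂ := D :: m') (by simp) (by simp)
        (r := (Q ++ (E₀ ++ x :: M) :: Ds ++ [Y, Z]).flatten.length) ?_ ?_
        (hH.front_cell.append hcG) ?_ ?_ ?_
      · grind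
      · grind
      · simp [hf]
      · have := mem_cuts_append_self (pre := Q ++ (E₀ ++ x :: M) :: Ds ++ [Y])
          (cs := Z :: (E ++ D) :: mA') (by simp) (by simp)
        grind
      · have := mem_cuts_append_self (pre := Q ++ (E₀ ++ x :: M) :: Ds ++ [Y, Z])
          (cs := (E ++ D) :: mA') (by simp) (by simp)
        grind
  · intro s' hd' hp
    have hne := flatten_ne_of_critical hτ hd'
    have e : Q ++ (E₀ ++ M) :: (Ds ++ Y :: [x] :: Z :: mA) =
        (Q ++ (E₀ ++ M) :: Ds) ++ ([] ++ Y) :: [x] :: Z :: mA := by simp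
    have hc := hτ.isCell
    rw [e] at hd' hne hc
    have := HasPath.hop_eq hN hd' hc (α := Q.flatten ++ E₀) (m := M ++ (Ds ++ [Y]).flatten) ?_
      (by simp) (by simp [hf]) hxY hp hne
    · rw [this]; simp
    · intro y hy
      rcases List.mem_append.1 hy with hy | hy
      · exact h.gt_first y hy
      · obtain ⟨C, hC, hy⟩ := List.mem_flatten.1 hy
        rcases List.mem_append.1 hC with hC | hC
        · exact (h.gt C hC y hy).1
        · rw [List.mem_singleton.1 hC] at hy; exact (hY y hy).1

end LastToFront

/-! ### Which memories can read a given word. -/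

section Reads
variable {A : Type*} {R : A → A → Prop}

variable (R) in
/-- The word `r` can be read off after the block `P`. -/
def Reads (P r : List A) : Prop := ∃ m, (P :: m).IsChain (Link R) ∧ m.flatten = r

theorem reads_nil {P : List A} : Reads R P [] := ⟨[], by simp, rfl⟩

theorem Link.reads_iff {P B r : List A} (h : Link R P B) : Reads R P (B ++ r) ↔ Reads R B r := by
  constructor
  · rintro ⟨m, hm, hf⟩
    cases m with
    | nil => simp at hf; exact absurd hf.1 h.ne_nil
    | cons C m =>
      rw [List.isChain_cons_cons] at hm
      obtain ⟨rfl, hr⟩ := hm.1.unique h (r := m.flatten) (r' := r) (by simpa using hf)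
      exact ⟨m, hm.2, hr⟩
  · rintro ⟨m, hm, rfl⟩
    exact ⟨B :: m, List.isChain_cons_cons.2 ⟨h, hm⟩, by simp⟩

theorem Reads.exists_link {P r : List A} (h : Reads R P r) (hr : r ≠ []) :
    ∃ B r', r = B ++ r' ∧ Link R P B := by
  obtain ⟨m, hm, rfl⟩ := h
  cases m with
  | nil => simp at hr
  | cons B m => exact ⟨B, m.flatten, by simp, (List.isChain_cons_cons.1 hm).1⟩

/-- The first tile contains the first letter at which the word stops being good. -/
theorem Reads.exists_prefix {P D r : List A} (h : Reads R P (D ++ r)) (hp : (P ++ D).Pairwise R)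
    (hr : D ++ r ≠ []) : ∃ E r', E ≠ [] ∧ r = E ++ r' ∧ Link R P (D ++ E) := by
  obtain ⟨B, r', he, hl⟩ := h.exists_link hr
  obtain ⟨E, hE, rfl, rfl⟩ := hl.exists_append hp he
  exact ⟨E, r', hE, rfl, hl⟩

theorem exists_maximal_prefix {P : List A} : ∀ (r D : List A), (P ++ D).Pairwise R →
    ((P ++ D ++ r).Pairwise R) ∨ ∃ U c r', r = U ++ c :: r' ∧ (P ++ D ++ U).Pairwise R ∧
      ¬ (P ++ D ++ U ++ [c]).Pairwise R := by
  intro r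
  induction r with
  | nil => intro D h; left; simpa using h
  | cons c r ih =>
    intro D h
    by_cases hc : (P ++ (D ++ [c])).Pairwise R
    · rcases ih (D ++ [c]) hc with h1 | ⟨U, d, r', rfl, h1, h2⟩
      · left; simpa using h1
      · right; exact ⟨c :: U, d, r', by simp, by simpa using h1, by simpa using h2⟩
    · grind

theorem Link.of_stop {P U : List A} {c : A} (hU : (P ++ U).Pairwise R)
    (hc : (U ++ [c]).Pairwise R) (h : ¬ (P ++ U ++ [c]).Pairwise R) : Link R P (U ++ [c]) := by
  refine ⟨U, c, rfl, hc, hU, ?_⟩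
  grind

/-- The first tile cannot end within the compatible part `U`, so it contains `U ++ [c]`. -/
theorem Reads.pairwise_snoc {P U r : List A} {c : A} (h : Reads R P (U ++ c :: r))
    (hU : (P ++ U).Pairwise R) : (U ++ [c]).Pairwise R := by
  obtain ⟨E, r', hE, he, hl⟩ := h.exists_prefix hU (by simp)
  obtain ⟨d, E, rfl⟩ := List.exists_cons_of_ne_nil hE
  simp only [List.cons_append, List.cons.injEq] at he
  rw [he.1]
  exact hl.pairwise.sublist (List.Sublist.append_left (by simp) U)

theorem Reads.eq_nil {P r : List A} (h : Reads R P r) (hp : (P ++ r).Pairwise R) : r = [] := by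
  by_contra hr
  obtain ⟨E, r', hE, he, -⟩ := Reads.exists_prefix (D := r) (r := []) (by simpa using h) hp
    (by simpa using hr)
  exact hE (List.append_eq_nil_iff.1 he.symm).1

/-- Of the three readings with the memories `Z`, `Y ++ Z` and `Y`, two exist if one does. -/
theorem reads_of_two : ∀ (n : ℕ) (Y Z β : List A), β.length ≤ n → Z ≠ [] →
    (Y ++ Z).Pairwise R →
    (Reads R Z β → Reads R (Y ++ Z) β ∨ Reads R Y (Z ++ β)) ∧
    (Reads R (Y ++ Z) β → Reads R Z β ∨ Reads R Y (Z ++ β)) ∧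
    (Reads R Y (Z ++ β) → Reads R Z β ∨ Reads R (Y ++ Z) β) ∧
    ¬ (Reads R Z β ∧ Reads R (Y ++ Z) β ∧ Reads R Y (Z ++ β)) := by
  intro n
  induction n with
  | zero =>
    intro Y Z β hn hZ hYZ
    obtain rfl : β = [] := List.length_eq_zero_iff.1 (by omega)
    have h3 : ¬ Reads R Y Z := fun h => hZ (h.eq_nil hYZ)
    simp [reads_nil, h3]
  | succ n ih =>
    intro Y Z β hn hZ hYZ
    have hZp := (List.pairwise_append.1 hYZ).2.1
    -- Let `c` be the first letter that breaks compatibility of the running word. If there is none,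
    -- a nonempty `β` is unreadable for all three memories, and an empty one is unreadable for `Y`
    -- only, which would have to read `Z`.
    rcases exists_maximal_prefix (R := R) (P := Y ++ Z) β [] (by simpa using hYZ) with
      h | ⟨U, c, r, rfl, hU, hc⟩
    · rw [List.append_nil] at h
      have h3 : ¬ Reads R Y (Z ++ β) := fun h3 =>
        hZ (List.append_eq_nil_iff.1 (h3.eq_nil (by simpa using h))).1
      rcases eq_or_ne β [] with rfl | hβ
      · rw [List.append_nil] at h3
        simp [reads_nil, h3]
      · have h2 : ¬ Reads R (Y ++ Z) β := fun h2 => hβ (h2.eq_nil h)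
        have h1 : ¬ Reads R Z β := fun h1 => hβ (h1.eq_nil
          (by rw [List.append_assoc] at h; exact (List.pairwise_append.1 h).2.1))
        simp [h1, h2, h3]
    · rw [List.append_nil] at hU hc
      have hZU : (Z ++ U).Pairwise R := by
        grind
      have e : Z ++ (U ++ c :: r) = (Z ++ U) ++ c :: r := by simp
      have h3p : Reads R Y (Z ++ (U ++ c :: r)) → (Z ++ U ++ [c]).Pairwise R := by
        rw [e]; exact fun h => h.pairwise_snoc (by simpa using hU)
      have e2 : U ++ c :: r = (U ++ [c]) ++ r := by simp
      by_cases hUc : (U ++ [c]).Pairwise R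
      · have hl2 : Link R (Y ++ Z) (U ++ [c]) := Link.of_stop hU hUc hc
        by_cases hZc : (Z ++ U ++ [c]).Pairwise R
        · have hl3 : Link R Y (Z ++ U ++ [c]) := by
            refine Link.of_stop (by simpa using hU) hZc ?_
            simpa using hc
          -- The memory `Y` reads `Z ++ U ++ [c]` and the memory `Y ++ Z` reads `U ++ [c]`, while
          -- `Z` has not stopped yet. The three new memories are of the same form with `Z` and `U ++
          -- [c]` as new `Y` and `Z`.
          have := ih Z (U ++ [c]) r (by simp at hn; omega) (by simp) (by simpa using hZc)
          have e3 : Z ++ (U ++ c :: r) = (Z ++ U ++ [c]) ++ r := by simp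
          rw [e3, hl3.reads_iff, e2, hl2.reads_iff]
          grind
        -- Here `Z` and `Y ++ Z` read the same tile, so they are equivalent, while `Y` would need a
        -- tile that is not compatible in itself.
        · have hl1 : Link R Z (U ++ [c]) := Link.of_stop hZU hUc hZc
          have h3 := mt h3p hZc
          have h12 : Reads R Z (U ++ c :: r) ↔ Reads R (Y ++ Z) (U ++ c :: r) := by
            rw [e2, hl1.reads_iff, hl2.reads_iff]
          tauto
      · have h1 : ¬ Reads R Z (U ++ c :: r) := fun h => hUc (h.pairwise_snoc hZU)
        have h2 : ¬ Reads R (Y ++ Z) (U ++ c :: r) := fun h => hUc (h.pairwise_snoc hU)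
        grind

/-- Two tilings of the same word that cannot be continued are equal. -/
theorem chain_append_unique {m : List (List A)} : ∀ {m' : List (List A)} {P U U' : List A},
    (P :: m).IsChain (Link R) → (P :: m').IsChain (Link R) →
    (∀ b B, P :: m = b ++ [B] → (B ++ U).Pairwise R) →
    (∀ b B, P :: m' = b ++ [B] → (B ++ U').Pairwise R) →
    m.flatten ++ U = m'.flatten ++ U' → m = m' ∧ U = U' := by
  have aux : ∀ {P B U V : List A}, (P ++ U).Pairwise R → Link R P B → U ≠ B ++ V := by
    rintro P _ _ V hp ⟨X, c, rfl, -, -, y, hy, hyc⟩ rfl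
    exact hyc ((List.pairwise_append.1 hp).2.2 y hy c (by simp))
  induction m with
  | nil =>
    intro m' P U U' _ hm' h h' he
    cases m' with
    | nil => simpa using he
    | cons B m' =>
      rw [List.isChain_cons_cons] at hm'
      exact absurd (by simpa using he) (aux (V := m'.flatten ++ U') (h [] P rfl) hm'.1)
  | cons C m ih =>
    intro m' P U U' hm hm' h h' he
    rw [List.isChain_cons_cons] at hm
    cases m' with
    | nil => exact absurd (by simpa using he.symm) (aux (V := m.flatten ++ U) (h' [] P rfl) hm.1)
    | cons B m' =>
      rw [List.isChain_cons_cons] at hm'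
      obtain ⟨rfl, hf⟩ := hm.1.unique hm'.1 (r := m.flatten ++ U) (r' := m'.flatten ++ U')
        (by simpa using he)
      grind

end Reads

/-! ### Readings with a prescribed initial part. -/

section Prefix
variable {A : Type*} {R : A → A → Prop}

theorem chain_prefix {m' : List (List A)} : ∀ {m : List (List A)} {P r : List A},
    (P :: m).IsChain (Link R) → (P :: m').IsChain (Link R) → m.flatten = m'.flatten ++ r →
    ∃ m'', m = m' ++ m'' := by
  induction m' with
  | nil => intro m P r _ _ _; exact ⟨m, rfl⟩
  | cons B m' ih =>
    intro m P r hm hm' he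
    rw [List.isChain_cons_cons] at hm'
    cases m with
    | nil =>
      simp only [List.flatten_nil, List.flatten_cons, List.append_assoc] at he
      exact absurd (List.append_eq_nil_iff.1 he.symm).1 hm'.1.ne_nil
    | cons C m =>
      rw [List.isChain_cons_cons] at hm
      obtain ⟨rfl, hf⟩ := hm.1.unique hm'.1 (r := m.flatten) (r' := m'.flatten ++ r)
        (by simpa using he)
      grind

theorem CPrefix.isReading {pre m : List (List A)} {P : List A} (h : CPrefix R pre P)
    (hm : (P :: m).IsChain (Link R)) : IsReading R (pre ++ P :: m) := by
  obtain ⟨h1, s, hs⟩ := h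
  refine ⟨?_, s, ?_⟩
  · rw [List.isChain_append] at h1 ⊢
    grind
  · grind

/-- Because reading is deterministic, a word beginning with the letters of an initial part is read
with that very initial part. -/
theorem IsReading.exists_tail {ρ pre : List (List A)} {P r : List A} (hρ : IsReading R ρ)
    (h : CPrefix R pre P) (hf : ρ.flatten = (pre ++ [P]).flatten ++ r) :
    ∃ m, ρ = pre ++ P :: m ∧ (P :: m).IsChain (Link R) ∧ m.flatten = r := by
  obtain ⟨s, hs⟩ := hρ.2
  obtain ⟨s', hs'⟩ := h.2
  obtain ⟨ρ', rfl⟩ : ∃ ρ', ρ = [s] :: ρ' := by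
    cases ρ with
    | nil => simp at hs
    | cons B ρ => simp at hs; exact ⟨ρ, by rw [hs]⟩
  obtain ⟨c', hc'⟩ : ∃ c', pre ++ [P] = [s'] :: c' := by
    cases hp : pre ++ [P] with
    | nil => simp at hp
    | cons B c => rw [hp] at hs'; simp at hs'; exact ⟨c, by rw [hs']⟩
  rw [hc'] at hf
  simp only [List.flatten_cons, List.cons_append, List.nil_append, List.cons.injEq] at hf
  obtain ⟨rfl, hf⟩ := hf
  have hch := h.1
  rw [hc'] at hch
  obtain ⟨m, rfl⟩ := chain_prefix hρ.1 hch hf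
  have he : [s] :: (c' ++ m) = pre ++ P :: m := by
    grind
  refine ⟨m, he, ?_, by simpa using hf⟩
  rw [he] at hρ
  exact hρ.chain

theorem Link.insert {P₁ P₂ B : List A} {x : A} (h : Link R (P₁ ++ P₂) B)
    (hp : (P₁ ++ x :: P₂).Pairwise R) (hB : ∀ b ∈ B, R x b) : Link R (P₁ ++ x :: P₂) B := by
  obtain ⟨X, c, rfl, hXc, hX, y, hy, hyc⟩ := h
  refine ⟨X, c, rfl, hXc, ?_, y, ?_, hyc⟩
  all_goals grind

theorem pairwise_cons_of_rel {x : A} {l : List A} (h : l.Pairwise R) (hx : ∀ y ∈ l, R x y) :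
    ([x] ++ l).Pairwise R := List.pairwise_cons.2 ⟨hx, h⟩

end Prefix

/-! ### The two readings of a fiber and the path between them. -/

section Fiber
variable {A : Type*} [LinearOrder A] {N : A → A → Prop}

/-- The tiles after the place `Q` from which the letter `x` is moved to the right. -/
structure Fiber (N : A → A → Prop) (Q : List (List A)) (E₀ M : List A) (Ds : List (List A)) (x : A)
    (U β : List A) : Prop where
  reading : IsReading (Rel N) (Q ++ (E₀ ++ M) :: Ds)
  last : ∃ Q₀ s, Q = Q₀ ++ [[s]] ∧ s < x ∧ ¬ N s x
  eq_first : ∀ y ∈ E₀, y = x ∧ ¬ N x x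
  gt_first : ∀ y ∈ M, x < y ∧ ¬ N x y
  first_ne : M ≠ []
  gt : ∀ B ∈ Ds, ∀ y ∈ B, x < y ∧ ¬ N x y
  gt_rest : ∀ y ∈ U, x < y ∧ ¬ N x y
  maximal : ∀ b B, (E₀ ++ M) :: Ds = b ++ [B] → (B ++ U).Pairwise (Rel N)
  ending : (U = [] ∧ β = []) ∨ ∃ z β', β = z :: β' ∧ ¬ Rel N x z ∧ (U ++ [z]).Pairwise (Rel N)

/-- The words in which the letter `x` stands in front of the tiles, behind them, or before the
last one. -/
def FiberWord (Q : List (List A)) (E₀ M : List A) (Ds : List (List A)) (x : A) (r w : List A) :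
    Prop :=
  w = Q.flatten ++ E₀ ++ x :: (M ++ Ds.flatten ++ r) ∨
  w = Q.flatten ++ E₀ ++ M ++ Ds.flatten ++ x :: r ∨
  ∃ Ds' Y, Ds = Ds' ++ [Y] ∧ w = Q.flatten ++ E₀ ++ M ++ Ds'.flatten ++ x :: (Y ++ r)

variable {Q : List (List A)} {E₀ M : List A} {Ds : List (List A)} {x : A} {U β : List A}

theorem Fiber.corridor (h : Fiber N Q E₀ M Ds x U β) : Corridor N Q E₀ M Ds x where
  reading := h.reading
  gt_first y hy := (h.gt_first y hy).1
  gt := h.gt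
  first_ne := h.first_ne
  pairwise := by
    have hp := (h.reading.isCell (E₀ ++ M) (by simp)).2
    rw [List.pairwise_append] at hp ⊢
    refine ⟨hp.1, List.pairwise_cons.2 ⟨fun y hy => ⟨(h.gt_first y hy).1.le, (h.gt_first y hy).2⟩,
      hp.2.1⟩, ?_⟩
    intro a ha b hb
    rcases List.mem_cons.1 hb with rfl | hb
    · obtain ⟨rfl, hN⟩ := h.eq_first a ha
      exact ⟨le_rfl, hN⟩
    · exact hp.2.2 a ha b hb

/-- The tiles in front of the letter `x` put behind them, as memories. -/
theorem Corridor.cPrefix_back (hN : Symmetric N) (h : Corridor N Q E₀ M Ds x) :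
    CPrefix (Rel N) (Q ++ (E₀ ++ M) :: Ds) [x] := by
  refine ⟨?_, ?_⟩
  · have h1 := h.reading.1
    rw [List.isChain_append]
    refine ⟨h1, by simp, ?_⟩
    intro B hB C hC
    simp only [List.head?_cons, Option.mem_some_iff] at hC
    subst hC
    have hmem := List.mem_of_getLast? hB
    have hBc := h.reading.isCell B hmem
    refine ⟨[], x, rfl, List.pairwise_singleton _ _, by simpa using hBc.2, ?_⟩
    suffices h2 : ∃ y ∈ B, x < y by
      obtain ⟨y, hy, hxy⟩ := h2
      exact ⟨y, hy, fun hr => absurd hr.1 (not_le.2 hxy)⟩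
    rcases List.eq_nil_or_concat Ds with rfl | ⟨Ds', D, rfl⟩
    · obtain ⟨y, M', rfl⟩ := List.exists_cons_of_ne_nil h.first_ne
      simp at hB
      exact ⟨y, by rw [← hB]; simp, h.gt_first y (by simp)⟩
    · rw [List.concat_eq_append] at hB
      have : Q ++ (E₀ ++ M) :: (Ds' ++ [D]) = (Q ++ (E₀ ++ M) :: Ds') ++ [D] := by simp
      rw [this, List.getLast?_concat] at hB
      obtain rfl := Option.some.inj hB
      obtain ⟨y, D', rfl⟩ := List.exists_cons_of_ne_nil hBc.1
      exact ⟨y, by simp, (h.gt (y :: D') (by simp) y (by simp)).1⟩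
  · obtain ⟨s, hs⟩ := h.reading.2
    refine ⟨s, ?_⟩
    cases Q <;> simpa using hs

/-- The reading with the letter `x` in front. -/
theorem Fiber.reading_front (h : Fiber N Q E₀ M Ds x U β) :
    IsReading (Rel N) (Q ++ (E₀ ++ x :: M) :: Ds) := by
  obtain ⟨Q₀, s, rfl, hsx, hN⟩ := h.last
  have hr := h.reading
  have hp := h.corridor.pairwise
  rw [List.append_assoc, List.singleton_append] at hr ⊢
  refine hr.cPrefix.isReading ?_
  have hch := hr.chain
  rw [List.isChain_cons_cons] at hch ⊢
  refine ⟨?_, ?_⟩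
  · obtain ⟨X, c, hX, -, hsX, y, hy, hyc⟩ := hch.1
    rw [List.mem_singleton] at hy
    subst hy
    rcases List.eq_nil_or_concat M with hM | ⟨M', d, rfl⟩
    · exact absurd hM h.first_ne
    rw [List.concat_eq_append] at hp ⊢
    rw [List.concat_eq_append, ← List.append_assoc] at hX
    obtain ⟨rfl, hd⟩ := List.append_inj' hX rfl
    simp only [List.cons.injEq, and_true] at hd
    subst hd
    refine ⟨E₀ ++ x :: M', d, by simp, by simpa using hp, ?_, y, by simp, hyc⟩
    have hEM : (E₀ ++ x :: M').Pairwise (Rel N) := by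
      refine hp.sublist ?_
      simp
    refine List.pairwise_append.2 ⟨List.pairwise_singleton _ _, hEM, ?_⟩
    intro a ha b hb
    rw [List.mem_singleton] at ha
    subst ha
    have hsX := (List.pairwise_append.1 hsX).2.2 _ (List.mem_singleton_self _)
    simp only [List.mem_append, List.mem_cons] at hb
    rcases hb with hb | rfl | hb
    · exact hsX b (by simp [hb])
    · exact ⟨hsx.le, hN⟩
    · exact hsX b (by simp [hb])
  · cases Ds with
    | nil => simp
    | cons D Ds =>
      rw [List.isChain_cons_cons] at hch ⊢
      refine ⟨hch.2.1.insert hp fun b hb => ?_, hch.2.2⟩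
      have := h.gt D (by simp) b hb
      exact ⟨this.1.le, this.2⟩

/-- A reading with the letter in one of the three positions is determined by how the rest of the
word is read, so existence depends only on the memory with which that rest is met. Either the
position before the last tile drops out and the other two share their tail, or `reads_of_two` says
that exactly two of the three occur. -/
theorem Fiber.exists_pair (hN : Symmetric N) (h : Fiber N Q E₀ M Ds x U β) {ρ : List (List A)}
    (hρ : IsReading (Rel N) ρ) (hw : FiberWord Q E₀ M Ds x (U ++ β) ρ.flatten) :
    ∃ τ σ, IsReading (Rel N) τ ∧ IsReading (Rel N) σ ∧
      FiberWord Q E₀ M Ds x (U ++ β) τ.flatten ∧ FiberWord Q E₀ M Ds x (U ++ β) σ.flatten ∧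
      (∃! q, CritPath (Rel N) τ σ q) ∧
      ∀ ρ', IsReading (Rel N) ρ' → FiberWord Q E₀ M Ds x (U ++ β) ρ'.flatten →
        ρ' = τ ∨ ρ' = σ := by
  have hback := h.corridor.cPrefix_back hN
  have hxU : ∀ y ∈ U, Rel N x y := fun y hy => ⟨(h.gt_rest y hy).1.le, (h.gt_rest y hy).2⟩
  -- the three readings
  have eA : ∀ m, Q ++ (E₀ ++ M) :: (Ds ++ [x] :: m) = (Q ++ (E₀ ++ M) :: Ds) ++ [x] :: m := by simp
  have hAto : ∀ ρ, IsReading (Rel N) ρ →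
      ρ.flatten = Q.flatten ++ E₀ ++ M ++ Ds.flatten ++ x :: (U ++ β) →
      ∃ m, ρ = Q ++ (E₀ ++ M) :: (Ds ++ [x] :: m) ∧ ([x] :: m).IsChain (Link (Rel N)) ∧
        m.flatten = U ++ β := by
    intro ρ hρ hf
    obtain ⟨m, rfl, h1, h2⟩ := hρ.exists_tail hback (r := U ++ β) (by rw [hf]; simp)
    exact ⟨m, by simp, h1, h2⟩
  have hAof : ∀ m, ([x] :: m).IsChain (Link (Rel N)) →
      IsReading (Rel N) (Q ++ (E₀ ++ M) :: (Ds ++ [x] :: m)) := by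
    intro m hm; rw [eA]; exact hback.isReading hm
  have hAw : ∀ m, m.flatten = U ++ β → FiberWord Q E₀ M Ds x (U ++ β)
      (Q ++ (E₀ ++ M) :: (Ds ++ [x] :: m)).flatten := by
    intro m hm; right; left; simp [hm]
  obtain ⟨preC, PC, hpC⟩ : ∃ pre P, Q ++ (E₀ ++ x :: M) :: Ds = pre ++ [P] := by
    rcases List.eq_nil_or_concat (Q ++ (E₀ ++ x :: M) :: Ds) with h | ⟨pre, P, h⟩
    · simp at h
    · exact ⟨pre, P, by simpa using h⟩
  have hfront := h.reading_front
  rw [hpC] at hfront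
  have hfp : CPrefix (Rel N) preC PC := hfront
  have eC : ∀ m, Q ++ (E₀ ++ x :: M) :: (Ds ++ m) = preC ++ PC :: m := by
    grind
  have hCto : ∀ ρ, IsReading (Rel N) ρ →
      ρ.flatten = Q.flatten ++ E₀ ++ x :: (M ++ Ds.flatten ++ (U ++ β)) →
      ∃ m, ρ = Q ++ (E₀ ++ x :: M) :: (Ds ++ m) ∧ (PC :: m).IsChain (Link (Rel N)) ∧
        m.flatten = U ++ β := by
    intro ρ hρ hf
    obtain ⟨m, rfl, h1, h2⟩ := hρ.exists_tail hfp (r := U ++ β) (by rw [hf, ← hpC]; simp)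
    exact ⟨m, (eC m).symm, h1, h2⟩
  have hCof : ∀ m, (PC :: m).IsChain (Link (Rel N)) →
      IsReading (Rel N) (Q ++ (E₀ ++ x :: M) :: (Ds ++ m)) := by
    intro m hm; rw [eC]; exact hfp.isReading hm
  have hCw : ∀ m, m.flatten = U ++ β → FiberWord Q E₀ M Ds x (U ++ β)
      (Q ++ (E₀ ++ x :: M) :: (Ds ++ m)).flatten := by
    intro m hm; left; simp [hm]
  -- the readings with `x` in front and behind have the same tail
  have same : (∀ m, m.flatten = U ++ β →
        (([x] :: m).IsChain (Link (Rel N)) ↔ (PC :: m).IsChain (Link (Rel N)))) →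
      (∀ Ds' D, Ds = Ds' ++ [D] → Blocked (Rel N) x (D ++ (U ++ β))) →
      (∀ ρ', IsReading (Rel N) ρ' → ∀ Ds' Y, Ds = Ds' ++ [Y] →
        ρ'.flatten ≠ Q.flatten ++ E₀ ++ M ++ Ds'.flatten ++ x :: (Y ++ (U ++ β))) →
      ∃ τ σ, IsReading (Rel N) τ ∧ IsReading (Rel N) σ ∧
      FiberWord Q E₀ M Ds x (U ++ β) τ.flatten ∧ FiberWord Q E₀ M Ds x (U ++ β) σ.flatten ∧
      (∃! q, CritPath (Rel N) τ σ q) ∧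
      ∀ ρ', IsReading (Rel N) ρ' → FiberWord Q E₀ M Ds x (U ++ β) ρ'.flatten →
        ρ' = τ ∨ ρ' = σ := by
    intro hs hbl hB
    obtain ⟨m, h1, h2, hm⟩ : ∃ m, ([x] :: m).IsChain (Link (Rel N)) ∧
        (PC :: m).IsChain (Link (Rel N)) ∧ m.flatten = U ++ β := by
      rcases hw with hw | hw | ⟨Ds', Y, hD, hw⟩
      · obtain ⟨m, -, h1, h2⟩ := hCto ρ hρ hw
        exact ⟨m, (hs m h2).2 h1, h1, h2⟩
      · obtain ⟨m, -, h1, h2⟩ := hAto ρ hρ hw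
        exact ⟨m, h1, (hs m h2).1 h1, h2⟩
      · exact absurd hw (hB ρ hρ Ds' Y hD)
    refine ⟨_, _, hAof m h1, hCof m h2, hAw m hm, hCw m hm,
      h.corridor.existsUnique_same_tail hN (hAof m h1) (hCof m h2) (by rw [hm]; exact hbl), ?_⟩
    intro ρ' hρ' hw'
    rcases hw' with hw' | hw' | ⟨Ds', Y, hD, hw'⟩
    · right; exact hρ'.unique (hCof m h2) (by rw [hw']; simp [hm])
    · left; exact hρ'.unique (hAof m h1) (by rw [hw']; simp [hm])
    · exact absurd hw' (hB ρ' hρ' Ds' Y hD)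
  have chain_cons : ∀ {P P' B : List A} {m : List (List A)} {r : List A}, Link (Rel N) P B →
      Link (Rel N) P' B → m.flatten = B ++ r → (P :: m).IsChain (Link (Rel N)) →
      (P' :: m).IsChain (Link (Rel N)) := by
    intro P P' B m r hl hl' hf hm
    cases m with
    | nil => simp
    | cons C m =>
      rw [List.isChain_cons_cons] at hm ⊢
      obtain ⟨rfl, -⟩ := hm.1.unique hl (r := m.flatten) (r' := r) (by simpa using hf)
      exact ⟨hl', hm.2⟩
  have hUp : U.Pairwise (Rel N) := by
    obtain ⟨b, B, hb⟩ : ∃ b B, (E₀ ++ M) :: Ds = b ++ [B] := by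
      rcases List.eq_nil_or_concat ((E₀ ++ M) :: Ds) with h | ⟨b, B, h⟩
      · simp at h
      · exact ⟨b, B, by simpa using h⟩
    exact (List.pairwise_append.1 (h.maximal b B hb)).2.1
  -- If nothing follows, the tails in front and behind are empty, and with `x` before the last tile
  -- that tile could not be read, being compatible with `x`.
  rcases h.ending with ⟨rfl, rfl⟩ | ⟨z, β', rfl, hz, hUz⟩
  · refine same ?_ ?_ ?_
    · intro m hm
      have : m = [] ∨ ∃ B m', m = B :: m' := by cases m <;> simp
      have hnn : ∀ P B (m' : List (List A)), m = B :: m' → ¬ (P :: m).IsChain (Link (Rel N)) := by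
        rintro P B m' rfl hch
        rw [List.isChain_cons_cons] at hch
        simp at hm
        exact hch.1.ne_nil hm.1
      rcases this with rfl | ⟨B, m', hm'⟩
      all_goals grind
    · intro Ds' D hD l₁ z l₂ he hz
      have hzD : z ∈ D := by
        grind
      have := h.gt D (by rw [hD]; simp) z hzD
      exact absurd ⟨this.1.le, this.2⟩ hz
    · intro ρ' hρ' Ds' Y hD hf
      have hY := h.reading.isCell Y (by rw [hD]; simp)
      have hc' : Corridor N Q E₀ M Ds' x := by have := h.corridor; rw [hD] at this; exact this.dropLast
      obtain ⟨m, -, h1, h2⟩ := hρ'.exists_tail (hc'.cPrefix_back hN) (r := Y) (by rw [hf]; simp)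
      refine hY.1 (Reads.eq_nil ⟨m, h1, h2⟩ (pairwise_cons_of_rel hY.2 fun y hy => ?_))
      have := h.gt Y (by rw [hD]; simp) y hy
      exact ⟨this.1.le, this.2⟩
  · have hlx : Link (Rel N) [x] (U ++ [z]) :=
      ⟨U, z, rfl, hUz, pairwise_cons_of_rel hUp hxU, x, by simp, hz⟩
    have eU : U ++ z :: β' = (U ++ [z]) ++ β' := by simp
    rcases List.eq_nil_or_concat Ds with hDs | ⟨Ds', Y, hDs⟩
    · have hPC : PC = E₀ ++ x :: M := by
        rw [hDs] at hpC
        have := congrArg List.getLast? hpC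
        simpa using this.symm
      have hlC : Link (Rel N) PC (U ++ [z]) := by
        refine ⟨U, z, rfl, hUz, ?_, x, by rw [hPC]; simp, hz⟩
        have h1 := h.maximal [] (E₀ ++ M) (by rw [hDs]; rfl)
        rw [hPC]
        refine List.pairwise_append.2 ⟨h.corridor.pairwise, hUp, ?_⟩
        intro a ha b hb
        simp only [List.mem_append, List.mem_cons] at ha
        rcases ha with ha | rfl | ha
        · exact (List.pairwise_append.1 h1).2.2 a (by simp [ha]) b hb
        · exact hxU b hb
        · exact (List.pairwise_append.1 h1).2.2 a (by simp [ha]) b hb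
      refine same ?_ ?_ ?_
      · grind
      · intro Ds' D hD; rw [hDs] at hD; simp at hD
      · intro ρ' _ Ds' Y hD; rw [hDs] at hD; simp at hD
    · rw [List.concat_eq_append] at hDs
      have hPC : PC = Y := by
        rw [hDs] at hpC
        have := congrArg List.getLast? hpC
        rw [List.getLast?_concat] at this
        have e : Q ++ (E₀ ++ x :: M) :: (Ds' ++ [Y]) = (Q ++ (E₀ ++ x :: M) :: Ds') ++ [Y] := by simp
        grind
      have hYc := h.reading.isCell Y (by rw [hDs]; simp)
      have hYx : ∀ y ∈ Y, x < y ∧ ¬ N x y := h.gt Y (by rw [hDs]; simp)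
      have hYx' : ∀ y ∈ Y, Rel N x y := fun y hy => ⟨(hYx y hy).1.le, (hYx y hy).2⟩
      have hYU : (Y ++ U).Pairwise (Rel N) := h.maximal ((E₀ ++ M) :: Ds') Y (by rw [hDs]; rfl)
      have hc' : Corridor N Q E₀ M Ds' x := by
        have := h.corridor; rw [hDs] at this; exact this.dropLast
      have hBto : ∀ ρ, IsReading (Rel N) ρ → ρ.flatten = Q.flatten ++ E₀ ++ M ++ Ds'.flatten ++
            x :: (Y ++ (U ++ z :: β')) →
          ∃ m, ρ = Q ++ (E₀ ++ M) :: (Ds' ++ [x] :: m) ∧ ([x] :: m).IsChain (Link (Rel N)) ∧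
            m.flatten = Y ++ U ++ z :: β' := by
        intro ρ hρ hf
        obtain ⟨m, rfl, h1, h2⟩ := hρ.exists_tail (hc'.cPrefix_back hN) (r := Y ++ U ++ z :: β')
          (by rw [hf]; simp)
        exact ⟨m, by simp, h1, h2⟩
      have hYinj : ∀ Ds₁ Y₁, Ds = Ds₁ ++ [Y₁] → Ds₁ = Ds' ∧ Y₁ = Y := by
        intro Ds₁ Y₁ h1
        rw [hDs] at h1
        obtain ⟨h2, h3⟩ := List.append_inj' h1 rfl
        grind
      -- If `z` fits behind `Y ++ U`, then with `Z := U ++ [z]` the letter behind, before the last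
      -- tile and in front leaves the rest to the memories `Z`, `Y ++ Z` and `Y`. If not, `U ++ [z]`
      -- is the tile after `x` as well as after `Y`, and the middle position has no reading.
      by_cases hYZ : (Y ++ U ++ [z]).Pairwise (Rel N)
      · have hZ0 : U ++ [z] ≠ [] := by simp
        have hlB : Link (Rel N) [x] (Y ++ (U ++ [z])) := by
          refine ⟨Y ++ U, z, by simp, by simpa using hYZ, pairwise_cons_of_rel hYU ?_, x, by simp, hz⟩
          grind
        obtain ⟨t1, t2, t3, t4⟩ := reads_of_two β'.length Y (U ++ [z]) β' le_rfl hZ0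
          (by simpa using hYZ)
        -- the readings in terms of the three memories
        have kA : ∀ ρ, IsReading (Rel N) ρ →
            ρ.flatten = Q.flatten ++ E₀ ++ M ++ Ds.flatten ++ x :: (U ++ z :: β') →
            Reads (Rel N) (U ++ [z]) β' := by
          intro ρ hρ hf
          obtain ⟨m, -, h1, h2⟩ := hAto ρ hρ hf
          exact hlx.reads_iff.1 ⟨m, h1, by rw [h2, eU]⟩
        have kB : ∀ ρ, IsReading (Rel N) ρ → ρ.flatten = Q.flatten ++ E₀ ++ M ++ Ds'.flatten ++
            x :: (Y ++ (U ++ z :: β')) → Reads (Rel N) (Y ++ (U ++ [z])) β' := by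
          intro ρ hρ hf
          obtain ⟨m, -, h1, h2⟩ := hBto ρ hρ hf
          exact hlB.reads_iff.1 ⟨m, h1, by rw [h2]; simp⟩
        have kC : ∀ ρ, IsReading (Rel N) ρ →
            ρ.flatten = Q.flatten ++ E₀ ++ x :: (M ++ Ds.flatten ++ (U ++ z :: β')) →
            Reads (Rel N) Y (U ++ [z] ++ β') := by
          intro ρ hρ hf
          obtain ⟨m, -, h1, h2⟩ := hCto ρ hρ hf
          exact ⟨m, by rwa [hPC] at h1, by rw [h2, eU]⟩
        have rA : ∀ m, ((U ++ [z]) :: m).IsChain (Link (Rel N)) → IsReading (Rel N)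
            (Q ++ (E₀ ++ M) :: (Ds' ++ Y :: [x] :: (U ++ [z]) :: m)) := by
          intro m hm
          have := hAof ((U ++ [z]) :: m) (List.isChain_cons_cons.2 ⟨hlx, hm⟩)
          rw [hDs] at this
          simpa using this
        have rB : ∀ m, ((Y ++ (U ++ [z])) :: m).IsChain (Link (Rel N)) → IsReading (Rel N)
            (Q ++ (E₀ ++ M) :: (Ds' ++ [x] :: (Y ++ (U ++ [z])) :: m)) := by
          intro m hm
          have := (hc'.cPrefix_back hN).isReading (List.isChain_cons_cons.2 ⟨hlB, hm⟩)
          simpa using this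
        have rC : ∀ m, (Y :: m).IsChain (Link (Rel N)) → IsReading (Rel N)
            (Q ++ (E₀ ++ x :: M) :: (Ds' ++ Y :: m)) := by
          intro m hm
          have := hCof m (by rwa [hPC])
          rw [hDs] at this
          simpa using this
        have hblB : ∀ (r : List A) Ds₁ D, Ds' = Ds₁ ++ [D] →
            Blocked (Rel N) x (D ++ Y ++ r) := by
          intro r Ds₁ D hD l₁ z' l₂ he hz' hp
          have hl : Link (Rel N) D Y := by
            have hr := h.reading
            rw [hDs, hD] at hr
            have : IsReading (Rel N) ((Q ++ (E₀ ++ M) :: Ds₁) ++ D :: Y :: []) := by simpa using hr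
            exact this.link
          obtain ⟨X, c, rfl, -, -, y, hy, hyc⟩ := hl
          have hDY : ∀ y ∈ D ++ (X ++ [c]), Rel N x y := by
            intro y hy
            rcases List.mem_append.1 hy with hy | hy
            · have := h.gt D (by rw [hDs, hD]; simp) y hy
              exact ⟨this.1.le, this.2⟩
            · exact hYx' y hy
          rcases List.append_eq_append_iff.1 he with ⟨a', h1, h2⟩ | ⟨c', h1, h2⟩
          · rw [h1] at hp
            have := (List.pairwise_append.1 (List.pairwise_append.1 (List.pairwise_append.1 hp).1).1).2.2
              y hy c (by simp)
            exact hyc this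
          · cases c' with
            | nil =>
              rw [List.append_nil] at h1
              have := (List.pairwise_append.1 (h1 ▸ (List.pairwise_append.1 hp).1)).2.2 y hy c
                (by simp)
              exact hyc this
            | cons v c' =>
              simp only [List.cons_append, List.cons.injEq] at h2
              exact hz' (hDY z' (by rw [h1, h2.1]; simp))
        -- The three possible pairs are joined by `existsUnique_last_to_middle`,
        -- `Corridor.existsUnique_last_to_front` and `Corridor.existsUnique_middle_to_front`.
        by_cases hA : Reads (Rel N) (U ++ [z]) β'
        · obtain ⟨mA, hmA, hfA⟩ := id hA
          by_cases hB : Reads (Rel N) (Y ++ (U ++ [z])) β'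
          · have hC : ¬ Reads (Rel N) Y (U ++ [z] ++ β') := fun hC => t4 ⟨hA, hB, hC⟩
            obtain ⟨mB, hmB, hfB⟩ := id hB
            have hrA := rA mA hmA
            have hrB := rB mB hmB
            obtain ⟨pre, P, hpP⟩ : ∃ pre P, Q ++ (E₀ ++ M) :: Ds' = pre ++ [P] := by
              rcases List.eq_nil_or_concat (Q ++ (E₀ ++ M) :: Ds') with h | ⟨pre, P, h⟩
              · simp at h
              · exact ⟨pre, P, by simpa using h⟩
            have e3 : ∀ m, Q ++ (E₀ ++ M) :: (Ds' ++ m) = pre ++ P :: m := by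
              intro m
              have : Q ++ (E₀ ++ M) :: (Ds' ++ m) = (Q ++ (E₀ ++ M) :: Ds') ++ m := by simp
              rw [this, hpP]; simp
            refine ⟨_, _, hrA, hrB, ?_, ?_, ?_, ?_⟩
            · right; left; rw [hDs]; simp [hfA]
            · right; right; exact ⟨Ds', Y, hDs, by simp [hfB]⟩
            · rw [e3] at hrA hrB
              rw [e3, e3]
              exact existsUnique_last_to_middle hN hrA hrB hYx (by rw [hfA, hfB])
            · rintro ρ' hρ' (hw' | hw' | ⟨Ds₁, Y₁, hD, hw'⟩)
              · exact absurd (kC ρ' hρ' hw') hC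
              · left; exact hρ'.unique hrA (by rw [hw', hDs]; simp [hfA])
              · obtain ⟨rfl, rfl⟩ := hYinj _ _ hD
                right; exact hρ'.unique hrB (by rw [hw']; simp [hfB])
          · have hC : Reads (Rel N) Y (U ++ [z] ++ β') := (t1 hA).resolve_left hB
            obtain ⟨mC, hmC, hfC⟩ := id hC
            refine ⟨_, _, rA mA hmA, rC mC hmC, ?_, ?_, ?_, ?_⟩
            · right; left; rw [hDs]; simp [hfA]
            · left; rw [hDs]; simp [hfC]
            · refine hc'.existsUnique_last_to_front hN (rA mA hmA) (rC mC hmC) ?_ hYx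
                (by rw [hfC, hfA]) ?_
              · have := (hc'.cPrefix_back hN).snoc hlB
                exact this
              · intro Ds₁ D hD
                have := hblB ((U ++ [z]) ++ mA.flatten) Ds₁ D hD
                simpa using this
            · rintro ρ' hρ' (hw' | hw' | ⟨Ds₁, Y₁, hD, hw'⟩)
              · right; exact hρ'.unique (rC mC hmC) (by rw [hw', hDs]; simp [hfC])
              · left; exact hρ'.unique (rA mA hmA) (by rw [hw', hDs]; simp [hfA])
              · grind
        · have hBC : Reads (Rel N) (Y ++ (U ++ [z])) β' ∧ Reads (Rel N) Y (U ++ [z] ++ β') := by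
            rcases hw with hw | hw | ⟨Ds₁, Y₁, hD, hw⟩
            all_goals grind
          obtain ⟨⟨mB, hmB, hfB⟩, ⟨mC, hmC, hfC⟩⟩ := hBC
          refine ⟨_, _, rB mB hmB, rC mC hmC, ?_, ?_, ?_, ?_⟩
          · right; right; exact ⟨Ds', Y, hDs, by simp [hfB]⟩
          · left; rw [hDs]; simp [hfC]
          · refine hc'.existsUnique_middle_to_front hN (rB mB hmB) (rC mC hmC) hZ0
              (by rw [hfC, hfB]) ?_
            intro Ds₁ D hD
            have := hblB ((U ++ [z]) ++ mB.flatten) Ds₁ D hD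
            simpa using this
          · rintro ρ' hρ' (hw' | hw' | ⟨Ds₁, Y₁, hD, hw'⟩)
            · right; exact hρ'.unique (rC mC hmC) (by rw [hw', hDs]; simp [hfC])
            · exact absurd (kA ρ' hρ' hw') hA
            · obtain ⟨rfl, rfl⟩ := hYinj _ _ hD
              left; exact hρ'.unique (rB mB hmB) (by rw [hw']; simp [hfB])
      · have hlC : Link (Rel N) PC (U ++ [z]) := by
          rw [hPC]; exact Link.of_stop hYU hUz hYZ
        refine same ?_ ?_ ?_
        · grind
        · intro Ds₁ D hD l₁ z' l₂ he hz' hp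
          obtain ⟨rfl, rfl⟩ := hYinj _ _ hD
          have hDU : ∀ y ∈ D ++ U, Rel N x y := by
            grind
          rw [← List.append_assoc] at he
          rcases List.append_eq_append_iff.1 he with ⟨a', h1, h2⟩ | ⟨c', h1, h2⟩
          · cases a' with
            | nil =>
              grind
            | cons v a' =>
              simp only [List.cons_append, List.cons.injEq] at h2
              refine hYZ (hp.sublist ?_)
              rw [h1, h2.1]
              simp
          · cases c' with
            | nil =>
              grind
            | cons v c' =>
              simp only [List.cons_append, List.cons.injEq] at h2
              exact hz' (hDU z' (by rw [h1, h2.1]; simp))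
        · intro ρ' hρ' Ds₁ Y₁ hD hf
          obtain ⟨rfl, rfl⟩ := hYinj _ _ hD
          obtain ⟨m, -, h1, h2⟩ := hBto ρ' hρ' hf
          refine hYZ (Reads.pairwise_snoc (P := [x]) (U := Y₁ ++ U) (r := β') ⟨m, h1, by rw [h2]⟩
            (pairwise_cons_of_rel hYU ?_))
          grind

end Fiber

/-! ### The toggled letter of a word. -/

section Toggle
variable {A : Type*} [LinearOrder A] (N : A → A → Prop)

/-- After the prefix `u`, the letter `a` can be moved to the left across letters `≥ a` and then
across a smaller letter. -/
def CandAt (u : List A) (a : A) : Prop :=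
  ∃ u₀ s mid, u = u₀ ++ s :: mid ∧ s < a ∧ ¬ N s a ∧ ∀ y ∈ mid, Rel N a y

/-- The last one of the least letters that can be moved to the left. -/
def Tog (w u : List A) (x : A) (v : List A) : Prop :=
  w = u ++ x :: v ∧ CandAt N u x ∧ ∀ u' a v', w = u' ++ a :: v' → CandAt N u' a →
    x ≤ a ∧ (a = x → v.count x ≤ v'.count x)

variable {N}

/-- The smaller letter to be crossed cannot lie in `mid`, whose letters are at least `a` and commute
with it. -/
theorem candAt_append_right {u mid : List A} {a : A} (h : ∀ y ∈ mid, Rel N a y) :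
    CandAt N (u ++ mid) a ↔ CandAt N u a := by
  constructor
  · rintro ⟨u₀, s, m, he, hs, hN, hm⟩
    rcases List.append_eq_append_iff.1 he with ⟨c, h1, h2⟩ | ⟨c, h1, h2⟩
    · exfalso
      have : s ∈ mid := by rw [h2]; simp
      exact absurd (h s this).1 (not_le.2 hs)
    · cases c with
      | nil =>
        exfalso
        have : s ∈ mid := by
          grind
        exact absurd (h s this).1 (not_le.2 hs)
      | cons d c =>
        simp only [List.cons_append, List.cons.injEq] at h2
        obtain ⟨rfl, rfl⟩ := h2
        exact ⟨u₀, s, c, h1, hs, hN, fun y hy => hm y (by simp [hy])⟩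
  · rintro ⟨u₀, s, m, rfl, hs, hN, hm⟩
    refine ⟨u₀, s, m ++ mid, by simp, hs, hN, fun y hy => ?_⟩
    grind

omit [LinearOrder A] in
theorem split_of_two {p q u v : List A} {c d y : A} (h : p ++ c :: d :: q = u ++ y :: v) :
    (∃ p', p = u ++ y :: p' ∧ v = p' ++ c :: d :: q) ∨ (u = p ∧ y = c ∧ v = d :: q) ∨
    (u = p ++ [c] ∧ y = d ∧ v = q) ∨ (∃ q', u = p ++ c :: d :: q' ∧ q = q' ++ y :: v) := by
  rcases List.append_eq_append_iff.1 h with ⟨e, h1, h2⟩ | ⟨e, h1, h2⟩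
  · rcases e with _ | ⟨e₁, _ | ⟨e₂, e⟩⟩
    all_goals grind
  · rcases e with _ | ⟨e₁, e⟩
    all_goals grind

theorem CandAt.swap {p q : List A} {c d a : A} (hc : a ≤ c) (hd : a ≤ d)
    (h : CandAt N (p ++ c :: d :: q) a) : CandAt N (p ++ d :: c :: q) a := by
  obtain ⟨u₀, s, mid, he, hs, hN, hm⟩ := h
  rcases split_of_two he with ⟨p', rfl, rfl⟩ | ⟨-, rfl, -⟩ | ⟨-, rfl, -⟩ | ⟨q', rfl, rfl⟩
  · refine ⟨u₀, s, p' ++ d :: c :: q, by simp, hs, hN, fun y hy => hm y ?_⟩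
    simp only [List.mem_append, List.mem_cons] at hy ⊢
    tauto
  · exact absurd hs (not_lt.2 hc)
  · exact absurd hs (not_lt.2 hd)
  · exact ⟨p ++ d :: c :: q', s, mid, by simp, hs, hN, hm⟩

/-- Following an occurrence of a letter through a swap of larger or equal letters. -/
theorem CandAt.exists_swap (hN : Symmetric N) {p q u v : List A} {c d y : A} (hcd : c ≠ d)
    (hNcd : ¬ N c d) (hc : y ≤ c) (hd : y ≤ d) (h : p ++ c :: d :: q = u ++ y :: v)
    (hy : CandAt N u y) : ∃ u' v', p ++ d :: c :: q = u' ++ y :: v' ∧ CandAt N u' y ∧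
      v'.count y = v.count y ∧
      ((y = d ∧ u = p ++ [c] ∧ v = q ∧ u' = p ∧ v' = c :: q) ∨
       (y = c ∧ u = p ∧ v = d :: q ∧ u' = p ++ [d] ∧ v' = q) ∨
        ∃ p' q', u ++ v = p' ++ c :: d :: q' ∧ u' ++ v' = p' ++ d :: c :: q') := by
  rcases split_of_two h with ⟨p', rfl, rfl⟩ | ⟨rfl, rfl, rfl⟩ | ⟨rfl, rfl, rfl⟩ | ⟨q', rfl, rfl⟩
  · refine ⟨u, p' ++ d :: c :: q, by simp, hy, ?_, Or.inr (Or.inr ⟨u ++ p', q, by simp, by simp⟩)⟩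
    simp only [List.count_append, List.count_cons]; omega
  · exact ⟨u ++ [d], q, by simp, (candAt_append_right (by simpa using ⟨hd, hNcd⟩)).2 hy,
      by simp [hcd.symm], Or.inr (Or.inl ⟨rfl, rfl, rfl, rfl, rfl⟩)⟩
  · exact ⟨p, c :: v, by simp, (candAt_append_right
      (by simpa using ⟨hc, fun h => hNcd (hN h)⟩)).1 hy, by simp [hcd],
      Or.inl ⟨rfl, rfl, rfl, rfl, rfl⟩⟩
  · exact ⟨p ++ d :: c :: q', v, by simp, hy.swap hc hd, rfl,
      Or.inr (Or.inr ⟨p, q' ++ v, by simp, by simp⟩)⟩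

theorem eq_of_count_eq {u v u' v' : List A} {x : A} (h : u ++ x :: v = u' ++ x :: v')
    (hc : v.count x = v'.count x) : u = u' ∧ v = v' := by
  rcases List.append_eq_append_iff.1 h with ⟨e, h1, h2⟩ | ⟨e, h1, h2⟩
  · rcases e with _ | ⟨e₁, e⟩
    all_goals grind
  · rcases e with _ | ⟨e₁, e⟩
    all_goals grind

theorem Tog.unique {w u v u' v' : List A} {x x' : A} (h : Tog N w u x v) (h' : Tog N w u' x' v') :
    u = u' ∧ x = x' ∧ v = v' := by
  have h1 := h.2.2 u' x' v' h'.1 h'.2.1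
  have h2 := h'.2.2 u x v h.1 h.2.1
  obtain rfl := le_antisymm h1.1 h2.1
  obtain ⟨rfl, rfl⟩ := eq_of_count_eq (h.1.symm.trans h'.1) (le_antisymm (h1.2 rfl) (h2.2 rfl))
  exact ⟨rfl, rfl, rfl⟩

theorem exists_tog {w u v : List A} {a : A} (hw : w = u ++ a :: v) (h : CandAt N u a) :
    ∃ u x v, Tog N w u x v ∧ x ≤ a := by
  classical
  have hfin : {a | ∃ u v, w = u ++ a :: v ∧ CandAt N u a}.Finite :=
    w.toFinset.finite_toSet.subset (by
      rintro a ⟨u, v, rfl, -⟩; simp)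
  obtain ⟨x, ⟨u', v', hw', hx⟩, hmin⟩ := Set.exists_min_image _ id hfin ⟨a, u, v, hw, h⟩
  have hex : ∃ k, ∃ u v, w = u ++ x :: v ∧ CandAt N u x ∧ v.count x = k :=
    ⟨_, u', v', hw', hx, rfl⟩
  obtain ⟨u₁, v₁, hw₁, hx₁, hk⟩ := Nat.find_spec hex
  refine ⟨u₁, x, v₁, ⟨hw₁, hx₁, ?_⟩, hmin a ⟨u, v, hw, h⟩⟩
  intro u₂ b v₂ hw₂ hb
  refine ⟨hmin b ⟨u₂, v₂, hw₂, hb⟩, ?_⟩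
  rintro rfl
  rw [hk]
  exact Nat.find_min' hex ⟨u₂, v₂, hw₂, hb, rfl⟩

/-- A swap of commuting letters that are not below `x` carries the candidates up to `x` to
candidates, preserving the number of equal letters to their right, and it is reversible. So it
preserves the least candidate and its last occurrence. -/
theorem Tog.swap (hN : Symmetric N) {p q u v : List A} {c d x : A} (hcd : c ≠ d)
    (hNcd : ¬ N c d) (hc : x ≤ c) (hd : x ≤ d) (h : Tog N (p ++ c :: d :: q) u x v) :
    ∃ u' v', Tog N (p ++ d :: c :: q) u' x v' ∧ v'.count x = v.count x ∧
      ((x = d ∧ u = p ++ [c] ∧ v = q ∧ u' = p ∧ v' = c :: q) ∨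
       (x = c ∧ u = p ∧ v = d :: q ∧ u' = p ++ [d] ∧ v' = q) ∨
        ∃ p' q', u ++ v = p' ++ c :: d :: q' ∧ u' ++ v' = p' ++ d :: c :: q') := by
  obtain ⟨u', v', he, hx, hcount, hcase⟩ := h.2.1.exists_swap hN hcd hNcd hc hd h.1
  refine ⟨u', v', ⟨he, hx, ?_⟩, hcount, hcase⟩
  intro u'' a v'' he' ha
  by_cases hax : x < a
  · exact ⟨hax.le, fun h => absurd h hax.ne'⟩
  · have hax := not_lt.1 hax
    obtain ⟨u₃, v₃, h3, ha3, hc3, -⟩ := ha.exists_swap hN hcd.symm (fun h => hNcd (hN h))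
      (hax.trans hd) (hax.trans hc) he'
    have := h.2.2 u₃ a v₃ h3 ha3
    grind

end Toggle

/-! ### A potential that is constant on fibers. -/

section Key
variable {A : Type*} [LinearOrder A] {N : A → A → Prop}

/-- The number of inversions with smaller letter `y`. -/
def cross (y : A) : List A → ℕ
  | [] => 0
  | h :: t => (if y < h then t.count y else 0) + cross y t

theorem cross_swap (y : A) {a b : A} (hab : a < b) (p q : List A) :
    cross y (p ++ b :: a :: q) = cross y (p ++ a :: b :: q) + if y = a then 1 else 0 := by
  induction p with
  | nil =>
    simp only [List.nil_append, cross, List.count_cons]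
    grind
  | cons c p ih =>
    simp only [List.cons_append, cross, ih]
    grind

theorem cross_move {x y : A} (hyx : y ≠ x) {m : List A} (hm : ∀ b ∈ m, x ≤ b) (p q : List A) :
    cross y (p ++ m ++ x :: q) = cross y (p ++ x :: (m ++ q)) := by
  induction m generalizing p with
  | nil => simp
  | cons b m ih =>
    have h1 := ih (fun b hb => hm b (by simp [hb])) (p ++ [b])
    have e : p ++ b :: m ++ x :: q = p ++ [b] ++ m ++ x :: q := by simp
    rw [e, h1]
    rcases (hm b (by simp)).eq_or_lt with rfl | hlt
    · simp
    · have := cross_swap y hlt p (m ++ q)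
      simpa [hyx] using this

open Classical in
variable (N) in
/-- A potential on words which only depends on the fiber. -/
noncomputable def key (w : List A) (y : A) : ℕ :=
  if h : ∃ t : List A × A × List A, Tog N w t.1 t.2.1 t.2.2 then
    if y < h.choose.2.1 then cross y w
    else if y = h.choose.2.1 then inversions (h.choose.1 ++ h.choose.2.2) else 0
  else cross y w

theorem Tog.key_eq {w u v : List A} {x : A} (h : Tog N w u x v) (y : A) :
    key N w y = if y < x then cross y w else if y = x then inversions (u ++ v) else 0 := by
  have hex : ∃ t : List A × A × List A, Tog N w t.1 t.2.1 t.2.2 := ⟨(u, x, v), h⟩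
  obtain ⟨h1, h2, h3⟩ := h.unique hex.choose_spec
  unfold key
  rw [dif_pos hex, ← h1, ← h2, ← h3]

theorem key_eq_cross {w : List A} (h : ∀ u x v, ¬ Tog N w u x v) (y : A) :
    key N w y = cross y w := by
  unfold key
  rw [dif_neg]
  rintro ⟨t, ht⟩
  exact h _ _ _ ht

variable (N) in
/-- The toggled letter `x` of `w` stands in the window which begins after `pre`, and the remaining
letters after `pre` form the word `post`. -/
def Fib (w pre : List A) (x : A) (post : List A) : Prop :=
  ∃ L v, Tog N w (pre ++ L) x v ∧ post = L ++ v ∧ (∀ y ∈ L, Rel N x y) ∧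
    ∃ α s, pre = α ++ [s] ∧ s < x ∧ ¬ N s x

theorem Tog.exists_fib {w u v : List A} {x : A} (h : Tog N w u x v) :
    ∃ pre post, Fib N w pre x post := by
  obtain ⟨u₀, s, mid, rfl, hs, hNs, hm⟩ := id h.2.1
  exact ⟨u₀ ++ [s], mid ++ v, mid, v, by simpa using h, rfl, hm, u₀, s, rfl, hs, hNs⟩

theorem eq_of_append_rel {x : A} {pre L pre' L' : List A} (h : pre ++ L = pre' ++ L')
    (hL : ∀ y ∈ L, Rel N x y) (hL' : ∀ y ∈ L', Rel N x y)
    (hp : ∃ α s, pre = α ++ [s] ∧ s < x ∧ ¬ N s x)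
    (hp' : ∃ α s, pre' = α ++ [s] ∧ s < x ∧ ¬ N s x) : pre = pre' ∧ L = L' := by
  obtain ⟨α, s, rfl, hs, -⟩ := hp
  obtain ⟨α', s', rfl, hs', -⟩ := hp'
  rcases List.append_eq_append_iff.1 h with ⟨e, h1, h2⟩ | ⟨e, h1, h2⟩
  · rcases List.eq_nil_or_concat e with rfl | ⟨e', t, rfl⟩
    · simp at h1 h2; exact ⟨by rw [h1.1, h1.2], h2⟩
    · rw [List.concat_eq_append, ← List.append_assoc] at h1
      obtain ⟨-, h3⟩ := List.append_inj' h1 rfl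
      simp only [List.cons.injEq, and_true] at h3
      have := hL t (by rw [h2]; simp)
      exact absurd this.1 (not_le.2 (h3 ▸ hs'))
  · rcases List.eq_nil_or_concat e with rfl | ⟨e', t, rfl⟩
    · simp at h1 h2; exact ⟨by rw [h1.1, h1.2], h2.symm⟩
    · rw [List.concat_eq_append, ← List.append_assoc] at h1
      obtain ⟨-, h3⟩ := List.append_inj' h1 rfl
      simp only [List.cons.injEq, and_true] at h3
      have := hL' t (by rw [h2]; simp)
      exact absurd this.1 (not_le.2 (h3 ▸ hs))

theorem Fib.unique {w pre post pre' post' : List A} {x x' : A} (h : Fib N w pre x post)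
    (h' : Fib N w pre' x' post') : pre = pre' ∧ x = x' ∧ post = post' := by
  obtain ⟨L, v, ht, rfl, hL, hp⟩ := h
  obtain ⟨L', v', ht', rfl, hL', hp'⟩ := h'
  obtain ⟨h1, rfl, rfl⟩ := ht.unique ht'
  obtain ⟨rfl, rfl⟩ := eq_of_append_rel h1 hL hL' hp hp'
  exact ⟨rfl, rfl, rfl⟩

/-- Moving `x` across letters that are at least `x` affects only inversions with smaller letter `x`.
These are replaced in the potential by the inversions of the word without the toggled letter, which
is the same for both words. -/
theorem Fib.key_eq {w w' pre post : List A} {x : A} (h : Fib N w pre x post)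
    (h' : Fib N w' pre x post) : key N w = key N w' := by
  obtain ⟨L, v, ht, rfl, hL, -⟩ := h
  obtain ⟨L', v', ht', he, hL', -⟩ := h'
  have key : ∀ {L v L' v' : List A} {y : A}, L ++ v = L' ++ v' → (∀ y ∈ L', Rel N x y) → y < x →
      L.length ≤ L'.length → cross y (pre ++ L ++ x :: v) = cross y (pre ++ L' ++ x :: v') := by
    intro L v L' v' y he hL' hy hle
    obtain ⟨m, rfl⟩ : L <+: L' := List.prefix_of_prefix_length_le (l₃ := L ++ v)
      (by simp) (by rw [he]; simp) hle
    rw [List.append_assoc] at he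
    obtain rfl := List.append_cancel_left he
    have := cross_move (x := x) hy.ne (m := m) (fun b hb => (hL' b (by simp [hb])).1) (pre ++ L) v'
    simp only [List.append_assoc] at this ⊢
    exact this.symm
  funext y
  rw [ht.key_eq, ht'.key_eq]
  have h1 : pre ++ L ++ v = pre ++ L' ++ v' := by
    rw [List.append_assoc, he, List.append_assoc]
  rw [h1]
  by_cases hy : y < x
  · rw [if_pos hy, if_pos hy, ht.1, ht'.1]
    rcases le_total L.length L'.length with hle | hle
    · exact key he hL' hy hle
    · exact (key he.symm hL hy hle).symm
  · rw [if_neg hy, if_neg hy]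

/-- Iterates `Tog.swap`; the preserved number of letters `x` to the right identifies the toggled
occurrence after each swap. -/
theorem Tog.move_left (hN : Symmetric N) {u m v : List A} {x : A}
    (hm : ∀ b ∈ m, x < b ∧ ¬ N x b) (h : Tog N (u ++ m ++ x :: v) (u ++ m) x v) :
    Tog N (u ++ x :: (m ++ v)) u x (m ++ v) := by
  induction m using List.reverseRecOn generalizing v with
  | nil => simpa using h
  | append_singleton m b ih =>
    have hb := hm b (by simp)
    have e : u ++ (m ++ [b]) ++ x :: v = (u ++ m) ++ b :: x :: v := by simp
    rw [e] at h
    obtain ⟨u', v', ht, hc, -⟩ := h.swap hN hb.1.ne' (fun h => hb.2 (hN h)) hb.1.le le_rfl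
    have he : (u ++ m) ++ x :: (b :: v) = u' ++ x :: v' := ht.1
    obtain ⟨rfl, rfl⟩ := eq_of_count_eq he (by rw [hc, List.count_cons]; simp [hb.1.ne'])
    simp_all

theorem Tog.move_right (hN : Symmetric N) {u m v : List A} {x : A}
    (hm : ∀ b ∈ m, x < b ∧ ¬ N x b) (h : Tog N (u ++ x :: (m ++ v)) u x (m ++ v)) :
    Tog N (u ++ m ++ x :: v) (u ++ m) x v := by
  induction m generalizing u with
  | nil => simpa using h
  | cons b m ih =>
    have hb := hm b (by simp)
    have e : u ++ x :: (b :: m ++ v) = u ++ x :: b :: (m ++ v) := by simp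
    rw [e] at h
    obtain ⟨u', v', ht, hc, -⟩ := h.swap hN hb.1.ne hb.2 le_rfl hb.1.le
    have he : (u ++ [b]) ++ x :: (m ++ v) = u' ++ x :: v' := by rw [← ht.1]; simp
    obtain ⟨rfl, rfl⟩ := eq_of_count_eq he (by rw [hc]; simp [hb.1.ne'])
    have := ih (u := u ++ [b]) (fun b hb => hm b (by simp [hb])) (by simpa using ht)
    simpa using this

/-- Swapping two commuting letters into increasing order lowers the potential, or it moves the
toggled letter inside its window. -/
theorem SwapStep.key_lt (hN : Symmetric N) {w w' : List A} (h : SwapStep N w w') :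
    toLex (key N w') < toLex (key N w) ∨
      ∃ pre x post, Fib N w pre x post ∧ Fib N w' pre x post := by
  obtain ⟨p, q, a, b, hab, hNab, rfl, rfl⟩ := h
  have hNba : ¬ N b a := fun h => hNab (hN h)
  -- If the toggled letter is at most `a`, it stays toggled: either it is swapped itself, within its
  -- window, or the rest of the word loses an inversion. Otherwise neither word toggles a letter up
  -- to `a`, and the inversions with smaller letter `a` drop by one.
  by_cases hT : ∃ u x v, Tog N (p ++ b :: a :: q) u x v ∧ x ≤ a
  · obtain ⟨u, x, v, ht, hxa⟩ := hT
    obtain ⟨u', v', ht', -, hcase⟩ := ht.swap hN hab.ne' hNba (hxa.trans hab.le) hxa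
    rcases hcase with ⟨rfl, rfl, rfl, rfl, rfl⟩ | ⟨rfl, -⟩ | ⟨p', q', h1, h2⟩
    · right
      have hc := ht.2.1
      rw [candAt_append_right (by simpa using ⟨hab.le, hNab⟩)] at hc
      obtain ⟨u₀, s, mid, rfl, hs, hNs, hm⟩ := hc
      refine ⟨u₀ ++ [s], x, mid ++ b :: v, ⟨mid ++ [b], v, by simpa using ht, by simp, ?_, u₀, s,
        rfl, hs, hNs⟩, ⟨mid, b :: v, by simpa using ht', by simp, hm, u₀, s, rfl, hs, hNs⟩⟩
      intro y hy
      rcases List.mem_append.1 hy with hy | hy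
      · exact hm y hy
      · rw [List.mem_singleton.1 hy]; exact ⟨hab.le, hNab⟩
    · exact absurd hab (not_lt.2 hxa)
    · left
      refine ⟨x, fun y hy => ?_, ?_⟩
      · change key N _ y = key N _ y
        rw [ht.key_eq, ht'.key_eq, if_pos hy, if_pos hy, cross_swap y hab, if_neg (hy.trans_le hxa).ne, add_zero]
      · change key N _ x < key N _ x
        rw [ht.key_eq, ht'.key_eq, if_neg (lt_irrefl x), if_pos rfl, if_neg (lt_irrefl x), if_pos rfl,
          h1, h2]
        exact inversions_lt_of_swapStep ⟨p', q', a, b, hab, hNab, rfl, rfl⟩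
  · left
    have hT' : ∀ u x v, Tog N (p ++ a :: b :: q) u x v → ¬ x ≤ a := by
      intro u x v ht hxa
      obtain ⟨u', v', ht', -⟩ := ht.swap hN hab.ne hNab hxa (hxa.trans hab.le)
      exact hT ⟨u', x, v', ht', hxa⟩
    have hk : ∀ w : List A, (∀ u x v, Tog N w u x v → ¬ x ≤ a) → ∀ y ≤ a, key N w y = cross y w := by
      intro w hw y hy
      by_cases hex : ∃ u x v, Tog N w u x v
      · obtain ⟨u, x, v, ht⟩ := hex
        rw [ht.key_eq, if_pos (hy.trans_lt (not_le.1 (hw u x v ht)))]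
      · push Not at hex
        exact key_eq_cross hex y
    have h1 := hk _ fun u x v ht hxa => hT ⟨u, x, v, ht, hxa⟩
    have h2 := hk _ hT'
    refine ⟨a, fun y hy => ?_, ?_⟩
    · change key N _ y = key N _ y
      rw [h1 y hy.le, h2 y hy.le, cross_swap y hab, if_neg hy.ne, add_zero]
    · change key N _ a < key N _ a
      rw [h1 a le_rfl, h2 a le_rfl, cross_swap a hab, if_pos rfl]
      omega

theorem Dom.key_lt (hN : Symmetric N) {w w' : List A} (h : Dom N w w') :
    w = w' ∨ toLex (key N w') < toLex (key N w) ∨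
      ∃ pre x post, Fib N w pre x post ∧ Fib N w' pre x post := by
  induction h with
  | refl => left; rfl
  | @tail w₁ w₂ _ hs ih =>
    right
    rcases ih with rfl | ih | ⟨pre, x, post, h1, h2⟩
    · exact hs.key_lt hN
    · left
      rcases hs.key_lt hN with h | ⟨pre, x, post, h1, h2⟩
      · exact h.trans ih
      · rwa [← h1.key_eq h2]
    · rcases hs.key_lt hN with h | ⟨pre', x', post', h3, h4⟩
      · left; rwa [h1.key_eq h2]
      · obtain ⟨rfl, rfl, rfl⟩ := h2.unique h3
        right; exact ⟨pre, x, post, h1, h4⟩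

end Key

/-! ### Every critical word with a toggled letter lies in a fiber. -/

section Classify
variable {A : Type*} [LinearOrder A] {N : A → A → Prop}

omit [LinearOrder A] in
theorem exists_block {ρ : List (List A)} : ∀ {α γ : List A} {s : A}, ρ.flatten = α ++ s :: γ →
    ∃ b₁ D₁ D₂ b₂, ρ = b₁ ++ (D₁ ++ s :: D₂) :: b₂ ∧ b₁.flatten ++ D₁ = α ∧
      D₂ ++ b₂.flatten = γ := by
  induction ρ with
  | nil => intro α γ s h; simp at h
  | cons B ρ ih =>
    intro α γ s h
    rw [List.flatten_cons] at h
    rcases List.append_eq_append_iff.1 h with ⟨e, h1, h2⟩ | ⟨e, h1, h2⟩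
    · grind
    · cases e with
      | nil =>
        grind
      | cons d e =>
        simp only [List.cons_append, List.cons.injEq] at h2
        exact ⟨[], α, e, ρ, by rw [h1, h2.1]; rfl, by simp, h2.2.symm⟩

/-- The first letter of a block with several letters can be moved to the left. -/
theorem IsReading.candAt_head {b₁ b₂ : List (List A)} {P t : List A} {h : A}
    (hρ : IsReading (Rel N) (b₁ ++ P :: (h :: t) :: b₂)) (ht : t ≠ []) :
    CandAt N (b₁.flatten ++ P) h := by
  obtain ⟨X, c, hX, hp, hPX, y, hy, hyc⟩ := hρ.link
  obtain ⟨X', rfl⟩ : ∃ X', X = h :: X' := by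
    cases X with
    | nil => simp at hX; exact absurd hX.2 ht
    | cons a X' => simp at hX; exact ⟨X', by rw [hX.1]⟩
  simp only [List.cons_append, List.cons.injEq, true_and] at hX
  have hPh : ∀ p ∈ P, Rel N p h := fun p hp => (List.pairwise_append.1 hPX).2.2 p hp h (by simp)
  by_cases hex : ∃ p ∈ P, p < h
  · obtain ⟨P₁, p, P₂, rfl, hph, hP₂⟩ := exists_last_of_exists hex
    refine ⟨b₁.flatten ++ P₁, p, P₂, by simp, hph, (hPh p (by simp)).2, fun q hq => ?_⟩
    have h1 := hPh q (by simp [hq])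
    obtain rfl := le_antisymm h1.1 (not_lt.1 (hP₂ q hq))
    exact h1
  · push Not at hex
    obtain rfl := le_antisymm (hPh y hy).1 (hex y hy)
    grind

/-- The block cannot be the first one, so its head is a candidate; the toggled letter is the least
candidate. -/
theorem IsReading.exists_tog {ρ b₁ b₂ : List (List A)} {t : List A} {h : A}
    (hρ : IsReading (Rel N) ρ) (he : ρ = b₁ ++ (h :: t) :: b₂) (ht : t ≠ []) :
    ∃ u x v, Tog N ρ.flatten u x v ∧ x ≤ h := by
  rcases List.eq_nil_or_concat b₁ with rfl | ⟨b, P, rfl⟩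
  · obtain ⟨s, hs⟩ := hρ.2
    rw [he] at hs
    simp at hs
    exact absurd hs.2 ht
  · rw [List.concat_eq_append] at he
    have he' : ρ = b ++ P :: (h :: t) :: b₂ := by rw [he]; simp
    exact QuadraticMorse.exists_tog (u := b.flatten ++ P) (v := t ++ b₂.flatten)
      (by rw [he']; simp) (IsReading.candAt_head (b₂ := b₂) (he' ▸ hρ) ht)

/-- Letters below the toggled one form blocks of their own. -/
theorem IsReading.eq_singleton {ρ b₁ b₂ : List (List A)} {D₁ D₂ : List A} {u v : List A} {s x : A}
    (hρ : IsReading (Rel N) ρ) (he : ρ = b₁ ++ (D₁ ++ s :: D₂) :: b₂) (ht : Tog N ρ.flatten u x v)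
    (hs : s < x) : D₁ = [] ∧ D₂ = [] := by
  have hB := (hρ.isCell (D₁ ++ s :: D₂) (by rw [he]; simp)).2
  have key : ∀ h t, D₁ ++ s :: D₂ = h :: t → h ≤ s → t = [] := by
    intro h t hht hhs
    by_contra ht0
    obtain ⟨u', x', v', ht', hx'⟩ := hρ.exists_tog (by rw [he, hht]) ht0
    obtain ⟨-, rfl, -⟩ := ht.unique ht'
    exact absurd (hx'.trans hhs) (not_le.2 hs)
  cases D₁ with
  | nil => exact ⟨rfl, key s D₂ rfl le_rfl⟩
  | cons d D₁ =>
    have := key d (D₁ ++ s :: D₂) rfl ((List.pairwise_cons.1 hB).1 s (by simp)).1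
    simp at this

theorem exists_rel_prefix (N : A → A → Prop) (x : A) : ∀ v : List A, ∃ L β, v = L ++ β ∧
    (∀ y ∈ L, Rel N x y) ∧ (β = [] ∨ ∃ z β', β = z :: β' ∧ ¬ Rel N x z) := by
  intro v
  induction v with
  | nil => exact ⟨[], [], rfl, by simp, Or.inl rfl⟩
  | cons a v ih =>
    by_cases ha : Rel N x a
    · grind
    · exact ⟨[], a :: v, rfl, by simp, Or.inr ⟨a, v, rfl, ha⟩⟩

omit [LinearOrder A] in
/-- The tiles that are contained in a given part of the word. -/
theorem exists_tiles_in {b : List (List A)} : ∀ {L β : List A}, b.flatten = L ++ β →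
    ∃ Ds b' U, b = Ds ++ b' ∧ L = Ds.flatten ++ U ∧ b'.flatten = U ++ β ∧
      (b' = [] ∨ ∃ V b'', b' = V :: b'' ∧ U.length < V.length) := by
  induction b with
  | nil =>
    grind
  | cons V b ih =>
    intro L β h
    by_cases hlt : L.length < V.length
    · grind
    · rw [List.flatten_cons] at h
      obtain ⟨L', rfl⟩ : V <+: L := List.prefix_of_prefix_length_le (l₃ := V ++ b.flatten)
        (by simp) (by rw [h]; simp) (not_lt.1 hlt)
      rw [List.append_assoc] at h
      obtain ⟨Ds, b', U, rfl, rfl, h2, h3⟩ := ih (List.append_cancel_left h)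
      exact ⟨V :: Ds, b', U, rfl, by simp, h2, h3⟩

/-- A block of letters `x` is not followed by a block whose last letter goes with `x`. -/
theorem Link.not_of_eq {P B : List A} {x : A} (h : Link (Rel N) P B) (hP : ∀ y ∈ P, y = x)
    (hB : ∀ X c, B = X ++ [c] → Rel N x c) : False := by
  obtain ⟨X, c, hX, -, -, y, hy, hyc⟩ := h
  rw [hP y hy] at hyc
  exact hyc (hB X c hX)

/-- A block beginning with `x` and containing another letter follows a block of letters `≤ x`. -/
theorem Link.le_head {P t : List A} {x : A} (h : Link (Rel N) P (x :: t)) (ht : t ≠ []) :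
    ∀ y ∈ P, y ≤ x := by
  obtain ⟨X, c, hX, -, hPX, -⟩ := h
  cases X with
  | nil => simp at hX; exact absurd hX.2 ht
  | cons a X =>
    simp only [List.cons_append, List.cons.injEq] at hX
    intro y hy
    exact ((List.pairwise_append.1 hPX).2.2 y hy x (by simp [hX.1])).1

theorem Link.erase {P₁ P₂ B : List A} {x : A} (h : Link (Rel N) (P₁ ++ x :: P₂) B)
    (hB : ∀ b ∈ B, Rel N x b) : Link (Rel N) (P₁ ++ P₂) B := by
  obtain ⟨X, c, rfl, hXc, hX, y, hy, hyc⟩ := h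
  refine ⟨X, c, rfl, hXc, hX.sublist ?_, y, ?_, hyc⟩
  all_goals grind

theorem eq_of_stop {x z z' : A} {L β X r : List A} (hL : ∀ y ∈ L, Rel N x y)
    (hX : ∀ y ∈ X, Rel N x y) (hz : ¬ Rel N x z) (hz' : ¬ Rel N x z')
    (h : L ++ z :: β = X ++ z' :: r) : L = X ∧ z = z' ∧ β = r := by
  rcases List.append_eq_append_iff.1 h with ⟨e, rfl, h2⟩ | ⟨e, rfl, h2⟩
  · cases e with
    | nil => simpa using h2
    | cons d e =>
      grind
  · cases e with
    | nil => simp at h2; exact ⟨by simp, h2.1.symm, h2.2.symm⟩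
    | cons d e =>
      grind

/-- Another `x` among these letters would be a candidate further to the right, while the toggled
letter is the last one. -/
theorem Tog.gt_of_rel {w u v L β : List A} {x : A} (h : Tog N w u x v) (hv : v = L ++ β)
    (hL : ∀ y ∈ L, Rel N x y) : ∀ y ∈ L, x < y ∧ ¬ N x y := by
  intro y hy
  refine ⟨lt_of_le_of_ne (hL y hy).1 ?_, (hL y hy).2⟩
  rintro rfl
  obtain ⟨p, q, rfl⟩ := List.append_of_mem hy
  have hc : CandAt N (u ++ x :: p) x := by
    refine (candAt_append_right ?_).2 h.2.1
    grind
  have := (h.2.2 (u ++ x :: p) x (q ++ β) (by rw [h.1, hv]; simp) hc).2 rfl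
  grind

/-- A block of letters `≥ x`. -/
theorem exists_split_of_le {B : List A} {x : A} (hB : B.Pairwise (Rel N)) (h : ∀ y ∈ B, Rel N x y) :
    ∃ E₀ M, B = E₀ ++ M ∧ (∀ y ∈ E₀, y = x ∧ ¬ N x x) ∧ ∀ y ∈ M, x < y ∧ ¬ N x y := by
  induction B with
  | nil => exact ⟨[], [], rfl, by simp, by simp⟩
  | cons b B ih =>
    rw [List.pairwise_cons] at hB
    have hb := h b (by simp)
    rcases hb.1.eq_or_lt with rfl | hlt
    · obtain ⟨E₀, M, rfl, h1, h2⟩ := ih hB.2 fun y hy => h y (by simp [hy])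
      refine ⟨x :: E₀, M, rfl, ?_, h2⟩
      intro y hy
      rcases List.mem_cons.1 hy with rfl | hy
      · exact ⟨rfl, hb.2⟩
      · exact h1 y hy
    · refine ⟨[], b :: B, rfl, by simp, ?_⟩
      intro y hy
      refine ⟨?_, (h y hy).2⟩
      rcases List.mem_cons.1 hy with rfl | hy
      · exact hlt
      · exact hlt.trans_le (hB.1 y hy).1

/-- The tiles in front of the toggled letter if it forms a block of its own. -/
theorem gt_of_chain {x : A} {s : A} (hsx : s < x) : ∀ (b : List (List A)) (P : List A),
    (P :: (b ++ [[x]])).IsChain (Link (Rel N)) → (∀ B ∈ b, ∀ y ∈ B, Rel N x y) →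
    (∀ y ∈ P, Rel N x y) → (∃ y ∈ P, y ≠ x) → ∀ B ∈ b, ∀ y ∈ B, x < y ∧ ¬ N x y := by
  intro b
  induction b with
  | nil => intro P _ _ _ _ B hB; simp at hB
  | cons C b ih =>
    intro P hch hb hP hPx
    rw [List.cons_append, List.isChain_cons_cons] at hch
    have hC := hb C (by simp)
    have hCp := hch.1.pairwise
    obtain ⟨E₀, M, rfl, h1, h2⟩ := exists_split_of_le hCp hC
    have hlast : ∀ B r, b ++ [[x]] = B :: r → E₀ ++ M ≠ [] → (∀ y ∈ E₀ ++ M, y = x) → False := by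
      intro B r hB hne hall
      have hl : Link (Rel N) (E₀ ++ M) B := by
        grind
      refine hl.not_of_eq hall ?_
      intro X c hX
      have hxx : Rel N x x := by
        obtain ⟨d, t, hd⟩ := List.exists_cons_of_ne_nil hne
        have h3 := hC d (by rw [hd]; simp)
        rwa [hall d (by rw [hd]; simp)] at h3
      cases b with
      | nil =>
        simp at hB
        rw [← hB.1] at hX
        have : X ++ [c] = [] ++ [x] := hX.symm
        have := (List.append_inj' this rfl).2
        simp at this
        rwa [this]
      | cons D b =>
        simp at hB
        exact hb D (by simp) c (by rw [hB.1, hX]; simp)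
    -- A block consisting of letters `x` only cannot be followed by a block whose last letter goes
    -- with `x`. A longer block headed by `x` would force all letters of the preceding block to be
    -- `x`.
    have hE₀ : E₀ = [] := by
      by_contra hE
      obtain ⟨d, E, rfl⟩ := List.exists_cons_of_ne_nil hE
      obtain rfl := (h1 d (by simp)).1
      rcases eq_or_ne (E ++ M) [] with ht | ht
      · obtain ⟨B, r, hB⟩ : ∃ B r, b ++ [[d]] = B :: r := by cases b <;> simp
        grind
      · obtain ⟨y, hy, hyx⟩ := hPx
        exact hyx (le_antisymm (Link.le_head hch.1 ht y hy) (hP y hy).1)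
    subst hE₀
    have hM0 : M ≠ [] := by simpa using hch.1.ne_nil
    intro B hB
    rcases List.mem_cons.1 hB with rfl | hB
    · simpa using h2
    · refine ih M (by simpa using hch.2) (fun B hB => hb B (by simp [hB]))
        (fun y hy => ⟨(h2 y hy).1.le, (h2 y hy).2⟩) ?_ B hB
      obtain ⟨d, t, rfl⟩ := List.exists_cons_of_ne_nil hM0
      exact ⟨d, by simp, (h2 d (by simp)).1.ne'⟩

/-- The fiber of a critical word. -/
theorem IsReading.exists_fiber {ρ : List (List A)} {u v : List A} {x : A}
    (hρ : IsReading (Rel N) ρ) (ht : Tog N ρ.flatten u x v) :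
    ∃ Q E₀ M Ds U β, Fiber N Q E₀ M Ds x U β ∧ FiberWord Q E₀ M Ds x (U ++ β) ρ.flatten ∧
      Fib N ρ.flatten Q.flatten x (E₀ ++ M ++ Ds.flatten ++ (U ++ β)) := by
  obtain ⟨α, s, L₁, rfl, hsx, hNs, hL₁⟩ := id ht.2.1
  obtain ⟨Q₀, D₁, D₂, rest, he, hα, hrest⟩ := exists_block (ρ := ρ) (α := α) (s := s)
    (γ := L₁ ++ x :: v) (by rw [ht.1]; simp)
  obtain ⟨rfl, rfl⟩ := hρ.eq_singleton he ht hsx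
  rw [List.nil_append] at he hrest
  rw [List.append_nil] at hα
  subst hα
  obtain ⟨L₂, β, hv, hL₂, hβ⟩ := exists_rel_prefix N x v
  have hL₂' := ht.gt_of_rel hv hL₂
  have hlast : ∃ Q₁ t, Q₀ ++ [[s]] = Q₁ ++ [[t]] ∧ t < x ∧ ¬ N t x := ⟨Q₀, s, rfl, hsx, hNs⟩
  have hQf : (Q₀ ++ [[s]]).flatten = Q₀.flatten ++ [s] := by simp
  have hρ1 : IsReading (Rel N) (Q₀ ++ [s] :: rest) := he ▸ hρ
  have hfib : ∀ post, post = L₁ ++ v → Fib N ρ.flatten (Q₀ ++ [[s]]).flatten x post := by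
    rintro post rfl
    exact ⟨L₁, v, by rw [hQf]; simpa using ht, rfl, hL₁, Q₀.flatten, s, hQf, hsx, hNs⟩
  obtain ⟨b₁, D₁, D₂, b₂, rfl, hL, hv'⟩ := exists_block hrest
  have hD₁ : ∀ y ∈ D₁, Rel N x y := fun y hy => hL₁ y (by rw [← hL]; simp [hy])
  have hb₁ : ∀ B ∈ b₁, ∀ y ∈ B, Rel N x y := fun B hB y hy =>
    hL₁ y (by rw [← hL]; exact List.mem_append_left _ (List.mem_flatten.2 ⟨B, hB, hy⟩))
  have hBc := hρ1.isCell (D₁ ++ x :: D₂) (by simp)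
  have hD₁x : ∀ y ∈ D₁, y = x ∧ ¬ N x x := by
    intro y hy
    have h1 := ((List.pairwise_append.1 hBc.2).2.2 y hy x (by simp)).1
    have h2 := hD₁ y hy
    obtain rfl := le_antisymm h1 h2.1
    exact ⟨rfl, h2.2⟩
  have hxD₂ : ∀ y ∈ D₂, Rel N x y :=
    (List.pairwise_cons.1 (List.pairwise_append.1 hBc.2).2.1).1
  have hch := hρ1.chain
  by_cases hsing : D₁ = [] ∧ D₂ = []
  · obtain ⟨rfl, rfl⟩ := hsing
    simp only [List.nil_append, List.append_nil] at hL hv' he hρ1 hch hρ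
    subst hL
    cases b₁ with
    | nil =>
      rw [List.nil_append, List.isChain_cons_cons] at hch
      exfalso
      obtain ⟨X, c, hX, -, -, y, hy, hyc⟩ := hch.1
      rw [List.mem_singleton] at hy
      have : X ++ [c] = [] ++ [x] := by rw [← hX]; rfl
      have := (List.append_inj' this rfl).2
      simp at this
      rw [hy, this] at hyc
      exact hyc ⟨hsx.le, hNs⟩
    | cons B b =>
      rw [List.cons_append, List.isChain_cons_cons] at hch
      obtain ⟨E₀, M, rfl, hE₀, hM⟩ := exists_split_of_le hch.1.pairwise (hb₁ B (by simp))
      have hchx : ((E₀ ++ M) :: (b ++ [[x]])).IsChain (Link (Rel N)) := by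
        have h1 := hch.2
        rw [show (E₀ ++ M) :: (b ++ [x] :: b₂) = ((E₀ ++ M) :: (b ++ [[x]])) ++ b₂ by simp] at h1
        exact (List.isChain_append.1 h1).1
      have hchb : ([x] :: b₂).IsChain (Link (Rel N)) := by
        have h1 := hch.2
        rw [show (E₀ ++ M) :: (b ++ [x] :: b₂) = ((E₀ ++ M) :: b) ++ [x] :: b₂ by simp] at h1
        exact (List.isChain_append.1 h1).2.1
      have hM0 : M ≠ [] := by
        rintro rfl
        rw [List.append_nil] at hchx hch hb₁
        have hl : ∃ C, Link (Rel N) E₀ C ∧ ∀ X c, C = X ++ [c] → Rel N x c := by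
          have hE0 := hch.1.ne_nil
          obtain ⟨d, E, rfl⟩ := List.exists_cons_of_ne_nil hE0
          have hd := hE₀ d (by simp)
          cases b with
          | nil =>
            grind
          | cons C b =>
            rw [List.cons_append, List.isChain_cons_cons] at hchx
            grind
        obtain ⟨C, hl, hC⟩ := hl
        exact hl.not_of_eq (fun y hy => (hE₀ y hy).1) hC
      have hgt := gt_of_chain hsx b (E₀ ++ M) hchx (fun B hB => hb₁ B (by simp [hB]))
        (fun y hy => hb₁ _ (by simp) y hy) (by
          obtain ⟨d, t, rfl⟩ := List.exists_cons_of_ne_nil hM0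
          exact ⟨d, by simp, (hM d (by simp)).1.ne'⟩)
      have hread : IsReading (Rel N) ((Q₀ ++ [[s]]) ++ (E₀ ++ M) :: b) := by
        have h1 := hρ1.1
        obtain ⟨t, h2⟩ := hρ1.2
        refine ⟨?_, t, ?_⟩
        · rw [show Q₀ ++ [s] :: ((E₀ ++ M) :: b ++ [x] :: b₂) =
            ((Q₀ ++ [[s]]) ++ (E₀ ++ M) :: b) ++ [x] :: b₂ by simp] at h1
          exact (List.isChain_append.1 h1).1
        · cases Q₀ <;> simpa using h2
      rcases hβ with rfl | ⟨z, β', rfl, hz⟩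
      · have hv0 : v = [] := by
          by_contra hv0
          cases b₂ with
          | nil => simp at hv'; exact hv0 hv'
          | cons C b₂ =>
            rw [List.isChain_cons_cons] at hchb
            refine hchb.1.not_of_eq (x := x) (by simp) fun X c hX => ?_
            grind
        subst hv0
        rw [List.append_nil] at hv
        subst hv
        refine ⟨Q₀ ++ [[s]], E₀, M, b, [], [], ⟨hread, hlast, hE₀, hM, hM0, hgt, by simp, ?_,
          Or.inl ⟨rfl, rfl⟩⟩, ?_, hfib _ (by simp)⟩
        · intro b' B hB
          rw [List.append_nil]
          exact (hread.isCell B (by rw [hB]; simp)).2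
        · right; left
          rw [ht.1]; simp
      · cases b₂ with
        | nil => simp at hv'; rw [hv'] at hv; simp at hv
        | cons C b₂ =>
          have hlC := (List.isChain_cons_cons.1 hchb).1
          obtain ⟨X, c, rfl, hXc, hxX, y, hy, hyc⟩ := hlC
          rw [List.mem_singleton] at hy
          subst hy
          obtain ⟨rfl, rfl, rfl⟩ := eq_of_stop (r := b₂.flatten) hL₂ (List.pairwise_cons.1 hxX).1 hz
            hyc (by rw [← hv, ← hv']; simp)
          obtain ⟨pre, P, hpP⟩ : ∃ pre P, (E₀ ++ M) :: b = pre ++ [P] := by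
            rcases List.eq_nil_or_concat ((E₀ ++ M) :: b) with h | ⟨pre, P, h⟩
            all_goals grind
          have hPp := hread.isCell P (by rw [hpP]; simp)
          -- If the last tile before `x` is compatible with all of `L₂`, then `x` stands behind all
          -- tiles of the fiber. Otherwise reading on from that tile stops inside `L₂`, giving one
          -- more tile, and `x` stands before the last tile.
          rcases exists_maximal_prefix (R := Rel N) (P := P) L₂ [] (by simpa using hPp.2) with
            h | ⟨U', c', r, rfl, hU', hc'⟩
          · refine ⟨Q₀ ++ [[s]], E₀, M, b, L₂, z :: b₂.flatten, ⟨hread, hlast, hE₀, hM, hM0, hgt,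
              hL₂', ?_, Or.inr ⟨z, _, rfl, hz, hXc⟩⟩, ?_, hfib _ (by rw [hv]; simp)⟩
            · simp_all
            · right; left
              rw [ht.1, hv]; simp
          · rw [List.append_nil] at hU' hc'
            have hYp : (U' ++ [c']).Pairwise (Rel N) := hXc.sublist (by simp)
            have hl := Link.of_stop hU' hYp hc'
            have hread' : IsReading (Rel N) ((Q₀ ++ [[s]]) ++ (E₀ ++ M) :: (b ++ [U' ++ [c']])) := by
              have h1 : IsReading (Rel N) ((Q₀ ++ [[s]] ++ pre) ++ [P]) := by
                rw [hpP] at hread; simpa using hread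
              have h2 := (isReading_snoc.1 h1).isReading
                (List.isChain_cons_cons.2 ⟨hl, List.isChain_singleton _⟩)
              rw [show Q₀ ++ [[s]] ++ (E₀ ++ M) :: (b ++ [U' ++ [c']]) =
                Q₀ ++ [[s]] ++ ((E₀ ++ M) :: b) ++ [U' ++ [c']] by simp, hpP]
              simpa using h2
            refine ⟨Q₀ ++ [[s]], E₀, M, b ++ [U' ++ [c']], r, z :: b₂.flatten, ⟨hread', hlast, hE₀,
              hM, hM0, ?_, fun y hy => hL₂' y (by simp [hy]), ?_,
              Or.inr ⟨z, _, rfl, hz, hXc.sublist (by simp)⟩⟩, ?_, hfib _ (by rw [hv]; simp)⟩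
            · intro B hB
              rcases List.mem_append.1 hB with hB | hB
              all_goals grind
            · intro b' B hB
              rw [show (E₀ ++ M) :: (b ++ [U' ++ [c']]) = ((E₀ ++ M) :: b) ++ [U' ++ [c']] by simp] at hB
              have h3 := (List.append_inj' hB rfl).2
              grind
            · right; right
              exact ⟨b, U' ++ [c'], rfl, by rw [ht.1, hv]; simp⟩
  · -- the block of `x` has several letters
    obtain ⟨d, t, hdt, hdx, ht0⟩ : ∃ d t, D₁ ++ x :: D₂ = d :: t ∧ d = x ∧ t ≠ [] := by
      cases D₁ with
      | nil =>
        refine ⟨x, D₂, rfl, rfl, fun h => hsing ⟨rfl, h⟩⟩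
      | cons d D₁ => exact ⟨d, D₁ ++ x :: D₂, rfl, (hD₁x d (by simp)).1, by simp⟩
    have hlastrel : ∀ X c, D₁ ++ x :: D₂ = X ++ [c] → Rel N x c := by
      intro X c hX
      rcases List.eq_nil_or_concat D₂ with rfl | ⟨D₃, e, rfl⟩
      · have := (List.append_inj' hX rfl).2
        simp at this
        subst this
        cases D₁ with
        | nil => simp at hsing
        | cons d D₁ => exact ⟨le_rfl, (hD₁x d (by simp)).2⟩
      · rw [List.concat_eq_append, ← List.cons_append, ← List.append_assoc] at hX
        have := (List.append_inj' hX rfl).2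
        grind
    -- A block in front of it within the window would consist of letters `x` only, hence could not
    -- be linked to a block whose last letter goes with `x`.
    have hb₁0 : b₁ = [] := by
      rcases List.eq_nil_or_concat b₁ with h | ⟨b, P, rfl⟩
      · exact h
      · exfalso
        rw [List.concat_eq_append] at hρ1 hb₁
        have hρ2 : IsReading (Rel N) ((Q₀ ++ [s] :: b) ++ P :: (D₁ ++ x :: D₂) :: b₂) := by
          simpa using hρ1
        have hl := hρ2.link
        refine hl.not_of_eq (x := x) ?_ hlastrel
        intro y hy
        rw [hdt, hdx] at hl
        exact le_antisymm (Link.le_head hl ht0 y hy) (hb₁ P (by simp) y hy).1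
    subst hb₁0
    simp only [List.flatten_nil, List.nil_append] at hL
    subst hL
    rw [List.nil_append, List.isChain_cons_cons] at hch
    rw [List.nil_append] at he hρ1
    have hD₂0 : D₂ ≠ [] := by
      rintro rfl
      obtain ⟨X, c, hX, -, -, y, hy, hyc⟩ := hch.1
      rw [List.mem_singleton] at hy
      have := (List.append_inj' hX rfl).2
      simp at this
      rw [hy, ← this] at hyc
      exact hyc ⟨hsx.le, hNs⟩
    obtain ⟨L₃, rfl⟩ : D₂ <+: L₂ := by
      rcases hβ with rfl | ⟨z, β', rfl, hz⟩
      · grind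
      · by_contra hcon
        have hle : L₂.length ≤ D₂.length := by
          by_contra hlt
          exact hcon (List.prefix_of_prefix_length_le (l₃ := v) (by rw [← hv']; simp)
            (by rw [hv]; simp) (by omega))
        obtain ⟨e, rfl⟩ : L₂ <+: D₂ := List.prefix_of_prefix_length_le (l₃ := v)
            (by rw [hv]; simp) (by rw [← hv']; simp) hle
        cases e with
        | nil => exact hcon (by simp)
        | cons f e =>
          simp_all
    rw [hv, List.append_assoc] at hv'
    obtain ⟨Ds, b', U, rfl, rfl, hb', hV⟩ := exists_tiles_in (List.append_cancel_left hv')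
    have hDsgt : ∀ B ∈ Ds, ∀ y ∈ B, x < y ∧ ¬ N x y := fun B hB y hy => hL₂' y (by
      rw [List.mem_append, List.mem_append]
      exact Or.inr (Or.inl (List.mem_flatten.2 ⟨B, hB, hy⟩)))
    have hUgt : ∀ y ∈ U, x < y ∧ ¬ N x y := fun y hy => hL₂' y (by simp [hy])
    have hMgt : ∀ y ∈ D₂, x < y ∧ ¬ N x y := fun y hy => hL₂' y (by simp [hy])
    have hlE : Link (Rel N) [s] (D₁ ++ D₂) := by
      obtain ⟨X, c, hX, hXp, hsX, y, hy, hyc⟩ := hch.1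
      rcases List.eq_nil_or_concat D₂ with rfl | ⟨D₃, e, rfl⟩
      · exact absurd rfl hD₂0
      rw [List.concat_eq_append] at *
      rw [← List.cons_append, ← List.append_assoc] at hX
      obtain ⟨rfl, h3⟩ := List.append_inj' hX rfl
      simp only [List.cons.injEq, and_true] at h3
      subst h3
      refine ⟨D₁ ++ D₃, e, by simp, hXp.sublist ?_, hsX.sublist ?_, y, hy, hyc⟩
      · simp
      · simp
    have hch2 : ((D₁ ++ D₂) :: Ds).IsChain (Link (Rel N)) := by
      have h1 : ((D₁ ++ x :: D₂) :: Ds).IsChain (Link (Rel N)) := by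
        have := hch.2
        rw [show (D₁ ++ x :: D₂) :: (Ds ++ b') = ((D₁ ++ x :: D₂) :: Ds) ++ b' by simp] at this
        exact (List.isChain_append.1 this).1
      cases Ds with
      | nil => simp
      | cons C Ds =>
        rw [List.isChain_cons_cons] at h1 ⊢
        exact ⟨h1.1.erase fun b hb => ⟨(hDsgt C (by simp) b hb).1.le, (hDsgt C (by simp) b hb).2⟩,
          h1.2⟩
    have hread : IsReading (Rel N) ((Q₀ ++ [[s]]) ++ (D₁ ++ D₂) :: Ds) := by
      have := hρ1.cPrefix.isReading (List.isChain_cons_cons.2 ⟨hlE, hch2⟩)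
      simpa using this
    have hend : (U = [] ∧ β = []) ∨ ∃ z β', β = z :: β' ∧ ¬ Rel N x z ∧
        (U ++ [z]).Pairwise (Rel N) := by
      rcases hβ with rfl | ⟨z, β', rfl, hz⟩
      · left
        rcases hV with rfl | ⟨V, b'', rfl, hlt⟩
        all_goals grind
      · right
        refine ⟨z, β', rfl, hz, ?_⟩
        rcases hV with rfl | ⟨V, b'', rfl, hlt⟩
        · simp at hb'
        · have hVp := (hρ1.isCell V (by simp)).2
          obtain ⟨e, rfl⟩ : U ++ [z] <+: V := List.prefix_of_prefix_length_le
            (l₃ := U ++ z :: β') (by simp) (by rw [← hb']; simp) (by simp; omega)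
          exact (List.pairwise_append.1 hVp).1
    refine ⟨Q₀ ++ [[s]], D₁, D₂, Ds, U, β, ⟨hread, hlast, hD₁x, hMgt, hD₂0, hDsgt, hUgt, ?_, hend⟩,
      ?_, hfib _ (by rw [hv]; simp)⟩
    · intro b B hB
      rcases hV with rfl | ⟨V, b'', rfl, hlt⟩
      · rw [List.flatten_nil] at hb'
        rw [(List.append_eq_nil_iff.1 hb'.symm).1, List.append_nil]
        exact (hread.isCell B (by rw [hB]; simp)).2
      -- The rest `U` is a proper initial part of the next block, so it is compatible with the block
      -- before it, and also after `x` is taken out.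
      · obtain ⟨b₃, B', hb₃, hBB'⟩ : ∃ b₃ B', (D₁ ++ x :: D₂) :: Ds = b₃ ++ [B'] ∧ B.Sublist B' := by
          rcases List.eq_nil_or_concat Ds with rfl | ⟨Ds', Y, rfl⟩
          · refine ⟨[], D₁ ++ x :: D₂, rfl, ?_⟩
            have h3 := (List.append_inj' (s₁ := []) hB rfl).2
            simp at h3
            rw [← h3]; simp
          · rw [List.concat_eq_append, ← List.cons_append] at hB
            have h3 := (List.append_inj' hB rfl).2
            grind
        have hρ3 : IsReading (Rel N) ((Q₀ ++ [[s]] ++ b₃) ++ B' :: V :: b'') := by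
          rw [show Q₀ ++ [s] :: (D₁ ++ x :: D₂) :: (Ds ++ V :: b'') =
            (Q₀ ++ [[s]]) ++ ((D₁ ++ x :: D₂) :: Ds) ++ V :: b'' by simp, hb₃] at hρ1
          simpa using hρ1
        obtain ⟨X, c, rfl, -, hX, -⟩ := hρ3.link
        obtain ⟨e, rfl⟩ : U <+: X := List.prefix_of_prefix_length_le
            (l₃ := U ++ β) (by simp) (by rw [← hb']; simp) (by simp at hlt; omega)
        refine hX.sublist ?_
        exact (List.Sublist.append_right hBB' U).trans (by simp)
    · left
      rw [ht.1, hv]; simp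

end Classify

/-! ### A fiber is determined by its window. -/

section FiberPair
variable {A : Type*} [LinearOrder A] {N : A → A → Prop} {Q : List (List A)} {E₀ M : List A}
  {Ds : List (List A)} {x : A} {U β : List A}

theorem append_inj_of_stop {A : Type*} (p : A → Prop) {L β L' β' : List A}
    (h : L ++ β = L' ++ β') (hL : ∀ y ∈ L, p y) (hL' : ∀ y ∈ L', p y)
    (hβ : ∀ z t, β = z :: t → ¬ p z) (hβ' : ∀ z t, β' = z :: t → ¬ p z) : L = L' ∧ β = β' := by
  rcases List.append_eq_append_iff.1 h with ⟨e, rfl, rfl⟩ | ⟨e, rfl, rfl⟩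
  · cases e with
    | nil => simp
    | cons z e => exact absurd (hL' z (by simp)) (hβ z (e ++ β') rfl)
  · cases e with
    | nil => simp
    | cons z e => exact absurd (hL z (by simp)) (hβ' z (e ++ β) rfl)

theorem Fiber.rel_letters (h : Fiber N Q E₀ M Ds x U β) :
    ∀ y ∈ E₀ ++ M ++ Ds.flatten ++ U, Rel N x y := by
  intro y hy
  simp only [List.mem_append, List.mem_flatten] at hy
  rcases hy with ((hy | hy) | ⟨B, hB, hy⟩) | hy
  · obtain ⟨rfl, h1⟩ := h.eq_first y hy
    exact ⟨le_rfl, h1⟩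
  · exact ⟨(h.gt_first y hy).1.le, (h.gt_first y hy).2⟩
  · exact ⟨(h.gt B hB y hy).1.le, (h.gt B hB y hy).2⟩
  · exact ⟨(h.gt_rest y hy).1.le, (h.gt_rest y hy).2⟩

theorem Fiber.gt_letters (h : Fiber N Q E₀ M Ds x U β) :
    ∀ y ∈ M ++ Ds.flatten, x < y ∧ ¬ N x y := by
  intro y hy
  simp only [List.mem_append, List.mem_flatten] at hy
  rcases hy with hy | ⟨B, hB, hy⟩
  exacts [h.gt_first y hy, h.gt B hB y hy]

theorem Fiber.stop_rel (h : Fiber N Q E₀ M Ds x U β) : ∀ z t, β = z :: t → ¬ Rel N x z := by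
  rintro z t rfl
  rcases h.ending with ⟨-, h⟩ | ⟨z, β', h, hz, -⟩
  · simp at h
  · simp at h
    rwa [h.1]

/-- `Q` is the reading of its word; `β` starts at the first letter not related to `x`; the tiles are
read off deterministically until reading stops; and `E₀` consists of the letters `x` of the first
tile. -/
theorem Fiber.unique {Q' : List (List A)} {E₀' M' : List A} {Ds' : List (List A)} {U' β' : List A}
    (h : Fiber N Q E₀ M Ds x U β) (h' : Fiber N Q' E₀' M' Ds' x U' β')
    (hQ : Q.flatten = Q'.flatten)
    (he : E₀ ++ M ++ Ds.flatten ++ (U ++ β) = E₀' ++ M' ++ Ds'.flatten ++ (U' ++ β')) :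
    Q = Q' ∧ E₀ = E₀' ∧ M = M' ∧ Ds = Ds' ∧ U ++ β = U' ++ β' := by
  have hr : ∀ {Q E₀ M Ds U β}, Fiber N Q E₀ M Ds x U β → IsReading (Rel N) Q := by
    intro Q E₀ M Ds U β h
    obtain ⟨Q₀, s, rfl, -, -⟩ := h.last
    have := h.reading
    rw [List.append_assoc] at this
    exact isReading_snoc.2 this.cPrefix
  obtain rfl := (hr h).unique (hr h') hQ
  rw [← List.append_assoc, ← List.append_assoc] at he
  obtain ⟨h1, rfl⟩ := append_inj_of_stop (Rel N x) he h.rel_letters h'.rel_letters h.stop_rel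
    h'.stop_rel
  obtain ⟨Q₀, s, rfl, -, -⟩ := h.last
  have hc : ∀ {E₀ M Ds U β}, Fiber N (Q₀ ++ [[s]]) E₀ M Ds x U β →
      ([s] :: (E₀ ++ M) :: Ds).IsChain (Link (Rel N)) := by
    intro E₀ M Ds U β h
    have := h.reading
    rw [List.append_assoc] at this
    exact this.chain
  have hm : ∀ {E₀ M Ds U β}, Fiber N (Q₀ ++ [[s]]) E₀ M Ds x U β →
      ∀ b B, [s] :: (E₀ ++ M) :: Ds = b ++ [B] → (B ++ U).Pairwise (Rel N) := by
    intro E₀ M Ds U β h b B hb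
    cases b with
    | nil => simp at hb
    | cons c b => exact h.maximal b B (by simpa using (List.cons.inj hb).2)
  obtain ⟨h2, rfl⟩ := chain_append_unique (hc h) (hc h') (hm h) (hm h') (by simpa using h1)
  obtain ⟨h3, rfl⟩ := List.cons.inj h2
  obtain ⟨rfl, rfl⟩ := append_inj_of_stop (fun y => y = x) h3 (fun y hy => (h.eq_first y hy).1)
    (fun y hy => (h'.eq_first y hy).1)
    (fun z t hz => (h.gt_first z (by rw [hz]; simp)).1.ne')
    (fun z t hz => (h'.gt_first z (by rw [hz]; simp)).1.ne')
  exact ⟨rfl, rfl, rfl, rfl, rfl⟩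

omit [LinearOrder A] in
theorem FiberWord.exists_split {r w : List A} (h : FiberWord Q E₀ M Ds x r w) :
    ∃ m₁ m₂, m₁ ++ m₂ = M ++ Ds.flatten ∧ w = Q.flatten ++ E₀ ++ m₁ ++ x :: (m₂ ++ r) := by
  rcases h with rfl | rfl | ⟨Ds', Y, rfl, rfl⟩
  · exact ⟨[], M ++ Ds.flatten, by simp, by simp⟩
  · exact ⟨M ++ Ds.flatten, [], by simp, by simp⟩
  · exact ⟨M ++ Ds'.flatten, Y, by simp, by simp⟩

theorem Fiber.candAt (h : Fiber N Q E₀ M Ds x U β) {m : List A}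
    (hm : ∀ y ∈ m, Rel N x y) : CandAt N (Q.flatten ++ m) x := by
  obtain ⟨Q₀, s, rfl, hs, hN⟩ := h.last
  exact ⟨Q₀.flatten, s, m, by simp, hs, hN, hm⟩

/-- All other copies of `x` in the related part of the window lie in `E₀`, hence further to the
left, and the toggled occurrence is the last candidate. -/
theorem Fiber.tog (h : Fiber N Q E₀ M Ds x U β) {m₁ m₂ : List A}
    (hm : m₁ ++ m₂ = M ++ Ds.flatten)
    (hf : Fib N (Q.flatten ++ E₀ ++ m₁ ++ x :: (m₂ ++ (U ++ β))) Q.flatten x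
      (E₀ ++ M ++ Ds.flatten ++ (U ++ β))) :
    Tog N (Q.flatten ++ E₀ ++ m₁ ++ x :: (m₂ ++ (U ++ β))) (Q.flatten ++ E₀ ++ m₁) x
      (m₂ ++ (U ++ β)) := by
  obtain ⟨L, v, ht, hp, hL, -⟩ := hf
  have hgt : ∀ y ∈ m₁ ++ m₂, x < y ∧ ¬ N x y := by rw [hm]; exact h.gt_letters
  have hp' : (E₀ ++ m₁) ++ (m₂ ++ (U ++ β)) = L ++ v := by
    rw [← hp, List.append_assoc E₀ M, ← hm]; simp
  have hw : (E₀ ++ m₁) ++ x :: (m₂ ++ (U ++ β)) = L ++ x :: v :=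
    List.append_cancel_left (as := Q.flatten) (by simpa using ht.1)
  have hc : CandAt N (Q.flatten ++ (E₀ ++ m₁)) x := h.candAt fun y hy => h.rel_letters y (by
    rw [List.append_assoc E₀ M, ← hm]
    simp only [List.mem_append] at hy ⊢
    tauto)
  rcases List.append_eq_append_iff.1 hw with ⟨e, rfl, he⟩ | ⟨e, he, he'⟩
  · cases e with
    | nil =>
      grind
    | cons y e =>
      exfalso
      simp only [List.cons_append, List.cons.injEq] at he
      obtain ⟨rfl, -⟩ := he
      rw [List.append_assoc] at hp'
      have h1 := List.append_cancel_left (List.append_cancel_left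
        (by simpa only [List.append_assoc] using hp'))
      rcases m₂ with _ | ⟨y, m₂⟩
      · rcases U with _ | ⟨y, U⟩
        · exact h.stop_rel _ _ h1 (hL x (by simp))
        · simp at h1
          exact (h.gt_rest y (by simp)).1.ne' h1.1
      · simp at h1
        exact (hgt y (by simp)).1.ne' h1.1
  · cases e with
    | nil =>
      grind
    | cons y e =>
      exfalso
      simp only [List.cons_append, List.cons.injEq] at he'
      obtain ⟨rfl, rfl⟩ := he'
      have := (ht.2.2 _ x (m₂ ++ (U ++ β)) (by simp) hc).2 rfl
      simp at this
      omega

theorem Fiber.fib (hN : Symmetric N) (h : Fiber N Q E₀ M Ds x U β) {w w' : List A}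
    (hw : FiberWord Q E₀ M Ds x (U ++ β) w) (hw' : FiberWord Q E₀ M Ds x (U ++ β) w')
    (hf : Fib N w Q.flatten x (E₀ ++ M ++ Ds.flatten ++ (U ++ β))) :
    Fib N w' Q.flatten x (E₀ ++ M ++ Ds.flatten ++ (U ++ β)) := by
  obtain ⟨m₁, m₂, hm, rfl⟩ := hw.exists_split
  obtain ⟨m₁', m₂', hm', rfl⟩ := hw'.exists_split
  have ht := h.tog hm hf
  have hgt := h.gt_letters
  have h1 := Tog.move_left hN (fun b hb => hgt b (by rw [← hm]; simp [hb])) ht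
  rw [← List.append_assoc m₁, hm, ← hm', List.append_assoc m₁'] at h1
  have h2 := Tog.move_right hN (fun b hb => hgt b (by rw [← hm']; simp [hb])) h1
  obtain ⟨Q₀, s, rfl, hs, hNs⟩ := h.last
  refine ⟨E₀ ++ m₁', m₂' ++ (U ++ β), by simpa using h2, ?_, fun y hy => h.rel_letters y ?_,
    Q₀.flatten, s, by simp, hs, hNs⟩
  all_goals grind

/-- `IsReading.exists_fiber` places every reading with this window in a fiber, and `Fiber.unique`
shows that it is always the same one. -/
theorem IsReading.exists_fiber_pair (hN : Symmetric N) {ρ : List (List A)} {pre post : List A}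
    (hρ : IsReading (Rel N) ρ) (hf : Fib N ρ.flatten pre x post) :
    ∃ τ σ, IsReading (Rel N) τ ∧ IsReading (Rel N) σ ∧ Fib N τ.flatten pre x post ∧
      Fib N σ.flatten pre x post ∧ (∃! q, CritPath (Rel N) τ σ q) ∧
      ∀ ρ', IsReading (Rel N) ρ' → Fib N ρ'.flatten pre x post → ρ' = τ ∨ ρ' = σ := by
  obtain ⟨L, v, ht, -⟩ := id hf
  obtain ⟨Q, E₀, M, Ds, U, β, hF, hw, hf'⟩ := hρ.exists_fiber ht
  obtain ⟨rfl, -, rfl⟩ := hf'.unique hf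
  obtain ⟨τ, σ, hτ, hσ, hτw, hσw, hu, hall⟩ := hF.exists_pair hN hρ hw
  refine ⟨τ, σ, hτ, hσ, hF.fib hN hw hτw hf, hF.fib hN hw hσw hf, hu, fun ρ' hρ' hf₁ => ?_⟩
  obtain ⟨L', v', ht', -⟩ := id hf₁
  obtain ⟨Q', E₀', M', Ds', U', β', hF', hw', hf₂⟩ := hρ'.exists_fiber ht'
  obtain ⟨h1, -, h2⟩ := hf₂.unique hf₁
  obtain ⟨rfl, rfl, rfl, rfl, h3⟩ := hF'.unique hF h1 h2
  rw [h3] at hw'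
  exact hall ρ' hρ' hw'

end FiberPair

/-! ### The matching of critical cells. -/

section FibPair
variable {A : Type*}

theorem AltPath.length_eq {R : A → A → Prop} {σ s : List (List A)} {p : List (List (List A))}
    (h : AltPath R σ s p) : s.length = σ.length := by
  induction h with
  | nil => rfl
  | cons hu hd _ _ ih =>
    obtain ⟨b₁, D, D', b₂, rfl, rfl, -⟩ := hu
    obtain ⟨c₁, E, E', c₂, G, h1, rfl, -⟩ := hd
    have := congrArg List.length h1
    simp at ih this ⊢
    omega

theorem CritPath.length_eq {R : A → A → Prop} {τ σ : List (List A)} {q : List (List (List A))}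
    (h : CritPath R τ σ q) : τ.length = σ.length + 1 := by
  obtain ⟨s, p, rfl, ⟨b₁, D, D', b₂, G, rfl, rfl, -⟩, hp⟩ := h
  have := hp.length_eq
  simp at this ⊢
  omega

variable [LinearOrder A] {N : A → A → Prop} {τ σ τ' σ' ρ : List (List A)}

theorem CritPath.dom (hN : Symmetric N) {q : List (List (List A))} (h : CritPath (Rel N) τ σ q) :
    Dom N τ.flatten σ.flatten := by
  obtain ⟨s, p, rfl, hd, hp⟩ := h
  exact (hd.dom hN).trans (HasPath.dom hN ⟨p, hp⟩)

/-- Two critical cells that differ by moving the toggled letter inside its window. -/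
def FibPair (N : A → A → Prop) (τ σ : List (List A)) : Prop :=
  IsReading (Rel N) τ ∧ IsReading (Rel N) σ ∧ τ.length = σ.length + 1 ∧
    ∃ pre x post, Fib N τ.flatten pre x post ∧ Fib N σ.flatten pre x post

/-- The two readings of the fiber differ by one in their number of blocks, which determines the
upper one. -/
theorem IsReading.existsUnique_fibPair (hN : Symmetric N) {pre post : List A} {x : A}
    (hρ : IsReading (Rel N) ρ) (hf : Fib N ρ.flatten pre x post) :
    ∃ τ σ, FibPair N τ σ ∧ (ρ = τ ∨ ρ = σ) ∧ (∃! q, CritPath (Rel N) τ σ q) ∧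
      ∀ τ' σ', FibPair N τ' σ' → (ρ = τ' ∨ ρ = σ') → τ' = τ ∧ σ' = σ := by
  obtain ⟨τ, σ, hτ, hσ, hτf, hσf, hu, hall⟩ := hρ.exists_fiber_pair hN hf
  have hlen := hu.exists.choose_spec.length_eq
  refine ⟨τ, σ, ⟨hτ, hσ, hlen, pre, x, post, hτf, hσf⟩, hall ρ hρ hf, hu, ?_⟩
  rintro τ' σ' ⟨h1, h2, h3, pre', x', post', h4, h5⟩ hρ'
  obtain ⟨rfl, rfl, rfl⟩ : pre' = pre ∧ x' = x ∧ post' = post := by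
    rcases hρ' with rfl | rfl
    exacts [h4.unique hf, h5.unique hf]
  grind

theorem FibPair.existsUnique (hN : Symmetric N) (h : FibPair N τ σ) :
    ∃! q, CritPath (Rel N) τ σ q := by
  obtain ⟨h1, -, -, pre, x, post, h2, -⟩ := id h
  obtain ⟨τ', σ', -, -, hu, hall⟩ := h1.existsUnique_fibPair hN h2
  obtain ⟨rfl, rfl⟩ := hall τ σ h (Or.inl rfl)
  exact hu

theorem FibPair.eq (hN : Symmetric N) (h : FibPair N τ σ) (h' : FibPair N τ' σ')
    (hρ : ρ = τ ∨ ρ = σ) (hρ' : ρ = τ' ∨ ρ = σ') : τ = τ' ∧ σ = σ' := by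
  obtain ⟨h1, h2, -, pre, x, post, h3, h4⟩ := id h
  have : IsReading (Rel N) ρ ∧ Fib N ρ.flatten pre x post := by
    grind
  obtain ⟨τ₀, σ₀, -, -, -, hall⟩ := this.1.existsUnique_fibPair hN this.2
  grind

theorem FibPair.key_eq (h : FibPair N τ σ) : key N τ.flatten = key N σ.flatten := by
  obtain ⟨-, -, -, pre, x, post, h1, h2⟩ := h
  exact h1.key_eq h2

/-- Along the dominance order the potential drops unless both words share a window. In that case the
cells form a pair, and the words cannot be equal because the numbers of blocks differ. -/
theorem CritPath.key_lt (hN : Symmetric N) {q : List (List (List A))}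
    (h : CritPath (Rel N) τ σ q) (hτ : IsReading (Rel N) τ) (hσ : IsReading (Rel N) σ)
    (hM : ¬ FibPair N τ σ) : toLex (key N σ.flatten) < toLex (key N τ.flatten) := by
  rcases (h.dom hN).key_lt hN with h1 | h1 | h1
  · have := h.length_eq
    rw [hτ.unique hσ h1] at this
    omega
  · exact h1
  · exact absurd ⟨hτ, hσ, h.length_eq, h1⟩ hM

end FibPair

/-! ### Commutation classes and their settled words. -/

section Classes
variable {A : Type*} {N : A → A → Prop}

/-- Swapping two adjacent commuting letters. -/
def Comm (N : A → A → Prop) (w w' : List A) : Prop :=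
  ∃ u v a b, ¬ N a b ∧ w = u ++ [a, b] ++ v ∧ w' = u ++ [b, a] ++ v

theorem Comm.perm {w w' : List A} (h : Comm N w w') : w.Perm w' := by
  obtain ⟨u, v, a, b, -, rfl, rfl⟩ := h
  simpa using List.Perm.append_left u (List.Perm.swap b a v)

theorem eqvGen_comm_perm {w w' : List A} (h : Relation.EqvGen (Comm N) w w') : w.Perm w' := by
  induction h with
  | rel _ _ h => exact h.perm
  | refl => exact List.Perm.refl _
  | symm _ _ _ ih => exact ih.symm
  | trans _ _ _ _ _ ih ih' => exact ih.trans ih'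

theorem eqvGen_apply {A B : Type*} {r : A → A → Prop} {f : A → B} (h : ∀ a b, r a b → f a = f b)
    {a b : A} (hab : Relation.EqvGen r a b) : f a = f b := by
  induction hab with
  | rel _ _ h' => exact h _ _ h'
  | refl => rfl
  | symm _ _ _ ih => exact ih.symm
  | trans _ _ _ _ _ ih ih' => exact ih.trans ih'

theorem eqvGen_move {u m v : List A} {x : A} (hm : ∀ y ∈ m, ¬ N y x) :
    Relation.EqvGen (Comm N) (u ++ m ++ x :: v) (u ++ x :: (m ++ v)) := by
  induction m generalizing u with
  | nil => simpa using Relation.EqvGen.refl _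
  | cons y m ih =>
    refine .trans _ (u ++ [y] ++ x :: (m ++ v)) _ (by
      simpa using ih (u := u ++ [y]) fun y hy => hm y (by simp [hy])) ?_
    exact .rel _ _ ⟨u, m ++ v, y, x, hm y (by simp), by simp, by simp⟩

theorem SwapStep.comm [LinearOrder A] (hN : Symmetric N) {w w' : List A} (h : SwapStep N w w') :
    Comm N w w' := by
  obtain ⟨u, v, a, b, -, h, rfl, rfl⟩ := h
  exact ⟨u, v, b, a, fun h' => h (hN h'), by simp, by simp⟩

theorem Dom.eqvGen [LinearOrder A] (hN : Symmetric N) {w w' : List A} (h : Dom N w w') :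
    Relation.EqvGen (Comm N) w w' := by
  induction h with
  | refl => exact .refl _
  | tail _ h ih => exact .trans _ _ _ ih (.rel _ _ (h.comm hN))

/-- The letter `b` can be moved to the front. -/
def Initial (N : A → A → Prop) (b : A) : List A → Prop
  | [] => False
  | y :: t => y = b ∨ (¬ N b y ∧ Initial N b t)

theorem Initial.comm (hN : Symmetric N) {b : A} {w w' : List A} (h : Comm N w w') :
    Initial N b w = Initial N b w' := by
  obtain ⟨u, v, a, c, hac, rfl, rfl⟩ := h
  have hca : ¬ N c a := fun h => hac (hN h)
  induction u with
  | nil =>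
    simp only [List.nil_append, List.cons_append, Initial, eq_iff_iff]
    grind
  | cons y u ih =>
    simp only [List.cons_append, List.append_assoc, List.nil_append, Initial] at ih ⊢
    rw [ih]

theorem Initial.exists_split {b : A} {w : List A} (h : Initial N b w) :
    ∃ m v, w = m ++ b :: v ∧ ∀ y ∈ m, y ≠ b ∧ ¬ N b y := by
  induction w with
  | nil => exact h.elim
  | cons y w ih =>
    by_cases hy : y = b
    · exact ⟨[], w, by simp [hy], by simp⟩
    · obtain ⟨h1, h2⟩ := h.resolve_left hy
      grind

theorem eqvGen_erase [DecidableEq A] {w w' : List A} (h : Relation.EqvGen (Comm N) w w') (b : A) :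
    Relation.EqvGen (Comm N) (w.erase b) (w'.erase b) := by
  induction h with
  | rel w w' h =>
    obtain ⟨u, v, a, c, hac, rfl, rfl⟩ := h
    by_cases hu : b ∈ u
    · rw [List.append_assoc, List.append_assoc, List.erase_append_left _ hu,
        List.erase_append_left _ hu]
      exact .rel _ _ ⟨u.erase b, v, a, c, hac, by simp, by simp⟩
    · rw [List.append_assoc, List.append_assoc, List.erase_append_right _ hu,
        List.erase_append_right _ hu]
      by_cases h1 : a = b
      · by_cases h2 : c = b
        · subst h1 h2; exact .refl _
        · subst h1; simp [h2]; exact .refl _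
      · by_cases h2 : c = b
        · subst h2; simp [h1]; exact .refl _
        · exact .rel _ _ ⟨u, v.erase b, a, c, hac, by simp [h1, h2],
            by simp [h1, h2]⟩
  | refl => exact .refl _
  | symm _ _ _ ih => exact .symm _ _ ih
  | trans _ _ _ _ _ ih ih' => exact .trans _ _ _ ih ih'

variable [LinearOrder A]

/-- No letter of `w` can be moved to the left past a smaller one. -/
def Settled (N : A → A → Prop) (w : List A) : Prop := ∀ u a v, w = u ++ a :: v → ¬ CandAt N u a

theorem settled_iff {w : List A} : Settled N w ↔ ∀ u x v, ¬ Tog N w u x v := by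
  refine ⟨fun h u x v ht => h u x v ht.1 ht.2.1, fun h u a v hw hc => ?_⟩
  obtain ⟨u, x, v, ht, -⟩ := exists_tog hw hc
  exact h u x v ht

/-- The last letter of `m` below `b` is the smaller letter that `b` can cross. -/
theorem exists_last_lt {m : List A} {b a : A} (ha : a ∈ m) (hab : a < b) (hm : ∀ y ∈ m, ¬ N b y)
    (hN : Symmetric N) (u : List A) : CandAt N (u ++ m) b := by
  obtain ⟨m₁, s, m₂, rfl, hs, h⟩ := exists_last_of_exists (p := (· < b)) ⟨a, ha, hab⟩
  exact ⟨u ++ m₁, s, m₂, by simp, hs, fun h => hm s (by simp) (hN h), fun y hy =>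
    ⟨not_lt.1 (h y hy), hm y (by simp [hy])⟩⟩

/-- The first letters agree: a larger first letter of one word could be brought to the front of the
other, past a smaller letter. Erasing them preserves equivalence and settledness. -/
theorem Settled.eq (hN : Symmetric N) {w w' : List A} (h : Settled N w) (h' : Settled N w')
    (he : Relation.EqvGen (Comm N) w w') : w = w' := by
  induction w generalizing w' with
  | nil => exact (eqvGen_comm_perm he).nil_eq
  | cons a t ih =>
    cases w' with
    | nil => exact (eqvGen_comm_perm he).eq_nil
    | cons b t' =>
      have key : ∀ {a b t t'}, Settled N (a :: t) → Relation.EqvGen (Comm N) (a :: t) (b :: t') →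
          ¬ a < b := by
        intro a b t t' hs he hab
        have hb : Initial N b (a :: t) := by
          rw [eqvGen_apply (fun _ _ h => Initial.comm hN h) he]
          exact Or.inl rfl
        obtain ⟨m, v, hm, hmb⟩ := hb.exists_split
        cases m with
        | nil => exact hab.ne (List.cons.inj hm).1
        | cons c m =>
          obtain ⟨rfl, -⟩ := List.cons.inj hm
          exact hs _ b v hm (exists_last_lt (m := a :: m) (by simp) hab
            (fun y hy => (hmb y hy).2) hN [])
      obtain rfl := le_antisymm (not_lt.1 (key h' (he.symm _ _))) (not_lt.1 (key h he))
      have ht : ∀ {t}, Settled N (a :: t) → Settled N t := by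
        rintro t hs u c v rfl ⟨u₀, s, mid, rfl, h⟩
        exact hs (a :: (u₀ ++ s :: mid)) c v rfl ⟨a :: u₀, s, mid, rfl, h⟩
      rw [ih (ht h) (ht h') (by simpa using eqvGen_erase he a)]

/-- The lexicographically largest word of the class is settled, since moving a candidate to the left
would give a larger one. -/
theorem exists_settled (hN : Symmetric N) (w : List A) :
    ∃ w', Relation.EqvGen (Comm N) w w' ∧ Settled N w' := by
  classical
  have hfin : {w' | Relation.EqvGen (Comm N) w w'}.Finite :=
    w.permutations.toFinset.finite_toSet.subset fun w' h => by
      simpa using (eqvGen_comm_perm h).symm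
  obtain ⟨w', h, hmax⟩ := hfin.exists_maximal ⟨w, .refl _⟩
  refine ⟨w', h, ?_⟩
  rintro _ a v rfl ⟨u₀, s, mid, rfl, hs, hNs, hmid⟩
  have h1 : Relation.EqvGen (Comm N) (u₀ ++ s :: mid ++ a :: v) (u₀ ++ a :: (s :: mid ++ v)) := by
    refine eqvGen_move (u := u₀) (m := s :: mid) fun y hy => ?_
    rcases List.mem_cons.1 hy with rfl | hy
    exacts [hNs, fun h => (hmid y hy).2 (hN h)]
  have hlt : u₀ ++ s :: mid ++ a :: v < u₀ ++ a :: (s :: mid ++ v) := by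
    rw [List.append_assoc]
    exact List.append_left_lt (List.Lex.rel hs)
  exact absurd (hmax (.trans _ _ _ h h1) hlt.le) (not_le.2 hlt)

/-- The pattern of the letters not commuting with `a`. -/
noncomputable def pattern (N : A → A → Prop) (a : A) (w : List A) : List Bool := by
  classical
  exact (w.filter fun y => decide (y = a ∨ N a y)).map fun y => decide (y = a)

theorem pattern_comm (hN : Symmetric N) (a : A) {w w' : List A} (h : Comm N w w') :
    pattern N a w = pattern N a w' := by
  obtain ⟨u, v, c, d, hcd, rfl, rfl⟩ := h
  have hdc : ¬ N d c := fun h => hcd (hN h)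
  simp only [pattern, List.filter_append, List.map_append]
  congr 2
  by_cases h1 : c = a
  · grind
  · by_cases h2 : d = a
    all_goals grind

/-- By invariance of the pattern, `w` contains two letters `a` with only commuting letters between
them. A smaller one among these would make the second `a` a candidate; otherwise the first of these
letters would itself be one. -/
theorem Settled.exists_adjacent (hN : Symmetric N) {w u v : List A} {a : A} (h : Settled N w)
    (ha : ¬ N a a) (he : Relation.EqvGen (Comm N) w (u ++ [a, a] ++ v)) :
    ∃ u' v', w = u' ++ [a, a] ++ v' := by
  have hp := eqvGen_apply (fun _ _ h => pattern_comm hN a h) he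
  have : pattern N a (u ++ [a, a] ++ v) = pattern N a u ++ (true :: true :: pattern N a v) := by
    simp [pattern]
  rw [this] at hp
  unfold pattern at hp
  obtain ⟨l₁, l₂, hl, -, h2⟩ := List.map_eq_append_iff.1 hp
  obtain ⟨c, l₃, rfl, hc, h3⟩ := List.map_eq_cons_iff.1 h2
  obtain ⟨d, l₄, rfl, hd, -⟩ := List.map_eq_cons_iff.1 h3
  simp only [decide_eq_true_eq] at hc hd
  subst hc
  subst hd
  obtain ⟨w₁, w₂, rfl, -, hw₂⟩ := List.filter_eq_append_iff.1 hl
  obtain ⟨m, w₃, rfl, -, -, hw₃⟩ := List.filter_eq_cons_iff.1 hw₂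
  obtain ⟨m', w₄, rfl, hm', -, -⟩ := List.filter_eq_cons_iff.1 hw₃
  have hm : ∀ y ∈ m', y ≠ d ∧ ¬ N d y := fun y hy => by simpa using hm' y hy
  cases m' with
  | nil => exact ⟨w₁ ++ m, w₄, by simp⟩
  | cons y m' =>
    exfalso
    by_cases hlt : ∃ z ∈ y :: m', z < d
    · obtain ⟨z, hz, hzd⟩ := hlt
      exact h (w₁ ++ m ++ [d] ++ y :: m') d w₄ (by simp)
        (exists_last_lt hz hzd (fun y hy => (hm y hy).2) hN _)
    · have hy := hm y (by simp)
      refine h (w₁ ++ m ++ [d]) y (m' ++ d :: w₄) (by simp) ⟨w₁ ++ m, d, [], rfl, ?_, hy.2, by simp⟩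
      grind

end Classes

/-! ### The toric ideal: non-minimal monomials are detected in degree two. -/

section Words
variable {e n : ℕ} (α : Fin n → (Fin e →₀ ℕ))

/-- The degree of a word. -/
noncomputable def deg (w : List (Fin n)) : Fin e →₀ ℕ := (w.map α).sum

/-- The degree of a monomial. -/
noncomputable def wt (m : Fin n →₀ ℕ) : Fin e →₀ ℕ := m.sum fun i c => c • α i

@[simp] theorem deg_nil : deg α [] = 0 := rfl

@[simp] theorem deg_cons (a : Fin n) (w : List (Fin n)) : deg α (a :: w) = α a + deg α w := rfl

@[simp] theorem deg_append (u v : List (Fin n)) : deg α (u ++ v) = deg α u + deg α v := by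
  simp [deg]

theorem content_cons (a : Fin n) (w : List (Fin n)) :
    content (a :: w) = Finsupp.single a 1 + content w := rfl

theorem content_append (u v : List (Fin n)) : content (u ++ v) = content u + content v := by
  simp [content]

theorem content_eq (w : List (Fin n)) : content w = Multiset.toFinsupp (w : Multiset (Fin n)) := by
  induction w with
  | nil => simp [content]
  | cons a w ih =>
    rw [content_cons, ih, ← Multiset.cons_coe, ← Multiset.singleton_add, map_add,
      Multiset.toFinsupp_singleton]

theorem content_eq_iff {u v : List (Fin n)} : content u = content v ↔ u.Perm v := by
  rw [content_eq, content_eq, Multiset.toFinsupp.injective.eq_iff, Multiset.coe_eq_coe]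

theorem exists_content (m : Fin n →₀ ℕ) : ∃ w, content w = m := by
  refine ⟨(Finsupp.toMultiset m).toList, ?_⟩
  rw [content_eq, Multiset.coe_toList, Multiset.toFinsupp_eq_iff]

theorem wt_add (m m' : Fin n →₀ ℕ) : wt α (m + m') = wt α m + wt α m' :=
  Finsupp.sum_add_index' (by simp) (by simp [add_smul])

theorem wt_content (w : List (Fin n)) : wt α (content w) = deg α w := by
  induction w with
  | nil => simp [content, wt]
  | cons a w ih => rw [content_cons, wt_add, ih]; simp [wt]

theorem deg_perm {u v : List (Fin n)} (h : u.Perm v) : deg α u = deg α v := (h.map α).sum_eq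

theorem sum_content (w : List (Fin n)) : ((content w).sum fun _ c => c) = w.length := by
  induction w with
  | nil => simp [content]
  | cons a w ih =>
    rw [content_cons, Finsupp.sum_add_index' (by simp) (by simp), ih]
    simp [add_comm]

theorem exists_deg {μ : Fin e →₀ ℕ} (h : μ ∈ semigroup α) : ∃ w, deg α w = μ := by
  induction h using AddSubmonoid.closure_induction with
  | mem x hx =>
    obtain ⟨i, rfl⟩ := hx
    exact ⟨[i], by simp⟩
  | zero => exact ⟨[], rfl⟩
  | add x y _ _ hx hy =>
    obtain ⟨u, rfl⟩ := hx
    obtain ⟨v, rfl⟩ := hy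
    exact ⟨u ++ v, by simp⟩

theorem deg_mem (w : List (Fin n)) : deg α w ∈ semigroup α := by
  induction w with
  | nil => exact zero_mem _
  | cons a w ih => exact add_mem (AddSubmonoid.subset_closure ⟨a, rfl⟩) ih

variable {α}

theorem deg_eq_zero (hα : IsMinimalGenerating α) {w : List (Fin n)} : deg α w = 0 ↔ w = [] := by
  cases w with
  | nil => simp
  | cons a w =>
    simp only [deg_cons, add_eq_zero, reduceCtorEq, iff_false, not_and]
    exact fun h => absurd h (hα.2 a).1

theorem eq_singleton_of_deg (hα : IsMinimalGenerating α) {w : List (Fin n)} {i : Fin n}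
    (h : deg α w = α i) : w = [i] := by
  cases w with
  | nil => exact absurd h.symm (hα.2 i).1
  | cons a w =>
    rcases (hα.2 i).2 _ (AddSubmonoid.subset_closure ⟨a, rfl⟩) _ (deg_mem α w) h with h0 | h0
    · exact absurd h0 (hα.2 a).1
    · rw [deg_eq_zero hα] at h0
      subst h0
      rw [hα.1 (show α a = α i by simpa using h)]

variable {k : Type*} [Field k] {mo : MonomialOrder (Fin n)}

theorem aeval_monomial_wt (m : Fin n →₀ ℕ) (c : k) :
    MvPolynomial.aeval (fun i => MvPolynomial.monomial (α i) (1 : k)) (MvPolynomial.monomial m c) =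
      MvPolynomial.monomial (wt α m) c := by
  rw [MvPolynomial.aeval_monomial, wt, MvPolynomial.monomial_finsupp_sum_index]
  simp [MvPolynomial.algebraMap_eq, MvPolynomial.monomial_pow]

/-- Monomials of different weight have different images, so a monomial alone in its weight could not
be cancelled in the image of `f`. -/
theorem exists_other {f : MvPolynomial (Fin n) k} (hf : f ∈ toricIdeal k α) {d : Fin n →₀ ℕ}
    (hd : d ∈ f.support) : ∃ d' ∈ f.support, d' ≠ d ∧ wt α d' = wt α d := by
  by_contra! h
  have h1 : MvPolynomial.aeval (fun i => MvPolynomial.monomial (α i) (1 : k)) f = 0 := hf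
  rw [f.as_sum, map_sum] at h1
  have h2 := congrArg (MvPolynomial.coeff (wt α d)) h1
  simp only [aeval_monomial_wt, MvPolynomial.coeff_sum, MvPolynomial.coeff_monomial,
    MvPolynomial.coeff_zero] at h2
  rw [Finset.sum_eq_single d (fun d' hd' hne => if_neg (h d' hd' hne))
    (fun hn => absurd hd hn), if_pos rfl] at h2
  exact MvPolynomial.mem_support_iff.1 hd h2

theorem monomial_mem_leadingIdeal {G : Set (MvPolynomial (Fin n) k)} {m : Fin n →₀ ℕ} :
    MvPolynomial.monomial m (1 : k) ∈ leadingIdeal mo G ↔ ∃ f ∈ G, f ≠ 0 ∧ mo.degree f ≤ m := by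
  have : {p | ∃ f ∈ G, f ≠ 0 ∧ p = MvPolynomial.monomial (mo.degree f) (1 : k)} =
      (fun s => MvPolynomial.monomial s (1 : k)) '' {d | ∃ f ∈ G, f ≠ 0 ∧ mo.degree f = d} := by
    grind
  rw [leadingIdeal, this, MvPolynomial.mem_ideal_span_monomial_image]
  simp [and_assoc]

/-- Replace the leading monomial by another monomial of `f` of the same weight. -/
theorem exists_smaller {m : Fin n →₀ ℕ} {f : MvPolynomial (Fin n) k} (hf : f ∈ toricIdeal k α)
    (h0 : f ≠ 0) (hm : mo.degree f ≤ m) :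
    ∃ m', wt α m' = wt α m ∧ mo.toSyn m' < mo.toSyn m := by
  obtain ⟨d, hd, hne, hw⟩ := exists_other hf (mo.degree_mem_support h0)
  obtain ⟨c, rfl⟩ := exists_add_of_le hm
  refine ⟨d + c, by rw [wt_add, wt_add, hw], ?_⟩
  rw [map_add, map_add]
  exact add_lt_add_left (lt_of_le_of_ne (mo.le_degree hd) fun h => hne (mo.toSyn.injective h)) _

theorem inJ_iff {a b : Fin n} : InJ k α mo a b ↔
    ∃ f ∈ toricIdeal k α, f ≠ 0 ∧ mo.degree f ≤ content [a, b] := by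
  rw [InJ, MvPolynomial.X, MvPolynomial.X,
    MvPolynomial.monomial_mul, one_mul, monomial_mem_leadingIdeal]
  simp [content]

theorem inJ_symm : Symmetric (InJ k α mo) := by
  intro a b h
  rwa [InJ, mul_comm] at h

/-- The binomial of `m` and `m'` lies in the toric ideal and has leading monomial `m`, which is
therefore divisible by the leading monomial of a basis element of degree at most two. -/
theorem exists_inJ (hα : IsMinimalGenerating α)
    (hG : HasQuadraticGroebnerBasis mo (toricIdeal k α)) {m m' : Fin n →₀ ℕ}
    (hw : wt α m' = wt α m) (hlt : mo.toSyn m' < mo.toSyn m) :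
    ∃ a b, InJ k α mo a b ∧ content [a, b] ≤ m := by
  obtain ⟨G, -, hGI, hGJ, hdeg⟩ := hG
  have hne : m' ≠ m := by rintro rfl; exact hlt.ne rfl
  have hmem : MvPolynomial.monomial m (1 : k) ∈ leadingIdeal mo G := by
    classical
    rw [hGJ, monomial_mem_leadingIdeal]
    have hd : mo.degree (MvPolynomial.monomial m (1 : k) - MvPolynomial.monomial m' 1) = m := by
      rw [mo.degree_sub_of_lt] <;> simp [mo.degree_monomial, hlt]
    refine ⟨MvPolynomial.monomial m 1 - MvPolynomial.monomial m' 1, ?_, ?_, hd.le⟩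
    · change _ - _ ∈ RingHom.ker _
      rw [RingHom.mem_ker, map_sub]
      exact sub_eq_zero.2 ((aeval_monomial_wt m 1).trans
        ((aeval_monomial_wt m' 1).trans (by rw [hw])).symm)
    · rw [sub_ne_zero]
      intro h
      simp_all
  obtain ⟨g, hg, hg0, hgm⟩ := monomial_mem_leadingIdeal.1 hmem
  have hgI : g ∈ toricIdeal k α := hGI ▸ Ideal.subset_span hg
  have hs := mo.degree_mem_support hg0
  have h2 := (MvPolynomial.le_totalDegree hs).trans (hdeg g hg)
  obtain ⟨d, hd, hdne, hdw⟩ := exists_other hgI hs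
  obtain ⟨v, hv⟩ := exists_content (mo.degree g)
  obtain ⟨v', rfl⟩ := exists_content d
  rw [← hv, sum_content] at h2
  rw [← hv, wt_content, wt_content] at hdw
  -- Degrees zero and one are impossible: a nonempty word does not have weight zero, and a minimal
  -- generator has no other factorization.
  match v with
  | [] => exact absurd (by rw [← hv, (deg_eq_zero hα).1 hdw]) hdne
  | [i] => exact absurd (by rw [← hv, eq_singleton_of_deg (w := v') (i := i) hα (by simpa using hdw)]) hdne
  | [a, b] => exact ⟨a, b, inJ_iff.2 ⟨g, hgI, hg0, hv.ge⟩, hv.le.trans hgm⟩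
  | _ :: _ :: _ :: _ => simp at h2

/-- If the content is not least in its degree, `exists_inJ` finds a quadratic obstruction among the
letters. Conversely, a pair in the initial ideal can be replaced by a smaller monomial of the same
degree. -/
theorem pairwise_not_inJ (hα : IsMinimalGenerating α)
    (hG : HasQuadraticGroebnerBasis mo (toricIdeal k α)) {w : List (Fin n)} :
    w.Pairwise (fun a b => ¬ InJ k α mo a b) ↔
      ∀ w', deg α w' = deg α w → mo.toSyn (content w) ≤ mo.toSyn (content w') := by
  constructor
  · intro h w' hw
    by_contra! hlt
    obtain ⟨a, b, hJ, hle⟩ := exists_inJ hα hG (by rw [wt_content, wt_content, hw]) hlt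
    obtain ⟨c, hc⟩ := exists_add_of_le hle
    obtain ⟨r, rfl⟩ := exists_content c
    rw [← content_append, content_eq_iff] at hc
    have := (hc.pairwise_iff fun h h' => h (inJ_symm h')).1 h
    simp at this
    exact this.1.1 hJ
  · intro h
    rw [List.pairwise_iff_forall_sublist]
    intro a b hs hJ
    obtain ⟨r, hr⟩ := hs.exists_perm_append
    obtain ⟨f, hf, h0, hle⟩ := inJ_iff.1 hJ
    obtain ⟨m', h1, h2⟩ := exists_smaller hf h0 hle
    obtain ⟨w', rfl⟩ := exists_content m'
    rw [wt_content, wt_content] at h1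
    have := h (w' ++ r) (by rw [deg_perm α hr, deg_append, deg_append, h1])
    rw [content_eq_iff.2 hr, content_append, content_append, map_add, map_add] at this
    exact absurd (add_lt_add_left h2 _) (not_lt.2 this)

end Words

/-! ### Earliest label sequences. -/

section Best
variable {n : ℕ} {mo : MonomialOrder (Fin n)}

/-- The labels, ordered by the term order on the variables. -/
def Label (_ : MonomialOrder (Fin n)) : Type := Fin n

noncomputable instance : LinearOrder (Label mo) :=
  LinearOrder.lift' (fun i : Fin n => mo.toSyn (Finsupp.single i 1)) fun _ _ h =>
    Finsupp.single_left_injective one_ne_zero (mo.toSyn.injective h)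

/-- The position of a facet in the facet order. -/
noncomputable def pos (mo : MonomialOrder (Fin n)) (w : List (Fin n)) : mo.syn ×ₗ List (Label mo) :=
  toLex (mo.toSyn (content w), w)

theorem earlier_iff {w w' : List (Fin n)} : Earlier mo w w' ↔ pos mo w < pos mo w' := by
  rw [Prod.Lex.lt_iff]
  exact or_congr Iff.rfl (and_congr mo.toSyn.injective.eq_iff.symm Iff.rfl)

theorem pos_injective : Function.Injective (pos mo) := fun _ _ h => (Prod.mk.inj h).2

theorem eq_or_earlier_iff {w w' : List (Fin n)} :
    w' = w ∨ Earlier mo w w' ↔ pos mo w ≤ pos mo w' := by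
  rw [earlier_iff, le_iff_eq_or_lt, eq_comm, pos_injective.eq_iff]

/-- Contents add up under concatenation. If they are equal, so are the lengths, hence a strict
lexicographic comparison of the first parts decides. -/
theorem pos_le_append {u u' v v' : List (Fin n)} (h : pos mo u ≤ pos mo u')
    (h' : pos mo v ≤ pos mo v') : pos mo (u ++ v) ≤ pos mo (u' ++ v') := by
  rw [← eq_or_earlier_iff] at h h' ⊢
  have hc : ∀ {w w'}, (w' = w ∨ Earlier mo w w') → mo.toSyn (content w) ≤ mo.toSyn (content w') := by
    rintro w w' (rfl | h | h)
    exacts [le_rfl, h.le, by rw [h.1]]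
  rcases h with rfl | h | ⟨h1, h2⟩
  · rcases h' with rfl | h' | ⟨h1', h2'⟩
    · exact Or.inl rfl
    · right; left
      rw [content_append, content_append, map_add, map_add]
      exact add_lt_add_right h' _
    · exact Or.inr (Or.inr ⟨by rw [content_append, content_append, h1'],
        List.append_left_lt (α := Label mo) h2'⟩)
  · right; left
    rw [content_append, content_append, map_add, map_add]
    exact add_lt_add_of_lt_of_le h (hc h')
  · rcases (hc h').lt_or_eq with h3 | h3
    · right; left
      rw [content_append, content_append, map_add, map_add, h1]
      exact add_lt_add_right h3 _
    · refine Or.inr (Or.inr ⟨by rw [content_append, content_append, h1, mo.toSyn.injective h3], ?_⟩)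
      have hl := (content_eq_iff.1 h1).length_eq
      have : ∀ {u u' v v' : List (Label mo)}, u.length = u'.length →
          List.Lex (· < ·) u u' → List.Lex (· < ·) (u ++ v) (u' ++ v') := by
        intro u u' v v' hl h
        induction h with
        | nil => simp at hl
        | rel h => exact .rel h
        | cons _ ih => exact .cons (ih (by simpa using hl))
      exact this hl h2

theorem pairwise_le_le {A : Type*} [LinearOrder A] {w w' : List A} (h : w.Pairwise (· ≤ ·))
    (hp : w.Perm w') : w = w' ∨ w < w' := by
  induction w generalizing w' with
  | nil => exact Or.inl hp.nil_eq
  | cons a t ih =>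
    cases w' with
    | nil => exact Or.inl hp.eq_nil
    | cons b t' =>
      have hab : a ≤ b := by
        rcases List.mem_cons.1 (hp.symm.subset (List.mem_cons_self (a := b))) with rfl | hb
        exacts [le_rfl, List.rel_of_pairwise_cons h hb]
      rcases hab.lt_or_eq with hab | rfl
      · exact Or.inr (.rel hab)
      · simp_all

variable {e : ℕ} {α : Fin n → (Fin e →₀ ℕ)} {k : Type*} [Field k]

/-- The relation of the labels that may follow one another in an earliest facet. -/
abbrev LRel (k : Type*) [Field k] (α : Fin n → (Fin e →₀ ℕ)) (mo : MonomialOrder (Fin n)) :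
    Fin n → Fin n → Prop := Rel (A := Label mo) (InJ k α mo)

/-- Such a word has the least content of its degree, and being sorted it is lexicographically least
among the words of that content. -/
theorem pos_le_of_pairwise (hα : IsMinimalGenerating α)
    (hG : HasQuadraticGroebnerBasis mo (toricIdeal k α)) {w w' : List (Fin n)}
    (h : w.Pairwise (LRel k α mo)) (hw : deg α w' = deg α w) : pos mo w ≤ pos mo w' := by
  rw [← eq_or_earlier_iff]
  rcases ((pairwise_not_inJ hα hG).1 (h.imp fun h => h.2) w' hw).lt_or_eq with h1 | h1
  · exact Or.inr (Or.inl h1)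
  · have h1 := mo.toSyn.injective h1
    rcases pairwise_le_le (A := Label mo) (h.imp fun h => h.1) (content_eq_iff.1 h1) with h2 | h2
    exacts [Or.inl h2.symm, Or.inr (Or.inr ⟨h1, h2⟩)]

theorem exists_best (hα : IsMinimalGenerating α)
    (hG : HasQuadraticGroebnerBasis mo (toricIdeal k α)) (w : List (Fin n)) :
    ∃ w', deg α w' = deg α w ∧ w'.Pairwise (LRel k α mo) := by
  obtain ⟨u, hu, hmin⟩ := WellFounded.has_min (InvImage.wf (fun w => mo.toSyn (content w))
    (wellFounded_lt (α := mo.syn))) {w' | deg α w' = deg α w} ⟨w, rfl⟩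
  have hp := List.perm_insertionSort (α := Label mo) (· ≤ ·) u
  have hs := List.pairwise_insertionSort (α := Label mo) (· ≤ ·) u
  refine ⟨List.insertionSort (α := Label mo) (· ≤ ·) u, (deg_perm α hp).trans hu, hs.and ?_⟩
  refine (hp.pairwise_iff fun h h' => h (inJ_symm h')).2 ((pairwise_not_inJ hα hG).2 fun w' hw => ?_)
  exact not_lt.1 fun h => hmin w' (hw.trans hu) h

end Best

/-! ### Cuts and minimal skipped rank sets. -/

section Split
variable {A : Type*} {R : A → A → Prop}

theorem mem_cuts_iff {bs : List (List A)} {r : ℕ} :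
    r ∈ cuts bs ↔ ∃ b₁ b₂, bs = b₁ ++ b₂ ∧ b₁ ≠ [] ∧ b₂ ≠ [] ∧ r = b₁.flatten.length := by
  constructor
  · intro h
    obtain ⟨b₁, D, D', b₂, rfl, rfl⟩ := cuts_split h
    exact ⟨b₁ ++ [D], D' :: b₂, by simp, by simp, by simp, by simp⟩
  · rintro ⟨b₁, b₂, rfl, h1, h2, rfl⟩
    rw [cuts_append h1]
    exact mem_union_right _ (mem_starts_self h2)

theorem exists_split_at {bs : List (List A)} : ∀ {r : ℕ}, 0 < r → r < bs.flatten.length →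
    r ∉ cuts bs → ∃ b₁ D D' b₂, bs = b₁ ++ (D ++ D') :: b₂ ∧ D ≠ [] ∧ D' ≠ [] ∧
      r = b₁.flatten.length + D.length := by
  induction bs with
  | nil => intro r _ h; simp at h
  | cons B bs ih =>
    intro r h0 hr hc
    rcases lt_trichotomy r B.length with h | rfl | h
    · refine ⟨[], B.take r, B.drop r, bs, by simp, ?_, ?_, by simp [h.le]⟩ <;>
        rw [ne_eq, ← List.length_eq_zero_iff] <;> simp only [List.length_take, List.length_drop] <;>
        omega
    · refine absurd (mem_cuts_iff.2 ⟨[B], bs, rfl, by simp, ?_, by simp⟩) hc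
      rintro rfl
      simp at hr
    · obtain ⟨b₁, D, D', b₂, rfl, hD, hD', he⟩ := ih (r := r - B.length) (by omega)
        (by rw [List.flatten_cons, List.length_append] at hr; omega) (fun hm => hc (by
          obtain ⟨b₁, b₂, rfl, -, h2, he⟩ := mem_cuts_iff.1 hm
          exact mem_cuts_iff.2 ⟨B :: b₁, b₂, rfl, by simp, h2, by
            rw [List.flatten_cons, List.length_append]; omega⟩))
      grind

theorem exists_cuts {w : List A} (hw : w ≠ []) {S : Finset ℕ} (hS : S ⊆ Ioo 0 w.length) :
    ∃ bs : List (List A), (∀ B ∈ bs, B ≠ []) ∧ bs.flatten = w ∧ cuts bs = S := by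
  induction S using Finset.induction_on with
  | empty => exact ⟨[w], by simpa using hw, by simp, rfl⟩
  | insert r S hr ih =>
    obtain ⟨bs, hb, rfl, rfl⟩ := ih ((subset_insert _ _).trans hS)
    have h1 := mem_Ioo.1 (hS (mem_insert_self _ _))
    obtain ⟨b₁, D, D', b₂, rfl, hD, hD', rfl⟩ := exists_split_at h1.1 h1.2 hr
    refine ⟨b₁ ++ D :: D' :: b₂, ?_, by simp, cuts_merge⟩
    grind

theorem exists_up {bs : List (List A)} {b : ℕ} (h : b ∈ piv R bs.flatten (cuts bs))
    (hb : b ∉ cuts bs) : ∃ bs', Up R bs bs' := by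
  have h1 := mem_Ioo.1 (piv_subset _ _ h)
  obtain ⟨b₁, D, D', b₂, he, hD, hD', rfl⟩ := exists_split_at h1.1 h1.2 hb
  exact ⟨_, b₁, D, D', b₂, he, rfl, hD, hD', h⟩

/-- Dropping the ranks of `K` leaves a clash unseparated exactly if `K` contains the interval of a
minimal clash, and these intervals form an antichain. -/
theorem minimal_clash {w : List A} {K : Finset ℕ} :
    Minimal (fun K => K ⊆ Ioo 0 w.length ∧ ¬ GoodCell R w (Ioo 0 w.length \ K)) K ↔
      K ∈ clashIntervals R w := by
  have key : ∀ K, K ⊆ Ioo 0 w.length ∧ ¬ GoodCell R w (Ioo 0 w.length \ K) ↔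
      K ⊆ Ioo 0 w.length ∧ ∃ a c, MinClash R w a c ∧ Ioc a c ⊆ K := by
    intro K
    refine and_congr_right fun _ => ?_
    constructor
    · intro h
      simp only [GoodCell, not_forall] at h
      obtain ⟨i, j, hij, h⟩ := h
      obtain ⟨a, c, hac, ha, hc⟩ := hij.exists_min
      refine ⟨a, c, hac, fun r hr => ?_⟩
      by_contra hrK
      rw [mem_Ioc] at hr
      have := hij.lt_length
      exact h ⟨r, mem_sdiff.2 ⟨mem_Ioo.2 ⟨by omega, by omega⟩, hrK⟩, by omega, by omega⟩
    · rintro ⟨a, c, hac, hK⟩ hg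
      obtain ⟨r, hr, h1, h2⟩ := hg a c hac.1
      exact (mem_sdiff.1 hr).2 (hK (mem_Ioc.2 ⟨h1, h2⟩))
  simp only [key]
  have hI := intervalSystem_minClash (R := R) w
  have hsub : ∀ {a c}, MinClash R w a c → Ioc a c ⊆ Ioo 0 w.length := by
    intro a c h r hr
    have := h.1.lt_length
    rw [mem_Ioc] at hr
    exact mem_Ioo.2 ⟨by omega, by omega⟩
  rw [mem_clashIntervals]
  constructor
  · rintro ⟨⟨h1, a, c, hac, h2⟩, hmin⟩
    grind
  · rintro ⟨a, c, hac, rfl⟩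
    refine ⟨⟨hsub hac, a, c, hac, subset_rfl⟩, ?_⟩
    rintro K ⟨-, a', c', hac', hK⟩ hKs
    have h1 := hI.lt hac'
    have h2 := mem_Ioc.1 (hKs (hK (mem_Ioc.2 ⟨h1, le_rfl⟩)))
    have h3 := mem_Ioc.1 (hKs (hK (mem_Ioc.2 ⟨Nat.lt_succ_self a', h1⟩)))
    obtain ⟨rfl, rfl⟩ := hac.2 a' c' hac'.1 (by omega) h2.2
    exact hK

end Split

/-! ### Faces of the order complex as block lists. -/

section Faces
variable {e n : ℕ} {α : Fin n → (Fin e →₀ ℕ)} {l : Fin e →₀ ℕ}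

theorem vertex_eq (w : List (Fin n)) (r : ℕ) : vertex α w r = deg α (w.take r) := rfl

theorem vertex_append (u v : List (Fin n)) : vertex α (u ++ v) u.length = deg α u := by
  simp [vertex_eq]

theorem vertex_add (w : List (Fin n)) (r t : ℕ) :
    vertex α w (r + t) = vertex α w r + vertex α (w.drop r) t := by
  rw [vertex_eq, List.take_add, deg_append]; rfl

theorem vertex_injOn (hα : IsMinimalGenerating α) {w : List (Fin n)} {r t : ℕ}
    (hr : r ≤ w.length) (ht : t ≤ w.length) (h : vertex α w r = vertex α w t) : r = t := by
  wlog hrt : r ≤ t generalizing r t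
  · exact (this ht hr h.symm (by omega)).symm
  obtain ⟨c, rfl⟩ := Nat.exists_eq_add_of_le hrt
  rw [vertex_add, left_eq_add, vertex_eq, deg_eq_zero hα] at h
  have := congrArg List.length h
  simp at this
  omega

/-- The chain of the elements between consecutive blocks. -/
noncomputable def face (α : Fin n → (Fin e →₀ ℕ)) (bs : List (List (Fin n))) : Finset (Fin e →₀ ℕ) :=
  (cuts bs).image (vertex α bs.flatten)

theorem deg_flatten (bs : List (List (Fin n))) :
    deg α bs.flatten = (bs.map (deg α)).sum := by
  induction bs with
  | nil => rfl
  | cons B bs ih => simp [ih]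

theorem mem_face {bs : List (List (Fin n))} {μ : Fin e →₀ ℕ} : μ ∈ face α bs ↔
    ∃ b₁ b₂, bs = b₁ ++ b₂ ∧ b₁ ≠ [] ∧ b₂ ≠ [] ∧ deg α b₁.flatten = μ := by
  simp only [face, mem_image, mem_cuts_iff]
  constructor
  · rintro ⟨_, ⟨b₁, b₂, rfl, h1, h2, rfl⟩, rfl⟩
    exact ⟨b₁, b₂, rfl, h1, h2, by rw [List.flatten_append, vertex_append]⟩
  · rintro ⟨b₁, b₂, rfl, h1, h2, rfl⟩
    exact ⟨_, ⟨b₁, b₂, rfl, h1, h2, rfl⟩, by rw [List.flatten_append, vertex_append]⟩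

theorem face_congr {bs bs' : List (List (Fin n))} (h : bs.map (deg α) = bs'.map (deg α)) :
    face α bs = face α bs' := by
  have key : ∀ {bs bs' : List (List (Fin n))}, bs.map (deg α) = bs'.map (deg α) →
      face α bs ⊆ face α bs' := by
    intro bs bs' h μ hμ
    obtain ⟨b₁, b₂, rfl, h1, h2, rfl⟩ := mem_face.1 hμ
    rw [List.map_append, eq_comm] at h
    obtain ⟨c₁, c₂, rfl, h3, h4⟩ := List.map_eq_append_iff.1 h
    refine mem_face.2 ⟨c₁, c₂, rfl, ?_, ?_, by rw [deg_flatten, deg_flatten, h3]⟩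
    · rintro rfl; exact h1 (by simpa using h3.symm)
    · rintro rfl; exact h2 (by simpa using h4.symm)
  exact subset_antisymm (key h) (key h.symm)

theorem filter_face (hα : IsMinimalGenerating α) {bs : List (List (Fin n))}
    (hb : ∀ B ∈ bs, B ≠ []) [DecidablePred fun r => vertex α bs.flatten r ∈ face α bs] :
    (ranks bs.flatten).filter (fun r => vertex α bs.flatten r ∈ face α bs) = cuts bs := by
  ext r
  rw [mem_filter]
  constructor
  · rintro ⟨hr, h⟩
    obtain ⟨t, ht, he⟩ := mem_image.1 h
    have h1 := mem_Ioo.1 hr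
    have h2 := mem_Ioo.1 (cuts_subset hb ht)
    rwa [← vertex_injOn hα (by omega) (by omega) he]
  · exact fun h => ⟨cuts_subset hb h, mem_image_of_mem _ h⟩

theorem eq_of_face (hα : IsMinimalGenerating α) {bs bs' : List (List (Fin n))}
    (hb : ∀ B ∈ bs, B ≠ []) (hb' : ∀ B ∈ bs', B ≠ []) (hf : bs.flatten = bs'.flatten)
    (h : face α bs = face α bs') : bs = bs' := by
  classical
  refine eq_of_cuts hb hb' hf ?_
  rw [← filter_face hα hb, ← filter_face hα hb', hf, h]

theorem face_subset_facet {bs : List (List (Fin n))} (hb : ∀ B ∈ bs, B ≠ []) :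
    face α bs ⊆ facet α bs.flatten := image_subset_image (cuts_subset hb)

theorem flatten_ne_nil {bs : List (List (Fin n))} (h0 : bs ≠ []) (hb : ∀ B ∈ bs, B ≠ []) :
    bs.flatten ≠ [] := by
  cases bs with
  | nil => exact absurd rfl h0
  | cons B bs => simp [hb B (by simp)]

theorem isFace_face (hα : IsMinimalGenerating α) {bs : List (List (Fin n))}
    (hb : ∀ B ∈ bs, B ≠ []) (hl : deg α bs.flatten = l) : IsFace α l (face α bs) := by
  have key : ∀ {b₁ b₂ : List (List (Fin n))}, (∀ B ∈ b₁ ++ b₂, B ≠ []) → b₂ ≠ [] →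
      SLt α (deg α b₁.flatten) (deg α (b₁ ++ b₂).flatten) := by
    intro b₁ b₂ hb h2
    refine ⟨?_, _, deg_mem α b₂.flatten, by simp⟩
    rw [List.flatten_append, deg_append, ne_eq, left_eq_add, deg_eq_zero hα]
    exact flatten_ne_nil h2 fun B hB => hb B (by simp [hB])
  refine ⟨fun μ hμ => ?_, fun μ hμ ν hν => ?_⟩
  · obtain ⟨b₁, b₂, rfl, h1, h2, rfl⟩ := mem_face.1 hμ
    exact ⟨deg_mem α _, key (b₁ := []) (fun B hB => hb B (by simp at hB; simp [hB])) h1,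
      hl ▸ key hb h2⟩
  · obtain ⟨b₁, b₂, rfl, h1, h2, rfl⟩ := mem_face.1 hμ
    obtain ⟨c₁, c₂, he, h3, h4, rfl⟩ := mem_face.1 hν
    rcases List.append_eq_append_iff.1 he with ⟨d, rfl, rfl⟩ | ⟨d, rfl, rfl⟩
    · by_cases hd : d = []
      all_goals grind
    · by_cases hd : d = []
      all_goals grind

theorem face_append_singleton {bs : List (List (Fin n))} (h0 : bs ≠ []) (hb : ∀ B ∈ bs, B ≠ [])
    (v : List (Fin n)) : face α (bs ++ [v]) = insert (deg α bs.flatten) (face α bs) := by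
  ext μ
  simp only [mem_insert, mem_face]
  constructor
  · rintro ⟨b₁, b₂, he, h1, h2, rfl⟩
    rcases List.eq_nil_or_concat b₂ with rfl | ⟨b₂, B, rfl⟩
    · exact absurd rfl h2
    · rw [List.concat_eq_append, ← List.append_assoc] at he
      obtain ⟨rfl, -⟩ := List.append_inj' he rfl
      grind
  · rintro (rfl | ⟨b₁, b₂, rfl, h1, h2, rfl⟩)
    exacts [⟨bs, [v], rfl, h0, by simp, rfl⟩, ⟨b₁, b₂ ++ [v], by simp, h1, by simp, rfl⟩]

theorem degree_lt_of_sLt {μ ν : Fin e →₀ ℕ} (h : SLt α μ ν) : μ.degree < ν.degree := by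
  obtain ⟨hne, γ, -, rfl⟩ := h
  rw [map_add]
  refine Nat.lt_add_of_pos_right (Nat.pos_of_ne_zero fun h0 => hne ?_)
  rw [Finsupp.degree_eq_zero_iff] at h0
  rw [h0, add_zero]

/-- Induction on the number of elements: the element of largest total degree is the top of the
chain, and the remaining elements form a face below it. -/
theorem exists_blocks (hα : IsMinimalGenerating α) {s : Finset (Fin e →₀ ℕ)}
    (h : IsFace α l s) (hl : l ∈ semigroup α) (hl0 : l ≠ 0) :
    ∃ bs : List (List (Fin n)), bs ≠ [] ∧ (∀ B ∈ bs, B ≠ []) ∧ deg α bs.flatten = l ∧ face α bs = s := by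
  induction hs : s.card generalizing s l with
  | zero =>
    obtain ⟨w, rfl⟩ := exists_deg α hl
    rw [card_eq_zero] at hs
    refine ⟨[w], by simp, ?_, by simp, by rw [hs]; rfl⟩
    rw [ne_eq, deg_eq_zero hα] at hl0
    simpa using hl0
  | succ c ih =>
    obtain ⟨μ, hμ, hmax⟩ := exists_max_image s Finsupp.degree (card_pos.1 (by omega))
    obtain ⟨h1, h2, h3⟩ := h.1 μ hμ
    obtain ⟨bs, hb0, hb, hd, hf⟩ := ih (s := s.erase μ) (l := μ) ⟨fun ν hν => by
        rw [mem_erase] at hν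
        obtain ⟨h4, h5, -⟩ := h.1 ν hν.2
        refine ⟨h4, h5, ?_⟩
        rcases h.2 ν hν.2 μ hμ with h6 | h6 | h6
        exacts [absurd h6 hν.1, h6, absurd (degree_lt_of_sLt h6) (not_lt.2 (hmax ν hν.2))],
      fun ν hν ν' hν' => h.2 ν (mem_of_mem_erase hν) ν' (mem_of_mem_erase hν')⟩ h1 h2.1.symm
      (by rw [card_erase_of_mem hμ]; omega)
    obtain ⟨hne, γ, hγ, rfl⟩ := h3
    obtain ⟨v, rfl⟩ := exists_deg α hγ
    refine ⟨bs ++ [v], by simp, ?_, by simp [hd], ?_⟩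
    · intro B hB
      rcases List.mem_append.1 hB with hB | hB
      · exact hb B hB
      · rw [List.mem_singleton.1 hB]
        rintro rfl
        simp at hne
    · rw [face_append_singleton hb0 hb, hd, hf, insert_erase hμ]

/-- Each element of the face occurs at some rank of `w`; cutting `w` there gives blocks with the
same degrees. -/
theorem exists_lift (hα : IsMinimalGenerating α) {bs : List (List (Fin n))} (h0 : bs ≠ [])
    (hb : ∀ B ∈ bs, B ≠ []) {w : List (Fin n)} (hw : deg α w = deg α bs.flatten)
    (hs : face α bs ⊆ facet α w) :
    ∃ bs' : List (List (Fin n)), bs'.flatten = w ∧ bs'.map (deg α) = bs.map (deg α) := by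
  induction bs generalizing w with
  | nil => exact absurd rfl h0
  | cons B bs ih =>
    by_cases hbs : bs = []
    · subst hbs
      exact ⟨[w], by simp, by simpa using hw⟩
    · obtain ⟨r, hr, he⟩ := mem_image.1 (hs (mem_face.2 ⟨[B], bs, rfl, by simp, hbs, rfl⟩))
      rw [List.flatten_singleton, vertex_eq] at he
      obtain ⟨bs', h1, h2⟩ := ih hbs (fun C hC => hb C (by simp [hC])) (w := w.drop r) (by
        rw [← List.take_append_drop r w, deg_append, he] at hw
        simpa using hw) (by
        intro μ hμ
        obtain ⟨b₁, b₂, rfl, h1, h2, rfl⟩ := mem_face.1 hμ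
        obtain ⟨t, ht, he'⟩ := mem_image.1 (hs (mem_face.2
          ⟨B :: b₁, b₂, rfl, by simp, h2, rfl⟩))
        rw [List.flatten_cons, deg_append, ← he, ← vertex_eq] at he'
        have hne := flatten_ne_nil h1 fun C hC => hb C (by simp [hC])
        rw [ne_eq, ← deg_eq_zero hα] at hne
        have hrt : r < t := by
          by_contra hrt
          obtain ⟨c, rfl⟩ := Nat.exists_eq_add_of_le (not_lt.1 hrt)
          rw [vertex_add, add_assoc, left_eq_add, add_eq_zero] at he'
          exact hne he'.2
        obtain ⟨c, rfl⟩ := Nat.exists_eq_add_of_le hrt.le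
        rw [vertex_add, add_right_inj] at he'
        refine mem_image.2 ⟨c, ?_, he'⟩
        simp only [ranks, mem_Ioo, List.length_drop] at ht ⊢
        omega)
      exact ⟨w.take r :: bs', by simp [h1], by simp [h2, he]⟩

end Faces

/-! ### Translation of the Morse function into words. -/

section Bridge
variable {e n : ℕ} {α : Fin n → (Fin e →₀ ℕ)} {l : Fin e →₀ ℕ} {k : Type*} [Field k]
  {mo : MonomialOrder (Fin n)} {bs bs' : List (List (Fin n))}

theorem ne_nil_of_deg (hl0 : l ≠ 0) (hl : deg α bs.flatten = l) : bs ≠ [] := by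
  rintro rfl
  exact hl0 hl.symm

variable (hα : IsMinimalGenerating α) (hG : HasQuadraticGroebnerBasis mo (toricIdeal k α))
include hα

theorem ne_nil_of_map_deg (hb : ∀ B ∈ bs, B ≠ []) (h : bs'.map (deg α) = bs.map (deg α)) :
    ∀ B ∈ bs', B ≠ [] := by
  rintro B hB rfl
  obtain ⟨C, hC, h0⟩ := List.mem_map.1 (h ▸ List.mem_map_of_mem (f := deg α) hB)
  exact hb C hC ((deg_eq_zero hα).1 h0)

include hG

theorem exists_cell (hb : ∀ B ∈ bs, B ≠ []) :
    ∃ bs', IsCell (LRel k α mo) bs' ∧ bs'.map (deg α) = bs.map (deg α) := by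
  have : ∃ bs' : List (List (Fin n)), (∀ B ∈ bs', B.Pairwise (LRel k α mo)) ∧
      bs'.map (deg α) = bs.map (deg α) := by
    clear hb
    induction bs with
    | nil => exact ⟨[], by simp, rfl⟩
    | cons B bs ih =>
      obtain ⟨bs', h1, h2⟩ := ih
      obtain ⟨C, h3, h4⟩ := exists_best hα hG B
      exact ⟨C :: bs', by simpa using ⟨h4, h1⟩, by simp [h2, h3]⟩
  obtain ⟨bs', h1, h2⟩ := this
  exact ⟨bs', fun B hB => ⟨ne_nil_of_map_deg hα hb h2 B hB, h1 B hB⟩, h2⟩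

theorem pos_flatten_le (hc : IsCell (LRel k α mo) bs) (h : bs'.map (deg α) = bs.map (deg α)) :
    pos mo bs.flatten ≤ pos mo bs'.flatten := by
  induction bs generalizing bs' with
  | nil => rw [List.map_eq_nil_iff.1 h]
  | cons B bs ih =>
    obtain ⟨B', cs, rfl, h1, h2⟩ := List.map_eq_cons_iff.1 h
    exact pos_le_append (pos_le_of_pairwise hα hG (hc B (by simp)).2 h1)
      (ih (fun C hC => hc C (by simp [hC])) h2)

/-- Any facet containing the face splits into blocks of the same degrees, and block by block the
sorted compatible words come first. -/
theorem isEarliest_face (hl0 : l ≠ 0) (hc : IsCell (LRel k α mo) bs)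
    (hl : deg α bs.flatten = l) : IsEarliest α mo l (face α bs) bs.flatten := by
  refine ⟨hl, face_subset_facet hc.ne_nil, fun w' hw' hs => ?_⟩
  obtain ⟨bs', rfl, h⟩ := exists_lift hα (ne_nil_of_deg hl0 hl) hc.ne_nil
    (Eq.trans hw' hl.symm) hs
  exact eq_or_earlier_iff.2 (pos_flatten_le hα hG hc h)

theorem labelSeq_face (hl0 : l ≠ 0) (hc : IsCell (LRel k α mo) bs)
    (hl : deg α bs.flatten = l) : labelSeq α mo l (face α bs) = bs.flatten := by
  have h := isEarliest_face hα hG hl0 hc hl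
  have hex : ∃ w, IsEarliest α mo l (face α bs) w := ⟨_, h⟩
  rw [labelSeq, dif_pos hex]
  have h' := hex.choose_spec
  exact pos_injective (mo := mo) (le_antisymm (eq_or_earlier_iff.1 (h'.2.2 _ h.1 h.2.1))
    (eq_or_earlier_iff.1 (h.2.2 _ h'.1 h'.2.1)))

theorem face_injective (hl0 : l ≠ 0) (hc : IsCell (LRel k α mo) bs) (hl : deg α bs.flatten = l)
    (hc' : IsCell (LRel k α mo) bs') (hl' : deg α bs'.flatten = l) (h : face α bs = face α bs') :
    bs = bs' := by
  refine eq_of_face hα hc.ne_nil hc'.ne_nil ?_ h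
  rw [← labelSeq_face hα hG hl0 hc hl, ← labelSeq_face hα hG hl0 hc' hl', h]

/-- The earliest facet of the larger face also contains the smaller one. Contents therefore weakly
decrease along gradient paths. -/
theorem content_le_of_subset (hl0 : l ≠ 0) (hc : IsCell (LRel k α mo) bs)
    (hl : deg α bs.flatten = l) (hc' : IsCell (LRel k α mo) bs') (hl' : deg α bs'.flatten = l)
    (h : face α bs' ⊆ face α bs) :
    mo.toSyn (content bs'.flatten) ≤ mo.toSyn (content bs.flatten) := by
  rcases (isEarliest_face hα hG hl0 hc' hl').2.2 _ hl (h.trans (face_subset_facet hc.ne_nil)) with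
    h1 | h1 | h1
  exacts [by rw [h1], h1.le, by rw [h1.1]]

theorem exists_face (hl : l ∈ semigroup α) (hl0 : l ≠ 0) {s : Finset (Fin e →₀ ℕ)}
    (h : IsFace α l s) :
    ∃ bs, IsCell (LRel k α mo) bs ∧ deg α bs.flatten = l ∧ face α bs = s := by
  obtain ⟨bs, -, h1, h2, rfl⟩ := exists_blocks hα h hl hl0
  obtain ⟨bs', h3, h4⟩ := exists_cell hα hG h1
  exact ⟨bs', h3, by rw [← h2, deg_flatten, deg_flatten, h4], face_congr h4⟩

/-- The facet is the earliest one through the remaining elements exactly if they separate all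
clashes. Otherwise replacing every block by the best word of its degree gives an earlier facet. -/
theorem skippable_iff (hl0 : l ≠ 0) {w : List (Fin n)} (hl : deg α w = l) {K : Finset ℕ} :
    Skippable α mo l w K ↔
      K ⊆ Ioo 0 w.length ∧ ¬ GoodCell (LRel k α mo) w (Ioo 0 w.length \ K) := by
  refine and_congr_right fun _ => ?_
  obtain ⟨bs, hb, rfl, hcut⟩ := exists_cuts (w := w) (by rintro rfl; exact hl0 hl.symm)
    (sdiff_subset (s := Ioo 0 w.length) (t := K))
  have hface : (ranks bs.flatten \ K).image (vertex α bs.flatten) = face α bs := by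
    rw [face, hcut]; rfl
  rw [hface, ← hcut]
  constructor
  · rintro ⟨w', h1, h2, h3⟩ hg
    have h4 := (isEarliest_face hα hG hl0 (isCell_of_goodCell hb hg) hl).2.2 w' h1 h3
    exact absurd (earlier_iff.1 h2) (not_lt.2 (eq_or_earlier_iff.1 h4))
  · intro hg
    obtain ⟨bs', hc, h⟩ := exists_cell hα hG hb
    have hl' : deg α bs'.flatten = l := by rw [← hl, deg_flatten, deg_flatten, h]
    refine ⟨bs'.flatten, hl', ?_, face_congr h ▸ face_subset_facet hc.ne_nil⟩
    rcases eq_or_earlier_iff.2 (pos_flatten_le hα hG hc h.symm) with h1 | h1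
    · obtain rfl := eq_of_face hα hb hc.ne_nil h1 (face_congr h).symm
      exact absurd hc.goodCell hg
    · exact h1

theorem iIntervals_eq (hl0 : l ≠ 0) {w : List (Fin n)} (hl : deg α w = l) :
    iIntervals α mo l w = clashIntervals (LRel k α mo) w := by
  ext K
  have h : Skippable α mo l w = fun K => K ⊆ Ioo 0 w.length ∧
      ¬ GoodCell (LRel k α mo) w (Ioo 0 w.length \ K) := by
    ext K
    exact skippable_iff hα hG hl0 hl
  classical
  rw [iIntervals, mem_filter, mem_powerset, h, minimal_clash, and_iff_right_iff_imp]
  exact fun hK => (minimal_clash.2 hK).1.1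

theorem partner_face (hl0 : l ≠ 0) (hc : IsCell (LRel k α mo) bs) (hl : deg α bs.flatten = l) :
    partner α mo l (face α bs) = symmDiff (face α bs)
      ((piv (LRel k α mo) bs.flatten (cuts bs)).image (vertex α bs.flatten)) := by
  rw [partner, labelSeq_face hα hG hl0 hc hl, iIntervals_eq hα hG hl0 hl, filter_face hα hc.ne_nil]
  rfl

theorem isCritical_face (hl0 : l ≠ 0) (hc : IsCell (LRel k α mo) bs)
    (hl : deg α bs.flatten = l) :
    IsCritical α mo l (face α bs) ↔ IsReading (LRel k α mo) bs := by
  rw [IsCritical, partner_face hα hG hl0 hc hl, symmDiff_eq_left, bot_eq_empty, image_eq_empty,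
    ← critical_iff (ne_nil_of_deg hl0 hl)]
  exact ⟨fun h => ⟨hc, h.2⟩, fun h => ⟨isFace_face hα hc.ne_nil hl, h.2⟩⟩

theorem face_of_up (hc : IsCell (LRel k α mo) bs) (h : Up (LRel k α mo) bs bs') :
    ∃ b, piv (LRel k α mo) bs.flatten (cuts bs) = {b} ∧
      vertex α bs.flatten b ∉ face α bs ∧
      face α bs' = insert (vertex α bs.flatten b) (face α bs) := by
  classical
  obtain ⟨b, h1, h2, h3⟩ := h.cuts_eq hc.ne_nil
  refine ⟨b, piv_eq_singleton h1, fun hm => h2 ?_, ?_⟩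
  · rw [← filter_face hα hc.ne_nil]
    exact mem_filter.2 ⟨piv_subset _ _ h1, hm⟩
  · rw [face, h3, image_insert, h.flatten]; rfl

theorem matched_face (hl0 : l ≠ 0) (hc : IsCell (LRel k α mo) bs) (hl : deg α bs.flatten = l)
    {t : Finset (Fin e →₀ ℕ)} :
    Matched α mo l (face α bs) t ↔ ∃ bs', Up (LRel k α mo) bs bs' ∧ face α bs' = t := by
  have key : ∀ {s : Finset (Fin e →₀ ℕ)} {v}, v ∉ s → symmDiff s {v} = insert v s := by
    intro s v hv
    ext x
    by_cases hx : x = v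
    · subst hx; simp [mem_symmDiff, hv]
    · simp [mem_symmDiff, hx]
  constructor
  · rintro ⟨-, -, hst, hp⟩
    rw [partner_face hα hG hl0 hc hl] at hp
    obtain ⟨b, hb⟩ : (piv (LRel k α mo) bs.flatten (cuts bs)).Nonempty := by
      rw [nonempty_iff_ne_empty]
      intro h0
      rw [h0, image_empty, ← bot_eq_empty, symmDiff_bot] at hp
      exact hst.ne hp
    have hbc : b ∉ cuts bs := fun hbc => by
      have hv : vertex α bs.flatten b ∈ face α bs := mem_image_of_mem _ hbc
      have h1 := hst.subset hv
      rw [← hp, piv_eq_singleton hb, image_singleton, mem_symmDiff] at h1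
      simp [hv] at h1
    obtain ⟨bs', hu⟩ := exists_up hb hbc
    refine ⟨bs', hu, ?_⟩
    obtain ⟨b, h1, h2, h3⟩ := face_of_up hα hG hc hu
    rw [h3, ← hp, h1, image_singleton, key h2]
  · rintro ⟨bs', hu, rfl⟩
    obtain ⟨b, h1, h2, h3⟩ := face_of_up hα hG hc hu
    refine ⟨isFace_face hα hc.ne_nil hl, isFace_face hα (hu.isCell hc).ne_nil
      (by rw [hu.flatten, hl]), ?_, ?_⟩
    · rw [h3]; exact ssubset_insert h2
    · rw [partner_face hα hG hl0 hc hl, h1, image_singleton, key h2, h3]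

omit hG in
theorem face_of_split {b₁ b₂ : List (List (Fin n))} {D D' : List (Fin n)}
    (hb : ∀ B ∈ b₁ ++ D :: D' :: b₂, B ≠ []) :
    vertex α (b₁ ++ D :: D' :: b₂).flatten (b₁.flatten.length + D.length) ∉
        face α (b₁ ++ (D ++ D') :: b₂) ∧
      face α (b₁ ++ D :: D' :: b₂) = insert (vertex α (b₁ ++ D :: D' :: b₂).flatten
        (b₁.flatten.length + D.length)) (face α (b₁ ++ (D ++ D') :: b₂)) := by
  classical
  have hf : (b₁ ++ (D ++ D') :: b₂).flatten = (b₁ ++ D :: D' :: b₂).flatten := by simp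
  have hn := not_mem_cuts_merge (b₁ := b₁) (b₂ := b₂) (hb D (by simp)) (hb D' (by simp))
    fun B hB => hb B (by simp [hB])
  have hcm := cuts_merge (b₁ := b₁) (b₂ := b₂) (D := D) (D' := D')
  refine ⟨fun hm => hn ?_, by rw [face, hcm, image_insert, face, hf]⟩
  rw [← filter_face hα (bs := b₁ ++ (D ++ D') :: b₂), mem_filter, hf]
  · exact ⟨cuts_subset hb (by rw [hcm]; exact mem_insert_self _ _), hm⟩
  · intro B hB
    simp only [List.mem_append, List.mem_cons] at hB
    rcases hB with hB | rfl | hB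
    exacts [hb B (by simp [hB]), by simp [hb D (by simp)], hb B (by simp [hB])]

omit hG in
theorem face_of_down (hb : ∀ B ∈ bs, B ≠ []) (h : Down (LRel k α mo) bs bs') :
    face α bs' ⊆ face α bs ∧ (face α bs).card = (face α bs').card + 1 ∧
      bs'.flatten.Perm bs.flatten := by
  obtain ⟨b₁, D, D', b₂, G, rfl, rfl, hG, -⟩ := h
  obtain ⟨h1, h2⟩ := face_of_split hα hb
  have h3 : face α (b₁ ++ (D ++ D') :: b₂) = face α (b₁ ++ G :: b₂) :=
    face_congr (by simp [deg_perm α hG])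
  grind

/-- Dropping an element merges two blocks, and the new block is the best word of their joint degree.
Equality of contents makes this word a rearrangement of the two blocks. -/
theorem down_of_face (hl0 : l ≠ 0) (hc : IsCell (LRel k α mo) bs) (hl : deg α bs.flatten = l)
    (hc' : IsCell (LRel k α mo) bs') (hl' : deg α bs'.flatten = l)
    (hs : face α bs' ⊆ face α bs) (hcard : (face α bs).card = (face α bs').card + 1)
    (hcont : content bs'.flatten = content bs.flatten) : Down (LRel k α mo) bs bs' := by
  obtain ⟨μ, hμ, hins⟩ := exists_eq_insert_iff.2 ⟨hs, hcard.symm⟩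
  obtain ⟨r, hr, rfl⟩ := mem_image.1 (hins ▸ mem_insert_self μ (face α bs'))
  obtain ⟨b₁, D, D', b₂, rfl, rfl⟩ := cuts_split hr
  obtain ⟨h1, h2⟩ := face_of_split hα hc.ne_nil
  have h3 : face α bs' = face α (b₁ ++ (D ++ D') :: b₂) := by
    rw [← erase_insert hμ, hins, h2, erase_insert h1]
  obtain ⟨G, hGd, hGp⟩ := exists_best hα hG (D ++ D')
  have hmap : (b₁ ++ G :: b₂).map (deg α) = (b₁ ++ (D ++ D') :: b₂).map (deg α) := by simp [hGd]
  have hcell : IsCell (LRel k α mo) (b₁ ++ G :: b₂) := by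
    intro B hB
    simp only [List.mem_append, List.mem_cons] at hB
    rcases hB with hB | rfl | hB
    · exact hc B (by simp [hB])
    · refine ⟨fun h0 => ?_, hGp⟩
      rw [h0, deg_nil, eq_comm, deg_eq_zero hα] at hGd
      exact hc.ne_nil D (by simp) (List.append_eq_nil_iff.1 hGd).1
    · exact hc B (by simp [hB])
  obtain rfl := face_injective hα hG hl0 hc' hl' hcell
    (by rw [deg_flatten, hmap, ← deg_flatten, ← hl]; simp) (h3.trans (face_congr hmap).symm)
  refine ⟨b₁, D, D', b₂, G, rfl, rfl, content_eq_iff.1 ?_, hGp⟩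
  simp only [List.flatten_append, List.flatten_cons, content_append, add_right_inj] at hcont
  rwa [← add_assoc, add_left_inj, ← content_append] at hcont

end Bridge

/-! ### The element matching is an involution. -/

section Toggle
variable {A : Type*} {R : A → A → Prop}

/-- Inserting the least rank of the first bad interval leaves that interval bad, because a cell
already meets it elsewhere; earlier intervals are unaffected. Hence the pivot stays the same. -/
theorem piv_insert {w : List A} {S : Finset ℕ} {b : ℕ} (hS : GoodCell R w S)
    (hb : b ∈ piv R w S) (hbS : b ∉ S) : b ∈ piv R w (insert b S) := by
  by_cases hcov : Covered R w
  · have hne : ∀ K, b ∉ K → insert b S ∩ K = S ∩ K := fun K hK => insert_inter_of_notMem hK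
    rcases exists_first_bad (jList R w) S with h | ⟨L₁, K, L₂, hL, h1, h2⟩
    · rw [piv_all_good hcov h] at hb
      have hbn := (mem_sdiff.1 (lowest_subset _ hb)).2
      rwa [piv_all_good hcov fun K hK => ?_]
      rw [hne K fun hbK => hbn (mem_support.2 ⟨K, hK, hbK⟩), h K hK]
    · rw [piv_first_bad hcov hL h1 h2] at hb
      rwa [piv_first_bad hcov hL]
      · intro K' hK'
        rw [hne K' fun hbK => (jrun_jList w).disjoint L₁ K L₂ hL K' (List.mem_append_left _ hK') b
          (lowest_subset _ hb) hbK, h1 K' hK']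
      · intro he
        refine hS.inter_nonempty hL h1 (eq_empty_of_forall_notMem fun t ht => hbS ?_)
        have htl : t ∈ lowest K := by
          grind
        rw [← eq_of_mem_lowest htl hb]
        exact (mem_inter.1 ht).1
  · rwa [piv_of_not_covered hcov _ S]

theorem Up.piv_eq {s T : List (List A)} (h : Up R s T) (hc : IsCell R s) :
    ∃ b, piv R T.flatten (cuts T) = {b} ∧ b ∉ cuts s ∧ cuts T = insert b (cuts s) := by
  obtain ⟨b, h1, h2, h3⟩ := h.cuts_eq hc.ne_nil
  refine ⟨b, ?_, h2, h3⟩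
  rw [h.flatten, h3]
  exact piv_eq_singleton (piv_insert hc.goodCell h1 h2)

theorem Up.not_up {s T T' : List (List A)} (h : Up R s T) (hc : IsCell R s) : ¬ Up R T T' := by
  intro h'
  obtain ⟨b, h1, -, h3⟩ := h.piv_eq hc
  obtain ⟨b', h4, h5, -⟩ := h'.cuts_eq (h.isCell hc).ne_nil
  grind

theorem Up.not_isReading {s T : List (List A)} (h : Up R s T) (hc : IsCell R s) :
    ¬ IsReading R T := by
  intro hT
  obtain ⟨b, h1, -⟩ := h.piv_eq hc
  have := hT.critical
  rw [CellCritical, h1] at this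
  simp at this

theorem Up.eq_of_up {s s' T : List (List A)} (h : Up R s T) (h' : Up R s' T) (hc : IsCell R s)
    (hc' : IsCell R s') : s = s' := by
  obtain ⟨b, h1, h2, h3⟩ := h.piv_eq hc
  obtain ⟨b', h1', h2', h3'⟩ := h'.piv_eq hc'
  rw [h1, singleton_inj] at h1'
  subst h1'
  refine eq_of_cuts hc.ne_nil hc'.ne_nil (by rw [← h.flatten, h'.flatten]) ?_
  rw [← erase_insert h2, ← h3, h3', erase_insert h2']

end Toggle

/-! ### Gradient paths and alternating paths. -/

section Paths
variable {e n : ℕ} {α : Fin n → (Fin e →₀ ℕ)} {l : Fin e →₀ ℕ} {k : Type*} [Field k]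
  {mo : MonomialOrder (Fin n)}

/-- The block lists of the faces of the complex. -/
def Cell (k : Type*) [Field k] (α : Fin n → (Fin e →₀ ℕ)) (mo : MonomialOrder (Fin n))
    (l : Fin e →₀ ℕ) (bs : List (List (Fin n))) : Prop :=
  IsCell (LRel k α mo) bs ∧ deg α bs.flatten = l

theorem Cell.up {s T : List (List (Fin n))} (hc : Cell k α mo l s) (h : Up (LRel k α mo) s T) :
    Cell k α mo l T := ⟨h.isCell hc.1, by rw [h.flatten, hc.2]⟩

variable (hα : IsMinimalGenerating α) (hG : HasQuadraticGroebnerBasis mo (toricIdeal k α))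
  (hl0 : l ≠ 0)
include hα

theorem Cell.down {s T : List (List (Fin n))} (hc : Cell k α mo l s)
    (h : Down (LRel k α mo) s T) : Cell k α mo l T :=
  ⟨h.isCell hc.1, by rw [deg_perm α (face_of_down hα hc.1.ne_nil h).2.2, hc.2]⟩

include hG hl0

theorem Cell.matched_iff {s T : List (List (Fin n))} (hs : Cell k α mo l s)
    (hT : Cell k α mo l T) :
    Matched α mo l (face α s) (face α T) ↔ Up (LRel k α mo) s T := by
  rw [matched_face hα hG hl0 hs.1 hs.2]
  refine ⟨?_, fun h => ⟨T, h, rfl⟩⟩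
  rintro ⟨T', h, he⟩
  rwa [← face_injective hα hG hl0 (hs.up h).1 (hs.up h).2 hT.1 hT.2 he]

theorem Cell.step {s T : List (List (Fin n))} (hs : Cell k α mo l s) (hT : Cell k α mo l T) :
    GradientStep α mo l (face α s) (face α T) ↔ Up (LRel k α mo) s T ∨
      (face α T ⊆ face α s ∧ (face α s).card = (face α T).card + 1 ∧ ¬ Up (LRel k α mo) T s) := by
  rw [GradientStep, hs.matched_iff hα hG hl0 hT, hT.matched_iff hα hG hl0 hs]
  have h1 := isFace_face hα hs.1.ne_nil hs.2
  have h2 := isFace_face hα hT.1.ne_nil hT.2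
  tauto

theorem Cell.card_up {s T : List (List (Fin n))} (hs : Cell k α mo l s)
    (h : Up (LRel k α mo) s T) : (face α T).card = (face α s).card + 1 := by
  obtain ⟨b, -, h1, h2⟩ := face_of_up hα hG hs.1 h
  rw [h2, card_insert_of_notMem h1]

/-- Backward induction along the path. A cell that is not matched upward has to step down, and two
upward steps never follow one another. So the path never falls below the dimension of `σ`, and
between neighbouring dimensions it must alternate. With equal contents at both ends the content is
constant, so all downward steps merely sort blocks. -/
theorem Cell.path_cases {σ : List (List (Fin n))} (hl : l ∈ semigroup α)
    (hσ : IsReading (LRel k α mo) σ) (hσl : deg α σ.flatten = l)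
    (p : List (Finset (Fin e →₀ ℕ))) : ∀ {bs : List (List (Fin n))}, Cell k α mo l bs →
      p.head? = some (face α bs) → p.getLast? = some (face α σ) → p.IsChain (GradientStep α mo l) →
      mo.toSyn (content σ.flatten) ≤ mo.toSyn (content bs.flatten) ∧
      (face α σ).card ≤ (face α bs).card ∧
      ((∀ T, ¬ Up (LRel k α mo) bs T) → bs ≠ σ → (face α σ).card + 1 ≤ (face α bs).card) ∧
      (content σ.flatten = content bs.flatten →
        ((face α bs).card = (face α σ).card → ∃ q, AltPath (LRel k α mo) σ bs q ∧
          p = q.map (face α)) ∧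
        ((face α bs).card = (face α σ).card + 1 → (∀ T, ¬ Up (LRel k α mo) bs T) →
          ∃ s q, Down (LRel k α mo) bs s ∧ ¬ Up (LRel k α mo) s bs ∧ AltPath (LRel k α mo) σ s q ∧
            p = face α bs :: q.map (face α))) := by
  have hσc : Cell k α mo l σ := ⟨hσ.isCell, hσl⟩
  induction p with
  | nil => intro bs _ h; simp at h
  | cons x p ih =>
    intro bs hc hh hlast hch
    obtain rfl : x = face α bs := by simpa using hh
    cases p with
    | nil =>
      obtain rfl : bs = σ := face_injective hα hG hl0 hc.1 hc.2 hσc.1 hσc.2 (by simpa using hlast)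
      exact ⟨le_rfl, le_rfl, fun _ h => absurd rfl h,
        fun _ => ⟨fun _ => ⟨[bs], .nil, rfl⟩, fun h => by omega⟩⟩
    | cons y p =>
      rw [List.isChain_cons_cons] at hch
      obtain ⟨T, hT, rfl⟩ : ∃ T, Cell k α mo l T ∧ face α T = y := by
        have hy : IsFace α l y := by
          rcases hch.1 with h | h
          exacts [h.2.1, h.2.1]
        obtain ⟨T, h1, h2, h3⟩ := exists_face hα hG hl hl0 hy
        exact ⟨T, ⟨h1, h2⟩, h3⟩
      obtain ⟨h1, h2, h3, h4⟩ := ih hT rfl (by simpa using hlast) hch.2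
      rcases (hc.step hα hG hl0 hT).1 hch.1 with hu | ⟨hs, hcard, hnu⟩
      · have hcd := hc.card_up hα hG hl0 hu
        have hn : ∀ T', ¬ Up (LRel k α mo) T T' := fun T' => hu.not_up hc.1
        -- An upper partner is neither matched upward nor critical, so it still has to descend.
        have h5 := h3 hn (by rintro rfl; exact hu.not_isReading hc.1 hσ)
        rw [hu.flatten] at h1 h4
        refine ⟨h1, by omega, fun h => absurd hu (h T), fun he => ⟨fun hcc => ?_,
          fun _ h => absurd hu (h T)⟩⟩
        obtain ⟨s, q, hd, hns, hq, hp⟩ := (h4 he).2 (by omega) hn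
        exact ⟨bs :: T :: q, .cons hu hd (by rintro rfl; exact hns hu) hq, by rw [hp]; rfl⟩
      · have hle := content_le_of_subset hα hG hl0 hc.1 hc.2 hT.1 hT.2 hs
        refine ⟨h1.trans hle, by omega, fun _ _ => by omega, fun he => ⟨fun _ => by omega,
          fun hcc _ => ?_⟩⟩
        have he' : content T.flatten = content bs.flatten :=
          mo.toSyn.injective (le_antisymm hle (he ▸ h1))
        obtain ⟨q, hq, hp⟩ := (h4 (he.trans he'.symm)).1 (by omega)
        exact ⟨T, q, down_of_face hα hG hl0 hc.1 hc.2 hT.1 hT.2 hs hcard he', hnu, hq, by rw [hp]⟩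

theorem Cell.chain_of_altPath {σ s : List (List (Fin n))} {q : List (List (List (Fin n)))}
    (h : AltPath (LRel k α mo) σ s q) : Cell k α mo l s → ∃ q', q = s :: q' ∧
      (q.map (face α)).getLast? = some (face α σ) ∧ (q.map (face α)).IsChain (GradientStep α mo l) := by
  induction h with
  | nil => exact fun _ => ⟨[], rfl, by simp, by simp⟩
  | @cons s T s' p hu hd hne _ ih =>
    intro hs
    have hT := hs.up hu
    have hs' := hT.down hα hd
    obtain ⟨q', rfl, h1, h2⟩ := ih hs'
    obtain ⟨h3, h4, -⟩ := face_of_down hα hT.1.ne_nil hd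
    refine ⟨_, rfl, by simpa using h1, ?_⟩
    simp only [List.map_cons, List.isChain_cons_cons] at h2 ⊢
    exact ⟨(hs.step hα hG hl0 hT).2 (Or.inl hu), (hT.step hα hG hl0 hs').2
      (Or.inr ⟨h3, h4, fun h => hne (h.eq_of_up hu hs'.1 hs.1)⟩), h2⟩

theorem isGradientPath_of_critPath {τ σ : List (List (Fin n))} {q : List (List (List (Fin n)))}
    (hτ : IsReading (LRel k α mo) τ) (hσ : IsReading (LRel k α mo) σ) (hl : deg α τ.flatten = l)
    (h : CritPath (LRel k α mo) τ σ q) :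
    deg α σ.flatten = l ∧ IsGradientPath α mo l (face α τ) (face α σ) (q.map (face α)) := by
  have hc : Cell k α mo l τ := ⟨hτ.isCell, hl⟩
  have hσl : deg α σ.flatten = l := by
    rw [← hl]
    exact (deg_perm α ((CritPath.dom (A := Label mo) inJ_symm h).perm)).symm
  have hlen := h.length_eq
  obtain ⟨s, p, rfl, hd, hp⟩ := h
  have hs := hc.down hα hd
  obtain ⟨q', rfl, h1, h2⟩ := Cell.chain_of_altPath hα hG hl0 hp hs
  obtain ⟨h3, h4, -⟩ := face_of_down hα hc.1.ne_nil hd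
  have hcr : ∀ {bs : List (List (Fin n))}, bs ≠ [] → (∀ B ∈ bs, B ≠ []) →
      (face α bs).card + 1 = bs.length := by
    intro bs h0 hb
    induction bs using List.reverseRecOn with
    | nil => exact absurd rfl h0
    | append_singleton bs B ih =>
      by_cases h : bs = []
      · subst h; simp [face, cuts, starts]
      · have hb' : ∀ B ∈ bs, B ≠ [] := fun B hB => hb B (by simp [hB])
        rw [face_append_singleton h hb', card_insert_of_notMem, ih h hb', List.length_append]
        · rfl
        · intro hm
          exact ((isFace_face hα hb' rfl).1 _ hm).2.2.1 rfl
  have h5 := hcr hτ.ne_nil hc.1.ne_nil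
  have h6 := hcr hσ.ne_nil hσ.isCell.ne_nil
  refine ⟨hσl, (isCritical_face hα hG hl0 hc.1 hc.2).2 hτ,
    (isCritical_face hα hG hl0 hσ.isCell hσl).2 hσ, by omega, rfl, by simpa using h1, ?_⟩
  simp only [List.map_cons, List.isChain_cons_cons] at h2 ⊢
  exact ⟨(hc.step hα hG hl0 hs).2 (Or.inr ⟨h3, h4, fun h => h.not_isReading hs.1 hτ⟩), h2⟩

theorem critPath_of_isGradientPath {τ σ : List (List (Fin n))} (hls : l ∈ semigroup α)
    (hτ : IsReading (LRel k α mo) τ) (hσ : IsReading (LRel k α mo) σ)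
    (hl : deg α τ.flatten = l) (hl' : deg α σ.flatten = l) {p : List (Finset (Fin e →₀ ℕ))}
    (h : IsGradientPath α mo l (face α τ) (face α σ) p) :
    mo.toSyn (content σ.flatten) < mo.toSyn (content τ.flatten) ∨
      ∃ q, CritPath (LRel k α mo) τ σ q ∧ p = q.map (face α) := by
  obtain ⟨-, -, hc, h1, h2, h3⟩ := h
  obtain ⟨h4, -, -, h5⟩ := Cell.path_cases hα hG hl0 hls hσ hl' p ⟨hτ.isCell, hl⟩ h1 h2 h3
  rcases h4.lt_or_eq with h4 | h4
  · exact Or.inl h4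
  · obtain ⟨s, q, hd, -, hq, hp⟩ := (h5 (mo.toSyn.injective h4)).2 hc
      fun T => CellCritical.not_up hτ.critical
    exact Or.inr ⟨τ :: q, ⟨s, q, rfl, hd, hq⟩, hp⟩

end Paths

/-! ### Alternating sums over a matching. -/

section Matching

/-- Exchanging the two members of a pair is a sign-reversing involution on the matched elements of
`S`. -/
theorem sum_unmatched {X : Type*} (S : Finset X) (ε : X → ℤ) (M : Set (X × X))
    [DecidablePred fun x => ∀ q ∈ M, x ≠ q.1 ∧ x ≠ q.2]
    (hM : ∀ q ∈ M, ∀ q' ∈ M, ∀ x, (x = q.1 ∨ x = q.2) → (x = q'.1 ∨ x = q'.2) → q = q')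
    (hε : ∀ q ∈ M, ε q.1 + ε q.2 = 0) (hne : ∀ q ∈ M, q.1 ≠ q.2)
    (hS : ∀ q ∈ M, q.1 ∈ S ↔ q.2 ∈ S) :
    ∑ x ∈ S, ε x = ∑ x ∈ S with ∀ q ∈ M, x ≠ q.1 ∧ x ≠ q.2, ε x := by
  classical
  rw [← sum_filter_add_sum_filter_not S fun x => ∀ q ∈ M, x ≠ q.1 ∧ x ≠ q.2, add_eq_left]
  have h : ∀ x ∈ S.filter (fun x => ¬ ∀ q ∈ M, x ≠ q.1 ∧ x ≠ q.2),
      ∃ y, (x, y) ∈ M ∨ (y, x) ∈ M := by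
    grind
  have huniq : ∀ {x y y'}, ((x, y) ∈ M ∨ (y, x) ∈ M) → ((x, y') ∈ M ∨ (y', x) ∈ M) → y = y' := by
    rintro x y y' (h1 | h1) (h2 | h2)
    · exact (Prod.mk.inj (hM _ h1 _ h2 x (by simp) (by simp))).2
    · obtain ⟨rfl, rfl⟩ := Prod.mk.inj (hM _ h1 _ h2 x (by simp) (by simp)); rfl
    · obtain ⟨rfl, rfl⟩ := Prod.mk.inj (hM _ h1 _ h2 x (by simp) (by simp)); rfl
    · exact (Prod.mk.inj (hM _ h1 _ h2 x (by simp) (by simp))).1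
  have hmem : ∀ x (hx : x ∈ S.filter fun x => ¬ ∀ q ∈ M, x ≠ q.1 ∧ x ≠ q.2),
      (h x hx).choose ∈ S.filter fun x => ¬ ∀ q ∈ M, x ≠ q.1 ∧ x ≠ q.2 := by
    grind
  refine sum_involution (fun x hx => (h x hx).choose) ?_ ?_ hmem ?_
  all_goals grind

end Matching

/-! ### Readings of settled words. -/

section Settled
variable {A : Type*} [LinearOrder A] {N : A → A → Prop} {ρ : List (List A)}

/-- A block with several letters would provide a toggled letter. -/
theorem IsReading.eq_map (hρ : IsReading (Rel N) ρ) (h : Settled N ρ.flatten) :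
    ρ = ρ.flatten.map fun a => [a] := by
  have key : ∀ B ∈ ρ, ∃ a, B = [a] := by
    intro B hB
    obtain ⟨a, t, rfl⟩ := List.exists_cons_of_ne_nil (hρ.isCell.ne_nil B hB)
    obtain ⟨b₁, b₂, he⟩ := List.append_of_mem hB
    by_cases ht : t = []
    · exact ⟨a, by rw [ht]⟩
    · obtain ⟨u, x, v, htog, -⟩ := hρ.exists_tog he ht
      exact absurd htog (settled_iff.1 h u x v)
  clear hρ h
  induction ρ with
  | nil => rfl
  | cons B ρ ih =>
    obtain ⟨a, rfl⟩ := key B (by simp)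
    simpa using ih fun C hC => key C (by simp [hC])

/-- Adjacent letters `a`, `b` clash: if `a < b` and they commuted, `b` could be moved to the left,
and `a = b` is left to the hypothesis on repetitions. -/
theorem Settled.isReading {w : List A} (hw : w ≠ []) (h : Settled N w)
    (hs : ∀ u v a, w = u ++ [a, a] ++ v → N a a) : IsReading (Rel N) (w.map fun a => [a]) := by
  refine ⟨?_, ?_⟩
  · rw [List.isChain_map, List.isChain_iff_forall_rel_of_append_cons_cons]
    intro a b u v he
    refine ⟨[], b, rfl, by simp, by simp, a, by simp, fun hab => ?_⟩
    rcases hab.1.lt_or_eq with hlt | rfl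
    · exact h (u ++ [a]) b v (by simp [he]) ⟨u, a, [], rfl, hlt, hab.2, by simp⟩
    · exact hab.2 (hs u v a (by simp [he]))
  · obtain ⟨a, t, rfl⟩ := List.exists_cons_of_ne_nil hw
    exact ⟨a, rfl⟩

theorem IsReading.not_adjacent {w u v : List A} {a : A}
    (h : IsReading (Rel N) (w.map fun a => [a])) (hw : w = u ++ [a, a] ++ v) : N a a := by
  by_contra ha
  subst hw
  have := h.1
  simp only [List.map_append, List.map_cons, List.append_assoc, List.cons_append,
    List.nil_append] at this
  obtain ⟨X, c, hX, -, -, y, hy, hyc⟩ := (List.isChain_cons_cons.1 (List.isChain_append.1 this).2.1).1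
  obtain ⟨rfl, hc⟩ := List.append_inj' (s₁ := []) hX rfl
  obtain rfl : a = c := by simpa using hc
  obtain rfl : y = a := by simpa using hy
  exact hyc ⟨le_rfl, ha⟩

end Settled

/-! ### Label sequences are saturated chains. -/

section Facets
variable {e n : ℕ} {α : Fin n → (Fin e →₀ ℕ)} {l : Fin e →₀ ℕ}

theorem flatten_map_singleton (w : List (Fin n)) : (w.map fun a => [a]).flatten = w := by
  induction w with
  | nil => rfl
  | cons a w ih => simp [ih]

theorem face_map_singleton (w : List (Fin n)) : face α (w.map fun a => [a]) = facet α w := by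
  rw [face, facet, flatten_map_singleton]
  congr 1
  refine subset_antisymm ?_ fun r hr => ?_
  · have := cuts_subset (bs := w.map fun a => [a]) (by simp)
    rwa [flatten_map_singleton] at this
  · have hr := mem_Ioo.1 hr
    refine mem_cuts_iff.2 ⟨(w.take r).map fun a => [a], (w.drop r).map fun a => [a], ?_, ?_, ?_, ?_⟩
    · rw [← List.map_append, List.take_append_drop]
    · rw [ne_eq, List.map_eq_nil_iff, ← List.length_eq_zero_iff, List.length_take]; omega
    · simp_all
    · rw [flatten_map_singleton, List.length_take]; omega

/-- A larger face lies in a facet whose word splits into blocks of degrees `α i`; minimality of the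
generators makes every such block the single letter `i`. -/
theorem maximal_facet (hα : IsMinimalGenerating α) (hl0 : l ≠ 0) (hls : l ∈ semigroup α)
    {w : List (Fin n)} (hl : deg α w = l) : Maximal (IsFace α l) (facet α w) := by
  have hb : ∀ B ∈ w.map fun a => [a], B ≠ [] := by simp
  refine ⟨face_map_singleton (α := α) w ▸ isFace_face hα hb (by rw [flatten_map_singleton, hl]),
    fun t ht hs => ?_⟩
  obtain ⟨bs, h0, hbs, hd, rfl⟩ := exists_blocks hα ht hls hl0
  rw [← face_map_singleton] at hs ⊢
  obtain ⟨cs, h1, h2⟩ := exists_lift hα (w := bs.flatten) (bs := w.map fun a => [a])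
    (by rintro h; rw [List.map_eq_nil_iff] at h; subst h; exact hl0 hl.symm) hb
    (by rw [flatten_map_singleton, hl, hd]) (hs.trans (face_subset_facet hbs))
  have h3 : cs = w.map fun a => [a] := by
    clear * - hα h2
    induction w generalizing cs with
    | nil => simpa using h2
    | cons a w ih =>
      obtain ⟨B, cs, rfl, h3, h4⟩ := List.map_eq_cons_iff.1 h2
      rw [ih _ h4, eq_singleton_of_deg hα (w := B) (i := a) (by simpa using h3)]
      rfl
  rw [h3, flatten_map_singleton] at h1
  rw [face_map_singleton, h1]
  exact face_subset_facet hbs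

end Facets

/-! ### The cancellation and the count of survivors. -/

section Main
variable {e n : ℕ} {α : Fin n → (Fin e →₀ ℕ)} {l : Fin e →₀ ℕ} {k : Type*} [Field k]
  {mo : MonomialOrder (Fin n)}

/-- The pairs of critical cells that differ by moving the toggled letter inside its window. -/
def matching (k : Type*) [Field k] (α : Fin n → (Fin e →₀ ℕ)) (mo : MonomialOrder (Fin n))
    (l : Fin e →₀ ℕ) : Set (Finset (Fin e →₀ ℕ) × Finset (Fin e →₀ ℕ)) :=
  {q | ∃ τ σ, FibPair (A := Label mo) (InJ k α mo) τ σ ∧ deg α (List.flatten τ) = l ∧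
    q = (face α τ, face α σ)}

theorem FibPair.existsUnique_critPath {τ σ : List (List (Fin n))}
    (h : FibPair (A := Label mo) (InJ k α mo) τ σ) : ∃! q, CritPath (LRel k α mo) τ σ q :=
  FibPair.existsUnique (A := Label mo) inJ_symm h

theorem CritPath.perm {τ σ : List (List (Fin n))} {q : List (List (List (Fin n)))}
    (h : CritPath (LRel k α mo) τ σ q) : τ.flatten.Perm σ.flatten :=
  (CritPath.dom (A := Label mo) inJ_symm h).perm

variable (hα : IsMinimalGenerating α) (hG : HasQuadraticGroebnerBasis mo (toricIdeal k α))
  (hl : l ∈ semigroup α) (hl0 : l ≠ 0)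
include hα hG hl0

theorem labelSeq_reading {ρ : List (List (Fin n))} (hρ : IsReading (LRel k α mo) ρ)
    (h : deg α ρ.flatten = l) :
    IsCritical α mo l (face α ρ) ∧ labelSeq α mo l (face α ρ) = ρ.flatten :=
  ⟨(isCritical_face hα hG hl0 hρ.isCell h).2 hρ, labelSeq_face hα hG hl0 hρ.isCell h⟩

theorem FibPair.deg_eq {τ σ : List (List (Fin n))} (h : FibPair (A := Label mo) (InJ k α mo) τ σ)
    (hd : deg α τ.flatten = l) : deg α σ.flatten = l := by
  obtain ⟨q, hq⟩ := h.existsUnique_critPath.exists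
  exact (isGradientPath_of_critPath hα hG hl0 h.1 h.2.1 hd hq).1

include hl

theorem exists_reading {s : Finset (Fin e →₀ ℕ)} (h : IsCritical α mo l s) :
    ∃ ρ, IsReading (LRel k α mo) ρ ∧ deg α ρ.flatten = l ∧ face α ρ = s ∧
      labelSeq α mo l s = ρ.flatten := by
  obtain ⟨ρ, h1, h2, rfl⟩ := exists_face hα hG hl hl0 h.1
  exact ⟨ρ, (isCritical_face hα hG hl0 h1 h2).1 h, h2, rfl, labelSeq_face hα hG hl0 h1 h2⟩

theorem labelSeq_injOn {s t : Finset (Fin e →₀ ℕ)} (hs : IsCritical α mo l s)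
    (ht : IsCritical α mo l t) (h : labelSeq α mo l s = labelSeq α mo l t) : s = t := by
  obtain ⟨ρ, h1, -, rfl, h2⟩ := exists_reading hα hG hl hl0 hs
  obtain ⟨ρ', h1', -, rfl, h2'⟩ := exists_reading hα hG hl hl0 ht
  rw [h1.unique h1' (by rw [← h2, ← h2', h])]

/-- A potential that decreases along the edges. -/
noncomputable def potential (k : Type*) [Field k] (α : Fin n → (Fin e →₀ ℕ))
    (mo : MonomialOrder (Fin n)) (l : Fin e →₀ ℕ) (s : Finset (Fin e →₀ ℕ)) :
    mo.syn ×ₗ (Lex (Label mo → ℕ) ×ₗ ℤ) :=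
  toLex (mo.toSyn (content (labelSeq α mo l s)),
    toLex (toLex (key (A := Label mo) (InJ k α mo) (labelSeq α mo l s)), -(s.card : ℤ)))

/-- A reversed matched edge keeps content and key but raises the dimension, which enters with a
minus sign. An unmatched edge lowers the content or, at equal content, the key. -/
theorem potential_lt {x y : Finset (Fin e →₀ ℕ)}
    (h : CancelStep α mo l (matching k α mo l) x y) :
    potential k α mo l y < potential k α mo l x := by
  rcases h with ⟨τ, σ, hp, hd, he⟩ | ⟨hn, p, hp⟩
  · obtain ⟨rfl, rfl⟩ := Prod.mk.inj he
    obtain ⟨q, hq⟩ := hp.existsUnique_critPath.exists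
    obtain ⟨hd', -, -, hc, -⟩ := isGradientPath_of_critPath hα hG hl0 hp.1 hp.2.1 hd hq
    have hcont := content_eq_iff.2 hq.perm
    rw [potential, potential, (labelSeq_reading hα hG hl0 hp.1 hd).2,
      (labelSeq_reading hα hG hl0 hp.2.1 hd').2]
    refine Prod.Lex.lt_iff.2 (Or.inr ⟨congrArg mo.toSyn hcont, Prod.Lex.lt_iff.2
      (Or.inr ⟨congrArg toLex (FibPair.key_eq (A := Label mo) hp), ?_⟩)⟩)
    simp_all
  · obtain ⟨τ, h1, h2, rfl, h3⟩ := exists_reading hα hG hl hl0 hp.1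
    obtain ⟨σ, h1', h2', rfl, h3'⟩ := exists_reading hα hG hl hl0 hp.2.1
    rw [potential, potential, h3, h3']
    rcases critPath_of_isGradientPath hα hG hl0 hl h1 h1' h2 h2' hp with h4 | ⟨q, hq, -⟩
    · exact Prod.Lex.lt_iff.2 (Or.inl h4)
    · refine Prod.Lex.lt_iff.2 (Or.inr ⟨congrArg mo.toSyn
        (content_eq_iff.2 hq.perm).symm, Prod.Lex.lt_iff.2
          (Or.inl ?_)⟩)
      exact CritPath.key_lt (A := Label mo) inJ_symm hq h1 h1' fun hf => hn ⟨τ, σ, hf, h2, rfl⟩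

theorem isCancellation_matching : IsCancellation α mo l (matching k α mo l) where
  unique_path := by
    rintro _ ⟨τ, σ, hp, hd, rfl⟩
    have hu := hp.existsUnique_critPath
    obtain ⟨q, hq, hqu⟩ := hu
    obtain ⟨hd', hg⟩ := isGradientPath_of_critPath hα hG hl0 hp.1 hp.2.1 hd hq
    refine ⟨_, hg, fun p hpath => ?_⟩
    rcases critPath_of_isGradientPath hα hG hl0 hl hp.1 hp.2.1 hd hd' hpath with h | ⟨q', hq', rfl⟩
    · rw [content_eq_iff.2 hq.perm] at h
      exact absurd h (lt_irrefl _)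
    · rw [hqu q' hq']
  equal_content := by
    rintro _ ⟨τ, σ, hp, hd, rfl⟩
    obtain ⟨q, hq⟩ := hp.existsUnique_critPath.exists
    rw [(labelSeq_reading hα hG hl0 hp.1 hd).2,
      (labelSeq_reading hα hG hl0 hp.2.1 (hp.deg_eq hα hG hl0 hd)).2]
    exact content_eq_iff.2 hq.perm
  matching := by
    rintro _ ⟨τ, σ, hp, hd, rfl⟩ _ ⟨τ', σ', hp', hd', rfl⟩ x hx hx'
    have key : ∀ {τ σ : List (List (Fin n))}, FibPair (A := Label mo) (InJ k α mo) τ σ →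
        deg α τ.flatten = l → (x = face α τ ∨ x = face α σ) →
        ∃ ρ, (ρ = τ ∨ ρ = σ) ∧ Cell k α mo l ρ ∧ face α ρ = x := by
      rintro τ σ hp hd (rfl | rfl)
      exacts [⟨τ, Or.inl rfl, ⟨hp.1.isCell, hd⟩, rfl⟩,
        ⟨σ, Or.inr rfl, ⟨hp.2.1.isCell, hp.deg_eq hα hG hl0 hd⟩, rfl⟩]
    obtain ⟨ρ, h1, h2, h3⟩ := key hp hd hx
    obtain ⟨ρ', h1', h2', h3'⟩ := key hp' hd' hx'
    obtain rfl := face_injective hα hG hl0 h2.1 h2.2 h2'.1 h2'.2 (h3.trans h3'.symm)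
    obtain ⟨rfl, rfl⟩ := FibPair.eq (A := Label mo) inJ_symm hp hp' h1 h1'
    rfl
  acyclic := by
    intro x hx
    have : ∀ y, Relation.TransGen (CancelStep α mo l (matching k α mo l)) x y →
        potential k α mo l y < potential k α mo l x := by
      intro y h
      induction h with
      | single h => exact potential_lt hα hG hl hl0 h
      | tail _ h ih => exact (potential_lt hα hG hl hl0 h).trans ih
    exact lt_irrefl _ (this x hx)

/-- A reading whose word has a toggled letter always belongs to a pair, and both words of a pair
have a toggled letter. -/
theorem survivors_matching {s : Finset (Fin e →₀ ℕ)} :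
    s ∈ survivors α mo l (matching k α mo l) ↔
      IsCritical α mo l s ∧ Settled (A := Label mo) (InJ k α mo) (labelSeq α mo l s) := by
  refine and_congr_right fun hs => ?_
  obtain ⟨ρ, hρ, hd, rfl, hlab⟩ := exists_reading hα hG hl hl0 hs
  rw [hlab]
  constructor
  · intro h
    refine (settled_iff (A := Label mo)).2 fun u x v ht => ?_
    obtain ⟨pre, post, hf⟩ := ht.exists_fib
    obtain ⟨τ, σ, hp, hρp, ⟨q, hq, -⟩, -⟩ := IsReading.existsUnique_fibPair (A := Label mo) inJ_symm hρ hf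
    have hdτ : deg α (List.flatten τ) = l := by
      rcases hρp with rfl | rfl
      · exact hd
      · rw [← hd, deg_perm α hq.perm]
    have := h _ ⟨τ, σ, hp, hdτ, rfl⟩
    rcases hρp with rfl | rfl
    exacts [this.1 rfl, this.2 rfl]
  · rintro h _ ⟨τ, σ, hp, hdτ, rfl⟩
    obtain ⟨h1, h2, -, pre, x, post, ⟨L, v, ht, -⟩, ⟨L', v', ht', -⟩⟩ := id hp
    constructor <;> intro he
    · rw [← hlab, he, (labelSeq_reading hα hG hl0 h1 hdτ).2] at h
      exact (settled_iff (A := Label mo)).1 h _ _ _ ht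
    · rw [← hlab, he, (labelSeq_reading hα hG hl0 h2 (hp.deg_eq hα hG hl0 hdτ)).2] at h
      exact (settled_iff (A := Label mo)).1 h _ _ _ ht'

theorem cancelsUnsaturated_matching : CancelsUnsaturated α mo l (matching k α mo l) := by
  intro s hs
  obtain ⟨h1, h2⟩ := (survivors_matching hα hG hl hl0).1 hs
  obtain ⟨ρ, hρ, hd, rfl, hlab⟩ := exists_reading hα hG hl hl0 h1
  rw [hlab] at h2
  rw [IsReading.eq_map (A := Label mo) hρ h2]
  have := maximal_facet hα hl0 hl hd
  rwa [← face_map_singleton] at this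

theorem finite_class (w : List (Fin n)) :
    {s | IsCritical α mo l s ∧ labelSeq α mo l s ∈ commClass k α mo w}.Finite := by
  classical
  refine Set.Finite.of_finite_image (f := labelSeq α mo l) ?_
    fun s hs t ht h => labelSeq_injOn hα hG hl hl0 hs.1 ht.1 h
  refine w.permutations.toFinset.finite_toSet.subset ?_
  rintro _ ⟨s, hs, rfl⟩
  simpa using (eqvGen_comm_perm hs.2).symm

-- A matched pair contributes zero, and its cells lie in the same class, as a path of constant
-- content performs commutations only. Every survivor is a facet of the common length, so it has
-- `w.length - 1` elements.
open Classical in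
theorem sum_class {M : Set (Finset (Fin e →₀ ℕ) × Finset (Fin e →₀ ℕ))}
    (hM : IsCancellation α mo l M) (hc : CancelsUnsaturated α mo l M) (w : List (Fin n)) :
    ∑ s ∈ (finite_class hα hG hl hl0 w).toFinset, (-1 : ℤ) ^ s.card =
      (((finite_class hα hG hl hl0 w).toFinset.filter fun s =>
        ∀ q ∈ M, s ≠ q.1 ∧ s ≠ q.2).card : ℤ) * (-1) ^ (w.length - 1) := by
  have hpair : ∀ q ∈ M, IsCritical α mo l q.1 ∧ IsCritical α mo l q.2 ∧ q.1.card = q.2.card + 1 ∧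
      Relation.EqvGen (CommStep k α mo) (labelSeq α mo l q.1) (labelSeq α mo l q.2) := by
    rintro ⟨s, t⟩ hq
    obtain ⟨p, hp⟩ := (hM.unique_path _ hq).exists
    obtain ⟨τ, h1, h2, rfl, h3⟩ := exists_reading hα hG hl hl0 hp.1
    obtain ⟨σ, h1', h2', rfl, h3'⟩ := exists_reading hα hG hl hl0 hp.2.1
    refine ⟨hp.1, hp.2.1, hp.2.2.1, ?_⟩
    have hcont := hM.equal_content _ hq
    rcases critPath_of_isGradientPath hα hG hl0 hl h1 h1' h2 h2' hp with h4 | ⟨q, hq, -⟩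
    · grind
    · simp only [h3, h3']
      exact Dom.eqvGen (A := Label mo) inJ_symm (CritPath.dom (A := Label mo) inJ_symm hq)
  rw [sum_unmatched _ _ M hM.matching, card_eq_sum_ones, Nat.cast_sum, sum_mul]
  · refine sum_congr rfl fun s hs => ?_
    obtain ⟨h1, h2⟩ := mem_filter.1 hs
    obtain ⟨h3, h4⟩ := (Set.Finite.mem_toFinset _).1 h1
    have hmax := hc s ⟨h3, h2⟩
    obtain ⟨ρ, hρ, hd, rfl, hlab⟩ := exists_reading hα hG hl hl0 h3
    have hle := face_subset_facet (α := α) hρ.isCell.ne_nil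
    have hface := subset_antisymm hle (hmax.2 (maximal_facet hα hl0 hl hd).1 hle)
    have hcard : (facet α ρ.flatten).card = (ranks ρ.flatten).card :=
      card_image_of_injOn fun r hr t ht h =>
        vertex_injOn hα (mem_Ioo.1 hr).2.le (mem_Ioo.1 ht).2.le h
    rw [hface, hcard, ← hlab, ranks, Nat.card_Ioo, ← (eqvGen_comm_perm h4).length_eq]
    simp
  · intro q hq
    rw [(hpair q hq).2.2.1, pow_succ]
    ring
  · grind
  · intro q hq
    obtain ⟨h1, h2, -, h3⟩ := hpair q hq
    rw [Set.Finite.mem_toFinset, Set.Finite.mem_toFinset]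
    exact ⟨fun h => ⟨h2, h.2.trans _ _ _ h3⟩, fun h => ⟨h1, h.2.trans _ _ _ (h3.symm _ _)⟩⟩

-- The left-hand sum in `sum_class` does not depend on the cancellation, so the count may be made
-- with the constructed matching.
open Classical in
theorem card_class {M : Set (Finset (Fin e →₀ ℕ) × Finset (Fin e →₀ ℕ))}
    (hM : IsCancellation α mo l M) (hc : CancelsUnsaturated α mo l M) (w : List (Fin n)) :
    ((finite_class hα hG hl hl0 w).toFinset.filter fun s => ∀ q ∈ M, s ≠ q.1 ∧ s ≠ q.2).card =
      ((finite_class hα hG hl hl0 w).toFinset.filter fun s =>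
        ∀ q ∈ matching k α mo l, s ≠ q.1 ∧ s ≠ q.2).card := by
  have h := (sum_class hα hG hl hl0 hM hc w).symm.trans (sum_class hα hG hl hl0
    (isCancellation_matching hα hG hl hl0) (cancelsUnsaturated_matching hα hG hl hl0) w)
  exact_mod_cast mul_right_cancel₀ (pow_ne_zero _ (by norm_num)) h

omit hl0 hG hl hα in
open Classical in
theorem mem_unmatched {M : Set (Finset (Fin e →₀ ℕ) × Finset (Fin e →₀ ℕ))} {w : List (Fin n)}
    {h : {s | IsCritical α mo l s ∧ labelSeq α mo l s ∈ commClass k α mo w}.Finite}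
    {s : Finset (Fin e →₀ ℕ)} : s ∈ (h.toFinset.filter fun s => ∀ q ∈ M, s ≠ q.1 ∧ s ≠ q.2) ↔
      s ∈ survivors α mo l M ∧ labelSeq α mo l s ∈ commClass k α mo w := by
  rw [mem_filter, Set.Finite.mem_toFinset]
  exact and_right_comm

/-- A class with a survivor also has one for the constructed matching. Its word is settled, so in a
stuttering class it would contain two adjacent equal commuting letters, which a reading into single
letters excludes. -/
theorem not_isStuttering {M : Set (Finset (Fin e →₀ ℕ) × Finset (Fin e →₀ ℕ))}
    (hM : IsCancellation α mo l M) (hc : CancelsUnsaturated α mo l M) {s : Finset (Fin e →₀ ℕ)}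
    (hs : s ∈ survivors α mo l M) :
    ∀ w ∈ commClass k α mo (labelSeq α mo l s), ¬ IsStuttering k α mo w := by
  classical
  rintro _ hw ⟨u, v, a, ha, rfl⟩
  have h1 := card_pos.2 ⟨s, (mem_unmatched (k := k) (h := finite_class hα hG hl hl0 _)).2
    ⟨hs, .refl _⟩⟩
  rw [card_class hα hG hl hl0 hM hc] at h1
  obtain ⟨t, ht⟩ := card_pos.1 h1
  obtain ⟨ht, htw⟩ := mem_unmatched.1 ht
  obtain ⟨h2, h3⟩ := (survivors_matching hα hG hl hl0).1 ht
  obtain ⟨ρ, hρ, -, rfl, hlab⟩ := exists_reading hα hG hl hl0 h2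
  rw [hlab] at h3 htw
  obtain ⟨u', v', he⟩ := Settled.exists_adjacent (A := Label mo) inJ_symm h3 ha
    (.trans _ _ _ (.symm _ _ htw) hw)
  exact ha (IsReading.not_adjacent (A := Label mo) (IsReading.eq_map (A := Label mo) hρ h3 ▸ hρ) he)

/-- The settled word of the class is a reading because no member stutters, so it is the only
survivor of the constructed matching; the equality of counts carries this over to `M`. -/
theorem existsUnique_survivor {M : Set (Finset (Fin e →₀ ℕ) × Finset (Fin e →₀ ℕ))}
    (hM : IsCancellation α mo l M) (hc : CancelsUnsaturated α mo l M) {w : List (Fin n)}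
    (hw : deg α w = l) (hns : ∀ w' ∈ commClass k α mo w, ¬ IsStuttering k α mo w') :
    ∃! s, s ∈ survivors α mo l M ∧ labelSeq α mo l s ∈ commClass k α mo w := by
  classical
  obtain ⟨v, hv, hvs⟩ : ∃ v : List (Fin n), Relation.EqvGen (Comm (InJ k α mo)) w v ∧
      Settled (A := Label mo) (InJ k α mo) v := exists_settled (A := Label mo) inJ_symm w
  have hvd : deg α v = l := by rw [← hw, deg_perm α (eqvGen_comm_perm hv)]
  have hρ : IsReading (LRel k α mo) (List.map (fun a => [a]) v) :=
    Settled.isReading (A := Label mo) (by rintro rfl; exact hl0 hvd.symm) hvs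
      fun u u' a he => by_contra fun ha => hns v hv ⟨u, u', a, ha, he⟩
  obtain ⟨h1, h2⟩ := labelSeq_reading hα hG hl0 hρ (by rw [flatten_map_singleton, hvd])
  rw [flatten_map_singleton] at h2
  have hone : ((finite_class hα hG hl hl0 w).toFinset.filter fun s =>
      ∀ q ∈ matching k α mo l, s ≠ q.1 ∧ s ≠ q.2) = {face α (List.map (fun a => [a]) v)} := by
    ext t
    rw [mem_unmatched, mem_singleton, survivors_matching hα hG hl hl0]
    constructor
    · rintro ⟨⟨h3, h4⟩, h5⟩
      refine labelSeq_injOn hα hG hl hl0 h3 h1 ?_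
      rw [h2]
      exact Settled.eq (A := Label mo) inJ_symm h4 hvs (.trans _ _ _ (.symm _ _ h5) hv)
    · rintro rfl
      rw [h2]
      exact ⟨⟨h1, hvs⟩, hv⟩
  have := card_class hα hG hl hl0 hM hc w
  rw [hone, card_singleton, card_eq_one] at this
  obtain ⟨s, hs⟩ := this
  have hiff : ∀ t, t ∈ survivors α mo l M ∧ labelSeq α mo l t ∈ commClass k α mo w ↔ t = s :=
    fun t => by rw [← mem_unmatched (h := finite_class hα hG hl hl0 w), hs, mem_singleton]
  exact ⟨s, (hiff s).2 rfl, fun t ht => (hiff t).1 ht⟩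

end Main
end QuadraticMorse

open QuadraticMorse MonoidPoset in
theorem mainTheorem6 {k : Type*} [Field k] {e n : ℕ} (α : Fin n → (Fin e →₀ ℕ))
    (hα : MonoidPoset.IsMinimalGenerating α) (mo : MonomialOrder (Fin n))
    (hG : MonoidPoset.HasQuadraticGroebnerBasis mo (MonoidPoset.toricIdeal k α))
    (l : Fin e →₀ ℕ) (hl : l ∈ MonoidPoset.semigroup α) (hl0 : l ≠ 0) :
    (∃ M, MonoidPoset.IsCancellation α mo l M ∧ MonoidPoset.CancelsUnsaturated α mo l M) ∧
    ∀ M, MonoidPoset.IsCancellation α mo l M → MonoidPoset.CancelsUnsaturated α mo l M →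
      ∀ m : Fin n →₀ ℕ, (m.sum fun i c => c • α i) = l →
        (∀ C ∈ MonoidPoset.nonStutteringClasses k α mo m,
          ∃! w, w ∈ C ∧ w ∈ MonoidPoset.survivingLabelSeqs α mo l M m) ∧
        Set.BijOn (MonoidPoset.commClass k α mo)
          (MonoidPoset.survivingLabelSeqs α mo l M m)
          (MonoidPoset.nonStutteringClasses k α mo m) ∧
        Set.BijOn (MonoidPoset.labelSeq α mo l)
          {s | s ∈ MonoidPoset.survivors α mo l M ∧
            MonoidPoset.content (MonoidPoset.labelSeq α mo l s) = m}
          (MonoidPoset.survivingLabelSeqs α mo l M m) := by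
  refine ⟨⟨matching k α mo l, isCancellation_matching hα hG hl hl0,
    cancelsUnsaturated_matching hα hG hl hl0⟩, fun M hM hc m hm => ?_⟩
  have hdeg : ∀ {w : List (Fin n)}, content w = m → deg α w = l := by
    rintro w rfl
    rw [← wt_content]
    exact hm
  have hperm : ∀ {w w' : List (Fin n)}, w' ∈ commClass k α mo w → content w' = content w :=
    fun h => (content_eq_iff.2 (eqvGen_comm_perm h)).symm
  have hclass : ∀ {w w' : List (Fin n)}, w' ∈ commClass k α mo w →
      commClass k α mo w' = commClass k α mo w := fun h => Set.ext fun v =>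
    ⟨fun h' => h.trans _ _ _ h', fun h' => (h.symm _ _).trans _ _ _ h'⟩
  have h1 : ∀ C ∈ nonStutteringClasses k α mo m,
      ∃! w, w ∈ C ∧ w ∈ survivingLabelSeqs α mo l M m := by
    rintro _ ⟨⟨w, hw, rfl⟩, hns⟩
    obtain ⟨s, ⟨hs, hsw⟩, hu⟩ := existsUnique_survivor hα hG hl hl0 hM hc (hdeg hw) hns
    refine ⟨labelSeq α mo l s, ⟨hsw, (hperm hsw).trans hw, s, hs, rfl⟩, ?_⟩
    rintro _ ⟨htw, -, t, ht, rfl⟩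
    rw [hu t ⟨ht, htw⟩]
  have h2 : Set.MapsTo (commClass k α mo) (survivingLabelSeqs α mo l M m)
      (nonStutteringClasses k α mo m) := by
    rintro _ ⟨hw, s, hs, rfl⟩
    exact ⟨⟨_, hw, rfl⟩, not_isStuttering hα hG hl hl0 hM hc hs⟩
  refine ⟨h1, ⟨h2, ?_, ?_⟩, ?_, ?_, ?_⟩
  · intro w hw w' hw' he
    exact (h1 _ (h2 hw)).unique ⟨Relation.EqvGen.refl _, hw⟩ ⟨he ▸ Relation.EqvGen.refl _, hw'⟩
  · intro C hC
    obtain ⟨w, ⟨hwC, hw⟩, -⟩ := h1 C hC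
    obtain ⟨⟨v, -, rfl⟩, -⟩ := hC
    exact ⟨w, hw, hclass hwC⟩
  · exact fun s hs => ⟨hs.2, s, hs.1, rfl⟩
  · exact fun s hs t ht h => labelSeq_injOn hα hG hl hl0 hs.1.1 ht.1.1 h
  · rintro _ ⟨hw, s, hs, rfl⟩
    exact ⟨s, ⟨hs, hw⟩, rfl⟩
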